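/- **Notation.** $\mathrm{CartSp}$ is the category of the spaces $U=\mathbb{R}^m$ and smooth maps. For $U\in\mathrm{CartSp}$ and $k\ge 0$, a *vertical form* on $U\times\Delta^k$ is a smooth (up to the boundary) family, parametrized by $U$, of differential forms on the standard simplex $\Delta^k$; it carries the wedge product and the differential along $\Delta^k$. Regard $\Delta^k$ as the regular simplex spanned by the standard basis of $\mathbb{R}^{k+1}$. A vertical form *has sitting instants* if for each $u\in U$ and $p\in\Delta^k$ it coincides near $p$, over $u$, with the pullback of its restriction to the smallest face $\Delta_p$ containing $p$ along the orthogonal projection onto the affine span of $\Delta_p$. Let $\Omega^\bullet_{\mathrm{si}}(U\times\Delta^k)_{\mathrm{vert}}$, $k\geq 0$, be the smallest simplicial dg-algebra of vertical forms (closed under products, $d$ and all simplicial operators) that contains all vertical forms with sitting instants. For a dg-algebra $A$ let $$\exp_\Delta(A)\colon (U,[k])\mapsto \mathrm{Hom}_{\mathrm{dgAlg}}\big(A,\Omega^\bullet_{\mathrm{si}}(U\times\Delta^k)_{\mathrm{vert}}\big),$$ a simplicial presheaf on $\mathrm{CartSp}$. For a finite-dimensional real Lie algebra $\mathfrak g$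 put $\exp_\Delta(\mathfrak g)=\exp_\Delta(\mathrm{CE}(\mathfrak g))$, where $\mathrm{CE}(\mathfrak g)=\Lambda^\bullet\mathfrak g^*$ is the Chevalley–Eilenberg algebra with $(d\alpha)(x,y)=-\alpha([x,y])$ on $\mathfrak g^*$. For $n\ge1$ put $\exp_\Delta(b^{n-1}\mathbb{R})=\exp_\Delta(\mathrm{CE}(b^{n-1}\mathbb{R}))$, where $\mathrm{CE}(b^{n-1}\mathbb{R})$ is the free graded-commutative algebra on one generator $c$ of degree $n$, with $dc=0$. A degree-$n$ cocycle $\mu\colon\mathfrak g\to b^{n-1}\mathbb{R}$ is a dg-algebra morphism $\mathrm{CE}(b^{n-1}\mathbb{R})\to\mathrm{CE}(\mathfrak g)$, equivalently a closed element $\mu\in\Lambda^n\mathfrak g^*$; precomposition with it is $\exp_\Delta(\mu)\colon\exp_\Delta(\mathfrak g)\to\exp_\Delta(b^{n-1}\mathbb{R})$. For a subgroup $\Lambda\subset\mathbb{R}$ write $C^\infty(U,\Lambda)$ for the smooth functions $U\to\mathbb{R}$ with values in $\Lambda$. Let $\mathbf B^n\mathbb{R}$ and $\mathbf B^n(\Lambda\to\mathbb{R})$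 be the simplicial presheaves associated by the Dold–Kan correspondence to the presheaf $C^\infty(-,\mathbb{R})$ in degree $n$, and to the presheaf of complexes $C^\infty(-,\Lambda)\hookrightarrow C^\infty(-,\mathbb{R})$ in degrees $n+1$ and $n$; there is a canonical morphism $q_\Lambda\colon\mathbf B^n\mathbb{R}\to\mathbf B^n(\Lambda\to\mathbb{R})$. Let $\mathbf{cosk}_n X$ be the objectwise $n$-coskeleton of a simplicial presheaf $X$, with its unit morphism $X\to\mathbf{cosk}_nX$. **Proposition.** Let $G$ be a (finite-dimensional, real) Lie group with Lie algebra $\mathfrak g$, let $n\ge1$, and let $\mu\colon\mathfrak g\to b^{n-1}\mathbb{R}$ be a degree-$n$ Lie algebra cocycle. Integration over simplices is a morphism of simplicial presheaves $\int_{\Delta^\bullet}\colon\exp_\Delta(b^{n-1}\mathbb{R})\to\mathbf B^n\mathbb{R}$, given on $n$-cells by sending a vertical $n$-form on $U\times\Delta^n$ to the smooth function on $U$ that is its integral over $\Delta^n$. There is a smallest subgroup $\Lambda_\mu$ among the subgroups $\Lambda$ of $(\mathbb{R},+)$ for which there is a morphism of simplicial presheaves $\varphi$ making the following diagram commute: $$\begin{array}{ccccc}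 \exp_\Delta(\mathfrak g)&\xrightarrow{\ \exp_\Delta(\mu)\ }&\exp_\Delta(b^{n-1}\mathbb{R})&\xrightarrow{\ \int_{\Delta^\bullet}\ }&\mathbf B^n\mathbb{R}\\ \big\downarrow&&&&\big\downarrow{\scriptstyle q_{\Lambda}}\\ \mathbf{cosk}_n\exp_\Delta(\mathfrak g)&&\xrightarrow{\qquad\varphi\qquad}&&\mathbf B^n(\Lambda\to\mathbb{R}). \end{array}$$ Moreover, there is a group homomorphism $\mathrm{per}_\mu\colon\pi_n(G,e)\to\mathbb{R}$ (the period homomorphism) that sends the class of a smooth map $F\colon([0,1]^n,\partial[0,1]^n)\to(G,e)$ to $\int_{[0,1]^n}F^*\mu$, where $\mu$ is extended to a left-invariant $n$-form on $G$; and if $n\ge2$, then $\Lambda_\mu$ is the subgroup of $\mathbb{R}$ generated by the image of $\mathrm{per}_\mu$. -/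

import Mathlib

open CategoryTheory Opposite Set Module Limits
open scoped Manifold ContDiff Topology

noncomputable section

namespace LieInt

/-- A Cartesian space `ℝ^dim`, as an object of the category of Cartesian spaces and smooth maps. -/
structure CartSp where
  dim : ℕ

/-- The points of a Cartesian space. -/
abbrev CartSp.Pt (U : CartSp) : Type := EuclideanSpace ℝ (Fin U.dim)

instance : Category CartSp where
  Hom U W := {f : U.Pt → W.Pt // ContDiff ℝ ∞ f}
  id _ := ⟨id, contDiff_id⟩
  comp f g := ⟨g.1 ∘ f.1, g.2.comp f.2⟩

/-! ### The standard simplex -/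

/-- The coordinate space of the `k`-simplex. -/
abbrev V (k : ℕ) : Type := Fin k → ℝ

/-- The standard `k`-simplex, in the coordinates `x₁, …, x_k`. -/
def Simp (k : ℕ) : Set (V k) := {x | (∀ i, 0 ≤ x i) ∧ ∑ i, x i ≤ 1}

/-- The barycentric coordinates `(1 - ∑ xᵢ, x₁, …, x_k)`. -/
def bary {k : ℕ} (x : V k) : Fin (k + 1) → ℝ := Fin.cons (1 - ∑ i, x i) x

/-- The linear part of the barycentric coordinates. -/
def baryLin (k : ℕ) : V k →ₗ[ℝ] (Fin (k + 1) → ℝ) where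
  toFun v := Fin.cons (-∑ i, v i) v
  map_add' v w := by
    ext i
    refine Fin.cases ?_ (fun i => ?_) i <;> simp [Finset.sum_add_distrib]
    ring
  map_smul' c v := by
    ext i
    refine Fin.cases ?_ (fun i => ?_) i <;> simp [Finset.mul_sum]

theorem bary_sum {k : ℕ} (x : V k) : ∑ a, bary x a = 1 := by
  simp [bary, Fin.sum_univ_succ]

theorem mem_Simp_iff {k : ℕ} {x : V k} : x ∈ Simp k ↔ ∀ a, 0 ≤ bary x a := by
  simp [Simp, bary, Fin.forall_fin_succ]
  tauto

/-- An affine map from the `k`-simplex to the `j`-simplex: row `a` of the matrix holds the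
barycentric coordinates of the image of the vertex `a`. -/
structure AffMap (k j : ℕ) where
  mat : Matrix (Fin (k + 1)) (Fin (j + 1)) ℝ
  nonneg : ∀ a b, 0 ≤ mat a b
  sum_eq : ∀ a, ∑ b, mat a b = 1

namespace AffMap

variable {k j l : ℕ}

@[ext] theorem ext' {P Q : AffMap k j} (h : P.mat = Q.mat) : P = Q := by
  cases P; cases Q; cases h; rfl

/-- The underlying map, in the coordinates `x₁, …, x_k`. -/
def fn (P : AffMap k j) (x : V k) : V j := fun b => ∑ a, bary x a * P.mat a b.succ

/-- The differential of `fn`. -/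
def lin (P : AffMap k j) : V k →ₗ[ℝ] V j where
  toFun v := fun b => ∑ a, baryLin k v a * P.mat a b.succ
  map_add' v w := by ext b; simp [add_mul, Finset.sum_add_distrib]
  map_smul' c v := by ext b; simp [mul_assoc, Finset.mul_sum]

theorem bary_fn (P : AffMap k j) (x : V k) (b : Fin (j + 1)) :
    bary (P.fn x) b = ∑ a, bary x a * P.mat a b := by
  refine Fin.cases ?_ (fun b => ?_) b
  · have h0 : ∀ a, P.mat a 0 = 1 - ∑ b : Fin j, P.mat a b.succ := fun a => by
      rw [← P.sum_eq a, Fin.sum_univ_succ]; ring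
    simp only [bary, Fin.cons_zero, fn, h0, mul_sub, mul_one, Finset.sum_sub_distrib]
    rw [Finset.sum_comm]
    congr 1
    · exact (bary_sum x).symm
    · simp [Finset.mul_sum]
  · simp [bary, fn]

theorem baryLin_lin (P : AffMap k j) (v : V k) (b : Fin (j + 1)) :
    baryLin j (P.lin v) b = ∑ a, baryLin k v a * P.mat a b := by
  have hs : ∑ a, baryLin k v a = 0 := by simp [baryLin, Fin.sum_univ_succ]
  refine Fin.cases ?_ (fun b => ?_) b
  · have h0 : ∀ a, P.mat a 0 = 1 - ∑ b : Fin j, P.mat a b.succ := fun a => by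
      rw [← P.sum_eq a, Fin.sum_univ_succ]; ring
    simp only [h0, mul_sub, mul_one, Finset.sum_sub_distrib, hs]
    simp only [baryLin, lin, LinearMap.coe_mk, AddHom.coe_mk, Fin.cons_zero, zero_sub]
    rw [Finset.sum_comm]
    simp [Finset.mul_sum]
  · simp [baryLin, lin]

theorem fn_mem (P : AffMap k j) {x : V k} (hx : x ∈ Simp k) : P.fn x ∈ Simp j := by
  rw [mem_Simp_iff] at hx ⊢
  intro b
  rw [bary_fn]
  exact Finset.sum_nonneg fun a _ => mul_nonneg (hx a) (P.nonneg a b)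

/-- The underlying map between the simplices. -/
def onSimp (P : AffMap k j) (x : Simp k) : Simp j := ⟨P.fn x.1, P.fn_mem x.2⟩

/-- Composition (`P` first). -/
def comp (P : AffMap k j) (Q : AffMap j l) : AffMap k l where
  mat := P.mat * Q.mat
  nonneg a b := by
    rw [Matrix.mul_apply]
    exact Finset.sum_nonneg fun c _ => mul_nonneg (P.nonneg a c) (Q.nonneg c b)
  sum_eq a := by
    simp only [Matrix.mul_apply]
    rw [Finset.sum_comm]
    simp [← Finset.mul_sum, Q.sum_eq, P.sum_eq]

theorem fn_comp (P : AffMap k j) (Q : AffMap j l) (x : V k) :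
    (P.comp Q).fn x = Q.fn (P.fn x) := by
  ext b
  simp only [fn, comp, Matrix.mul_apply]
  simp only [bary_fn, Finset.mul_sum, Finset.sum_mul]
  rw [Finset.sum_comm]
  simp [mul_assoc]

theorem lin_comp (P : AffMap k j) (Q : AffMap j l) : (P.comp Q).lin = Q.lin ∘ₗ P.lin := by
  refine LinearMap.ext fun c => funext fun b => ?_
  change ∑ a : Fin (k + 1), _ * _ = ∑ a : Fin (j + 1), baryLin j (P.lin _) a * _
  simp only [baryLin_lin, comp, Matrix.mul_apply, Finset.mul_sum, Finset.sum_mul]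
  rw [Finset.sum_comm]
  simp [mul_assoc]

/-- The affine map induced by a map of vertices. -/
def ofVertices (θ : Fin (k + 1) → Fin (j + 1)) : AffMap k j where
  mat := Matrix.of fun a b => if θ a = b then 1 else 0
  nonneg a b := by simp only [Matrix.of_apply]; split_ifs <;> norm_num
  sum_eq a := by simp

theorem ofVertices_comp (θ : Fin (k + 1) → Fin (j + 1)) (η : Fin (j + 1) → Fin (l + 1)) :
    ofVertices (η ∘ θ) = (ofVertices θ).comp (ofVertices η) := by
  ext a b
  simp only [ofVertices, comp, Matrix.mul_apply, Matrix.of_apply, Function.comp_apply]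
  rw [Finset.sum_eq_single (θ a) (fun c _ hc => by simp [hc.symm]) (by simp)]
  simp

theorem fn_id (x : V k) : (ofVertices (id : Fin (k + 1) → Fin (k + 1))).fn x = x := by
  ext b
  simp [fn, ofVertices, bary]

theorem lin_id : (ofVertices (id : Fin (k + 1) → Fin (k + 1))).lin = LinearMap.id := by
  refine LinearMap.ext fun v => funext fun b => ?_
  simp [lin, ofVertices, baryLin]

/-- The orthogonal projection of the simplex with vertices the standard basis of `ℝ^(k+1)` onto
the affine span of the face with vertex set `S`: in barycentric coordinates, the coordinates
outside `S` become `0` and their sum is distributed equally over `S`. -/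
def faceProj (S : Finset (Fin (k + 1))) (hS : S.Nonempty) : AffMap k k where
  mat := Matrix.of fun a b =>
    if a ∈ S then (if a = b then 1 else 0) else (if b ∈ S then (S.card : ℝ)⁻¹ else 0)
  nonneg a b := by simp only [Matrix.of_apply]; split_ifs <;> positivity
  sum_eq a := by
    simp only [Matrix.of_apply]
    split_ifs
    · simp
    · have : (S.card : ℝ) ≠ 0 := by exact_mod_cast hS.card_pos.ne'
      simp [this]

end AffMap

/-- The vertices of the smallest face that contains `p`. -/
def supp {k : ℕ} (p : V k) : Finset (Fin (k + 1)) := {a | bary p a ≠ 0}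

theorem supp_nonempty {k : ℕ} (p : V k) : (supp p).Nonempty := by
  by_contra h
  rw [Finset.not_nonempty_iff_eq_empty, supp, Finset.filter_eq_empty_iff] at h
  have := bary_sum p
  simp at h
  simp [h] at this

theorem Simp_uniqueDiffOn (k : ℕ) : UniqueDiffOn ℝ (Simp k) := by
  apply uniqueDiffOn_convex
  · intro x hx y hy s t hs ht hst
    refine ⟨fun i => ?_, ?_⟩
    · have := hx.1 i; have := hy.1 i; simp; positivity
    · have h1 := hx.2; have h2 := hy.2
      simp only [Pi.add_apply, Pi.smul_apply, smul_eq_mul, Finset.sum_add_distrib,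
        ← Finset.mul_sum]
      nlinarith
  · refine ⟨fun _ => 1 / (k + 2 : ℝ), ?_⟩
    rw [mem_interior]
    refine ⟨{x | (∀ i, 0 < x i) ∧ ∑ i, x i < 1}, fun x hx => ⟨fun i => (hx.1 i).le, hx.2.le⟩, ?_, ?_⟩
    · have h1 : IsOpen {x : V k | ∀ i, 0 < x i} := by
        have : {x : V k | ∀ i, 0 < x i} = ⋂ i, {x : V k | 0 < x i} := by ext; simp
        rw [this]
        exact isOpen_iInter_of_finite fun i => isOpen_lt continuous_const (continuous_apply i)
      have h2 : IsOpen {x : V k | ∑ i, x i < 1} :=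
        isOpen_lt (continuous_finsetSum _ fun i _ => continuous_apply i) continuous_const
      exact h1.inter h2
    · refine ⟨fun i => by positivity, ?_⟩
      simp
      rw [← div_eq_mul_inv, div_lt_one (by positivity)]
      linarith


/-! ### Vertical forms on `U × Δᵏ` -/

/-- The exterior algebra of the cotangent space of the `k`-simplex. -/
abbrev Alt (k : ℕ) : Type := ExteriorAlgebra ℝ (Dual ℝ (V k))

/-- The standard basis of the exterior algebra (increasing products of the `dxᵢ`). -/
def altBasis (k : ℕ) : Basis (Finset (Fin k)) ℝ (Alt k) :=
  (Pi.basisFun ℝ (Fin k)).dualBasis.ExteriorAlgebra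

/-- The covector `dxᵢ`. -/
def dx {k : ℕ} (i : Fin k) : Alt k := ExteriorAlgebra.ι ℝ (LinearMap.proj i)

/-- Vertical forms on `U × Δᵏ`, not necessarily smooth, with their pointwise (wedge) product. -/
abbrev Form (U : CartSp) (k : ℕ) : Type := U.Pt → Simp k → Alt k

namespace Form

variable {U W X : CartSp} {k j l : ℕ}

open Classical in
/-- The functional `φ` applied to a form, as a function on the coordinate space of the simplex
(zero outside of the simplex). -/
def coef (φ : Alt k →ₗ[ℝ] ℝ) (α : Form U k) (u : U.Pt) (x : V k) : ℝ :=
  if h : x ∈ Simp k then φ (α u ⟨x, h⟩) else 0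

theorem coef_of_mem (φ : Alt k →ₗ[ℝ] ℝ) (α : Form U k) (u : U.Pt) {x : V k} (h : x ∈ Simp k) :
    coef φ α u x = φ (α u ⟨x, h⟩) := dif_pos h

/-- A vertical form is smooth if its coefficients are smooth on `U × Δᵏ`, up to the boundary. -/
def Smooth (α : Form U k) : Prop :=
  ∀ S, ContDiffOn ℝ ∞ (fun p : U.Pt × V k => coef ((altBasis k).coord S) α p.1 p.2)
    (univ ×ˢ Simp k)

/-- The derivative of a form at `(u, x)` in the direction `v` along the simplex. -/
def D (α : Form U k) (u : U.Pt) (x : Simp k) : V k →ₗ[ℝ] Alt k :=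
  ∑ S, LinearMap.smulRight
    (fderivWithin ℝ (coef ((altBasis k).coord S) α u) (Simp k) x.1 : V k →ₗ[ℝ] ℝ) (altBasis k S)

/-- The vertical de Rham differential `d α = ∑ᵢ dxᵢ ∧ ∂ᵢ α`. -/
def d (α : Form U k) : Form U k := fun u x => ∑ i, dx i * D α u x (Pi.single i 1)

/-- Pullback of vertical forms along a map `g : W → U` of parameter spaces and an affine map `P`
of simplices. -/
def pull (g : W.Pt → U.Pt) (P : AffMap k j) : Form U j →ₐ[ℝ] Form W k where
  toFun α := fun w x => ExteriorAlgebra.map P.lin.dualMap (α (g w) (P.onSimp x))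
  map_one' := by funext w x; simp
  map_mul' a b := by funext w x; simp
  map_zero' := by funext w x; simp
  map_add' a b := by funext w x; simp
  commutes' r := by
    funext w x
    exact AlgHom.commutes _ r

/-- A vertical form has sitting instants if over each parameter `u`, near each point `p` of the
simplex, it is the pullback of its restriction to the smallest face that contains `p`, along the
orthogonal projection to that face. -/
def SittingInstants (α : Form U k) : Prop :=
  ∀ (u : U.Pt) (p : Simp k), ∀ᶠ x in 𝓝 p,
    α u x = pull id (AffMap.faceProj (supp p.1) (supp_nonempty p.1)) α u x

/-- The differential of `α` at `(u, x)` along the simplex is `T`. -/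
def HasD (α : Form U k) (u : U.Pt) (x : Simp k) (T : V k →ₗ[ℝ] Alt k) : Prop :=
  ∀ φ : Alt k →ₗ[ℝ] ℝ, HasFDerivWithinAt (coef φ α u) (LinearMap.toContinuousLinearMap (φ ∘ₗ T))
    (Simp k) x.1

theorem functional_eq (φ : Alt k →ₗ[ℝ] ℝ) (a : Alt k) :
    φ a = ∑ S, (altBasis k).coord S a * φ (altBasis k S) := by
  have := congrArg φ ((altBasis k).sum_repr a)
  simp only [map_sum, map_smul, smul_eq_mul] at this
  exact this.symm

theorem functional_mul_eq (φ : Alt k →ₗ[ℝ] ℝ) (a b : Alt k) :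
    φ (a * b) = ∑ S, ∑ S', (altBasis k).coord S a * (altBasis k).coord S' b *
      φ (altBasis k S * altBasis k S') := by
  have h1 := functional_eq (φ ∘ₗ LinearMap.mulRight ℝ b) a
  simp only [LinearMap.comp_apply, LinearMap.mulRight_apply] at h1
  rw [h1]
  refine Finset.sum_congr rfl fun S _ => ?_
  have h2 := functional_eq (φ ∘ₗ LinearMap.mulLeft ℝ (altBasis k S)) b
  simp only [LinearMap.comp_apply, LinearMap.mulLeft_apply] at h2
  rw [h2, Finset.mul_sum]
  exact Finset.sum_congr rfl fun _ _ => by ring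

theorem coef_eq_sum (φ : Alt k →ₗ[ℝ] ℝ) (α : Form U k) (u : U.Pt) (x : V k) :
    coef φ α u x = ∑ S, coef ((altBasis k).coord S) α u x * φ (altBasis k S) := by
  by_cases h : x ∈ Simp k
  · simp only [coef_of_mem _ _ _ h]
    exact functional_eq _ _
  · simp [coef, h]

theorem Smooth.functional {α : Form U k} (h : Smooth α) (φ : Alt k →ₗ[ℝ] ℝ) :
    ContDiffOn ℝ ∞ (fun p : U.Pt × V k => coef φ α p.1 p.2) (univ ×ˢ Simp k) := by
  simp only [coef_eq_sum φ]
  exact ContDiffOn.sum fun S _ => (h S).mul contDiffOn_const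

theorem Smooth.coef_right {α : Form U k} (h : Smooth α) (φ : Alt k →ₗ[ℝ] ℝ) (u : U.Pt) :
    ContDiffOn ℝ ∞ (coef φ α u) (Simp k) :=
  (h.functional φ).comp (g := fun p : U.Pt × V k => coef φ α p.1 p.2) (f := fun x => (u, x))
    (by fun_prop) (fun x hx => ⟨mem_univ _, hx⟩)

theorem Smooth.hasD {α : Form U k} (h : Smooth α) (u : U.Pt) (x : Simp k) :
    HasD α u x (D α u x) := by
  intro φ
  have h1 : ∀ S, HasFDerivWithinAt (coef ((altBasis k).coord S) α u)
      (fderivWithin ℝ (coef ((altBasis k).coord S) α u) (Simp k) x.1) (Simp k) x.1 := fun S =>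
    (((h.coef_right _ u).differentiableOn (by simp)) x.1 x.2).hasFDerivWithinAt
  have h2 := HasFDerivWithinAt.fun_sum (u := Finset.univ)
    fun S _ => (h1 S).mul_const (φ (altBasis k S))
  have h3 : coef φ α u = fun x => ∑ S, coef ((altBasis k).coord S) α u x * φ (altBasis k S) :=
    funext fun x => coef_eq_sum φ α u x
  rw [h3]
  refine h2.congr_fderiv ?_
  ext v
  simp [D, mul_comm]

theorem HasD.eq {α : Form U k} {u : U.Pt} {x : Simp k} {T : V k →ₗ[ℝ] Alt k}
    (h : HasD α u x T) : D α u x = T := by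
  refine LinearMap.ext fun v => (altBasis k).ext_elem fun S => ?_
  have := (h ((altBasis k).coord S)).fderivWithin (Simp_uniqueDiffOn k x.1 x.2)
  have h2 : ∀ S, fderivWithin ℝ (coef ((altBasis k).coord S) α u) (Simp k) x.1 v
      = (altBasis k).coord S (T v) := fun S => by
    rw [(h ((altBasis k).coord S)).fderivWithin (Simp_uniqueDiffOn k x.1 x.2)]; rfl
  simp [D, h2]

theorem HasD.congr {α η : Form U k} {u : U.Pt} {x : Simp k} {T : V k →ₗ[ℝ] Alt k}
    (h : HasD α u x T) (he : ∀ᶠ y in 𝓝 x, η u y = α u y) : HasD η u x T := by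
  intro φ
  refine (h φ).congr_of_eventuallyEq ?_ ?_
  · rw [Filter.EventuallyEq, nhdsWithin_eq_map_subtype_coe x.2, Filter.eventually_map]
    filter_upwards [he] with y hy
    simp only [coef_of_mem _ _ _ y.2, hy]
  · simp only [coef_of_mem _ _ _ x.2, he.self_of_nhds]

theorem coef_mul (φ : Alt k →ₗ[ℝ] ℝ) (α η : Form U k) (u : U.Pt) (x : V k) :
    coef φ (α * η) u x = ∑ S, ∑ S', coef ((altBasis k).coord S) α u x *
      coef ((altBasis k).coord S') η u x * φ (altBasis k S * altBasis k S') := by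
  by_cases h : x ∈ Simp k
  · simp only [coef_of_mem _ _ _ h, Pi.mul_apply]
    exact functional_mul_eq _ _ _
  · simp [coef, h]

theorem HasD.mul {α η : Form U k} {u : U.Pt} {x : Simp k} {T S : V k →ₗ[ℝ] Alt k}
    (h : HasD α u x T) (h' : HasD η u x S) :
    HasD (α * η) u x (LinearMap.mulRight ℝ (η u x) ∘ₗ T + LinearMap.mulLeft ℝ (α u x) ∘ₗ S) := by
  intro φ
  have h1 := HasFDerivWithinAt.fun_sum (u := Finset.univ)
    fun I _ => HasFDerivWithinAt.fun_sum (u := Finset.univ)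
    fun J _ => ((h ((altBasis k).coord I)).mul (h' ((altBasis k).coord J))).mul_const
      (φ (altBasis k I * altBasis k J))
  rw [show coef φ (α * η) u = _ from funext fun x => coef_mul φ α η u x]
  refine h1.congr_fderiv ?_
  ext v
  simp only [coef_of_mem _ _ _ x.2, LinearMap.coe_toContinuousLinearMap', LinearMap.comp_apply,
    LinearMap.add_apply, LinearMap.mulRight_apply, LinearMap.mulLeft_apply, map_add,
    sum_apply, smul_apply, add_apply, smul_eq_mul]
  rw [functional_mul_eq φ (T v), functional_mul_eq φ (α u x)]
  simp only [← Finset.sum_add_distrib]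
  refine Finset.sum_congr rfl fun _ _ => Finset.sum_congr rfl fun _ _ => by ring

theorem _root_.LieInt.AffMap.fn_eq (P : AffMap k j) :
    P.fn = fun x => LinearMap.toContinuousLinearMap P.lin x + P.fn 0 := by
  ext y b
  simp only [AffMap.fn, AffMap.lin, LinearMap.coe_toContinuousLinearMap', LinearMap.coe_mk,
    AddHom.coe_mk, Pi.add_apply, ← Finset.sum_add_distrib, ← add_mul]
  refine Finset.sum_congr rfl fun a _ => ?_
  congr 1
  refine Fin.cases ?_ (fun a => ?_) a
  · simp [bary, baryLin]; ring
  · simp [bary, baryLin]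

theorem _root_.LieInt.AffMap.hasFDerivAt_fn (P : AffMap k j) (x : V k) :
    HasFDerivAt P.fn (LinearMap.toContinuousLinearMap P.lin) x := by
  rw [P.fn_eq]
  exact (LinearMap.toContinuousLinearMap P.lin).hasFDerivAt.add_const _

theorem _root_.LieInt.AffMap.contDiff_fn (P : AffMap k j) : ContDiff ℝ ∞ P.fn := by
  rw [P.fn_eq]
  exact (LinearMap.toContinuousLinearMap P.lin).contDiff.add contDiff_const

theorem coef_pull (φ : Alt k →ₗ[ℝ] ℝ) (g : W.Pt → U.Pt) (P : AffMap k j) (α : Form U j)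
    (w : W.Pt) {x : V k} (hx : x ∈ Simp k) :
    coef φ (pull g P α) w x =
      coef (φ ∘ₗ (ExteriorAlgebra.map P.lin.dualMap).toLinearMap) α (g w) (P.fn x) := by
  rw [coef_of_mem _ _ _ hx, coef_of_mem _ _ _ (P.fn_mem hx)]
  rfl

theorem HasD.pull {α : Form U j} {g : W.Pt → U.Pt} {P : AffMap k j} {w : W.Pt} {x : Simp k}
    {T : V j →ₗ[ℝ] Alt j} (h : HasD α (g w) (P.onSimp x) T) :
    HasD (pull g P α) w x ((ExteriorAlgebra.map P.lin.dualMap).toLinearMap ∘ₗ T ∘ₗ P.lin) := by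
  intro φ
  have h1 := HasFDerivWithinAt.comp (t := Simp j) x.1
    (h (φ ∘ₗ (ExteriorAlgebra.map P.lin.dualMap).toLinearMap))
    (P.hasFDerivAt_fn x.1).hasFDerivWithinAt (fun y hy => P.fn_mem hy)
  refine h1.congr (fun y hy => coef_pull φ g P α w hy) (coef_pull φ g P α w x.2)

theorem Smooth.pull {α : Form U j} (h : Smooth α) {g : W.Pt → U.Pt} (hg : ContDiff ℝ ∞ g)
    (P : AffMap k j) : Smooth (pull g P α) := by
  intro S
  have h1 := (h.functional ((altBasis k).coord S ∘ₗ
    (ExteriorAlgebra.map P.lin.dualMap).toLinearMap)).comp (s := univ ×ˢ Simp k)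
    (f := fun p : W.Pt × V k => (g p.1, P.fn p.2))
    ((hg.comp contDiff_fst).prodMk (P.contDiff_fn.comp contDiff_snd)).contDiffOn
    (fun p hp => ⟨mem_univ _, P.fn_mem hp.2⟩)
  exact h1.congr fun p hp => coef_pull _ g P α p.1 hp.2

theorem Smooth.mul {α η : Form U k} (h : Smooth α) (h' : Smooth η) : Smooth (α * η) := by
  intro S
  simp only [coef_mul]
  exact ContDiffOn.sum fun I _ => ContDiffOn.sum fun J _ =>
    ((h I).mul (h' J)).mul contDiffOn_const

theorem Smooth.add {α η : Form U k} (h : Smooth α) (h' : Smooth η) : Smooth (α + η) := by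
  intro S
  refine ((h S).add (h' S)).congr fun p hp => ?_
  simp [coef_of_mem _ _ _ hp.2]

theorem Smooth.const (r : ℝ) : Smooth (algebraMap ℝ (Form U k) r) := by
  intro S
  refine (contDiffOn_const (c := (altBasis k).coord S (algebraMap ℝ (Alt k) r))).congr
    fun p hp => ?_
  rw [coef_of_mem _ _ _ hp.2]
  rfl

/-- The algebra of smooth vertical forms. -/
def smoothForms (U : CartSp) (k : ℕ) : Subalgebra ℝ (Form U k) where
  carrier := {α | Smooth α}
  mul_mem' := Smooth.mul
  add_mem' := Smooth.add
  algebraMap_mem' := Smooth.const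

theorem d_pull {α : Form U j} (h : Smooth α) (g : W.Pt → U.Pt) (P : AffMap k j) :
    d (pull g P α) = pull g P (d α) := by
  funext w x
  change ∑ i, dx i * D (pull g P α) w x _ =
    ExteriorAlgebra.map P.lin.dualMap (∑ i, dx i * D α (g w) (P.onSimp x) _)
  rw [(h.hasD (g w) (P.onSimp x)).pull.eq]
  have h1 : ∀ v : V k, P.lin v = ∑ b, (P.lin v) b • (Pi.single b 1 : V j) := fun v => by
    ext b; simp [Pi.single_apply]
  have h2 : ∀ b : Fin j, ExteriorAlgebra.map P.lin.dualMap (dx b) =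
      ∑ i, P.lin (Pi.single i 1) b • dx i := fun b => by
    rw [dx, ExteriorAlgebra.map_apply_ι]
    have : P.lin.dualMap (LinearMap.proj b) =
        ∑ i, P.lin (Pi.single i 1) b • (LinearMap.proj i : Dual ℝ (V k)) := by
      refine (Pi.basisFun ℝ (Fin k)).ext fun i => ?_
      simp [Pi.single_apply]
    rw [this]
    simp [dx]
  simp only [map_sum, map_mul, h2, Finset.sum_mul, LinearMap.comp_apply]
  rw [Finset.sum_comm]
  refine Finset.sum_congr rfl fun i _ => ?_
  conv_lhs => rw [h1 (Pi.single i 1)]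
  simp [Finset.mul_sum]

/-- The grading involution, `(-1)^p` on forms of degree `p`. -/
def inv : Form U k →ₐ[ℝ] Form U k where
  toFun α := fun u x => CliffordAlgebra.involute (α u x)
  map_one' := by funext u x; exact map_one _
  map_mul' a b := by funext u x; exact map_mul _ _ _
  map_zero' := by funext u x; exact map_zero _
  map_add' a b := by funext u x; exact map_add _ _ _
  commutes' r := by
    funext u x
    exact AlgHom.commutes _ r

theorem dx_mul (i : Fin k) (a : Alt k) : dx i * a = CliffordAlgebra.involute a * dx i := by
  induction a using ExteriorAlgebra.induction with
  | algebraMap r => rw [AlgHom.commutes]; exact (Algebra.commutes r _).symm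
  | ι m =>
    rw [show CliffordAlgebra.involute (ExteriorAlgebra.ι ℝ m) = -ExteriorAlgebra.ι ℝ m from
      CliffordAlgebra.involute_ι m, neg_mul, eq_neg_iff_add_eq_zero]
    exact ExteriorAlgebra.ι_add_mul_swap _ _
  | mul a b ha hb => rw [map_mul, ← mul_assoc, ha, mul_assoc, hb, mul_assoc]
  | add a b ha hb => rw [map_add, mul_add, add_mul, ha, hb]

theorem d_mul {α η : Form U k} (h : Smooth α) (h' : Smooth η) :
    d (α * η) = d α * η + inv α * d η := by
  funext u x
  simp only [d, Pi.add_apply, Pi.mul_apply, ((h.hasD u x).mul (h'.hasD u x)).eq,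
    LinearMap.add_apply, LinearMap.comp_apply, LinearMap.mulRight_apply, LinearMap.mulLeft_apply,
    mul_add, Finset.sum_add_distrib, Finset.sum_mul, Finset.mul_sum]
  congr 1
  · simp only [mul_assoc]
  · refine Finset.sum_congr rfl fun i _ => ?_
    rw [← mul_assoc, dx_mul, mul_assoc]
    rfl

theorem HasD.add {α η : Form U k} {u : U.Pt} {x : Simp k} {T S : V k →ₗ[ℝ] Alt k}
    (h : HasD α u x T) (h' : HasD η u x S) : HasD (α + η) u x (T + S) := by
  intro φ
  refine (((h φ).add (h' φ)).congr (fun y hy => ?_) ?_).congr_fderiv ?_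
  · simp [coef_of_mem _ _ _ hy]
  · simp [coef_of_mem _ _ _ x.2]
  · ext v; simp

theorem d_add {α η : Form U k} (h : Smooth α) (h' : Smooth η) : d (α + η) = d α + d η := by
  funext u x
  simp only [d, Pi.add_apply, ((h.hasD u x).add (h'.hasD u x)).eq, LinearMap.add_apply, mul_add,
    Finset.sum_add_distrib]

theorem d_const (r : ℝ) : d (algebraMap ℝ (Form U k) r) = 0 := by
  funext u x
  have h : HasD (algebraMap ℝ (Form U k) r) u x 0 := by
    intro φ
    refine ((hasFDerivWithinAt_const (φ (algebraMap ℝ (Alt k) r)) x.1 (Simp k)).congr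
      (fun y hy => ?_) ?_).congr_fderiv ?_
    · rw [coef_of_mem _ _ _ hy]; rfl
    · rw [coef_of_mem _ _ _ x.2]; rfl
    · ext v; simp
  simp [d, h.eq]

theorem pull_inv (g : W.Pt → U.Pt) (P : AffMap k j) (α : Form U j) :
    inv (pull g P α) = pull g P (inv α) := by
  funext w x
  change CliffordAlgebra.involute (ExteriorAlgebra.map P.lin.dualMap (α (g w) (P.onSimp x))) =
    ExteriorAlgebra.map P.lin.dualMap (CliffordAlgebra.involute (α (g w) (P.onSimp x)))
  refine AlgHom.congr_fun (φ₁ := CliffordAlgebra.involute.comp (ExteriorAlgebra.map P.lin.dualMap))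
    (φ₂ := (ExteriorAlgebra.map P.lin.dualMap).comp CliffordAlgebra.involute) ?_ _
  refine ExteriorAlgebra.hom_ext (LinearMap.ext fun m => ?_)
  have h1 : ∀ (i : ℕ) (m : Dual ℝ (V i)), CliffordAlgebra.involute (ExteriorAlgebra.ι ℝ m) =
    -ExteriorAlgebra.ι ℝ m := fun i m => CliffordAlgebra.involute_ι m
  simp [h1]

theorem Smooth.inv {α : Form U k} (h : Smooth α) : Smooth (inv α) := by
  intro S
  refine (h.functional ((altBasis k).coord S ∘ₗ CliffordAlgebra.involute.toLinearMap)).congr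
    fun p hp => ?_
  rw [coef_of_mem _ _ _ hp.2, coef_of_mem _ _ _ hp.2]
  rfl

theorem SittingInstants.inv {α : Form U k} (h : SittingInstants α) : SittingInstants (inv α) := by
  intro u p
  filter_upwards [h u p] with x hx
  rw [← pull_inv]
  exact congrArg CliffordAlgebra.involute hx

theorem SittingInstants.d {α : Form U k} (hs : Smooth α) (h : SittingInstants α) :
    SittingInstants (d α) := by
  intro u p
  filter_upwards [eventually_eventually_nhds.2 (h u p)] with x hx
  rw [← d_pull hs]
  change ∑ i, dx i * D α u x _ = ∑ i, dx i * D (Form.pull id _ α) u x _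
  rw [(((hs.pull contDiff_id _).hasD u x).congr hx).eq]

theorem Smooth.d {α : Form U k} (h : Smooth α) : Smooth (d α) := by
  have h1 : ∀ (S) (v : V k), ContDiffOn ℝ ∞ (fun p : U.Pt × V k =>
      fderivWithin ℝ (coef ((altBasis k).coord S) α p.1) (Simp k) p.2 v) (univ ×ˢ Simp k) := by
    intro S v
    have hu : UniqueDiffOn ℝ ((univ : Set U.Pt) ×ˢ Simp k) :=
      uniqueDiffOn_univ.prod (Simp_uniqueDiffOn k)
    have h2 := ((h S).fderivWithin hu (m := ∞) (by simp)).clm_apply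
      (contDiffOn_const (c := ((0 : U.Pt), v)))
    refine h2.congr fun p hp => ?_
    have h3 := ((h S).differentiableOn (by simp) p hp).hasFDerivWithinAt
    have h4 : HasFDerivWithinAt (fun x : V k => (p.1, x)) (ContinuousLinearMap.inr ℝ U.Pt (V k))
      (Simp k) p.2 := (hasFDerivAt_prodMk_right p.1 p.2).hasFDerivWithinAt
    have h5 := HasFDerivWithinAt.comp (t := univ ×ˢ Simp k) p.2 h3 h4
      (fun x hx => ⟨mem_univ _, hx⟩)
    have h6 := h5.fderivWithin (Simp_uniqueDiffOn k p.2 hp.2)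
    change fderivWithin ℝ (coef ((altBasis k).coord S) α p.1) _ _ = _ at h6
    rw [h6]
    rfl
  intro S
  refine (ContDiffOn.sum (s := Finset.univ) fun i _ => ContDiffOn.sum (s := Finset.univ) fun I _ =>
    (h1 I (Pi.single i 1)).mul
      (contDiffOn_const (c := (altBasis k).coord S (dx i * altBasis k I)))).congr fun p hp => ?_
  rw [coef_of_mem _ _ _ hp.2]
  simp [Form.d, D, Finset.mul_sum]

/-- The smooth forms with sitting instants, together with their images under all simplicial
operators. -/
def siGenerators (U : CartSp) (k : ℕ) : Set (Form U k) :=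
  {η | ∃ (j : ℕ) (θ : SimplexCategory.mk k ⟶ SimplexCategory.mk j) (α : Form U j),
    Smooth α ∧ SittingInstants α ∧ η = pull id (AffMap.ofVertices θ.toOrderHom) α}

/-- The algebra of vertical forms with sitting instants on `U × Δᵏ`. -/
def siForms (U : CartSp) (k : ℕ) : Subalgebra ℝ (Form U k) :=
  Algebra.adjoin ℝ (siGenerators U k)

theorem siForms_le (U : CartSp) (k : ℕ) : siForms U k ≤ smoothForms U k := by
  refine Algebra.adjoin_le ?_
  rintro _ ⟨j, θ, α, hs, -, rfl⟩
  exact hs.pull contDiff_id _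

theorem inv_mem {α : Form U k} (h : α ∈ siForms U k) : inv α ∈ siForms U k := by
  induction h using Algebra.adjoin_induction with
  | mem α h =>
    obtain ⟨j, θ, α, hs, hi, rfl⟩ := h
    rw [pull_inv]
    exact Algebra.subset_adjoin ⟨j, θ, _, hs.inv, hi.inv, rfl⟩
  | algebraMap r => rw [AlgHom.commutes]; exact Subalgebra.algebraMap_mem _ r
  | add α η _ _ h h' => rw [map_add]; exact Subalgebra.add_mem _ h h'
  | mul α η _ _ h h' => rw [map_mul]; exact Subalgebra.mul_mem _ h h'

theorem d_mem {α : Form U k} (h : α ∈ siForms U k) : d α ∈ siForms U k := by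
  induction h using Algebra.adjoin_induction with
  | mem α h =>
    obtain ⟨j, θ, α, hs, hi, rfl⟩ := h
    rw [d_pull hs]
    exact Algebra.subset_adjoin ⟨j, θ, _, hs.d, hi.d hs, rfl⟩
  | algebraMap r => rw [d_const]; exact Subalgebra.zero_mem _
  | add α η ha he h h' =>
    rw [d_add (siForms_le _ _ ha) (siForms_le _ _ he)]; exact Subalgebra.add_mem _ h h'
  | mul α η ha he h h' =>
    rw [d_mul (siForms_le _ _ ha) (siForms_le _ _ he)]
    exact Subalgebra.add_mem _ (Subalgebra.mul_mem _ h he) (Subalgebra.mul_mem _ (inv_mem ha) h')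

theorem pull_pull {m : ℕ} (g : W.Pt → U.Pt) (P : AffMap k j) (f : X.Pt → W.Pt) (Q : AffMap m k)
    (α : Form U j) : pull f Q (pull g P α) = pull (g ∘ f) (Q.comp P) α := by
  funext w x
  have hx : (Q.comp P).onSimp x = P.onSimp (Q.onSimp x) := Subtype.ext (AffMap.fn_comp _ _ _)
  change ExteriorAlgebra.map Q.lin.dualMap (ExteriorAlgebra.map P.lin.dualMap
    (α (g (f w)) (P.onSimp (Q.onSimp x)))) =
    ExteriorAlgebra.map (Q.comp P).lin.dualMap (α (g (f w)) ((Q.comp P).onSimp x))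
  rw [hx, AffMap.lin_comp, ← LinearMap.dualMap_comp_dualMap, ← ExteriorAlgebra.map_comp_map]
  rfl

theorem SittingInstants.pull_param {α : Form U k} (h : SittingInstants α) (g : W.Pt → U.Pt) :
    SittingInstants (pull g (AffMap.ofVertices id) α) := by
  intro w p
  filter_upwards [h (g w) p] with x hx
  have key : ∀ y, pull g (AffMap.ofVertices id) α w y = α (g w) y := fun y => by
    change ExteriorAlgebra.map (AffMap.ofVertices id).lin.dualMap
      (α (g w) ((AffMap.ofVertices id).onSimp y)) = _
    rw [AffMap.lin_id, show (AffMap.ofVertices id).onSimp y = y from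
      Subtype.ext (AffMap.fn_id y.1), LinearMap.dualMap_id, ExteriorAlgebra.map_id]
    rfl
  rw [key, hx]
  exact congrArg _ (key _).symm

/-- The simplicial operators and the smooth maps of parameter spaces act on `siForms`. -/
theorem pull_mem {α : Form U j} (h : α ∈ siForms U j) {g : W.Pt → U.Pt} (hg : ContDiff ℝ ∞ g)
    (θ : SimplexCategory.mk k ⟶ SimplexCategory.mk j) :
    pull g (AffMap.ofVertices θ.toOrderHom) α ∈ siForms W k := by
  induction h using Algebra.adjoin_induction with
  | mem α h =>
    obtain ⟨l, η, α, hs, hi, rfl⟩ := h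
    refine Algebra.subset_adjoin ⟨l, θ ≫ η, pull g (AffMap.ofVertices id) α,
      hs.pull hg _, hi.pull_param g, ?_⟩
    rw [pull_pull, pull_pull]
    have : AffMap.ofVertices (k := k) (j := l) (θ ≫ η).toOrderHom =
        (AffMap.ofVertices θ.toOrderHom).comp (AffMap.ofVertices η.toOrderHom) := by
      rw [← AffMap.ofVertices_comp]; rfl
    rw [this, ← AffMap.ofVertices_comp, ← AffMap.ofVertices_comp]
    rfl
  | algebraMap r => rw [AlgHom.commutes]; exact Subalgebra.algebraMap_mem _ r
  | add α η _ _ h h' => rw [map_add]; exact Subalgebra.add_mem _ h h'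
  | mul α η _ _ h h' => rw [map_mul]; exact Subalgebra.mul_mem _ h h'

end Form

/-! ### Differential graded algebras and their morphisms -/

/-- The data of a differential graded `ℝ`-algebra: a product, the submodules of homogeneous
elements, a differential. -/
structure DGAlg where
  carrier : Type
  [ring : Ring carrier]
  [algebra : Algebra ℝ carrier]
  deg : ℕ → Submodule ℝ carrier
  d : carrier →ₗ[ℝ] carrier

attribute [instance] DGAlg.ring DGAlg.algebra

/-- Morphisms of differential graded algebras. -/
structure DGAlg.Hom (A B : DGAlg) where
  toAlgHom : A.carrier →ₐ[ℝ] B.carrier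
  map_deg : ∀ p, ∀ a ∈ A.deg p, toAlgHom a ∈ B.deg p
  map_d : ∀ a, toAlgHom (A.d a) = B.d (toAlgHom a)

theorem DGAlg.Hom.ext {A B : DGAlg} {f g : DGAlg.Hom A B} (h : f.toAlgHom = g.toAlgHom) :
    f = g := by
  cases f; cases g; cases h; rfl

/-- Composition (`f` first). -/
def DGAlg.Hom.comp {A B C : DGAlg} (f : DGAlg.Hom A B) (g : DGAlg.Hom B C) : DGAlg.Hom A C where
  toAlgHom := g.toAlgHom.comp f.toAlgHom
  map_deg p a ha := g.map_deg p _ (f.map_deg p a ha)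
  map_d a := by simp [f.map_d, g.map_d]

/-- The dg-algebra `Ω_si^•(U × Δᵏ)_vert` of vertical forms with sitting instants. -/
def Omega (U : CartSp) (k : ℕ) : DGAlg where
  carrier := Form.siForms U k
  deg p :=
    { carrier := {α | ∀ u x, α.1 u x ∈ ⋀[ℝ]^p (Dual ℝ (V k))}
      add_mem' := fun ha hb u x => Submodule.add_mem _ (ha u x) (hb u x)
      zero_mem' := fun u x => Submodule.zero_mem _
      smul_mem' := fun c α ha u x => Submodule.smul_mem _ c (ha u x) }
  d :=
    { toFun := fun α => ⟨Form.d α.1, Form.d_mem α.2⟩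
      map_add' := fun α η =>
        Subtype.ext (Form.d_add (Form.siForms_le _ _ α.2) (Form.siForms_le _ _ η.2))
      map_smul' := fun c α => Subtype.ext (by
        have h := Form.d_mul (Form.Smooth.const (U := U) (k := k) c) (Form.siForms_le _ _ α.2)
        rw [Form.d_const, zero_mul, zero_add, AlgHom.commutes] at h
        simpa [Algebra.smul_def] using h) }

/-- Pullback of forms along a smooth map of parameter spaces and a simplicial operator. -/
def Omega.pull {U W : CartSp} {k j : ℕ} (g : W ⟶ U)
    (θ : SimplexCategory.mk k ⟶ SimplexCategory.mk j) : DGAlg.Hom (Omega U j) (Omega W k) where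
  toAlgHom := ((Form.pull g.1 (AffMap.ofVertices θ.toOrderHom)).comp
    (Form.siForms U j).val).codRestrict (Form.siForms W k)
      (fun α => Form.pull_mem α.2 g.2 θ)
  map_deg p α hα w x := by
    have : ∀ a ∈ ⋀[ℝ]^p (Dual ℝ (V j)), ExteriorAlgebra.map
        (AffMap.ofVertices (k := k) (j := j) θ.toOrderHom).lin.dualMap a ∈
        ⋀[ℝ]^p (Dual ℝ (V k)) := by
      intro a ha
      rw [← ExteriorAlgebra.ιMulti_span_fixedDegree] at ha
      induction ha using Submodule.span_induction with
      | mem a ha =>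
        obtain ⟨v, rfl⟩ := ha
        rw [ExteriorAlgebra.map_apply_ιMulti]
        exact ExteriorAlgebra.ιMulti_range ℝ p ⟨_, rfl⟩
      | zero => simp
      | add a b _ _ ha hb => rw [map_add]; exact Submodule.add_mem _ ha hb
      | smul c a _ ha => rw [map_smul]; exact Submodule.smul_mem _ c ha
    exact this _ (hα _ _)
  map_d α := Subtype.ext (Form.d_pull (Form.siForms_le _ _ α.2) _ _).symm

theorem Omega.pull_id (U : CartSp) (k : ℕ) (α : (Omega U k).carrier) :
    (Omega.pull (𝟙 U) (𝟙 (SimplexCategory.mk k))).toAlgHom α = α := by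
  refine Subtype.ext (funext fun u => funext fun x => ?_)
  change ExteriorAlgebra.map (AffMap.ofVertices id).lin.dualMap
      (α.1 u ((AffMap.ofVertices id).onSimp x)) = _
  rw [AffMap.lin_id, show (AffMap.ofVertices id).onSimp x = x from
    Subtype.ext (AffMap.fn_id x.1), LinearMap.dualMap_id, ExteriorAlgebra.map_id]
  rfl

theorem Omega.pull_comp {U W X : CartSp} {k j l : ℕ} (g : W ⟶ U) (f : X ⟶ W)
    (θ : SimplexCategory.mk k ⟶ SimplexCategory.mk j)
    (η : SimplexCategory.mk j ⟶ SimplexCategory.mk l) (α : (Omega U l).carrier) :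
    (Omega.pull (f ≫ g) (θ ≫ η)).toAlgHom α =
      (Omega.pull f θ).toAlgHom ((Omega.pull g η).toAlgHom α) := by
  refine Subtype.ext ?_
  refine Eq.trans ?_ (Form.pull_pull g.1 (AffMap.ofVertices η.toOrderHom) f.1
    (AffMap.ofVertices θ.toOrderHom) α.1).symm
  rw [← AffMap.ofVertices_comp]
  rfl

/-! ### The simplicial presheaves `exp_Δ` -/

/-- The simplicial presheaf `(U, [k]) ↦ Hom(A, Ω_si^•(U × Δᵏ)_vert)`. -/
def expD (A : DGAlg) : CartSpᵒᵖ ⥤ SSet.{0} where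
  obj U :=
    { obj := fun k => DGAlg.Hom A (Omega U.unop k.unop.len)
      map := fun {k j} θ => ↾fun Φ => Φ.comp (Omega.pull (𝟙 U.unop) θ.unop)
      map_id := fun k => by
        ext Φ
        exact DGAlg.Hom.ext (AlgHom.ext fun a => Omega.pull_id _ _ _)
      map_comp := fun {k j l} θ η => by
        ext Φ
        refine DGAlg.Hom.ext (AlgHom.ext fun a => ?_)
        exact Omega.pull_comp (𝟙 U.unop) (𝟙 U.unop) η.unop θ.unop _ }
  map {U W} g :=
    { app := fun k => ↾fun Φ => Φ.comp (Omega.pull g.unop (𝟙 k.unop))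
      naturality := fun k j θ => by
        ext Φ
        refine DGAlg.Hom.ext (AlgHom.ext fun a => ?_)
        refine (Omega.pull_comp (𝟙 _) g.unop (𝟙 _) θ.unop _).symm.trans ?_
        exact Omega.pull_comp g.unop (𝟙 _) θ.unop (𝟙 _) _ }
  map_id U := by
    ext k Φ
    exact DGAlg.Hom.ext (AlgHom.ext fun a => Omega.pull_id _ _ _)
  map_comp {U W X} g f := by
    ext k Φ
    refine DGAlg.Hom.ext (AlgHom.ext fun a => ?_)
    exact Omega.pull_comp g.unop f.unop (𝟙 _) (𝟙 _) _

/-- A morphism of dg-algebras `μ : B → A` induces `exp_Δ(μ)`, by precomposition. -/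
def expMap {A B : DGAlg} (μ : DGAlg.Hom B A) : expD A ⟶ expD B where
  app U := { app := fun k => ↾fun Φ => μ.comp Φ }

/-! ### Chevalley-Eilenberg algebras -/

/-- The Chevalley-Eilenberg differential `-½ ∑ᵢⱼ bⁱ ∧ bʲ ∧ ι_{[bᵢ, bⱼ]}`: the antiderivation of
`Λ 𝔤*` with `(dα)(x, y) = -α([x, y])` for `α` in `𝔤*`. It does not depend on the basis `b`. -/
def ceD (𝔤 : Type) [LieRing 𝔤] [LieAlgebra ℝ 𝔤] [FiniteDimensional ℝ 𝔤] :
    ExteriorAlgebra ℝ (Dual ℝ 𝔤) →ₗ[ℝ] ExteriorAlgebra ℝ (Dual ℝ 𝔤) :=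
  let b := Module.finBasis ℝ 𝔤
  (-(1 / 2) : ℝ) • ∑ i, ∑ j,
    LinearMap.mulLeft ℝ (ExteriorAlgebra.ι ℝ (b.coord i) * ExteriorAlgebra.ι ℝ (b.coord j)) ∘ₗ
      CliffordAlgebra.contractLeft (Q := (0 : QuadraticForm ℝ (Dual ℝ 𝔤)))
        (Dual.eval ℝ 𝔤 ⁅b i, b j⁆)

/-- The Chevalley-Eilenberg algebra of a finite-dimensional Lie algebra. -/
def CE (𝔤 : Type) [LieRing 𝔤] [LieAlgebra ℝ 𝔤] [FiniteDimensional ℝ 𝔤] : DGAlg where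
  carrier := ExteriorAlgebra ℝ (Dual ℝ 𝔤)
  deg p := ⋀[ℝ]^p (Dual ℝ 𝔤)
  d := ceD 𝔤

/-- The free graded-commutative algebra on one generator of degree `n`. -/
abbrev LineAlg (n : ℕ) : Type :=
  Polynomial ℝ ⧸ Ideal.span {if Odd n then (Polynomial.X ^ 2 : Polynomial ℝ) else 0}

/-- The generator of `LineAlg n`. -/
def lineGen (n : ℕ) : LineAlg n := Ideal.Quotient.mk _ Polynomial.X

/-- The Chevalley-Eilenberg algebra of the line Lie `n`-algebra `b^{n-1} ℝ`, with one generator, of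
degree `n`, and trivial differential. -/
def CELine (n : ℕ) : DGAlg where
  carrier := LineAlg n
  deg p := Submodule.span ℝ {a | ∃ j : ℕ, n * j = p ∧ a = lineGen n ^ j}
  d := 0

/-! ### The simplicial presheaves `Bⁿℝ` and `Bⁿ(Λ → ℝ)` -/

/-- The presheaf `U ↦ C^∞(U, Λ)` of smooth functions with values in a subgroup `Λ` of `ℝ`. -/
def smoothFun (Λ : AddSubgroup ℝ) : CartSpᵒᵖ ⥤ AddCommGrpCat.{0} where
  obj U := AddCommGrpCat.of (AddSubgroup.mk (G := U.unop.Pt → ℝ)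
    { carrier := {h | ContDiff ℝ ∞ h ∧ ∀ u, h u ∈ Λ}
      add_mem' := fun ha hb => ⟨ha.1.add hb.1, fun u => Λ.add_mem (ha.2 u) (hb.2 u)⟩
      zero_mem' := ⟨contDiff_const, fun _ => Λ.zero_mem⟩ }
    (fun ha => ⟨ha.1.neg, fun u => Λ.neg_mem (ha.2 u)⟩))
  map {U W} g := AddCommGrpCat.ofHom
    { toFun := fun h => ⟨fun w => h.1 (g.unop.1 w), h.2.1.comp g.unop.2, fun w => h.2.2 _⟩
      map_zero' := rfl
      map_add' := fun _ _ => rfl }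

/-- The inclusion `C^∞(-, Λ) → C^∞(-, ℝ)`. -/
def smoothIncl (Λ : AddSubgroup ℝ) : smoothFun Λ ⟶ smoothFun ⊤ where
  app U := AddCommGrpCat.ofHom
    { toFun := fun h => ⟨h.1, h.2.1, fun _ => AddSubgroup.mem_top _⟩
      map_zero' := rfl
      map_add' := fun _ _ => rfl }

/-- The Dold-Kan functor to simplicial abelian groups, followed by the forgetful functor. -/
def DK : ChainComplex AddCommGrpCat.{0} ℕ ⥤ SSet.{0} :=
  CategoryTheory.Abelian.DoldKan.Γ ⋙
    (SimplicialObject.whiskering AddCommGrpCat.{0} (Type 0)).obj (forget AddCommGrpCat.{0})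

/-- The presheaf of complexes `C^∞(-, ℝ)[n]`. -/
def oneTerm (n : ℕ) : CartSpᵒᵖ ⥤ ChainComplex AddCommGrpCat.{0} ℕ :=
  smoothFun ⊤ ⋙ HomologicalComplex.single _ _ n

theorem rel_down (n : ℕ) : (ComplexShape.down ℕ).Rel (n + 1) n := rfl

/-- The presheaf of complexes `C^∞(-, Λ) → C^∞(-, ℝ)` in degrees `n + 1` and `n`. -/
def twoTerm (n : ℕ) (Λ : AddSubgroup ℝ) : CartSpᵒᵖ ⥤ ChainComplex AddCommGrpCat.{0} ℕ where
  obj U := HomologicalComplex.double ((smoothIncl Λ).app U) (rel_down n)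
  map {U W} g := HomologicalComplex.mkHomFromDouble (rel_down n) (by simp)
    ((smoothFun Λ).map g ≫
      (HomologicalComplex.doubleXIso₀ ((smoothIncl Λ).app W) (rel_down n)).inv)
    ((smoothFun ⊤).map g ≫
      (HomologicalComplex.doubleXIso₁ ((smoothIncl Λ).app W) (rel_down n) (by simp)).inv)
    (by
      rw [HomologicalComplex.double_d _ _ (by simp)]
      simp)
    (fun k hk => by rw [HomologicalComplex.double_d_eq_zero₀ _ _ _ _ (by simp), comp_zero])
  map_id U := by
    apply HomologicalComplex.from_double_hom_ext <;> simp
  map_comp g f := by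
    apply HomologicalComplex.from_double_hom_ext <;> simp

/-- The inclusion of complexes `C^∞(U, ℝ)[n] → (C^∞(U, Λ) → C^∞(U, ℝ))`. -/
def oneToTwoApp (n : ℕ) (Λ : AddSubgroup ℝ) (U : CartSpᵒᵖ) :
    (HomologicalComplex.single AddCommGrpCat.{0} (ComplexShape.down ℕ) n).obj
      ((smoothFun ⊤).obj U) ⟶ HomologicalComplex.double ((smoothIncl Λ).app U) (rel_down n) :=
  HomologicalComplex.mkHomFromSingle
    (HomologicalComplex.doubleXIso₁ ((smoothIncl Λ).app U) (rel_down n) (by simp)).inv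
    (fun k hk => (congrArg (CategoryStruct.comp _)
      (HomologicalComplex.double_d_eq_zero₀ _ _ _ _ (by simp))).trans comp_zero)

theorem oneToTwoApp_f (n : ℕ) (Λ : AddSubgroup ℝ) (U : CartSpᵒᵖ) : (oneToTwoApp n Λ U).f n =
    (HomologicalComplex.singleObjXSelf (ComplexShape.down ℕ) n ((smoothFun ⊤).obj U)).hom ≫
      (HomologicalComplex.doubleXIso₁ ((smoothIncl Λ).app U) (rel_down n) (by simp)).inv :=
  HomologicalComplex.mkHomFromSingle_f _ _

/-- The inclusion of complexes `C^∞(-, ℝ)[n] → (C^∞(-, Λ) → C^∞(-, ℝ))`. -/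
def oneToTwo (n : ℕ) (Λ : AddSubgroup ℝ) : oneTerm n ⟶ twoTerm n Λ where
  app U := oneToTwoApp n Λ U
  naturality U W g := by
    apply HomologicalComplex.from_single_hom_ext
    dsimp only [oneTerm, twoTerm, Functor.comp_obj, Functor.comp_map, HomologicalComplex.comp_f]
    rw [oneToTwoApp_f, oneToTwoApp_f, HomologicalComplex.single_map_f_self,
      HomologicalComplex.mkHomFromDouble_f₁]
    simp

/-- The simplicial presheaf `Bⁿℝ`. -/
def BR (n : ℕ) : CartSpᵒᵖ ⥤ SSet.{0} := oneTerm n ⋙ DK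

/-- The simplicial presheaf `Bⁿ(Λ → ℝ)`. -/
def BQuot (n : ℕ) (Λ : AddSubgroup ℝ) : CartSpᵒᵖ ⥤ SSet.{0} := twoTerm n Λ ⋙ DK

/-- The canonical morphism `Bⁿℝ → Bⁿ(Λ → ℝ)`. -/
def toBQuot (n : ℕ) (Λ : AddSubgroup ℝ) : BR n ⟶ BQuot n Λ :=
  Functor.whiskerRight (oneToTwo n Λ) DK

open AlgebraicTopology.DoldKan in
/-- The `n`-cell of `Bⁿℝ` over `U` given by a smooth function `h` on `U`: the element `h` of the
degree `n` part of the complex, placed in the summand of `DK(C)_n` indexed by the identity. -/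
def BRcell (n : ℕ) (U : CartSp) (h : (smoothFun ⊤).obj (op U)) :
    ((BR n).obj (op U)).obj (op (SimplexCategory.mk n)) :=
  (((Γ₀.splitting ((oneTerm n).obj (op U))).cofan (op (SimplexCategory.mk n))).inj
    (SimplicialObject.Splitting.IndexSet.id (op (SimplexCategory.mk n))))
    ((HomologicalComplex.singleObjXSelf (ComplexShape.down ℕ) n ((smoothFun ⊤).obj (op U))).inv h)

/-! ### Coskeleta -/

/-- The `n`-coskeleton of a simplicial presheaf. -/
def coskP (n : ℕ) (X : CartSpᵒᵖ ⥤ SSet.{0}) : CartSpᵒᵖ ⥤ SSet.{0} := X ⋙ SSet.cosk n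

/-- The canonical morphism `X → cosk_n X`, the unit of the adjunction `tr_n ⊣ cosk_n`. -/
def toCosk (n : ℕ) (X : CartSpᵒᵖ ⥤ SSet.{0}) : X ⟶ coskP n X :=
  Functor.whiskerLeft X (SSet.coskAdj n).unit

/-! ### Integration -/

/-- The value of an element of `Λ W*` on the vectors `v₁, …, v_n`, with the convention
`(φ₁ ∧ ⋯ ∧ φ_n)(v₁, …, v_n) = det (φᵢ(vⱼ))`; only the part of degree `n` contributes. -/
def evalAlt {W : Type} [AddCommGroup W] [Module ℝ W] {n : ℕ} (v : Fin n → W) :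
    ExteriorAlgebra ℝ (Dual ℝ W) →ₗ[ℝ] ℝ :=
  ExteriorAlgebra.liftAlternating (Pi.single n
    (Matrix.detRowAlternating.compLinearMap (LinearMap.pi fun j => Dual.eval ℝ W (v j))))

/-- The integral of an `n`-form over `Δⁿ`, fiberwise over `U`. -/
def simplexIntegral {U : CartSp} {n : ℕ} (α : (Omega U n).carrier) (u : U.Pt) : ℝ :=
  ∫ x in Simp n, Form.coef (evalAlt fun i => (Pi.single i 1 : V n)) α.1 u x

/-- `I` is the morphism `∫_{Δ^•} : exp_Δ(b^{n-1}ℝ) → Bⁿℝ` of fiber integration over simplices: on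
`n`-cells, it takes a form to its integral over `Δⁿ`. (Maps into `Bⁿℝ` are determined by their
values on `n`-cells.) -/
def IsFiberIntegration {n : ℕ} (I : expD (CELine n) ⟶ BR n) : Prop :=
  ∀ (U : CartSp) (Φ : DGAlg.Hom (CELine n) (Omega U n)),
    ∃ h : (smoothFun ⊤).obj (op U),
      (∀ u, h.1 u = simplexIntegral (Φ.toAlgHom (lineGen n)) u) ∧
      (I.app (op U)).app (op (SimplexCategory.mk n)) Φ = BRcell n U h

/-! ### The period homomorphism -/

section Period

variable {d : ℕ} {G : Type*} [TopologicalSpace G] [ChartedSpace (EuclideanSpace ℝ (Fin d)) G]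
  [Group G] [LieGroup (𝓡 d) ∞ G]

instance : FiniteDimensional ℝ (GroupLieAlgebra (𝓡 d) G) :=
  inferInstanceAs (FiniteDimensional ℝ (EuclideanSpace ℝ (Fin d)))

instance : LieGroup (𝓡 d) (minSmoothness ℝ 3) G := by
  rw [minSmoothness_of_isRCLikeNormedField]
  infer_instance

/-- The pullback along `F : ℝⁿ → G` of the left-invariant Maurer-Cartan form of `G`, at the point
`y` and on the vector `v`: the differential of `z ↦ F(y)⁻¹ F(z)` at `z = y`, applied to `v`. -/
def mcPull {n : ℕ} (F : (Fin n → ℝ) → G) (y v : Fin n → ℝ) : GroupLieAlgebra (𝓡 d) G :=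
  mfderiv 𝓘(ℝ, Fin n → ℝ) (𝓡 d) (fun z => (F y)⁻¹ * F z) y v

/-- The integral over the unit cube of the pullback along `F : ℝⁿ → G` of the left-invariant
`n`-form on `G` given by an element `m` of `Λ 𝔤*`. -/
def cubeIntegral {n : ℕ} (m : ExteriorAlgebra ℝ (Dual ℝ (GroupLieAlgebra (𝓡 d) G)))
    (F : (Fin n → ℝ) → G) : ℝ :=
  ∫ y in Icc (0 : Fin n → ℝ) 1, evalAlt (fun i => mcPull (d := d) F y (Pi.single i 1)) m

/-- `per` is the period homomorphism `π_n(G, 1) → ℝ` of the cocycle `μ`: on the class of a based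
map of the `n`-cube to `G` that extends to a smooth map `F : ℝⁿ → G`, it is the integral of `μ`
over `F`. (Every class contains such a map.) -/
def IsPeriodHom {n : ℕ} [NeZero n] (μ : DGAlg.Hom (CELine n) (CE (GroupLieAlgebra (𝓡 d) G)))
    (per : Additive (HomotopyGroup.Pi n G (1 : G)) →+ ℝ) : Prop :=
  ∀ (F : (Fin n → ℝ) → G) (f : GenLoop (Fin n) G 1),
    ContMDiff 𝓘(ℝ, Fin n → ℝ) (𝓡 d) ∞ F → (∀ y, f y = F fun i => y i) →
      per (Additive.ofMul ⟦f⟧) = cubeIntegral (μ.toAlgHom (lineGen n)) F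

end Period

end LieInt

end

open CategoryTheory Opposite Set Module Limits
open scoped Manifold ContDiff Topology

noncomputable section

namespace LieInt

open AlgebraicTopology AlgebraicTopology.DoldKan SimplicialObject Simplicial

/-! ### Maps into the simplicial object `Γ₀` of a chain complex -/

section DoldKan

variable {A : Type*} [Category* A] [Abelian A]

/-! A map from a simplicial set to `DK.obj C` amounts to a family of normalized cochains with values
in the terms of `C` that is compatible with the differentials (`dk_hom_ext`, `dk_exists`). Hence a
map from a simplicial presheaf `X` to `Bⁿℝ` is a normalized `n`-cocycle with values in smooth
functions, and a map to `Bⁿ(Λ → ℝ)` is a normalized `n`-cochain whose coboundary has values in `Λ`.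
Since `X` and its `n`-coskeleton have the same `n`-cells, the cochain of `φ` is forced to be the
integral of `μ`, and `φ` exists exactly if the coboundary of this cochain on the `(n+1)`-cells of
the coskeleton lies in `Λ` (`exists_cosk_factorization_iff`). The least `Λ` is therefore the group
`cosubgroup μ` generated by the values of these coboundaries, for every `n ≥ 1`. On `X` itself the
coboundary vanishes by Stokes' theorem; in the coskeleton there are boundaries of simplices without
a filler.

To compare with periods, fix a parameter `u`. A cell of `exp_Δ(𝔤)` is then a flat `𝔤`-valued form on
a simplex, and by the Frobenius theorem it is the Maurer-Cartan form of a smooth map to `G`, unique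
up to left translation (`exists_mcForm_eq`, `exists_eq_mul_of_MC_eq`). An `(n+1)`-cell of the
coskeleton gives maps on the faces of `Δⁿ⁺¹` that agree on intersections up to translation. If `n ≥
2`, the translations can be chosen so that the maps agree (`Coherent.exists_translates`). A horn
filler in the simplicial group of smooth simplices takes care of all faces but one. Stokes' theorem,
together with the additivity of the integral for products with a simplex that is trivial on the
boundary (`sInt_mul`), shows that the coboundary is the integral over a simplex that is trivial on
the boundary, which is a period (`exists_delta_cosk_eq`). Conversely, a smooth sphere in `G`,
concentrated in the interior of a simplex and completed by constant faces, is an `(n+1)`-cell of the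
coskeleton whose coboundary is the given period (`exists_cosk_cell`).

The period homomorphism is defined by smooth representatives that are trivial outside the open cube.
Representatives and homotopies are smoothed by approximation in the group
(`exists_smooth_homotopic`). Stokes' theorem on a simplex gives homotopy invariance. Concatenation
is the pointwise product of cubes with disjoint supports, so `sInt_mul` also makes periods additive.
-/

instance : (N₁ : SimplicialObject A ⥤ _).Full :=
  -- By the Dold-Kan theorem for Karoubi envelopes `N₂` is an equivalence, and `N₁` is its composite
  -- with the fully faithful embedding in the envelope.
  haveI : (N₂ : Idempotents.Karoubi (SimplicialObject A) ⥤ _).IsEquivalence :=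
    (Preadditive.DoldKan.equivalence (C := A)).isEquivalence_functor
  Functor.Full.of_iso (toKaroubiCompN₂IsoN₁ (C := A))

instance : (N₁ : SimplicialObject A ⥤ _).Faithful :=
  haveI : (N₂ : Idempotents.Karoubi (SimplicialObject A) ⥤ _).IsEquivalence :=
    (Preadditive.DoldKan.equivalence (C := A)).isEquivalence_functor
  Functor.Faithful.of_iso (toKaroubiCompN₂IsoN₁ (C := A))

/-- The projection of `Γ₀(K)_n` to its nondegenerate summand `K_n`. -/
def gammaProj (K : ChainComplex A ℕ) (n : ℕ) : (Γ₀.obj K).obj (op ⦋n⦌) ⟶ K.X n :=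
  (Γ₀.splitting K).πSummand (Splitting.IndexSet.id (op ⦋n⦌))

/-- The inclusion of the nondegenerate summand `K_n` in `Γ₀(K)_n`. -/
def gammaInj (K : ChainComplex A ℕ) (n : ℕ) : K.X n ⟶ (Γ₀.obj K).obj (op ⦋n⦌) :=
  ((Γ₀.splitting K).cofan (op ⦋n⦌)).inj (Splitting.IndexSet.id (op ⦋n⦌))

theorem gammaInj_proj (K : ChainComplex A ℕ) (n : ℕ) :
    gammaInj K n ≫ gammaProj K n = 𝟙 _ :=
  (Γ₀.splitting K).cofan_inj_πSummand_eq_id _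

theorem gamma_PInfty_proj (K : ChainComplex A ℕ) (n : ℕ) :
    (PInfty : AlternatingFaceMapComplex.obj (Γ₀.obj K) ⟶ _).f n ≫ gammaProj K n = gammaProj K n :=
  (Γ₀.splitting K).PInfty_comp_πSummand_id n

theorem gammaInj_PInfty (K : ChainComplex A ℕ) (n : ℕ) :
    gammaInj K n ≫ (PInfty : AlternatingFaceMapComplex.obj (Γ₀.obj K) ⟶ _).f n = gammaInj K n :=
  PInfty_on_Γ₀_splitting_summand_eq_self K

theorem gamma_proj_inj (K : ChainComplex A ℕ) (n : ℕ) :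
    gammaProj K n ≫ gammaInj K n = (PInfty : AlternatingFaceMapComplex.obj (Γ₀.obj K) ⟶ _).f n := by
  have := (Γ₀.splitting K).πSummand_comp_cofan_inj_id_comp_PInfty_eq_PInfty n
  rw [← this]
  exact congrArg (gammaProj K n ≫ ·) (gammaInj_PInfty K n).symm

/-- On the nondegenerate summand of `Γ₀` the face `δ 0` is the differential of `K` and all other
faces vanish, so one term of the alternating sum survives. -/
theorem gammaInj_d (K : ChainComplex A ℕ) (n : ℕ) :
    gammaInj K (n + 1) ≫ (AlternatingFaceMapComplex.obj (Γ₀.obj K)).d (n + 1) n = K.d (n + 1) n ≫ gammaInj K n := by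
  rw [AlternatingFaceMapComplex.obj_d_eq, Preadditive.comp_sum, Finset.sum_eq_single 0]
  · have := Γ₀.Obj.mapMono_on_summand_id K (SimplexCategory.δ (0 : Fin (n + 2)))
    rw [Γ₀.Obj.Termwise.mapMono_δ₀] at this
    simp only [Fin.val_zero, pow_zero, one_smul]
    exact this
  · intro j _ hj
    obtain ⟨i, rfl⟩ := Fin.exists_succ_eq.2 hj
    rw [Preadditive.comp_zsmul]
    have := HigherFacesVanish.on_Γ₀_summand_id K n i (by lia)
    rw [show gammaInj K (n + 1) ≫ (Γ₀.obj K).δ i.succ = 0 from this, smul_zero]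
  · simp

/-- The projection absorbs `PInfty`, which is a chain map with image in the nondegenerate summand;
there `gammaInj_d` applies. -/
theorem gammaProj_d (K : ChainComplex A ℕ) (n : ℕ) :
    gammaProj K (n + 1) ≫ K.d (n + 1) n = (AlternatingFaceMapComplex.obj (Γ₀.obj K)).d (n + 1) n ≫ gammaProj K n := by
  rw [← gamma_PInfty_proj K n, ← Category.assoc ((AlternatingFaceMapComplex.obj (Γ₀.obj K)).d (n + 1) n),
    ← (PInfty : AlternatingFaceMapComplex.obj (Γ₀.obj K) ⟶ _).comm (n + 1) n, ← gamma_proj_inj, Category.assoc, Category.assoc,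
    ← Category.assoc (gammaInj K (n + 1)), gammaInj_d, Category.assoc, gammaInj_proj,
    Category.comp_id]

theorem gammaProj_naturality {K L : ChainComplex A ℕ} (f : K ⟶ L) (n : ℕ) :
    (Γ₀.map f).app (op ⦋n⦌) ≫ gammaProj L n = gammaProj K n ≫ f.f n := by
  have h : gammaInj K n ≫ (Γ₀.map f).app (op ⦋n⦌) = f.f n ≫ gammaInj L n :=
    (Γ₀.splitting K).ι_desc _ _ _
  rw [← gamma_PInfty_proj L n, ← Category.assoc, ← gamma_PInfty_proj K n]
  have h2 := PInfty_f_naturality n (Γ₀.map f)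
  rw [h2, ← gamma_proj_inj K, Category.assoc, Category.assoc, Category.assoc, ← Category.assoc
    (gammaInj K n), h, Category.assoc, gammaInj_proj, Category.comp_id, Category.assoc,
    ← Category.assoc (gammaInj K n), gammaInj_proj, Category.id_comp]

/-- `N₁` is faithful and only sees a map through `PInfty`, which on `Γ₀.obj K` is the projection to
the nondegenerate summand followed by its inclusion. -/
theorem gamma_hom_ext {Y : SimplicialObject A} {K : ChainComplex A ℕ} {a b : Y ⟶ Γ₀.obj K}
    (h : ∀ n, a.app (op ⦋n⦌) ≫ gammaProj K n = b.app (op ⦋n⦌) ≫ gammaProj K n) : a = b := by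
  apply (N₁ : SimplicialObject A ⥤ _).map_injective
  apply Idempotents.Karoubi.hom_ext
  ext n
  change PInfty.f n ≫ a.app _ = PInfty.f n ≫ b.app _
  rw [← PInfty_f_naturality, ← PInfty_f_naturality]
  rw [← gamma_proj_inj, ← Category.assoc, h, Category.assoc]

/-- The complement `QInfty` of `PInfty` is a sum of maps that end in a degeneracy, so it is
annihilated by maps that vanish on degenerate elements. -/
theorem comp_PInfty_of_sigma {Y : SimplicialObject A} {Z : A} (n : ℕ)
    (g : Y.obj (op ⦋n + 1⦌) ⟶ Z) (hg : ∀ i : Fin (n + 1), Y.σ i ≫ g = 0) :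
    (PInfty : AlternatingFaceMapComplex.obj Y ⟶ _).f (n + 1) ≫ g = g := by
  have h1 := PInfty_f_add_QInfty_f (X := Y) (n + 1)
  have h2 : (QInfty : AlternatingFaceMapComplex.obj Y ⟶ _).f (n + 1) ≫ g = 0 := by
    rw [QInfty_f, decomposition_Q, Preadditive.sum_comp]
    refine Finset.sum_eq_zero fun i _ => ?_
    rw [Category.assoc, Category.assoc, hg, comp_zero, comp_zero]
  calc _ = (PInfty.f (n + 1) + QInfty.f (n + 1)) ≫ g := by rw [Preadditive.add_comp, h2, add_zero]
    _ = g := by rw [h1]; exact Category.id_comp g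

/-- The existence half of Dold-Kan: fullness of `N₁` lifts the chain map `PInfty ≫ g ≫ i`, with `i`
the inclusion of `K` in the alternating face complex of `Γ₀.obj K`. -/
theorem gamma_exists {Y : SimplicialObject A} {K : ChainComplex A ℕ} (g : AlternatingFaceMapComplex.obj Y ⟶ K) :
    ∃ a : Y ⟶ Γ₀.obj K, ∀ n, a.app (op ⦋n⦌) ≫ gammaProj K n = (PInfty : AlternatingFaceMapComplex.obj Y ⟶ _).f n ≫ g.f n := by
  let i : K ⟶ AlternatingFaceMapComplex.obj (Γ₀.obj K) :=
    { f := gammaInj K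
      comm' := by
        rintro _ n rfl
        exact gammaInj_d K n }
  have hi : i ≫ PInfty = i := by
    ext n
    exact gammaInj_PInfty K n
  let h : N₁.obj Y ⟶ N₁.obj (Γ₀.obj K) :=
    { f := PInfty ≫ g ≫ i
      comm := by
        change PInfty ≫ (PInfty ≫ g ≫ i) ≫ PInfty = PInfty ≫ g ≫ i
        rw [Category.assoc, Category.assoc, hi, PInfty_idem_assoc] }
  obtain ⟨a, ha⟩ := N₁.map_surjective h
  refine ⟨a, fun n => ?_⟩
  have h1 : (PInfty : AlternatingFaceMapComplex.obj Y ⟶ _).f n ≫ a.app (op ⦋n⦌) = PInfty.f n ≫ g.f n ≫ gammaInj K n :=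
    congrArg (fun q : N₁.obj Y ⟶ N₁.obj (Γ₀.obj K) => q.f.f n) ha
  rw [← gamma_PInfty_proj K n, ← Category.assoc, PInfty_f_naturality, h1, Category.assoc,
    Category.assoc, gammaInj_proj, Category.comp_id]

end DoldKan

/-! ### Maps from a simplicial set to `DK` as cochains -/

section Cells

/-- The component of degree `n` of an `n`-cell of `DK C`. -/
def dkProj (C : ChainComplex AddCommGrpCat.{0} ℕ) (n : ℕ) (y : (DK.obj C).obj (op ⦋n⦌)) : C.X n :=
  gammaProj C n y

theorem dkProj_naturality {C D : ChainComplex AddCommGrpCat.{0} ℕ} (f : C ⟶ D) (n : ℕ)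
    (y : (DK.obj C).obj (op ⦋n⦌)) :
    dkProj D n ((DK.map f).app (op ⦋n⦌) y) = f.f n (dkProj C n y) :=
  ConcreteCategory.congr_hom (gammaProj_naturality f n) y

theorem addCommGrp_sum_zsmul_apply {P Q : AddCommGrpCat.{0}} {ι : Type*} (s : Finset ι)
    (c : ι → ℤ) (f : ι → (P ⟶ Q)) (x : P) :
    (∑ i ∈ s, c i • f i : P ⟶ Q) x = ∑ i ∈ s, c i • f i x := by
  classical
  induction s using Finset.induction_on with
  | empty => rfl
  | insert a s ha ih =>
    rw [Finset.sum_insert ha, Finset.sum_insert ha, ← ih]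
    rfl

theorem dkProj_d (C : ChainComplex AddCommGrpCat.{0} ℕ) (n : ℕ)
    (y : (DK.obj C).obj (op ⦋n + 1⦌)) :
    C.d (n + 1) n (dkProj C (n + 1) y) = ∑ i : Fin (n + 2), (-1 : ℤ) ^ (i : ℕ) •
      dkProj C n ((DK.obj C).map (SimplexCategory.δ i).op y) := by
  have h := ConcreteCategory.congr_hom (gammaProj_d C n) y
  rw [AlternatingFaceMapComplex.obj_d_eq, Preadditive.sum_comp] at h
  simp only [Preadditive.zsmul_comp] at h
  exact h.trans (addCommGrp_sum_zsmul_apply _ _ _ _)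

/-- The free simplicial abelian group on a simplicial set. -/
def freeSimp (X : SSet.{0}) : SimplicialObject AddCommGrpCat.{0} :=
  ((SimplicialObject.whiskering _ _).obj AddCommGrpCat.free).obj X

/-- The generator of the free simplicial abelian group given by a cell. -/
def freeSimpOf {X : SSet.{0}} {k : SimplexCategoryᵒᵖ} (x : X.obj k) : (freeSimp X).obj k :=
  FreeAbelianGroup.of x

/-- The extension of a function on cells to the free abelian group. -/
def freeSimpDesc {X : SSet.{0}} {k : SimplexCategoryᵒᵖ} {Q : AddCommGrpCat.{0}}
    (f : X.obj k → Q) : (freeSimp X).obj k ⟶ Q :=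
  AddCommGrpCat.ofHom (FreeAbelianGroup.lift f)

theorem freeSimpDesc_of {X : SSet.{0}} {k : SimplexCategoryᵒᵖ} {Q : AddCommGrpCat.{0}}
    (f : X.obj k → Q) (x : X.obj k) : freeSimpDesc f (freeSimpOf x) = f x :=
  FreeAbelianGroup.lift_apply_of _ _

theorem freeSimp_map_of {X : SSet.{0}} {k j : SimplexCategoryᵒᵖ} (θ : k ⟶ j) (x : X.obj k) :
    (freeSimp X).map θ (freeSimpOf x) = freeSimpOf (X.map θ x) :=
  FreeAbelianGroup.map_of_apply _

theorem freeSimp_hom_ext {X : SSet.{0}} {k : SimplexCategoryᵒᵖ} {Q : AddCommGrpCat.{0}}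
    {a b : (freeSimp X).obj k ⟶ Q}
    (h : ∀ x : X.obj k, a (freeSimpOf x) = b (freeSimpOf x)) : a = b :=
  AddCommGrpCat.hom_ext (FreeAbelianGroup.lift_ext _ _ h)

/-- A map to `DK.obj C` extends linearly to the free simplicial abelian group on the source, where
`gamma_hom_ext` applies. -/
theorem dk_hom_ext {X : SSet.{0}} {C : ChainComplex AddCommGrpCat.{0} ℕ} {Φ Ψ : X ⟶ DK.obj C}
    (h : ∀ n (x : X.obj (op ⦋n⦌)), dkProj C n (Φ.app _ x) = dkProj C n (Ψ.app _ x)) : Φ = Ψ := by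
  have ex : ∀ Θ : X ⟶ DK.obj C, ∃ a : freeSimp X ⟶ Γ₀.obj C,
      ∀ k (x : X.obj k), a.app k (freeSimpOf x) = Θ.app k x := by
    intro Θ
    refine ⟨{ app := fun k => freeSimpDesc (Q := (Γ₀.obj C).obj k) fun x => Θ.app k x,
              naturality := ?_ }, fun k x => freeSimpDesc_of _ _⟩
    intro k j θ
    refine freeSimp_hom_ext fun x => ?_
    refine ((congrArg (freeSimpDesc (Q := (Γ₀.obj C).obj j) fun x => Θ.app j x)
      (freeSimp_map_of θ x)).trans (freeSimpDesc_of _ _)).trans ?_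
    refine (ConcreteCategory.congr_hom (Θ.naturality θ) x).trans ?_
    exact congrArg ((Γ₀.obj C).map θ) (freeSimpDesc_of (Q := (Γ₀.obj C).obj k) _ _).symm
  obtain ⟨a, ha⟩ := ex Φ
  obtain ⟨b, hb⟩ := ex Ψ
  have h1 : a = b := by
    refine gamma_hom_ext fun n => ?_
    refine freeSimp_hom_ext fun x => ?_
    refine (congrArg (gammaProj C n) (ha _ x)).trans ?_
    exact (h n x).trans (congrArg (gammaProj C n) (hb _ x)).symm
  refine NatTrans.ext (funext fun k => ?_)
  ext x
  exact (ha k x).symm.trans ((ConcreteCategory.congr_hom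
    (congrArg (fun q => NatTrans.app q k) h1) (freeSimpOf x)).trans (hb k x))

/-- A normalized cochain on a simplicial set with values in a complex, compatible with the
differentials, is the family of components of a map to the Dold-Kan simplicial set. -/
theorem dk_exists {X : SSet.{0}} {C : ChainComplex AddCommGrpCat.{0} ℕ}
    (f : ∀ n, X.obj (op ⦋n⦌) → C.X n)
    (hσ : ∀ n (i : Fin (n + 1)) (x : X.obj (op ⦋n⦌)),
      f (n + 1) (X.map (SimplexCategory.σ i).op x) = 0)
    (hd : ∀ n (x : X.obj (op ⦋n + 1⦌)), C.d (n + 1) n (f (n + 1) x) =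
      ∑ i : Fin (n + 2), (-1 : ℤ) ^ (i : ℕ) • f n (X.map (SimplexCategory.δ i).op x)) :
    ∃ Φ : X ⟶ DK.obj C, ∀ n (x : X.obj (op ⦋n⦌)), dkProj C n (Φ.app _ x) = f n x := by
  let F : ∀ n, (freeSimp X).obj (op ⦋n⦌) ⟶ C.X n := fun n => freeSimpDesc (f n)
  have hF : ∀ n x, F n (freeSimpOf x) = f n x := fun n x => freeSimpDesc_of _ _
  let g : AlternatingFaceMapComplex.obj (freeSimp X) ⟶ C :=
    { f := F
      comm' := by
        rintro _ n rfl
        rw [AlternatingFaceMapComplex.obj_d_eq]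
        refine freeSimp_hom_ext fun x => ?_
        refine (congrArg (C.d (n + 1) n) (hF _ x)).trans ((hd n x).trans ?_)
        refine Eq.symm ((congrArg (F n) (addCommGrp_sum_zsmul_apply _ _ _ _)).trans ?_)
        refine (map_sum _ _ _).trans (Finset.sum_congr rfl fun i _ => ?_)
        refine (map_zsmul _ _ _).trans (congrArg _ ?_)
        exact (congrArg (F n) (freeSimp_map_of _ x)).trans (hF _ _) }
  obtain ⟨a, ha⟩ := gamma_exists g
  -- The cochain vanishes on degenerate cells, so `PInfty` does not change its linear extension.
  have hP : ∀ n, (PInfty : AlternatingFaceMapComplex.obj (freeSimp X) ⟶ _).f n ≫ F n = F n := by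
    rintro (_ | n)
    · exact Category.id_comp _
    · refine comp_PInfty_of_sigma n _ fun i => ?_
      refine freeSimp_hom_ext fun x => ?_
      exact ((congrArg (F (n + 1)) (freeSimp_map_of _ x)).trans (hF _ _)).trans (hσ n i x)
  refine ⟨{ app := fun k => ↾fun x => a.app k (freeSimpOf x), naturality := ?_ }, ?_⟩
  · intro k j θ
    ext x
    refine Eq.trans ?_ (ConcreteCategory.congr_hom (a.naturality θ) (freeSimpOf x))
    exact congrArg (fun q => a.app j q) (freeSimp_map_of θ x).symm
  · intro n x
    exact (ConcreteCategory.congr_hom ((ha n).trans (hP n)) (freeSimpOf x)).trans (hF n x)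

/-- The other summands of `Γ₀` in degree `n` are copies of terms `C.X j` with `j < n`, which are
zero here. -/
theorem dkProj_injective {C : ChainComplex AddCommGrpCat.{0} ℕ} {n : ℕ}
    (hC : ∀ j < n, ∀ c : C.X j, c = 0) {y z : (DK.obj C).obj (op ⦋n⦌)}
    (h : dkProj C n y = dkProj C n z) : y = z := by
  have h1 : gammaProj C n ≫ gammaInj C n = 𝟙 _ := by
    rw [(Γ₀.splitting C).decomposition_id (op ⦋n⦌), Finset.sum_eq_single
      (Splitting.IndexSet.id (op ⦋n⦌))]
    · rfl
    · intro B _ hB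
      have : B.1.unop.len < n := lt_of_not_ge fun h => hB (B.eqId_iff_len_le.2 h)
      refine AddCommGrpCat.hom_ext (AddMonoidHom.ext fun w => ?_)
      have h0 : (Γ₀.splitting C).πSummand B w = 0 := hC _ this _
      change ((Γ₀.splitting C).cofan (op ⦋n⦌)).inj B ((Γ₀.splitting C).πSummand B w) = 0
      rw [h0]
      exact map_zero _
    · simp
  have h2 : ∀ w : (DK.obj C).obj (op ⦋n⦌), gammaInj C n (dkProj C n w) = w := fun w =>
    ConcreteCategory.congr_hom h1 w
  rw [← h2 y, ← h2 z, h]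

theorem dkProj_gammaInj (C : ChainComplex AddCommGrpCat.{0} ℕ) (n : ℕ) (c : C.X n) :
    dkProj C n (gammaInj C n c) = c :=
  ConcreteCategory.congr_hom (gammaInj_proj C n) c

end Cells
end LieInt

namespace LieInt

open AlgebraicTopology SimplicialObject Simplicial

/-! ### Maps to `Bⁿℝ` and `Bⁿ(Λ → ℝ)` as normalized cochains -/

section CellsOfBR

/-- The degree `n` part of `oneTerm n`. -/
def oneIso (n : ℕ) (U : CartSpᵒᵖ) : ((oneTerm n).obj U).X n ≅ (smoothFun ⊤).obj U :=
  HomologicalComplex.singleObjXSelf (ComplexShape.down ℕ) n ((smoothFun ⊤).obj U)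

/-- The degree `n` part of `twoTerm n Λ`. -/
def twoIso (n : ℕ) (Λ : AddSubgroup ℝ) (U : CartSpᵒᵖ) :
    ((twoTerm n Λ).obj U).X n ≅ (smoothFun ⊤).obj U :=
  HomologicalComplex.doubleXIso₁ ((smoothIncl Λ).app U) (rel_down n) (by simp)

/-- The degree `n + 1` part of `twoTerm n Λ`. -/
def twoIsoSucc (n : ℕ) (Λ : AddSubgroup ℝ) (U : CartSpᵒᵖ) :
    ((twoTerm n Λ).obj U).X (n + 1) ≅ (smoothFun Λ).obj U :=
  HomologicalComplex.doubleXIso₀ ((smoothIncl Λ).app U) (rel_down n)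

theorem oneTerm_zero {n k : ℕ} (h : k ≠ n) (U : CartSpᵒᵖ) (c : ((oneTerm n).obj U).X k) : c = 0 :=
  ConcreteCategory.congr_hom ((HomologicalComplex.isZero_single_obj_X (ComplexShape.down ℕ) n
    ((smoothFun ⊤).obj U) k h).eq_of_src (𝟙 _) 0) c

theorem twoTerm_zero {n k : ℕ} (Λ : AddSubgroup ℝ) (h : k ≠ n) (h' : k ≠ n + 1) (U : CartSpᵒᵖ)
    (c : ((twoTerm n Λ).obj U).X k) : c = 0 :=
  ConcreteCategory.congr_hom ((HomologicalComplex.isZero_double_X ((smoothIncl Λ).app U)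
    (rel_down n) k h' h).eq_of_src (𝟙 _) 0) c

theorem oneTerm_map (n : ℕ) {U W : CartSpᵒᵖ} (g : U ⟶ W) (c : ((oneTerm n).obj U).X n) :
    (oneIso n W).hom (((oneTerm n).map g).f n c) = (smoothFun ⊤).map g ((oneIso n U).hom c) := by
  have h : ((oneTerm n).map g).f n ≫ (oneIso n W).hom =
      (oneIso n U).hom ≫ (smoothFun ⊤).map g := by
    simp [oneTerm, oneIso, HomologicalComplex.single_map_f_self]
  exact ConcreteCategory.congr_hom h c

theorem twoTerm_map (n : ℕ) (Λ : AddSubgroup ℝ) {U W : CartSpᵒᵖ} (g : U ⟶ W)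
    (c : ((twoTerm n Λ).obj U).X n) :
    (twoIso n Λ W).hom (((twoTerm n Λ).map g).f n c) =
      (smoothFun ⊤).map g ((twoIso n Λ U).hom c) := by
  have h : ((twoTerm n Λ).map g).f n ≫ (twoIso n Λ W).hom =
      (twoIso n Λ U).hom ≫ (smoothFun ⊤).map g := by
    dsimp only [twoTerm, twoIso]
    rw [HomologicalComplex.mkHomFromDouble_f₁ (rel_down n) (by simp)]
    simp
  exact ConcreteCategory.congr_hom h c

theorem twoTerm_d (n : ℕ) (Λ : AddSubgroup ℝ) (U : CartSpᵒᵖ)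
    (c : ((twoTerm n Λ).obj U).X (n + 1)) :
    (twoIso n Λ U).hom (((twoTerm n Λ).obj U).d (n + 1) n c) =
      (smoothIncl Λ).app U ((twoIsoSucc n Λ U).hom c) := by
  have h : ((twoTerm n Λ).obj U).d (n + 1) n ≫ (twoIso n Λ U).hom =
      (twoIsoSucc n Λ U).hom ≫ (smoothIncl Λ).app U := by
    dsimp only [twoTerm, twoIso, twoIsoSucc]
    rw [HomologicalComplex.double_d _ _ (by simp)]
    simp
  exact ConcreteCategory.congr_hom h c

theorem oneToTwo_f (n : ℕ) (Λ : AddSubgroup ℝ) (U : CartSpᵒᵖ) (c : ((oneTerm n).obj U).X n) :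
    (twoIso n Λ U).hom (((oneToTwo n Λ).app U).f n c) = (oneIso n U).hom c := by
  have h : ((oneToTwo n Λ).app U).f n ≫ (twoIso n Λ U).hom = (oneIso n U).hom := by
    change (oneToTwoApp n Λ U).f n ≫ _ = _
    rw [oneToTwoApp_f]
    simp [oneIso, twoIso]
  exact ConcreteCategory.congr_hom h c

theorem iso_hom_injective {P Q : AddCommGrpCat.{0}} (e : P ≅ Q) : Function.Injective e.hom :=
  fun a b h => by
    have := congrArg e.inv h
    rwa [← ConcreteCategory.comp_apply, ← ConcreteCategory.comp_apply, e.hom_inv_id] at this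

theorem iso_inv_hom {P Q : AddCommGrpCat.{0}} (e : P ≅ Q) (q : Q) : e.hom (e.inv q) = q :=
  ConcreteCategory.congr_hom e.inv_hom_id q

/-- The function given by an `n`-cell of `Bⁿℝ`. -/
def oneCellFun {n : ℕ} {U : CartSpᵒᵖ} (y : ((BR n).obj U).obj (op ⦋n⦌)) : (smoothFun ⊤).obj U :=
  (oneIso n U).hom (dkProj ((oneTerm n).obj U) n y)

/-- The function given by an `n`-cell of `Bⁿ(Λ → ℝ)`. -/
def twoCellFun {n : ℕ} {Λ : AddSubgroup ℝ} {U : CartSpᵒᵖ} (y : ((BQuot n Λ).obj U).obj (op ⦋n⦌)) :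
    (smoothFun ⊤).obj U :=
  (twoIso n Λ U).hom (dkProj ((twoTerm n Λ).obj U) n y)

theorem oneCellFun_BRcell (n : ℕ) (U : CartSp) (h : (smoothFun ⊤).obj (op U)) :
    oneCellFun (BRcell n U h) = h := by
  refine (congrArg (oneIso n (op U)).hom (dkProj_gammaInj ((oneTerm n).obj (op U)) n
    ((oneIso n (op U)).inv h))).trans (iso_inv_hom _ _)

theorem oneCellFun_injective {n : ℕ} {U : CartSpᵒᵖ} :
    Function.Injective (oneCellFun (n := n) (U := U)) := fun _ _ h =>
  dkProj_injective (fun _ hj c => oneTerm_zero hj.ne U c) (iso_hom_injective _ h)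

theorem twoCellFun_toBQuot {n : ℕ} (Λ : AddSubgroup ℝ) {U : CartSpᵒᵖ}
    (y : ((BR n).obj U).obj (op ⦋n⦌)) :
    twoCellFun (((toBQuot n Λ).app U).app _ y) = oneCellFun y := by
  refine Eq.trans ?_ (oneToTwo_f n Λ U (dkProj _ n y))
  exact congrArg (twoIso n Λ U).hom (dkProj_naturality ((oneToTwo n Λ).app U) n y)

variable {X : CartSpᵒᵖ ⥤ SSet.{0}} {n : ℕ}

theorem smoothIncl_injective (Λ : AddSubgroup ℝ) (U : CartSpᵒᵖ) :
    Function.Injective ((smoothIncl Λ).app U) := fun _ _ h =>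
  Subtype.ext (congrArg (fun q : (smoothFun ⊤).obj U => q.1) h)

/-- The differential is the inclusion of the functions with values in `Λ`, so a component of degree
`n + 1` is determined by its boundary. -/
theorem two_d_injective (Λ : AddSubgroup ℝ) (U : CartSpᵒᵖ) :
    Function.Injective (((twoTerm n Λ).obj U).d (n + 1) n) := fun _ _ h => by
  have := congrArg (twoIso n Λ U).hom h
  rw [twoTerm_d, twoTerm_d] at this
  exact iso_hom_injective _ (smoothIncl_injective Λ U this)

/-- By injectivity of the differential, the components of degree `n + 1` follow from those of the
faces; outside degrees `n` and `n + 1` the complex is zero. -/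
theorem bquot_obj_hom_ext {Λ : AddSubgroup ℝ} {U : CartSpᵒᵖ} {Y : SSet.{0}}
    {I J : Y ⟶ (BQuot n Λ).obj U} (h : ∀ x : Y.obj (op ⦋n⦌),
      twoCellFun (I.app _ x) = twoCellFun (J.app _ x)) : I = J := by
  have h0 : ∀ x : Y.obj (op ⦋n⦌), dkProj ((twoTerm n Λ).obj U) n (I.app _ x) =
      dkProj ((twoTerm n Λ).obj U) n (J.app _ x) := fun x => iso_hom_injective _ (h x)
  refine dk_hom_ext fun k x => ?_
  by_cases hk : k = n
  · subst hk
    exact h0 x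
  by_cases hk' : k = n + 1
  · subst hk'
    refine two_d_injective Λ U ?_
    refine (dkProj_d _ n _).trans (Eq.trans ?_ (dkProj_d _ n _).symm)
    refine Finset.sum_congr rfl fun i _ => congrArg _ ?_
    refine (congrArg (dkProj _ n) (ConcreteCategory.congr_hom
      (I.naturality (SimplexCategory.δ i).op) x)).symm.trans ?_
    refine (h0 _).trans ?_
    exact congrArg (dkProj _ n) (ConcreteCategory.congr_hom
      (J.naturality (SimplexCategory.δ i).op) x)
  · exact (twoTerm_zero Λ hk hk' U _).trans (twoTerm_zero Λ hk hk' U _).symm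

theorem bquot_hom_ext {Λ : AddSubgroup ℝ} {I J : X ⟶ BQuot n Λ}
    (h : ∀ U (x : (X.obj U).obj (op ⦋n⦌)),
      twoCellFun ((I.app U).app _ x) = twoCellFun ((J.app U).app _ x)) : I = J :=
  NatTrans.ext (funext fun U => bquot_obj_hom_ext (h U))

/-- Evaluation of smooth functions at a point. -/
def smoothEval (U : CartSpᵒᵖ) (u : U.unop.Pt) : (smoothFun ⊤).obj U →+ ℝ where
  toFun h := h.1 u
  map_zero' := rfl
  map_add' _ _ := rfl

/-- A normalized cochain of degree `n` on a simplicial presheaf, with values in `C^∞(-, ℝ)`. -/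
structure NormCochain (X : CartSpᵒᵖ ⥤ SSet.{0}) (n : ℕ) where
  val : ∀ U, (X.obj U).obj (op ⦋n⦌) → (smoothFun ⊤).obj U
  natural : ∀ {U W} (g : U ⟶ W) x, val W ((X.map g).app _ x) = (smoothFun ⊤).map g (val U x)
  normalized : ∀ U {j : ℕ} (θ : ⦋n⦌ ⟶ ⦋j⦌), ¬ Function.Injective θ.toOrderHom →
    ∀ y, val U ((X.obj U).map θ.op y) = 0

/-- The coboundary of a cochain. -/
def NormCochain.delta (f : NormCochain X n) (U : CartSpᵒᵖ) (x : (X.obj U).obj (op ⦋n + 1⦌)) :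
    (smoothFun ⊤).obj U :=
  ∑ i : Fin (n + 2), (-1 : ℤ) ^ (i : ℕ) • f.val U ((X.obj U).map (SimplexCategory.δ i).op x)

/-- All faces of a degenerate cell but two are degenerate; the two exceptions are equal and enter
with opposite signs. -/
theorem NormCochain.delta_sigma (f : NormCochain X n) (U : CartSpᵒᵖ) (j : Fin (n + 1))
    (x : (X.obj U).obj (op ⦋n⦌)) :
    f.delta U ((X.obj U).map (SimplexCategory.σ j).op x) = 0 := by
  have key : ∀ i, (X.obj U).map (SimplexCategory.δ i).op
      ((X.obj U).map (SimplexCategory.σ j).op x) =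
      (X.obj U).map (SimplexCategory.δ i ≫ SimplexCategory.σ j).op x := fun i => by
    rw [op_comp, Functor.map_comp]; rfl
  simp only [delta, key]
  rw [Finset.sum_eq_add (j.castSucc : Fin (n + 2)) j.succ (Fin.castSucc_lt_succ).ne]
  · rw [SimplexCategory.δ_comp_σ_self, SimplexCategory.δ_comp_σ_succ]
    simp [pow_succ]
  · intro i _ hi
    rw [f.normalized U _ ?_ x, smul_zero]
    -- The vertices `j` and `j + 1` both lie on the face `i`, and `σ j` identifies them.
    intro hinj
    obtain ⟨a, ha⟩ := Fin.exists_succAbove_eq hi.1.symm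
    obtain ⟨b, hb⟩ := Fin.exists_succAbove_eq hi.2.symm
    have : a = b := by
      apply hinj
      change Fin.predAbove j (Fin.succAbove i a) = Fin.predAbove j (Fin.succAbove i b)
      rw [ha, hb]
      simp
    rw [this, hb] at ha
    exact (Fin.castSucc_lt_succ).ne ha.symm
  · simp
  · simp

theorem NormCochain.delta_eq (f : NormCochain X n) (U : CartSpᵒᵖ)
    (x : (X.obj U).obj (op ⦋n + 1⦌)) :
    f.delta U x = freeSimpDesc (f.val U)
      (AlternatingFaceMapComplex.objD (freeSimp (X.obj U)) n (freeSimpOf x)) := by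
  refine Eq.symm ((congrArg _ (addCommGrp_sum_zsmul_apply _ _ _ _)).trans ?_)
  refine (map_sum _ _ _).trans (Finset.sum_congr rfl fun i _ => ?_)
  refine (map_zsmul _ _ _).trans (congrArg _ ?_)
  exact (congrArg _ (freeSimp_map_of _ x)).trans (freeSimpDesc_of _ _)

/-- By `NormCochain.delta_eq` the sum is the value of the linear extension of the cochain on `d ∘ d`
of a generator of the free simplicial abelian group. -/
theorem NormCochain.delta_delta (f : NormCochain X n) (U : CartSpᵒᵖ)
    (x : (X.obj U).obj (op ⦋n + 1 + 1⦌)) :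
    ∑ i : Fin (n + 1 + 2), (-1 : ℤ) ^ (i : ℕ) •
      f.delta U ((X.obj U).map (SimplexCategory.δ i).op x) = 0 := by
  have h := ConcreteCategory.congr_hom (AlternatingFaceMapComplex.d_squared (freeSimp (X.obj U)) n)
    (freeSimpOf x)
  refine Eq.trans ?_ ((congrArg (freeSimpDesc (f.val U)) h).trans (map_zero _))
  refine Eq.symm ((congrArg (fun q => freeSimpDesc (f.val U)
    (AlternatingFaceMapComplex.objD (freeSimp (X.obj U)) n q))
    (addCommGrp_sum_zsmul_apply _ _ _ _)).trans ?_)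
  refine ((congrArg _ (map_sum _ _ _)).trans (map_sum _ _ _)).trans
    (Finset.sum_congr rfl fun i _ => ?_)
  refine ((congrArg _ (map_zsmul _ _ _)).trans (map_zsmul _ _ _)).trans (congrArg _ ?_)
  rw [f.delta_eq]
  exact congrArg (fun q => freeSimpDesc (f.val U)
    (AlternatingFaceMapComplex.objD (freeSimp (X.obj U)) n q)) (freeSimp_map_of _ x)

theorem not_injective_sigma {k : ℕ} (i : Fin (k + 1)) :
    ¬ Function.Injective (SimplexCategory.σ i).toOrderHom := by
  intro h
  have : i.castSucc = i.succ := by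
    apply h
    change Fin.predAbove i _ = Fin.predAbove i _
    simp
  exact (Fin.castSucc_lt_succ).ne this

/-- The cocycle in degree `n`, completed by zero in all other degrees, satisfies the hypotheses of
`dk_exists`. -/
theorem NormCochain.exists_br (f : NormCochain X n) (hf : ∀ U x, f.delta U x = 0) :
    ∃ I : X ⟶ BR n, ∀ U x, oneCellFun ((I.app U).app _ x) = f.val U x := by
  classical
  have h : ∀ U, ∃ I : X.obj U ⟶ (BR n).obj U, ∀ x, oneCellFun (I.app _ x) = f.val U x := by
    intro U
    let F : ∀ k, (X.obj U).obj (op ⦋k⦌) → ((oneTerm n).obj U).X k := fun k x =>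
      if h : k = n then by subst h; exact (oneIso k U).inv (f.val U x) else 0
    have hF : ∀ x, F n x = (oneIso n U).inv (f.val U x) := fun x => dif_pos rfl
    have hσ : ∀ k (i : Fin (k + 1)) (x : (X.obj U).obj (op ⦋k⦌)),
        F (k + 1) ((X.obj U).map (SimplexCategory.σ i).op x) = 0 := by
      intro k i x
      by_cases h : k + 1 = n
      · subst h
        rw [hF, f.normalized U _ (not_injective_sigma i), map_zero]
      · exact dif_neg h
    have hd : ∀ k (x : (X.obj U).obj (op ⦋k + 1⦌)), ((oneTerm n).obj U).d (k + 1) k (F (k + 1) x) =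
        ∑ i : Fin (k + 2), (-1 : ℤ) ^ (i : ℕ) • F k ((X.obj U).map (SimplexCategory.δ i).op x) := by
      intro k x
      by_cases h : k = n
      · subst h
        rw [oneTerm_zero (by omega) U (F (k + 1) x), map_zero]
        simp only [hF, ← map_zsmul, ← map_sum]
        exact ((congrArg _ (hf U x)).trans (map_zero _)).symm
      · exact (oneTerm_zero h U _).trans (oneTerm_zero h U _).symm
    obtain ⟨I, hI⟩ := dk_exists (X := X.obj U) (C := (oneTerm n).obj U) F hσ hd
    refine ⟨I, fun x => ?_⟩
    refine (congrArg (oneIso n U).hom ((hI n x).trans (hF x))).trans (iso_inv_hom _ _)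
  choose I hI using h
  refine ⟨{ app := I, naturality := fun U W g => ?_ }, hI⟩
  refine dk_hom_ext fun k x => ?_
  by_cases hk : k = n
  · subst hk
    refine iso_hom_injective (oneIso k W) ?_
    refine ((hI W _).trans (f.natural g x)).trans ?_
    refine (congrArg _ (hI U x)).symm.trans ?_
    refine (oneTerm_map k g _).symm.trans ?_
    exact congrArg (oneIso k W).hom (dkProj_naturality ((oneTerm k).map g) k _).symm
  · exact (oneTerm_zero hk W _).trans (oneTerm_zero hk W _).symm

/-- The component of degree `n + 1` has to be the coboundary, and `hf` makes it an element of the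
degree `n + 1` term of the complex. -/
theorem NormCochain.exists_bquot (f : NormCochain X n) (Λ : AddSubgroup ℝ)
    (hf : ∀ U x u, (f.delta U x).1 u ∈ Λ) :
    ∃ I : X ⟶ BQuot n Λ, ∀ U x, twoCellFun ((I.app U).app _ x) = f.val U x := by
  classical
  have h : ∀ U, ∃ I : X.obj U ⟶ (BQuot n Λ).obj U, ∀ x, twoCellFun (I.app _ x) = f.val U x := by
    intro U
    let D : ∀ x : (X.obj U).obj (op ⦋n + 1⦌), (smoothFun Λ).obj U := fun x =>
      ⟨(f.delta U x).1, (f.delta U x).2.1, hf U x⟩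
    have hD : ∀ x, (smoothIncl Λ).app U (D x) = f.delta U x := fun x => rfl
    let F : ∀ k, (X.obj U).obj (op ⦋k⦌) → ((twoTerm n Λ).obj U).X k := fun k x =>
      if h : k = n then by subst h; exact (twoIso k Λ U).inv (f.val U x) else
      if h : k = n + 1 then by subst h; exact (twoIsoSucc n Λ U).inv (D x) else 0
    have hF : ∀ x, F n x = (twoIso n Λ U).inv (f.val U x) := fun x => dif_pos rfl
    have hF' : ∀ x, F (n + 1) x = (twoIsoSucc n Λ U).inv (D x) := fun x =>
      (dif_neg (by omega)).trans (dif_pos rfl)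
    have hσ : ∀ k (i : Fin (k + 1)) (x : (X.obj U).obj (op ⦋k⦌)),
        F (k + 1) ((X.obj U).map (SimplexCategory.σ i).op x) = 0 := by
      intro k i x
      by_cases h : k + 1 = n
      · subst h
        rw [hF, f.normalized U _ (not_injective_sigma i), map_zero]
      by_cases h' : k = n
      · subst h'
        rw [hF', show D ((X.obj U).map (SimplexCategory.σ i).op x) = 0 from
          smoothIncl_injective Λ U ((hD _).trans ((f.delta_sigma U i x).trans (map_zero _).symm)),
          map_zero]
      · exact (dif_neg h).trans (dif_neg (by omega))
    have hd : ∀ k (x : (X.obj U).obj (op ⦋k + 1⦌)), ((twoTerm n Λ).obj U).d (k + 1) k (F (k + 1) x) =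
        ∑ i : Fin (k + 2), (-1 : ℤ) ^ (i : ℕ) • F k ((X.obj U).map (SimplexCategory.δ i).op x) := by
      intro k x
      by_cases h : k = n
      · subst h
        refine iso_hom_injective (twoIso k Λ U) ?_
        rw [hF', twoTerm_d, iso_inv_hom, hD]
        simp only [hF, ← map_zsmul, ← map_sum, iso_inv_hom]
        rfl
      by_cases h' : k = n + 1
      · subst h'
        rw [twoTerm_zero Λ (by omega) (by omega) U (F (n + 1 + 1) x), map_zero]
        refine two_d_injective Λ U ?_
        refine iso_hom_injective (twoIso n Λ U) ?_
        rw [map_zero, map_zero, map_sum, map_sum]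
        simp only [map_zsmul, hF', twoTerm_d, iso_inv_hom, hD]
        exact (f.delta_delta U x).symm
      · exact (twoTerm_zero Λ h h' U _).trans (twoTerm_zero Λ h h' U _).symm
    obtain ⟨I, hI⟩ := dk_exists (X := X.obj U) (C := (twoTerm n Λ).obj U) F hσ hd
    refine ⟨I, fun x => ?_⟩
    refine (congrArg (twoIso n Λ U).hom ((hI n x).trans (hF x))).trans (iso_inv_hom _ _)
  choose I hI using h
  refine ⟨{ app := I, naturality := fun U W g => ?_ }, hI⟩
  refine bquot_obj_hom_ext fun x => ?_
  refine ((hI W _).trans (f.natural g x)).trans ?_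
  refine (congrArg _ (hI U x)).symm.trans ?_
  refine (twoTerm_map n Λ g _).symm.trans ?_
  exact congrArg (twoIso n Λ W).hom (dkProj_naturality ((twoTerm n Λ).map g) n _).symm

/-- By `dkProj_d` the sum is the differential of the degree `n + 1` component of the cell, and that
component is a function with values in `Λ`. -/
theorem bquot_coboundary_mem {Λ : AddSubgroup ℝ} (φ : X ⟶ BQuot n Λ) (U : CartSpᵒᵖ)
    (x : (X.obj U).obj (op ⦋n + 1⦌)) (u : U.unop.Pt) :
    ∑ i : Fin (n + 2), (-1 : ℝ) ^ (i : ℕ) * (twoCellFun ((φ.app U).app _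
      ((X.obj U).map (SimplexCategory.δ i).op x))).1 u ∈ Λ := by
  obtain ⟨y, hy⟩ : ∃ y : (DK.obj ((twoTerm n Λ).obj U)).obj (op ⦋n + 1⦌),
    y = (φ.app U).app _ x := ⟨_, rfl⟩
  have h := twoTerm_d n Λ U (dkProj _ (n + 1) y)
  rw [dkProj_d, map_sum] at h
  have h2 : ∑ i : Fin (n + 2), (-1 : ℤ) ^ (i : ℕ) • twoCellFun ((φ.app U).app _
      ((X.obj U).map (SimplexCategory.δ i).op x)) = (smoothIncl Λ).app U
        ((twoIsoSucc n Λ U).hom (dkProj _ (n + 1) y)) := by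
    rw [← h]
    refine Finset.sum_congr rfl fun i _ => ?_
    rw [map_zsmul]
    refine congrArg _ (congrArg (twoIso n Λ U).hom (congrArg (dkProj _ n) ?_))
    rw [hy]
    exact ConcreteCategory.congr_hom ((φ.app U).naturality (SimplexCategory.δ i).op) x
  have h3 := congrArg (fun q => smoothEval U u q) h2
  simp only [map_sum, map_zsmul] at h3
  have h4 : smoothEval U u ((smoothIncl Λ).app U
        ((twoIsoSucc n Λ U).hom (dkProj _ (n + 1) y))) ∈ Λ :=
    ((twoIsoSucc n Λ U).hom (dkProj _ (n + 1) y)).2.2 u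
  rw [← h3] at h4
  convert h4 using 2 with i
  rw [zsmul_eq_mul]
  push_cast
  rfl

end CellsOfBR
end LieInt

namespace LieInt

open AlgebraicTopology SimplicialObject Simplicial

/-! ### Cells and cochains of the coskeleton -/

section Coskeleton

/-- By a triangle identity the truncated unit is inverse to the counit, which is invertible since
the coskeleton functor is fully faithful. -/
theorem cosk_unit_bijective {n k : ℕ} (hk : k ≤ n) (X : SSet.{0}) :
    Function.Bijective (((SSet.coskAdj n).unit.app X).app (op ⦋k⦌)) := by
  have h := (SSet.coskAdj n).left_triangle_components X
  have h1 : IsIso ((SSet.truncation n).map ((SSet.coskAdj n).unit.app X)) := by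
    have := IsIso.of_isIso_fac_right h
    exact this
  have h2 : IsIso (((SSet.truncation n).map ((SSet.coskAdj n).unit.app X)).app
    (op ⟨⦋k⦌, hk⟩)) := inferInstance
  exact (isIso_iff_bijective _).1 h2

/-- A cell of the coskeleton is a compatible family of cells of dimension at most `n`. -/
theorem cosk_cell_exists {n m : ℕ} (X : SSet.{0})
    (y : ∀ k, k ≤ n → (⦋k⦌ ⟶ ⦋m⦌) → X.obj (op ⦋k⦌))
    (hy : ∀ k hk j hj (ρ : ⦋j⦌ ⟶ ⦋k⦌) (θ : ⦋k⦌ ⟶ ⦋m⦌), X.map ρ.op (y k hk θ) = y j hj (ρ ≫ θ)) :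
    ∃ z : ((SSet.cosk n).obj X).obj (op ⦋m⦌), ∀ k hk (θ : ⦋k⦌ ⟶ ⦋m⦌),
      ((SSet.cosk n).obj X).map θ.op z = ((SSet.coskAdj n).unit.app X).app _ (y k hk θ) := by
  -- By the Yoneda lemma, the cells sought are maps from the standard simplex; these correspond
  -- under the adjunction to maps from its truncation, that is, to compatible families.
  let τ : (SSet.truncation n).obj (SSet.stdSimplex.obj ⦋m⦌) ⟶ (SSet.truncation n).obj X :=
    { app := fun k => ↾fun θ => y k.unop.obj.len k.unop.property (SSet.stdSimplex.objEquiv θ)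
      naturality := fun k j ρ => by
        ext θ
        exact (hy _ k.unop.property _ j.unop.property ρ.unop.hom (SSet.stdSimplex.objEquiv θ)).symm }
  let Φ := (SSet.coskAdj n).homEquiv _ _ τ
  have h : (SSet.truncation n).map Φ = τ ≫ (SSet.truncation n).map ((SSet.coskAdj n).unit.app X) := by
    have h1 : (SSet.truncation n).map Φ ≫ (SSet.coskAdj n).counit.app _ = τ :=
      ((SSet.coskAdj n).homEquiv_counit _ _ _).symm.trans (Equiv.symm_apply_apply _ _)
    have h2 := (SSet.coskAdj n).left_triangle_components X
    have h3 : (τ ≫ (SSet.truncation n).map ((SSet.coskAdj n).unit.app X)) ≫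
        (SSet.coskAdj n).counit.app _ = τ := by
      rw [Category.assoc, h2]
      exact Category.comp_id _
    exact (cancel_mono ((SSet.coskAdj n).counit.app _)).1 (h1.trans h3.symm)
  refine ⟨Φ.app _ (SSet.stdSimplex.objEquiv.symm (𝟙 ⦋m⦌)), fun k hk θ => ?_⟩
  have h4 := ConcreteCategory.congr_hom (Φ.naturality θ.op) (SSet.stdSimplex.objEquiv.symm (𝟙 ⦋m⦌))
  refine h4.symm.trans ?_
  have h5 := ConcreteCategory.congr_hom (congrArg (fun q => NatTrans.app q (op ⟨⦋k⦌, hk⟩)) h)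
    (SSet.stdSimplex.objEquiv.symm θ)
  refine Eq.trans ?_ (h5.trans ?_)
  · refine congrArg (Φ.app (op ⦋k⦌)) ?_
    refine (SSet.stdSimplex.map_objEquiv_symm _ _).trans ?_
    exact congrArg _ (Category.comp_id θ)
  · refine congrArg (((SSet.coskAdj n).unit.app X).app (op ⦋k⦌)) ?_
    exact congrArg (y k hk) (Equiv.apply_symm_apply _ _)

/-- The `n`-cells of the `n`-coskeleton are the `n`-cells. -/
def coskEquiv (n : ℕ) (X : CartSpᵒᵖ ⥤ SSet.{0}) (U : CartSpᵒᵖ) :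
    (X.obj U).obj (op ⦋n⦌) ≃ ((coskP n X).obj U).obj (op ⦋n⦌) :=
  Equiv.ofBijective (((toCosk n X).app U).app _) (cosk_unit_bijective (le_refl n) (X.obj U))

/-- A cochain of degree `n` is a cochain on the `n`-coskeleton. -/
def NormCochain.cosk {X : CartSpᵒᵖ ⥤ SSet.{0}} {n : ℕ} (f : NormCochain X n) :
    NormCochain (coskP n X) n :=
  let e := fun U => coskEquiv n X U
  have he : ∀ U x, ((toCosk n X).app U).app _ ((e U).symm x) = x := fun U x =>
    (e U).apply_symm_apply x
  { val := fun U x => f.val U ((e U).symm x)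
    natural := fun {U W} g x => by
      rw [← f.natural]
      congr 1
      apply (e W).injective
      rw [Equiv.apply_symm_apply]
      refine Eq.trans ?_ (ConcreteCategory.congr_hom (congrArg (fun q => NatTrans.app q (op ⦋n⦌))
        ((toCosk n X).naturality g)) ((e U).symm x)).symm
      exact congrArg _ (he U x).symm
    normalized := fun U {j} θ hθ y => by
      -- The cells of the coskeleton of dimension `j` need not come from `X`. Factoring `θ` through
      -- its image passes through dimension at most `n`, and the map to the image is already not
      -- injective.
      have hj : ∃ j', ∃ _ : j' ≤ n, ∃ (α : ⦋n⦌ ⟶ ⦋j'⦌) (β : ⦋j'⦌ ⟶ ⦋j⦌),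
          θ = α ≫ β ∧ ¬ Function.Injective α.toOrderHom := by
        refine ⟨(Limits.image θ).len, SimplexCategory.len_le_of_epi (factorThruImage θ),
          factorThruImage θ, Limits.image.ι θ, (Limits.image.fac θ).symm, fun h => hθ ?_⟩
        have h1 := congrArg (fun q => (SimplexCategory.Hom.toOrderHom q : _ → _)) (Limits.image.fac θ)
        simp only at h1
        rw [← h1]
        exact ((SimplexCategory.mono_iff_injective (f := Limits.image.ι θ)).1 inferInstance).comp h
      obtain ⟨j', hj', α, β, rfl, hα⟩ := hj
      obtain ⟨w, hw⟩ := (cosk_unit_bijective hj' (X.obj U)).2 (((coskP n X).obj U).map β.op y)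
      rw [← f.normalized U α hα w]
      congr 1
      apply (e U).injective
      rw [Equiv.apply_symm_apply, op_comp, Functor.map_comp]
      refine Eq.trans ?_ (ConcreteCategory.congr_hom
        (((toCosk n X).app U).naturality α.op) w).symm
      exact congrArg (((coskP n X).obj U).map α.op) hw.symm }

theorem NormCochain.cosk_val_unit {X : CartSpᵒᵖ ⥤ SSet.{0}} {n : ℕ} (f : NormCochain X n)
    (U : CartSpᵒᵖ) (x : (X.obj U).obj (op ⦋n⦌)) :
    f.cosk.val U (((toCosk n X).app U).app _ x) = f.val U x :=
  congrArg (f.val U) (Equiv.ofBijective_symm_apply_apply _ _ _)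

/-- A factorization exists through the coskeleton exactly if the coboundaries lie in `Λ`. -/
theorem exists_cosk_factorization_iff {X : CartSpᵒᵖ ⥤ SSet.{0}} {n : ℕ} (f : NormCochain X n)
    (Λ : AddSubgroup ℝ) (J : X ⟶ BR n) (hJ : ∀ U x, oneCellFun ((J.app U).app _ x) = f.val U x) :
    (∃ φ : coskP n X ⟶ BQuot n Λ, toCosk n X ≫ φ = J ≫ toBQuot n Λ) ↔
      ∀ U x u, (f.cosk.delta U x).1 u ∈ Λ := by
  constructor
  · rintro ⟨φ, hφ⟩ U x u
    -- The cochain of `φ` is forced, because every `n`-cell of the coskeleton comes from `X`, where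
    -- the square commutes.
    have h1 : ∀ w, twoCellFun ((φ.app U).app _ w) = f.cosk.val U w := by
      intro w
      obtain ⟨x, rfl⟩ := (cosk_unit_bijective (le_refl n) (X.obj U)).2 w
      refine Eq.trans ?_ (f.cosk_val_unit U x).symm
      rw [← hJ]
      refine Eq.trans ?_ (twoCellFun_toBQuot Λ _)
      exact congrArg twoCellFun (ConcreteCategory.congr_hom (congrArg
        (fun q => NatTrans.app (NatTrans.app q U) (op ⦋n⦌)) hφ) x)
    have h2 := bquot_coboundary_mem φ U x u
    simp only [h1] at h2
    have h3 : (f.cosk.delta U x).1 u = smoothEval U u (f.cosk.delta U x) := rfl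
    rw [h3, NormCochain.delta, map_sum]
    convert h2 using 2 with i
    rw [map_zsmul, zsmul_eq_mul]
    push_cast
    rfl
  · intro h
    obtain ⟨φ, hφ⟩ := f.cosk.exists_bquot Λ h
    refine ⟨φ, bquot_hom_ext fun U x => ?_⟩
    refine ((hφ U _).trans (f.cosk_val_unit U x)).trans ?_
    rw [← hJ]
    exact (twoCellFun_toBQuot Λ _).symm

end Coskeleton
end LieInt

namespace LieInt

/-! ### Evaluation of exterior forms on vectors -/

section EvalAlt

variable {W W' : Type} [AddCommGroup W] [Module ℝ W] [AddCommGroup W'] [Module ℝ W'] {n : ℕ}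

theorem evalAlt_ιMulti (v φ) : evalAlt v (ExteriorAlgebra.ιMulti ℝ n φ) =
    (Matrix.of fun i j => (φ i : Dual ℝ W) (v j)).det := by
  rw [evalAlt, ExteriorAlgebra.liftAlternating_apply_ιMulti, Pi.single_eq_same]
  rfl

theorem evalAlt_ιMulti_of_ne {m : ℕ} (h : m ≠ n) (v : Fin n → W) (φ : Fin m → Dual ℝ W) :
    evalAlt v (ExteriorAlgebra.ιMulti ℝ m φ) = 0 := by
  rw [evalAlt, ExteriorAlgebra.liftAlternating_apply_ιMulti, Pi.single_eq_of_ne h]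
  rfl

/-- Linear functionals on an exterior algebra that vanish outside of degree `n` agree if they
agree on the products of `n` covectors. -/
theorem evalAlt_ext {f g : ExteriorAlgebra ℝ (Dual ℝ W) →ₗ[ℝ] ℝ}
    (h0 : ∀ m ≠ n, ∀ φ : Fin m → Dual ℝ W, f (ExteriorAlgebra.ιMulti ℝ m φ) = 0 ∧
      g (ExteriorAlgebra.ιMulti ℝ m φ) = 0)
    (h : ∀ φ : Fin n → Dual ℝ W, f (ExteriorAlgebra.ιMulti ℝ n φ) =
      g (ExteriorAlgebra.ιMulti ℝ n φ)) : f = g := by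
  refine ExteriorAlgebra.lhom_ext fun m => AlternatingMap.ext fun φ => ?_
  by_cases hm : m = n
  · subst hm
    exact h φ
  · exact (h0 m hm φ).1.trans (h0 m hm φ).2.symm

theorem evalAlt_map (f : W →ₗ[ℝ] W') (v : Fin n → W) (a : ExteriorAlgebra ℝ (Dual ℝ W')) :
    evalAlt v (ExteriorAlgebra.map f.dualMap a) = evalAlt (fun i => f (v i)) a := by
  refine LinearMap.congr_fun (f := evalAlt v ∘ₗ (ExteriorAlgebra.map f.dualMap).toLinearMap)
    (evalAlt_ext (n := n) (fun m hm φ => ⟨?_, evalAlt_ιMulti_of_ne hm _ _⟩) fun φ => ?_) a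
  · simp only [LinearMap.comp_apply, AlgHom.toLinearMap_apply, ExteriorAlgebra.map_apply_ιMulti]
    exact evalAlt_ιMulti_of_ne hm _ _
  · simp only [LinearMap.comp_apply, AlgHom.toLinearMap_apply, ExteriorAlgebra.map_apply_ιMulti]
    rw [evalAlt_ιMulti, evalAlt_ιMulti]
    rfl

/-- The value of an element of the exterior algebra, as an alternating map. -/
def altOf (a : ExteriorAlgebra ℝ (Dual ℝ W)) : W [⋀^Fin n]→ₗ[ℝ] ℝ where
  toFun v := evalAlt v a
  map_update_add' {inst} v i x y := by
    obtain rfl : inst = instDecidableEqFin n := Subsingleton.elim _ _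
    rw [← LinearMap.add_apply]
    refine LinearMap.congr_fun (evalAlt_ext (n := n) (fun m hm φ => ⟨evalAlt_ιMulti_of_ne hm _ _,
      ?_⟩) fun φ => ?_) a
    · rw [LinearMap.add_apply, evalAlt_ιMulti_of_ne hm, evalAlt_ιMulti_of_ne hm, add_zero]
    · rw [LinearMap.add_apply, evalAlt_ιMulti, evalAlt_ιMulti, evalAlt_ιMulti]
      have h : ∀ z, (Matrix.of fun k j => φ k (Function.update v i z j)) =
          (Matrix.of fun k j => φ k (v j)).updateCol i fun k => φ k z := fun z => by
        ext k j
        by_cases hj : j = i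
        · subst hj; simp
        · simp [hj]
      rw [h, h, h, ← Matrix.det_updateCol_add]
      congr 2
      ext k
      simp
  map_update_smul' {inst} v i c x := by
    obtain rfl : inst = instDecidableEqFin n := Subsingleton.elim _ _
    rw [← LinearMap.smul_apply]
    refine LinearMap.congr_fun (evalAlt_ext (n := n) (fun m hm φ => ⟨evalAlt_ιMulti_of_ne hm _ _,
      ?_⟩) fun φ => ?_) a
    · rw [LinearMap.smul_apply, evalAlt_ιMulti_of_ne hm, smul_zero]
    · rw [LinearMap.smul_apply, evalAlt_ιMulti, evalAlt_ιMulti, smul_eq_mul]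
      have h : ∀ z, (Matrix.of fun k j => φ k (Function.update v i z j)) =
          (Matrix.of fun k j => φ k (v j)).updateCol i fun k => φ k z := fun z => by
        ext k j
        by_cases hj : j = i
        · subst hj; simp
        · simp [hj]
      rw [h, h, ← Matrix.det_updateCol_smul]
      congr 2
      ext k
      simp
  map_eq_zero_of_eq' v i j hv hij := by
    refine LinearMap.congr_fun (g := 0) (evalAlt_ext (n := n) (fun m hm φ =>
      ⟨evalAlt_ιMulti_of_ne hm _ _, rfl⟩) fun φ => ?_) a
    rw [evalAlt_ιMulti]
    exact Matrix.det_zero_of_column_eq hij fun k => by simp [hv]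

theorem altOf_apply (a : ExteriorAlgebra ℝ (Dual ℝ W)) (v : Fin n → W) :
    altOf a v = evalAlt v a := rfl

/-- Laplace expansion of a determinant along its first row. -/
theorem evalAlt_ι_mul (v : Fin (n + 1) → W) (φ : Dual ℝ W) (a : ExteriorAlgebra ℝ (Dual ℝ W)) :
    evalAlt v (ExteriorAlgebra.ι ℝ φ * a) =
      ∑ j : Fin (n + 1), (-1 : ℝ) ^ (j : ℕ) * φ (v j) * evalAlt (fun k => v (j.succAbove k)) a := by
  have hmul : ∀ (m : ℕ) (ψ : Fin m → Dual ℝ W), ExteriorAlgebra.ι ℝ φ *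
      ExteriorAlgebra.ιMulti ℝ m ψ = ExteriorAlgebra.ιMulti ℝ (m + 1) (Fin.cons φ ψ) := by
    intro m ψ
    rw [ExteriorAlgebra.ιMulti_succ_apply]
    simp [Matrix.vecTail, Function.comp_def]
  have key : evalAlt v ∘ₗ LinearMap.mulLeft ℝ (ExteriorAlgebra.ι ℝ φ) =
      ∑ j : Fin (n + 1), ((-1 : ℝ) ^ (j : ℕ) * φ (v j)) •
        evalAlt (fun k => v (j.succAbove k)) := by
    refine evalAlt_ext (n := n) (fun m hm ψ => ⟨?_, ?_⟩) fun ψ => ?_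
    · rw [LinearMap.comp_apply, LinearMap.mulLeft_apply, hmul]
      exact evalAlt_ιMulti_of_ne (by omega) _ _
    · simp [evalAlt_ιMulti_of_ne hm]
    · rw [LinearMap.comp_apply, LinearMap.mulLeft_apply, hmul, evalAlt_ιMulti,
        Matrix.det_succ_row_zero]
      simp only [LinearMap.sum_apply, LinearMap.smul_apply, evalAlt_ιMulti, smul_eq_mul]
      refine Finset.sum_congr rfl fun j _ => ?_
      congr 1
  have := LinearMap.congr_fun key a
  simpa using this

/-- The value on differences with a fixed vector. -/
theorem evalAlt_sub (v₀ : W) (v : Fin n → W) (a : ExteriorAlgebra ℝ (Dual ℝ W)) :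
    evalAlt (fun i => v i - v₀) a = ∑ j : Fin (n + 1), (-1 : ℝ) ^ (j : ℕ) *
      evalAlt (fun k => (Fin.cons v₀ v : Fin (n + 1) → W) (j.succAbove k)) a := by
  have key : evalAlt (fun i => v i - v₀) = ∑ j : Fin (n + 1), (-1 : ℝ) ^ (j : ℕ) •
      evalAlt (fun k => (Fin.cons v₀ v : Fin (n + 1) → W) (j.succAbove k)) := by
    refine evalAlt_ext (n := n) (fun m hm ψ => ⟨evalAlt_ιMulti_of_ne hm _ _, ?_⟩) fun ψ => ?_
    · simp [evalAlt_ιMulti_of_ne hm]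
    · simp only [LinearMap.sum_apply, LinearMap.smul_apply, evalAlt_ιMulti, smul_eq_mul]
      -- The first row of `A` consists of ones. Subtracting column `0` from the other columns gives
      -- `B`, whose first row is `(1, 0, …, 0)`; expansion of both determinants along the first row
      -- gives the two sides.
      let A : Matrix (Fin (n + 1)) (Fin (n + 1)) ℝ := Matrix.of fun i j =>
        (Fin.cons 1 (fun i => ψ i ((Fin.cons v₀ v : Fin (n + 1) → W) j)) : Fin (n + 1) → ℝ) i
      let B : Matrix (Fin (n + 1)) (Fin (n + 1)) ℝ := Matrix.of fun i j =>
        A i j - (if j = 0 then 0 else 1) * A i 0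
      have hAB : A.det = B.det := by
        rw [← Matrix.det_transpose A, ← Matrix.det_transpose B]
        refine Matrix.det_eq_of_forall_row_eq_smul_add_const
          (fun j => if j = 0 then 0 else 1) 0 (by simp) fun j i => ?_
        simp [B]
      have hA : A.det = ∑ j : Fin (n + 1), (-1 : ℝ) ^ (j : ℕ) * (Matrix.of fun i k =>
          (ψ i) ((Fin.cons v₀ v : Fin (n + 1) → W) (j.succAbove k))).det := by
        rw [Matrix.det_succ_row_zero]
        refine Finset.sum_congr rfl fun j _ => ?_
        simp [A, Matrix.submatrix, Matrix.of_apply]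
      have hB : B.det = (Matrix.of fun i j => (ψ i) (v j - v₀)).det := by
        rw [Matrix.det_succ_row_zero, Finset.sum_eq_single 0]
        · simp [B, A, Matrix.submatrix, Matrix.of_apply, map_sub]
        · intro j _ hj
          simp [B, A, hj]
        · simp
      rw [← hB, ← hAB, hA]
  have := LinearMap.congr_fun key a
  simpa using this

end EvalAlt
end LieInt

namespace LieInt

open MeasureTheory

/-! ### Integration over the standard simplex -/

section Simplex

variable {k : ℕ}

theorem convex_Simp (k : ℕ) : Convex ℝ (Simp k) := by
  intro x hx y hy s t hs ht hst
  refine ⟨fun i => ?_, ?_⟩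
  · have := hx.1 i; have := hy.1 i; simp; positivity
  · have h1 := hx.2; have h2 := hy.2
    simp only [Pi.add_apply, Pi.smul_apply, smul_eq_mul, Finset.sum_add_distrib, ← Finset.mul_sum]
    nlinarith

theorem isClosed_Simp (k : ℕ) : IsClosed (Simp k) := by
  have : Simp k = (⋂ i, {x : V k | 0 ≤ x i}) ∩ {x | ∑ i, x i ≤ 1} := by ext; simp [Simp]
  rw [this]
  exact (isClosed_iInter fun i => isClosed_le continuous_const (continuous_apply i)).inter
    (isClosed_le (continuous_finsetSum _ fun i _ => continuous_apply i) continuous_const)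

theorem Simp_le_one {x : V k} (hx : x ∈ Simp k) (i : Fin k) : x i ≤ 1 :=
  (Finset.single_le_sum (fun j _ => hx.1 j) (Finset.mem_univ i)).trans hx.2

theorem Simp_subset_Icc (k : ℕ) : Simp k ⊆ Icc 0 1 := fun _ hx =>
  ⟨fun i => hx.1 i, fun i => Simp_le_one hx i⟩

theorem isCompact_Simp (k : ℕ) : IsCompact (Simp k) :=
  isCompact_Icc.of_isClosed_subset (isClosed_Simp k) (Simp_subset_Icc k)

theorem measurableSet_Simp (k : ℕ) : MeasurableSet (Simp k) := (isClosed_Simp k).measurableSet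

theorem zero_mem_Simp (k : ℕ) : (0 : V k) ∈ Simp k := ⟨fun _ => le_rfl, by simp⟩

theorem insertNth_mem_Simp {i : Fin (k + 1)} {t : ℝ} {x : V k} :
    i.insertNth t x ∈ Simp (k + 1) ↔ x ∈ Simp k ∧ t ∈ Icc 0 (1 - ∑ j, x j) := by
  simp only [Simp, mem_ofPred_eq, Fin.forall_iff_succAbove i, Fin.insertNth_apply_same,
    Fin.insertNth_apply_succAbove, Fin.sum_univ_succAbove _ i, mem_Icc]
  constructor
  · rintro ⟨⟨h1, h2⟩, h3⟩
    exact ⟨⟨h2, by linarith⟩, h1, by linarith⟩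
  · rintro ⟨⟨h1, h2⟩, h3, h4⟩
    exact ⟨⟨h3, h1⟩, by linarith⟩

/-- Fubini for the simplex. -/
theorem setIntegral_Simp_succ (i : Fin (k + 1)) {g : V (k + 1) → ℝ}
    (hg : ContinuousOn g (Simp (k + 1))) :
    ∫ x in Simp (k + 1), g x =
      ∫ x in Simp k, ∫ t in (0 : ℝ)..(1 - ∑ j, x j), g (i.insertNth t x) := by
  have hint : Integrable (indicator (Simp (k + 1)) g) := by
    rw [integrable_indicator_iff (measurableSet_Simp _)]
    exact hg.integrableOn_compact (isCompact_Simp _)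
  have hmp := volume_preserving_piFinSuccAbove (fun _ : Fin (k + 1) => ℝ) i
  rw [← integral_indicator (measurableSet_Simp _), ← integral_indicator (measurableSet_Simp _),
    ← hmp.symm.integral_comp' (g := indicator (Simp (k + 1)) g)]
  have hint' := (hmp.symm.integrable_comp_emb
    (MeasurableEquiv.measurableEmbedding _)).2 hint
  rw [Measure.volume_eq_prod]
  refine (integral_prod_symm _ hint').trans ?_
  refine integral_congr_ae (Filter.Eventually.of_forall fun x => ?_)
  have hs : ∀ t : ℝ, (indicator (Simp (k + 1)) g ∘ (MeasurableEquiv.piFinSuccAbove (fun _ : Fin (k + 1) => ℝ) i).symm) (t, x) =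
      indicator (Simp (k + 1)) g (i.insertNth t x) := fun t => rfl
  simp only [hs]
  by_cases hx : x ∈ Simp k
  · have h0 : 0 ≤ 1 - ∑ j, x j := by have := hx.2; linarith
    rw [indicator_of_mem hx, intervalIntegral.integral_of_le h0, ← integral_Icc_eq_integral_Ioc,
      ← integral_indicator measurableSet_Icc]
    refine integral_congr_ae (Filter.Eventually.of_forall fun t => ?_)
    by_cases ht : t ∈ Icc 0 (1 - ∑ j, x j)
    · simp only [indicator_of_mem ht, indicator_of_mem (insertNth_mem_Simp.2 ⟨hx, ht⟩)]
    · simp only [indicator_of_notMem ht,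
        indicator_of_notMem (fun h => ht (insertNth_mem_Simp.1 h).2)]
  · rw [indicator_of_notMem hx]
    have : ∀ t : ℝ, indicator (Simp (k + 1)) g (i.insertNth t x) = 0 := fun t =>
      indicator_of_notMem (fun h => hx (insertNth_mem_Simp.1 h).1) _
    simp [this]

/-- The fundamental theorem of calculus along one coordinate of the simplex. -/
theorem setIntegral_Simp_deriv (i : Fin (k + 1)) {b : V (k + 1) → ℝ}
    {b' : V (k + 1) → V (k + 1) →L[ℝ] ℝ}
    (hb : ∀ x ∈ Simp (k + 1), HasFDerivWithinAt b (b' x) (Simp (k + 1)) x)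
    (hc : ContinuousOn (fun x => b' x (Pi.single i 1)) (Simp (k + 1))) :
    ∫ x in Simp (k + 1), b' x (Pi.single i 1) =
      (∫ x in Simp k, b (i.insertNth (1 - ∑ j, x j) x)) -
        ∫ x in Simp k, b (i.insertNth 0 x) := by
  have hbc : ContinuousOn b (Simp (k + 1)) := fun x hx => (hb x hx).continuousWithinAt
  have hcont : ∀ s : V k → ℝ, Continuous s → (∀ x ∈ Simp k, s x ∈ Icc 0 (1 - ∑ j, x j)) →
      IntegrableOn (fun x => b (i.insertNth (s x) x)) (Simp k) := by
    intro s hs hm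
    refine ContinuousOn.integrableOn_compact (isCompact_Simp _)
      (hbc.comp (Continuous.continuousOn ?_)
      fun x hx => insertNth_mem_Simp.2 ⟨hx, hm x hx⟩)
    exact Continuous.finInsertNth i hs continuous_id
  have h1 : ∀ x ∈ Simp k, (0 : ℝ) ≤ 1 - ∑ j, x j := fun x hx => by have := hx.2; linarith
  rw [← integral_sub (hcont _ (by fun_prop) fun x hx => ⟨h1 x hx, le_rfl⟩)
    (hcont _ (by fun_prop) fun x hx => ⟨le_rfl, h1 x hx⟩), setIntegral_Simp_succ i hc]
  refine setIntegral_congr_fun (measurableSet_Simp _) fun x hx => ?_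
  have hline : ∀ t : ℝ, HasDerivAt (fun t : ℝ => (i.insertNth t x : V (k + 1)))
      (Pi.single i 1) t := by
    intro t
    rw [hasDerivAt_pi]
    intro j
    refine Fin.succAboveCases i ?_ (fun j => ?_) j
    · simpa using hasDerivAt_id' t
    · simpa [Fin.succAbove_ne] using hasDerivAt_const t (x j)
  have hmem : ∀ t ∈ Icc 0 (1 - ∑ j, x j), (i.insertNth t x : V (k + 1)) ∈ Simp (k + 1) :=
    fun t ht => insertNth_mem_Simp.2 ⟨hx, ht⟩
  have hlc : Continuous fun t : ℝ => (i.insertNth t x : V (k + 1)) :=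
    Continuous.finInsertNth i continuous_id continuous_const
  refine intervalIntegral.integral_eq_sub_of_hasDerivAt_of_le (h1 x hx)
    (hbc.comp hlc.continuousOn hmem) (fun t ht => ?_)
    (ContinuousOn.intervalIntegrable_of_Icc (h1 x hx) (hc.comp hlc.continuousOn hmem))
  have h2 := (hb _ (hmem t (Ioo_subset_Icc_self ht))).comp_hasDerivWithinAt t
    ((hline t).hasDerivWithinAt (s := Icc 0 (1 - ∑ j, x j))) (fun s hs => hmem s hs)
  exact h2.hasDerivAt (Icc_mem_nhds ht.1 ht.2)

theorem bary_injective : Function.Injective (bary (k := k)) := fun x y h => by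
  ext i
  simpa [bary] using congrFun h i.succ

theorem bary_ofVertices_perm (π : Equiv.Perm (Fin (k + 1))) (x : V k) (b : Fin (k + 1)) :
    bary ((AffMap.ofVertices π).fn x) b = bary x (π.symm b) := by
  rw [AffMap.bary_fn, Finset.sum_eq_single (π.symm b)]
  · simp [AffMap.ofVertices]
  · intro a _ ha
    have : π a ≠ b := fun h => ha (by simp [← h])
    simp [AffMap.ofVertices, this]
  · simp

/-- A permutation has finite order, so a positive power of the determinant is `1`. -/
theorem abs_det_ofVertices_perm (π : Equiv.Perm (Fin (k + 1))) :
    |LinearMap.det (AffMap.ofVertices (j := k) π).lin| = 1 := by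
  have hpow : ∀ r : ℕ, (AffMap.ofVertices (j := k) (π ^ r)).lin =
      (AffMap.ofVertices (j := k) π).lin ^ r := by
    intro r
    induction r with
    | zero => exact AffMap.lin_id
    | succ r ih =>
      rw [pow_succ, pow_succ, ← ih, Equiv.Perm.coe_mul, AffMap.ofVertices_comp, AffMap.lin_comp]
      rfl
  have h := hpow (orderOf π)
  rw [pow_orderOf_eq_one] at h
  have h1 : (LinearMap.det (AffMap.ofVertices (j := k) π).lin) ^ orderOf π = 1 := by
    rw [← map_pow, ← h]
    change LinearMap.det (AffMap.ofVertices id).lin = 1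
    rw [AffMap.lin_id, LinearMap.det_id]
  exact (pow_eq_one_iff_of_nonneg (abs_nonneg _) (orderOf_pos π).ne').1 (by rw [← abs_pow, h1, abs_one])

theorem ofVertices_perm_symm_fn (π : Equiv.Perm (Fin (k + 1))) (x : V k) :
    (AffMap.ofVertices π.symm).fn ((AffMap.ofVertices (j := k) π).fn x) = x := by
  refine bary_injective (funext fun b => ?_)
  rw [bary_ofVertices_perm, bary_ofVertices_perm]
  simp

/-- The integral over the simplex is invariant under permutations of the vertices. -/
theorem setIntegral_Simp_perm (π : Equiv.Perm (Fin (k + 1))) (g : V k → ℝ) :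
    ∫ x in Simp k, g ((AffMap.ofVertices π).fn x) = ∫ x in Simp k, g x := by
  have himg : (AffMap.ofVertices (j := k) π).fn '' Simp k = Simp k := by
    refine Subset.antisymm (image_subset_iff.2 fun x hx => AffMap.fn_mem _ hx) fun x hx =>
      ⟨(AffMap.ofVertices π.symm).fn x, AffMap.fn_mem _ hx, ?_⟩
    exact ofVertices_perm_symm_fn π.symm x
  have hinj : InjOn (AffMap.ofVertices (j := k) π).fn (Simp k) := fun x _ y _ h => by
    have := congrArg (AffMap.ofVertices π.symm).fn h
    rwa [ofVertices_perm_symm_fn, ofVertices_perm_symm_fn] at this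
  have h := integral_image_eq_integral_abs_det_fderiv_smul volume (measurableSet_Simp k)
    (fun x _ => ((AffMap.ofVertices (j := k) π).hasFDerivAt_fn x).hasFDerivWithinAt) hinj g
  rw [himg] at h
  rw [h]
  refine setIntegral_congr_fun (measurableSet_Simp k) fun x _ => ?_
  have : ContinuousLinearMap.det (LinearMap.toContinuousLinearMap
    (AffMap.ofVertices (j := k) π).lin) = LinearMap.det (AffMap.ofVertices (j := k) π).lin := rfl
  simp only [this, abs_det_ofVertices_perm, one_smul]

end Simplex

end LieInt

namespace LieInt

open MeasureTheory

/-! ### Stokes' theorem on the simplex -/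

section Stokes

variable {U : CartSp} {k : ℕ}

/-- The standard frame of the simplex. -/
abbrev frame (k : ℕ) : Fin k → V k := fun i => Pi.single i 1

theorem evalAlt_dx_mul (i : Fin (k + 1)) (a : Alt (k + 1)) :
    evalAlt (frame (k + 1)) (dx i * a) =
      (-1 : ℝ) ^ (i : ℕ) * evalAlt (fun l => frame (k + 1) (i.succAbove l)) a := by
  rw [dx, evalAlt_ι_mul, Finset.sum_eq_single i]
  · simp
  · intro j _ hj
    simp [hj.symm]
  · simp

theorem face_succ_fn (i : Fin (k + 1)) (x : V k) :
    (AffMap.ofVertices (j := k + 1) i.succ.succAbove).fn x = i.insertNth 0 x := by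
  ext j
  simp only [AffMap.fn, AffMap.ofVertices, Matrix.of_apply, mul_ite, mul_one, mul_zero]
  refine Fin.succAboveCases i ?_ (fun j => ?_) j
  · rw [Fin.insertNth_apply_same]
    exact Finset.sum_eq_zero fun a _ => if_neg (Fin.succAbove_ne _ _)
  · rw [Fin.insertNth_apply_succAbove, Finset.sum_eq_single j.succ]
    · simp [bary]
    · intro a _ ha
      refine if_neg fun h => ha ?_
      rw [← Fin.succ_succAbove_succ] at h
      exact Fin.succAbove_right_injective h
    · simp

theorem face_succ_lin (i : Fin (k + 1)) (l : Fin k) :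
    (AffMap.ofVertices (j := k + 1) i.succ.succAbove).lin (frame k l) =
      frame (k + 1) (i.succAbove l) := by
  have h := (AffMap.ofVertices (j := k + 1) i.succ.succAbove).fn_eq
  have h1 := congrFun h (frame k l)
  rw [face_succ_fn, face_succ_fn] at h1
  change _ = (AffMap.ofVertices (j := k + 1) i.succ.succAbove).lin (frame k l) + _ at h1
  rw [← sub_eq_iff_eq_add.2 h1]
  ext j
  refine Fin.succAboveCases i ?_ (fun j => ?_) j
  · simp [(Fin.succAbove_ne i l).symm]
  · simp [Pi.single_apply]

theorem face_zero_fn (x : V k) :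
    (AffMap.ofVertices (j := k + 1) (Fin.succAbove 0)).fn x = bary x := by
  ext j
  simp only [AffMap.fn, AffMap.ofVertices, Matrix.of_apply, mul_ite, mul_one, mul_zero]
  rw [Finset.sum_eq_single j]
  · simp
  · intro a _ ha
    exact if_neg fun h => ha (by simpa using h)
  · simp

theorem face_zero_lin (l : Fin k) :
    (AffMap.ofVertices (j := k + 1) (Fin.succAbove 0)).lin (frame k l) =
      frame (k + 1) l.succ - frame (k + 1) 0 := by
  have h := (AffMap.ofVertices (j := k + 1) (Fin.succAbove 0)).fn_eq
  have h1 := congrFun h (frame k l)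
  rw [face_zero_fn, face_zero_fn] at h1
  change _ = (AffMap.ofVertices (j := k + 1) (Fin.succAbove 0)).lin (frame k l) + _ at h1
  rw [← sub_eq_iff_eq_add.2 h1]
  ext j
  refine Fin.cases ?_ (fun j => ?_) j
  · simp [bary]
  · simp [bary, Pi.single_apply]

/-- The far end of the segment over `x` in direction `i` lies on the slanted face, opposite to the
vertex `0`. The resulting parametrization of that face depends on `i` only by a permutation of
vertices, so integrals over it do not depend on `i`. -/
theorem insertNth_eq_bary_perm (i : Fin (k + 1)) (x : V k) :
    (i.insertNth (1 - ∑ j, x j) x : V (k + 1)) =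
      bary ((AffMap.ofVertices (i.cycleRange).symm).fn x) := by
  ext j
  rw [bary_ofVertices_perm, Equiv.symm_symm]
  refine Fin.succAboveCases i ?_ (fun j => ?_) j
  · simp [bary]
  · simp [bary, Fin.cycleRange_succAbove]

variable {α : Form U (k + 1)}

theorem evalAlt_d (u : U.Pt) (x : Simp (k + 1)) :
    evalAlt (frame (k + 1)) (Form.d α u x) = ∑ i : Fin (k + 1), (-1 : ℝ) ^ (i : ℕ) *
      evalAlt (fun l => frame (k + 1) (i.succAbove l)) (Form.D α u x (frame (k + 1) i)) := by
  rw [Form.d, map_sum]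
  exact Finset.sum_congr rfl fun i _ => evalAlt_dx_mul i _

/-- Stokes' theorem for the simplex. -/
theorem stokes_Simp (hα : Form.Smooth α) (u : U.Pt) :
    ∫ x in Simp (k + 1), Form.coef (evalAlt (frame (k + 1))) (Form.d α) u x =
      ∑ i : Fin (k + 2), (-1 : ℝ) ^ (i : ℕ) * ∫ x in Simp k, Form.coef (evalAlt (frame k))
        (Form.pull id (AffMap.ofVertices i.succAbove) α) u x := by
  -- `b i` is the coefficient of the form that is paired with `dx i`. The fundamental theorem in
  -- direction `i` turns the integral of its `i`-th derivative into an integral over the slanted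
  -- face minus one over the face `xᵢ = 0`.
  set φ : Fin (k + 1) → Alt (k + 1) →ₗ[ℝ] ℝ := fun i =>
    evalAlt (fun l => frame (k + 1) (i.succAbove l)) with hφ
  set b : Fin (k + 1) → V (k + 1) → ℝ := fun i => Form.coef (φ i) α u with hb
  set b' : Fin (k + 1) → V (k + 1) → V (k + 1) →L[ℝ] ℝ := fun i =>
    fderivWithin ℝ (b i) (Simp (k + 1)) with hb'
  have hbs : ∀ i, ContDiffOn ℝ ∞ (b i) (Simp (k + 1)) := fun i => hα.coef_right _ u
  have hbd : ∀ i, ∀ x ∈ Simp (k + 1), HasFDerivWithinAt (b i) (b' i x) (Simp (k + 1)) x :=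
    fun i x hx => ((hbs i).differentiableOn (by simp) x hx).hasFDerivWithinAt
  have hbc : ∀ i, ContinuousOn (fun x => b' i x (frame (k + 1) i)) (Simp (k + 1)) := fun i =>
    ((hbs i).continuousOn_fderivWithin (Simp_uniqueDiffOn _) (by simp)).clm_apply
      continuousOn_const
  have h1 : ∫ x in Simp (k + 1), Form.coef (evalAlt (frame (k + 1))) (Form.d α) u x =
      ∑ i : Fin (k + 1), (-1 : ℝ) ^ (i : ℕ) * ∫ x in Simp (k + 1), b' i x (frame (k + 1) i) := by
    simp only [← integral_const_mul]
    rw [← integral_finsetSum _ fun i _ =>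
      ((hbc i).integrableOn_compact (isCompact_Simp _)).const_mul _]
    refine setIntegral_congr_fun (measurableSet_Simp _) fun x hx => ?_
    rw [Form.coef_of_mem _ _ _ hx, evalAlt_d]
    refine Finset.sum_congr rfl fun i _ => ?_
    exact congrArg ((-1 : ℝ) ^ (i : ℕ) * ·) (DFunLike.congr_fun
      (((hα.hasD u ⟨x, hx⟩) (φ i)).fderivWithin (Simp_uniqueDiffOn _ x hx)) (frame (k + 1) i)).symm
  rw [h1, Fin.sum_univ_succ (n := k + 1)]
  have h2 : ∀ i : Fin (k + 1), ∫ x in Simp k, b i (i.insertNth 0 x) = ∫ x in Simp k,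
      Form.coef (evalAlt (frame k)) (Form.pull id (AffMap.ofVertices i.succ.succAbove) α) u x := by
    intro i
    refine setIntegral_congr_fun (measurableSet_Simp _) fun x hx => ?_
    rw [Form.coef_pull _ _ _ _ _ hx, face_succ_fn]
    simp only [hb, id]
    congr 1
    refine LinearMap.ext fun a => ?_
    change _ = evalAlt _ (ExteriorAlgebra.map _ a)
    rw [evalAlt_map]
    simp only [face_succ_lin, hφ]
  have h3 : ∀ i : Fin (k + 1), ∫ x in Simp k, b i (i.insertNth (1 - ∑ j, x j) x) =
      ∫ x in Simp k, b i (bary x) := by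
    intro i
    simp only [insertNth_eq_bary_perm]
    exact setIntegral_Simp_perm _ fun x => b i (bary x)
  have hbary : ∀ x ∈ Simp k, bary x ∈ Simp (k + 1) := fun x hx => by
    rw [← face_zero_fn]
    exact AffMap.fn_mem _ hx
  have hbaryc : Continuous (bary (k := k)) := by
    have : bary (k := k) = (AffMap.ofVertices (j := k + 1) (Fin.succAbove 0)).fn :=
      funext fun x => (face_zero_fn x).symm
    rw [this]
    exact (AffMap.contDiff_fn _).continuous
  -- The tangent frame of the slanted face consists of the differences `e_{l+1} - e_0`, so
  -- `evalAlt_sub` combines the slanted contributions of all directions into one pullback.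
  have h4 : ∑ i : Fin (k + 1), (-1 : ℝ) ^ (i : ℕ) * ∫ x in Simp k, b i (bary x) =
      ∫ x in Simp k, Form.coef (evalAlt (frame k))
        (Form.pull id (AffMap.ofVertices (Fin.succAbove 0)) α) u x := by
    simp only [← integral_const_mul]
    have hint : ∀ i, IntegrableOn (fun x => b i (bary x)) (Simp k) := fun i =>
      ContinuousOn.integrableOn_compact (isCompact_Simp _)
        ((hbs i).continuousOn.comp hbaryc.continuousOn hbary)
    rw [← integral_finsetSum _ fun i _ => (hint i).const_mul _]
    refine setIntegral_congr_fun (measurableSet_Simp _) fun x hx => ?_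
    rw [Form.coef_pull _ _ _ _ _ hx, face_zero_fn, Form.coef_of_mem _ _ _ (hbary x hx)]
    simp only [LinearMap.comp_apply, AlgHom.toLinearMap_apply]
    rw [evalAlt_map]
    simp only [face_zero_lin]
    rw [evalAlt_sub]
    refine Finset.sum_congr rfl fun i _ => ?_
    simp only [hb, hφ, Form.coef_of_mem _ _ _ (hbary x hx)]
    have : (Fin.cons (frame (k + 1) 0) fun i : Fin k => frame (k + 1) i.succ) =
        frame (k + 1) := by
      ext j : 1
      refine Fin.cases ?_ (fun j => ?_) j <;> simp
    rw [this]
    rfl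
  simp only [fun i : Fin (k + 1) => setIntegral_Simp_deriv i (hbd i) (hbc i), h2, h3, mul_sub,
    Finset.sum_sub_distrib, h4]
  simp only [Fin.val_succ, pow_succ, mul_neg, mul_one, neg_mul, Finset.sum_neg_distrib, Fin.val_zero, pow_zero, one_mul]
  ring

end Stokes

/-! ### Smooth dependence of integrals on parameters -/

section Parametric

variable {E : Type} [NormedAddCommGroup E] [NormedSpace ℝ E] {k : ℕ}

theorem exists_bound_near [FiniteDimensional ℝ E] {F : Type} [NormedAddCommGroup F]
    {f : E × V k → F}
    (hf : ContinuousOn f (univ ×ˢ Simp k)) (u : E) :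
    ∃ M, ∀ v ∈ Metric.ball u 1, ∀ x ∈ Simp k, ‖f (v, x)‖ ≤ M := by
  have hK : IsCompact (Metric.closedBall u 1 ×ˢ Simp k) :=
    (isCompact_closedBall u 1).prod (isCompact_Simp k)
  obtain ⟨M, hM⟩ := hK.exists_bound_of_continuousOn
    (hf.mono (prod_mono (subset_univ _) subset_rfl))
  exact ⟨M, fun v hv x hx => hM _ ⟨Metric.ball_subset_closedBall hv, hx⟩⟩

omit [NormedSpace ℝ E] in
theorem continuousOn_slice {F : Type} [NormedAddCommGroup F]
    {f : E × V k → F} (hf : ContinuousOn f (univ ×ˢ Simp k)) (u : E) :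
    ContinuousOn (fun x => f (u, x)) (Simp k) :=
  hf.comp (by fun_prop) fun x hx => ⟨mem_univ _, hx⟩

theorem continuous_setIntegral_Simp [FiniteDimensional ℝ E] {F : Type} [NormedAddCommGroup F]
    [NormedSpace ℝ F]
    {f : E × V k → F} (hf : ContinuousOn f (univ ×ˢ Simp k)) :
    Continuous fun u => ∫ x in Simp k, f (u, x) := by
  refine continuous_iff_continuousAt.2 fun u => ?_
  obtain ⟨M, hM⟩ := exists_bound_near hf u
  refine continuousAt_of_dominated (bound := fun _ => M) ?_ ?_ ?_ ?_
  · exact Filter.Eventually.of_forall fun v =>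
      (continuousOn_slice hf v).aestronglyMeasurable (measurableSet_Simp k)
  · filter_upwards [Metric.ball_mem_nhds u one_pos] with v hv
    exact (ae_restrict_iff' (measurableSet_Simp k)).2 (Filter.Eventually.of_forall fun x hx =>
      hM v hv x hx)
  · exact continuousOn_const.integrableOn_compact (isCompact_Simp k)
  · refine (ae_restrict_iff' (measurableSet_Simp k)).2 (Filter.Eventually.of_forall fun x hx => ?_)
    have h := hf (u, x) ⟨mem_univ _, hx⟩
    exact (h.comp (t := univ ×ˢ Simp k) (s := univ) (f := fun v : E => (v, x)) (x := u)
      (by fun_prop) (fun v _ => ⟨mem_univ _, hx⟩)).continuousAt Filter.univ_mem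

/-- Differentiation under the integral sign, dominated by a bound on a ball of parameters times the
compact simplex. The target `F` varies in the induction because the derivative takes values in a
space of linear maps. -/
theorem contDiff_setIntegral_Simp_nat [FiniteDimensional ℝ E] (m : ℕ) :
    ∀ {F : Type} [NormedAddCommGroup F] [NormedSpace ℝ F]
    {f : E × V k → F}, ContDiffOn ℝ ∞ f (univ ×ˢ Simp k) →
    ContDiff ℝ m fun u => ∫ x in Simp k, f (u, x) := by
  have hu : UniqueDiffOn ℝ ((univ : Set E) ×ˢ Simp k) :=
    uniqueDiffOn_univ.prod (Simp_uniqueDiffOn k)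
  induction m with
  | zero =>
    intro F _ _ f hf
    exact contDiff_zero.2 (continuous_setIntegral_Simp hf.continuousOn)
  | succ m ih =>
    intro F _ _ f hf
    have hf' : ContDiffOn ℝ ∞ (fun p => (fderivWithin ℝ f (univ ×ˢ Simp k) p).comp
        (ContinuousLinearMap.inl ℝ E (V k))) (univ ×ˢ Simp k) :=
      (hf.fderivWithin hu (by simp)).clm_comp contDiffOn_const
    rw [Nat.cast_add, Nat.cast_one, contDiff_succ_iff_hasFDerivAt]
    refine ⟨_, ih hf', fun u => ?_⟩
    obtain ⟨M, hM⟩ := exists_bound_near hf'.continuousOn u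
    refine hasFDerivAt_integral_of_dominated_of_fderiv_le (𝕜 := ℝ) (μ := volume.restrict (Simp k))
      (bound := fun _ => M) (F' := fun v x => (fderivWithin ℝ f (univ ×ˢ Simp k) (v, x)).comp
        (ContinuousLinearMap.inl ℝ E (V k)))
      (F := fun v x => f (v, x)) (Metric.ball_mem_nhds u one_pos) ?_ ?_ ?_ ?_ ?_ ?_
    · exact Filter.Eventually.of_forall fun v =>
        (continuousOn_slice hf.continuousOn v).aestronglyMeasurable (measurableSet_Simp k)
    · exact (continuousOn_slice hf.continuousOn u).integrableOn_compact (isCompact_Simp k)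
    · exact (continuousOn_slice hf'.continuousOn u).aestronglyMeasurable (measurableSet_Simp k)
    · exact (ae_restrict_iff' (measurableSet_Simp k)).2 (Filter.Eventually.of_forall
        fun x hx v hv => hM v hv x hx)
    · exact continuousOn_const.integrableOn_compact (isCompact_Simp k)
    · refine (ae_restrict_iff' (measurableSet_Simp k)).2 (Filter.Eventually.of_forall
        fun x hx v _ => ?_)
      have h3 := (hf.differentiableOn (by simp) (v, x) ⟨mem_univ _, hx⟩).hasFDerivWithinAt
      have h5 := HasFDerivWithinAt.comp (t := univ ×ˢ Simp k) (s := univ) (f := fun w => (w, x)) v h3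
        (hasFDerivAt_prodMk_left v x).hasFDerivWithinAt (fun w _ => ⟨mem_univ _, hx⟩)
      exact h5.hasFDerivAt Filter.univ_mem

theorem contDiff_setIntegral_Simp [FiniteDimensional ℝ E] {f : E × V k → ℝ}
    (hf : ContDiffOn ℝ ∞ f (univ ×ˢ Simp k)) : ContDiff ℝ ∞ fun u => ∫ x in Simp k, f (u, x) :=
  contDiff_infty.2 fun m => contDiff_setIntegral_Simp_nat m hf

end Parametric

end LieInt

namespace LieInt

open AlgebraicTopology SimplicialObject MeasureTheory

/-! ### The cochain of integrals -/

section IntegralCochain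

open Simplicial

/-- If `θ a = θ b` with `a ≠ b`, the nonzero tangent vector from the vertex `b` to the vertex `a` is
mapped to zero. -/
theorem not_injective_frame {k j : ℕ} {θ : Fin (k + 1) → Fin (j + 1)}
    (hθ : ¬ Function.Injective θ) :
    ¬ LinearIndependent ℝ fun i => (AffMap.ofVertices (j := j) θ).lin (frame k i) := by
  intro h
  simp only [Function.Injective, not_forall] at hθ
  obtain ⟨a, b, hab, hne⟩ := hθ
  let e : Fin (k + 1) → ℝ := Pi.single a 1 - Pi.single b 1
  have he : baryLin k (fun i => e i.succ) = e := by
    have hs : ∑ i, e i = 0 := by simp [e]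
    rw [Fin.sum_univ_succ] at hs
    ext i
    refine Fin.cases ?_ (fun i => rfl) i
    change -∑ i : Fin k, e i.succ = e 0
    linarith
  have h0 : (AffMap.ofVertices (j := j) θ).lin (fun i => e i.succ) = 0 := by
    ext l
    change ∑ i, baryLin k _ i * _ = (0 : ℝ)
    rw [he]
    simp only [e, Pi.sub_apply, sub_mul, Finset.sum_sub_distrib, Pi.single_apply, ite_mul, one_mul,
      zero_mul, Finset.sum_ite_eq', Finset.mem_univ, if_true]
    simp [AffMap.ofVertices, hab]
  have h1 : ∑ i : Fin k, e i.succ • (AffMap.ofVertices (j := j) θ).lin (frame k i) = 0 := by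
    simp only [← map_smul, ← map_sum]
    rw [← h0]
    congr 1
    ext i
    simp [Finset.sum_apply, Pi.single_apply]
  have h2 := Fintype.linearIndependent_iff.1 h _ h1
  have h3 : e = 0 := by
    rw [← he, show (fun i : Fin k => e i.succ) = 0 from funext h2, map_zero]
  have := congrFun h3 a
  simp [e, hne] at this

theorem evalAlt_eq_zero {W : Type} [AddCommGroup W] [Module ℝ W] {n : ℕ} {v : Fin n → W}
    (h : ¬ LinearIndependent ℝ v) (a : ExteriorAlgebra ℝ (Dual ℝ W)) : evalAlt v a = 0 :=
  (altOf (n := n) a).map_linearDependent v h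

theorem pull_param_apply {U W : CartSp} {k : ℕ} (g : W.Pt → U.Pt) (α : Form U k) (w : W.Pt)
    (x : Simp k) : Form.pull g (AffMap.ofVertices id) α w x = α (g w) x := by
  change ExteriorAlgebra.map (AffMap.ofVertices id).lin.dualMap
    (α (g w) ((AffMap.ofVertices id).onSimp x)) = _
  rw [AffMap.lin_id, show (AffMap.ofVertices id).onSimp x = x from
    Subtype.ext (AffMap.fn_id x.1), LinearMap.dualMap_id, ExteriorAlgebra.map_id]
  rfl

/-- Integrals over simplices of the value of a map at a fixed closed element. -/
def integralCochain (A : DGAlg) (n : ℕ) (m : A.carrier) : NormCochain (expD A) n where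
  val U Φ := ⟨fun u => simplexIntegral ((Φ : DGAlg.Hom A (Omega U.unop n)).toAlgHom m) u,
    contDiff_setIntegral_Simp (Form.Smooth.functional
      (Form.siForms_le _ _ ((Φ : DGAlg.Hom A (Omega U.unop n)).toAlgHom m).2) _),
    fun _ => AddSubgroup.mem_top _⟩
  natural {U W} g Φ := Subtype.ext (funext fun w => by
    refine setIntegral_congr_fun (measurableSet_Simp _) fun x hx => ?_
    rw [Form.coef_of_mem _ _ _ hx, Form.coef_of_mem _ _ _ hx]
    exact congrArg _ (pull_param_apply g.unop.1 _ w ⟨x, hx⟩))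
  normalized U j θ hθ Φ := Subtype.ext (funext fun u => by
    refine setIntegral_eq_zero_of_forall_eq_zero fun x hx => ?_
    change Form.coef _ _ u x = (0 : ℝ)
    rw [Form.coef_of_mem _ _ _ hx]
    refine (evalAlt_map (AffMap.ofVertices θ.toOrderHom).lin _ _).trans ?_
    exact evalAlt_eq_zero (not_injective_frame hθ) _)

theorem delta_apply {X : CartSpᵒᵖ ⥤ SSet.{0}} {n : ℕ} (f : NormCochain X n) (U : CartSpᵒᵖ)
    (x : (X.obj U).obj (op ⦋n + 1⦌)) (u : U.unop.Pt) : (f.delta U x).1 u =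
      ∑ i : Fin (n + 2), (-1 : ℝ) ^ (i : ℕ) *
        (f.val U ((X.obj U).map (SimplexCategory.δ i).op x)).1 u := by
  have h := map_sum (smoothEval U u) (fun i : Fin (n + 2) => (-1 : ℤ) ^ (i : ℕ) •
    f.val U ((X.obj U).map (SimplexCategory.δ i).op x)) Finset.univ
  refine h.trans (Finset.sum_congr rfl fun i _ => ?_)
  rw [map_zsmul, zsmul_eq_mul]
  push_cast
  rfl

/-- By Stokes' theorem the coboundary is the integral of the differential of the image of `m`, which
is zero. -/
theorem integralCochain_delta {A : DGAlg} {n : ℕ} {m : A.carrier} (hm : A.d m = 0)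
    (U : CartSpᵒᵖ) (Φ : ((expD A).obj U).obj (op ⦋n + 1⦌)) :
    (integralCochain A n m).delta U Φ = 0 := by
  refine Subtype.ext (funext fun u => ?_)
  rw [delta_apply]
  let Ψ : DGAlg.Hom A (Omega U.unop (n + 1)) := Φ
  have hd : Form.d (Ψ.toAlgHom m).1 = 0 := by
    have h := Ψ.map_d m
    rw [hm, map_zero] at h
    exact (congrArg Subtype.val h).symm
  have h := stokes_Simp (Form.siForms_le _ _ (Ψ.toAlgHom m).2) u
  refine h.symm.trans ?_
  rw [hd]
  refine setIntegral_eq_zero_of_forall_eq_zero fun x hx => ?_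
  rw [Form.coef_of_mem _ _ _ hx]
  exact map_zero _

end IntegralCochain

/-! ### The least subgroup in terms of coboundaries on the coskeleton -/

section LeastSubgroup

variable (n : ℕ)

theorem exists_fiberIntegration : ∃ I : expD (CELine n) ⟶ BR n, IsFiberIntegration I ∧
    ∀ U x, oneCellFun ((I.app U).app _ x) = (integralCochain (CELine n) n (lineGen n)).val U x := by
  obtain ⟨I, hI⟩ := NormCochain.exists_br (f := integralCochain (CELine n) n (lineGen n))
    (integralCochain_delta rfl)
  refine ⟨I, fun U Φ => ⟨(integralCochain (CELine n) n (lineGen n)).val (op U) Φ,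
    fun u => rfl, oneCellFun_injective ?_⟩, hI⟩
  exact (hI (op U) Φ).trans (oneCellFun_BRcell n U _).symm

variable {n} {A : DGAlg} (μ : DGAlg.Hom (CELine n) A)

/-- The cochain of integrals of the cocycle `μ`. -/
abbrev cocycleCochain : NormCochain (expD A) n := integralCochain A n (μ.toAlgHom (lineGen n))

/-- The subgroup generated by the coboundaries on the coskeleton of the integrals of `μ`. -/
def cosubgroup : AddSubgroup ℝ :=
  AddSubgroup.closure {r | ∃ U x u, (((cocycleCochain μ).cosk).delta U x).1 u = r}

/-- By `exists_cosk_factorization_iff`, a subgroup admits a factorization exactly if it contains all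
the generators of `cosubgroup μ`. -/
theorem isLeast_cosubgroup {I : expD (CELine n) ⟶ BR n}
    (hI : ∀ U x, oneCellFun ((I.app U).app _ x) =
      (integralCochain (CELine n) n (lineGen n)).val U x) :
    IsLeast {Λ : AddSubgroup ℝ | ∃ φ : coskP n (expD A) ⟶ BQuot n Λ,
      toCosk n _ ≫ φ = expMap μ ≫ I ≫ toBQuot n Λ} (cosubgroup μ) := by
  have h : ∀ Λ : AddSubgroup ℝ, (∃ φ : coskP n (expD A) ⟶ BQuot n Λ,
      toCosk n _ ≫ φ = expMap μ ≫ I ≫ toBQuot n Λ) ↔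
      ∀ U x u, (((cocycleCochain μ).cosk).delta U x).1 u ∈ Λ := by
    intro Λ
    have := exists_cosk_factorization_iff (cocycleCochain μ) Λ (expMap μ ≫ I) fun U x =>
      hI U (((expMap μ).app U).app _ x)
    simpa only [Category.assoc] using this
  refine ⟨(h _).2 fun U x u => AddSubgroup.subset_closure ⟨U, x, u, rfl⟩, fun Λ hΛ => ?_⟩
  rw [cosubgroup, AddSubgroup.closure_le]
  rintro _ ⟨U, x, u, rfl⟩
  exact (h Λ).1 hΛ U x u

theorem cocycle_d : A.d (μ.toAlgHom (lineGen n)) = 0 := by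
  exact (μ.map_d _).symm.trans (map_zero μ.toAlgHom)

end LeastSubgroup

end LieInt

namespace LieInt

/-! ### The Maurer-Cartan form in the chart at the unit -/

section MaurerCartan

variable {F F' : Type} [NormedAddCommGroup F] [NormedSpace ℝ F] [NormedAddCommGroup F']
  [NormedSpace ℝ F'] {d : ℕ} {G : Type*} [TopologicalSpace G]
  [ChartedSpace (EuclideanSpace ℝ (Fin d)) G] [Group G]

variable (d) in
/-- The chart at `1`. -/
def lc (g : G) : EuclideanSpace ℝ (Fin d) := extChartAt (𝓡 d) (1 : G) g

/-- The inverse of the chart at `1`. -/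
def ec (z : EuclideanSpace ℝ (Fin d)) : G := (extChartAt (𝓡 d) (1 : G)).symm z

variable (d G) in
/-- The domain of the chart at `1`. -/
def lcSource : Set G := (extChartAt (𝓡 d) (1 : G)).source

variable (d G) in
/-- The image of the chart at `1`. -/
def lcTarget : Set (EuclideanSpace ℝ (Fin d)) := (extChartAt (𝓡 d) (1 : G)).target

variable (d) in
/-- The pullback of the left-invariant Maurer-Cartan form along `h`. -/
def MC (s : Set F) (h : F → G) (x : F) : F →L[ℝ] EuclideanSpace ℝ (Fin d) :=
  fderivWithin ℝ (fun z => lc d ((h x)⁻¹ * h z)) s x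

theorem isOpen_lcSource : IsOpen (lcSource d G) := isOpen_extChartAt_source _

theorem isOpen_lcTarget : IsOpen (lcTarget d G) := isOpen_extChartAt_target _

theorem one_mem_lcSource : (1 : G) ∈ lcSource d G := mem_extChartAt_source _

theorem lc_mem {g : G} (hg : g ∈ lcSource d G) : lc d g ∈ lcTarget d G :=
  (extChartAt (𝓡 d) (1 : G)).map_source hg

theorem ec_lc {g : G} (hg : g ∈ lcSource d G) : ec (lc d g) = g :=
  (extChartAt (𝓡 d) (1 : G)).left_inv hg

theorem lc_ec {z : EuclideanSpace ℝ (Fin d)} (hz : z ∈ lcTarget d G) : lc d (ec z : G) = z :=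
  (extChartAt (𝓡 d) (1 : G)).right_inv hz

theorem ec_lc_one : (ec (lc d (1 : G)) : G) = 1 := ec_lc one_mem_lcSource

section Basic

variable {s : Set F} {h h' : F → G} {x : F}

theorem MC_mul_left (g : G) : MC d s (fun z => g * h z) x = MC d s h x := by
  simp [MC, mul_assoc]

theorem MC_congr (hh : h =ᶠ[𝓝[s] x] h') (hx : h x = h' x) : MC d s h x = MC d s h' x := by
  refine Filter.EventuallyEq.fderivWithin_eq ?_ (by rw [hx])
  filter_upwards [hh] with z hz
  rw [hz, hx]

theorem MC_comp {t : Set F'} {h : F' → G} {f : F → F'} (hf : DifferentiableWithinAt ℝ f s x)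
    (hst : MapsTo f s t)
    (hd : DifferentiableWithinAt ℝ (fun z => lc d ((h (f x))⁻¹ * h z)) t (f x))
    (hs : UniqueDiffWithinAt ℝ s x) :
    MC d s (fun z => h (f z)) x = (MC d t h (f x)).comp (fderivWithin ℝ f s x) :=
  fderivWithin_comp (g := fun z => lc d ((h (f x))⁻¹ * h z)) x hd hf hst hs

end Basic

variable [LieGroup (𝓡 d) ∞ G]

theorem contMDiffAt_lc {g : G} (hg : g ∈ lcSource d G) :
    ContMDiffAt (𝓡 d) 𝓘(ℝ, EuclideanSpace ℝ (Fin d)) ∞ (lc d : G → _) g :=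
  contMDiffAt_extChartAt' (by simpa [lcSource] using hg)

theorem contMDiffAt_ec {z : EuclideanSpace ℝ (Fin d)} (hz : z ∈ lcTarget d G) :
    ContMDiffAt 𝓘(ℝ, EuclideanSpace ℝ (Fin d)) (𝓡 d) ∞ (ec : _ → G) z :=
  (contMDiffOn_extChartAt_symm (1 : G)).contMDiffAt (isOpen_lcTarget.mem_nhds hz)

theorem continuousAt_ec {z : EuclideanSpace ℝ (Fin d)} (hz : z ∈ lcTarget d G) :
    ContinuousAt (ec : _ → G) z := (contMDiffAt_ec hz).continuousAt

section Smooth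

variable {s : Set F} {h : F → G} {x : F}

theorem contDiffWithinAt_lc_comp (hh : ContMDiffWithinAt 𝓘(ℝ, F) (𝓡 d) ∞ h s x)
    (hx : h x ∈ lcSource d G) : ContDiffWithinAt ℝ ∞ (fun z => lc d (h z)) s x :=
  contMDiffWithinAt_iff_contDiffWithinAt.1
    ((contMDiffAt_lc hx).comp_contMDiffWithinAt x hh)

theorem contMDiffWithinAt_mul_left (g : G) (hh : ContMDiffWithinAt 𝓘(ℝ, F) (𝓡 d) ∞ h s x) :
    ContMDiffWithinAt 𝓘(ℝ, F) (𝓡 d) ∞ (fun z => g * h z) s x :=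
  contMDiffWithinAt_const.mul hh

theorem contDiffWithinAt_lc_mul (g : G) (hh : ContMDiffWithinAt 𝓘(ℝ, F) (𝓡 d) ∞ h s x)
    (hx : g * h x ∈ lcSource d G) : ContDiffWithinAt ℝ ∞ (fun z => lc d (g * h z)) s x :=
  contDiffWithinAt_lc_comp (contMDiffWithinAt_mul_left g hh) hx

theorem contDiffWithinAt_lc_inv_mul (hh : ContMDiffWithinAt 𝓘(ℝ, F) (𝓡 d) ∞ h s x) :
    ContDiffWithinAt ℝ ∞ (fun z => lc d ((h x)⁻¹ * h z)) s x :=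
  contDiffWithinAt_lc_mul _ hh (by rw [inv_mul_cancel]; exact one_mem_lcSource)

theorem MC_comp_smooth {t : Set F'} {h : F' → G} {f : F → F'} (hf : DifferentiableWithinAt ℝ f s x)
    (hst : MapsTo f s t) (hh : ContMDiffWithinAt 𝓘(ℝ, F') (𝓡 d) ∞ h t (f x))
    (hs : UniqueDiffWithinAt ℝ s x) :
    MC d s (fun z => h (f z)) x = (MC d t h (f x)).comp (fderivWithin ℝ f s x) :=
  MC_comp hf hst ((contDiffWithinAt_lc_inv_mul hh).differentiableWithinAt (by simp)) hs

variable (d G) in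
/-- The Maurer-Cartan form in the chart at `1`. -/
def mcChart (z : EuclideanSpace ℝ (Fin d)) :
    EuclideanSpace ℝ (Fin d) →L[ℝ] EuclideanSpace ℝ (Fin d) := MC d univ (ec : _ → G) z

theorem MC_ec_comp {y : F → EuclideanSpace ℝ (Fin d)} (hy : DifferentiableWithinAt ℝ y s x)
    (hx : y x ∈ lcTarget d G) (hs : UniqueDiffWithinAt ℝ s x) :
    MC d s (fun z => (ec (y z) : G)) x = (mcChart d G (y x)).comp (fderivWithin ℝ y s x) :=
  MC_comp_smooth hy (mapsTo_univ _ _) (contMDiffAt_ec hx).contMDiffWithinAt hs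

/-- A left translation does not change `MC` and moves the values near `x` into the domain of the
chart, where the map factors through `ec`. Thus `MC` is expressed by one smooth function on the
chart. -/
theorem MC_eq_mcChart (g : G) (hh : ContMDiffWithinAt 𝓘(ℝ, F) (𝓡 d) ∞ h s x)
    (hx : g * h x ∈ lcSource d G) (hs : UniqueDiffWithinAt ℝ s x) :
    MC d s h x = (mcChart d G (lc d (g * h x))).comp
      (fderivWithin ℝ (fun z => lc d (g * h z)) s x) := by
  have hc := contMDiffWithinAt_mul_left g hh
  rw [← MC_ec_comp ((contDiffWithinAt_lc_comp hc hx).differentiableWithinAt (by simp)) (lc_mem hx)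
    hs, ← MC_mul_left g]
  refine MC_congr ?_ (ec_lc hx).symm
  filter_upwards [hc.continuousWithinAt (isOpen_lcSource.mem_nhds hx)] with z hz
  exact (ec_lc hz).symm

/-- `mcChart` is the partial derivative in `w`, on the diagonal, of `lc ((ec z)⁻¹ * ec w)`, which is
smooth near the diagonal. -/
theorem contDiffOn_mcChart : ContDiffOn ℝ ∞ (mcChart d G) (lcTarget d G) := by
  intro z hz
  refine ContDiffAt.contDiffWithinAt ?_
  have h1 : ContDiffAt ℝ ∞ (Function.uncurry fun (z w : EuclideanSpace ℝ (Fin d)) =>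
      lc d ((ec z : G)⁻¹ * ec w)) (z, z) := by
    have h2 : ContMDiffAt 𝓘(ℝ, EuclideanSpace ℝ (Fin d) × EuclideanSpace ℝ (Fin d)) (𝓡 d) ∞
        (fun p : EuclideanSpace ℝ (Fin d) × EuclideanSpace ℝ (Fin d) =>
          (ec p.1 : G)⁻¹ * ec p.2) (z, z) := by
      have e1 := ContMDiffAt.comp (f := Prod.fst) (z, z) (contMDiffAt_ec (G := G) hz)
        (contDiff_fst.contMDiff.contMDiffAt)
      have e2 := ContMDiffAt.comp (f := Prod.snd) (z, z) (contMDiffAt_ec (G := G) hz)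
        (contDiff_snd.contMDiff.contMDiffAt)
      exact e1.inv.mul e2
    have := contDiffWithinAt_lc_comp (s := univ) h2.contMDiffWithinAt
      (by rw [inv_mul_cancel]; exact one_mem_lcSource)
    exact contDiffWithinAt_univ.1 this
  have h3 := h1.fderiv contDiffAt_id (m := ∞) (by simp)
  refine h3.congr_of_eventuallyEq (Filter.Eventually.of_forall fun w => ?_)
  simp [mcChart, MC]

theorem contDiffOn_MC (hh : ContMDiffOn 𝓘(ℝ, F) (𝓡 d) ∞ h s) (hs : UniqueDiffOn ℝ s) :
    ContDiffOn ℝ ∞ (MC d s h) s := by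
  intro x hx
  have hc : ∀ᶠ z in 𝓝[s] x, (h x)⁻¹ * h z ∈ lcSource d G :=
    (contMDiffWithinAt_mul_left (h x)⁻¹ (hh x hx)).continuousWithinAt
      (isOpen_lcSource.mem_nhds (by rw [inv_mul_cancel]; exact one_mem_lcSource))
  have h1 : MC d s h =ᶠ[𝓝[s] x] fun z => (mcChart d G (lc d ((h x)⁻¹ * h z))).comp
      (fderivWithin ℝ (fun z => lc d ((h x)⁻¹ * h z)) s z) := by
    filter_upwards [hc, self_mem_nhdsWithin] with z hz hzs
    exact MC_eq_mcChart _ (hh z hzs) hz (hs z hzs)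
  have h2 := contDiffWithinAt_lc_inv_mul (hh x hx)
  have hx1 : (h x)⁻¹ * h x ∈ lcSource d G := by rw [inv_mul_cancel]; exact one_mem_lcSource
  refine ContDiffWithinAt.congr_of_eventuallyEq ?_ h1 (h1.self_of_nhdsWithin hx)
  refine ContDiffWithinAt.clm_comp ?_ (h2.fderivWithin_right hs (by simp) hx)
  exact ((contDiffOn_mcChart (G := G)).contDiffAt (isOpen_lcTarget.mem_nhds (lc_mem hx1))).comp_contDiffWithinAt x h2

theorem mcChart_one : mcChart d G (lc d (1 : G)) = ContinuousLinearMap.id ℝ _ := by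
  have h1 : MC d univ (ec : _ → G) (lc d (1 : G)) = fderiv ℝ id (lc d (1 : G)) := by
    rw [MC, fderivWithin_univ]
    refine Filter.EventuallyEq.fderiv_eq ?_
    filter_upwards [isOpen_lcTarget.mem_nhds (lc_mem (one_mem_lcSource (d := d) (G := G)))] with z hz
    rw [ec_lc_one, inv_one, one_mul, lc_ec hz, id]
  rw [mcChart, h1, fderiv_id]

end Smooth

end MaurerCartan

end LieInt

namespace LieInt

/-! ### The Lie bracket in coordinates and the Maurer-Cartan equation -/

section Bracket

open VectorField

variable {F : Type} [NormedAddCommGroup F] [NormedSpace ℝ F] {d : ℕ} {G : Type*}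
  [TopologicalSpace G] [ChartedSpace (EuclideanSpace ℝ (Fin d)) G] [Group G] [LieGroup (𝓡 d) ∞ G]

local notation "E" => EuclideanSpace ℝ (Fin d)

/-- The tangent space at `1` is identified with the model space by the chart at `1` itself. -/
theorem mfderiv_lc_one : (mfderiv (𝓡 d) 𝓘(ℝ, E) (lc d : G → E) 1 : E →L[ℝ] E) =
    ContinuousLinearMap.id ℝ E := by
  have h1 := (contMDiffAt_lc (d := d) (one_mem_lcSource (G := G))).mdifferentiableAt (by simp)
  rw [h1.mfderiv]
  have h2 : fderivWithin ℝ (writtenInExtChartAt (𝓡 d) 𝓘(ℝ, E) (1 : G) (lc d))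
      (range (𝓡 d)) (extChartAt (𝓡 d) (1 : G) 1) =
      fderivWithin ℝ id (range (𝓡 d)) (extChartAt (𝓡 d) (1 : G) 1) := by
    refine Filter.EventuallyEq.fderivWithin_eq ?_ ?_
    · filter_upwards [mem_nhdsWithin_of_mem_nhds (isOpen_lcTarget.mem_nhds
        (lc_mem (one_mem_lcSource (d := d) (G := G))))] with z hz
      exact lc_ec hz
    · exact lc_ec (lc_mem one_mem_lcSource)
  refine h2.trans ?_
  simp

variable (G) in
/-- The values of the left-invariant vector fields in the chart at `1`. -/
def invField (z : E) : E →L[ℝ] E :=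
  (mfderivWithin 𝓘(ℝ, E) (𝓡 d) (ec : E → G) (range (𝓡 d)) z).inverse ∘L
    (mfderiv (𝓡 d) (𝓡 d) (fun x => (ec z : G) * x) 1 : E →L[ℝ] E)

/-- The chart derivatives cancel, and what remains is the derivative at `1` of `x ↦ lc ((ec z)⁻¹ *
(ec z * x))`, which is `lc`. -/
theorem mcChart_comp_invField {z : E} (hz : z ∈ lcTarget d G) :
    mcChart d G z ∘L invField G z = ContinuousLinearMap.id ℝ E := by
  have hec := (contMDiffAt_ec (G := G) hz).mdifferentiableAt (by simp)
  have hT : MDifferentiableAt (𝓡 d) 𝓘(ℝ, E) (fun x : G => lc d ((ec z)⁻¹ * x)) (ec z) := by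
    refine MDifferentiableAt.comp (g := (lc d : G → E)) (ec z) ?_
      ((contMDiff_mul_left (I := 𝓡 d) (n := ∞) (a := (ec z : G)⁻¹)).mdifferentiable (by simp) _)
    exact (contMDiffAt_lc (by rw [inv_mul_cancel]; exact one_mem_lcSource)).mdifferentiableAt
      (by simp)
  let T : E →L[ℝ] E := mfderiv (𝓡 d) 𝓘(ℝ, E) (fun x : G => lc d ((ec z)⁻¹ * x)) (ec z)
  have hT1 : ∀ p, p = (ec z : G) → MDifferentiableAt (𝓡 d) 𝓘(ℝ, E)
      (fun x : G => lc d ((ec z)⁻¹ * x)) p ∧ (mfderiv (𝓡 d) 𝓘(ℝ, E)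
      (fun x : G => lc d ((ec z)⁻¹ * x)) p : E →L[ℝ] E) = T := by
    rintro p rfl
    exact ⟨hT, rfl⟩
  have h1 : mcChart d G z = T ∘L (mfderiv 𝓘(ℝ, E) (𝓡 d) (ec : E → G) z : E →L[ℝ] E) := by
    have := mfderiv_comp z hT hec
    rw [mfderiv_eq_fderiv] at this
    rw [mcChart, MC, fderivWithin_univ]
    exact this
  have h2 : T ∘L (mfderiv (𝓡 d) (𝓡 d) (fun x => (ec z : G) * x) 1 : E →L[ℝ] E) =
      ContinuousLinearMap.id ℝ E := by
    obtain ⟨h3, h4⟩ := hT1 (ec z * 1) (mul_one _)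
    have := mfderiv_comp (1 : G) h3
      ((contMDiff_mul_left (I := 𝓡 d) (n := ∞) (a := (ec z : G))).mdifferentiable (by simp) 1)
    have h5 : (fun x : G => lc d ((ec z)⁻¹ * x)) ∘ (fun x => (ec z : G) * x) = lc d := by
      ext1 x; simp
    rw [h5] at this
    rw [← h4]
    exact this.symm.trans mfderiv_lc_one
  have h3 : (mfderiv 𝓘(ℝ, E) (𝓡 d) (ec : E → G) z : E →L[ℝ] E) ∘L
      ((mfderivWithin 𝓘(ℝ, E) (𝓡 d) (ec : E → G) (range (𝓡 d)) z).inverse : E →L[ℝ] E) =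
      ContinuousLinearMap.id ℝ E := by
    have h4 := isInvertible_mfderivWithin_extChartAt_symm (I := 𝓡 d) (x := (1 : G)) hz
    have h5 : (mfderivWithin 𝓘(ℝ, E) (𝓡 d) (ec : E → G) (range (𝓡 d)) z : E →L[ℝ] E) =
      mfderiv 𝓘(ℝ, E) (𝓡 d) (ec : E → G) z := by
      simp [mfderivWithin_univ]
    rw [← h5]
    exact h4.self_comp_inverse
  have key : ∀ M T A B C : E →L[ℝ] E, M = T ∘L A → T ∘L C = ContinuousLinearMap.id ℝ E →
      A ∘L B = ContinuousLinearMap.id ℝ E → M ∘L (B ∘L C) = ContinuousLinearMap.id ℝ E := by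
    rintro _ T A B C rfl hTC hAB
    rw [ContinuousLinearMap.comp_assoc, ← ContinuousLinearMap.comp_assoc A, hAB,
      ContinuousLinearMap.id_comp, hTC]
  exact key _ _ _ _ _ h1 h2 h3

theorem invField_comp_mcChart {z : E} (hz : z ∈ lcTarget d G) :
    invField G z ∘L mcChart d G z = ContinuousLinearMap.id ℝ E := by
  have h := congrArg (fun f : E →L[ℝ] E => (f : E →ₗ[ℝ] E)) (mcChart_comp_invField hz)
  have h2 := (LinearMap.comp_eq_id_comm ℝ E).1 h
  ext1 v
  exact LinearMap.congr_fun h2 v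

theorem inverse_mcChart {z : E} (hz : z ∈ lcTarget d G) : (mcChart d G z).inverse = invField G z :=
  ContinuousLinearMap.inverse_eq (mcChart_comp_invField hz) (invField_comp_mcChart hz)

theorem contDiffOn_invField : ContDiffOn ℝ ∞ (invField (d := d) G) (lcTarget d G) := by
  have h : ContDiffOn ℝ ∞ (fun z => (mcChart d G z).inverse) (lcTarget d G) := by
    intro z hz
    have hi : (mcChart d G z).IsInvertible := ⟨ContinuousLinearEquiv.equivOfInverse
      (mcChart d G z) (invField G z) (fun v => DFunLike.congr_fun (invField_comp_mcChart hz) v)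
      (fun v => DFunLike.congr_fun (mcChart_comp_invField hz) v), rfl⟩
    exact hi.contDiffAt_map_inverse.comp_contDiffWithinAt z (contDiffOn_mcChart z hz)
  exact h.congr fun z hz => (inverse_mcChart hz).symm

/-- Derivative of the relation between `mcChart` and its inverse `invField` at the unit, where both
are the identity. -/
theorem fderiv_invField_one (a v : E) : fderiv ℝ (invField (d := d) G) (lc d (1 : G)) a v =
    -fderiv ℝ (mcChart d G) (lc d (1 : G)) a v := by
  have ho := lc_mem (one_mem_lcSource (d := d) (G := G))
  have h1 := ((contDiffOn_mcChart (G := G)).contDiffAt (isOpen_lcTarget.mem_nhds ho)).differentiableAt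
    (by simp)
  have h2 := ((contDiffOn_invField (G := G)).contDiffAt
    (isOpen_lcTarget.mem_nhds ho)).differentiableAt (by simp)
  have h3 := (h1.hasFDerivAt.clm_comp h2.hasFDerivAt).congr_of_eventuallyEq
    (f₁ := fun _ => ContinuousLinearMap.id ℝ E) (by
      filter_upwards [isOpen_lcTarget.mem_nhds ho] with z hz
      exact (mcChart_comp_invField hz).symm)
  have h4 := h3.unique (hasFDerivAt_const _ _)
  have h5 := DFunLike.congr_fun (DFunLike.congr_fun h4 a) v
  have h6 : invField G (lc d (1 : G)) = ContinuousLinearMap.id ℝ E := by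
    have := mcChart_comp_invField ho
    rwa [mcChart_one, ContinuousLinearMap.id_comp] at this
  simp [mcChart_one, h6] at h5
  exact eq_neg_of_add_eq_zero_left h5

variable (G) in
/-- The Lie bracket of `𝔤`, in coordinates. -/
def lieBr (v w : E) : E :=
  Bracket.bracket (L := GroupLieAlgebra (𝓡 d) G) (M := GroupLieAlgebra (𝓡 d) G) v w

/-- The bracket of `𝔤` is the bracket of left-invariant vector fields at `1`. In the chart these
fields are given by `invField`, whose derivative at the unit is minus that of `mcChart`. -/
theorem lieBr_eq (v w : E) : lieBr G v w =
    (fderiv ℝ (mcChart d G) (lc d (1 : G)) w v - fderiv ℝ (mcChart d G) (lc d (1 : G)) v w : E) := by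
  have ho := lc_mem (one_mem_lcSource (d := d) (G := G))
  have hset : ((extChartAt (𝓡 d) (1 : G)).symm ⁻¹' univ ∩ range (𝓡 d)) = univ := by simp
  have h2 : ((mfderiv (𝓡 d) 𝓘(ℝ, E) (extChartAt (𝓡 d) (1 : G)) 1).inverse : E →L[ℝ] E) =
      ContinuousLinearMap.id ℝ E :=
    (congrArg ContinuousLinearMap.inverse (mfderiv_lc_one (d := d) (G := G))).trans
      ContinuousLinearMap.inverse_id
  -- Unfolded, the bracket is the inverse of the derivative of the chart at `1`, which is the
  -- identity, applied to a bracket of vector fields on the model space.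
  suffices hX : lieBracketWithin ℝ (fun z => invField G z v) (fun z => invField G z w)
      ((extChartAt (𝓡 d) (1 : G)).symm ⁻¹' univ ∩ range (𝓡 d)) (lc d (1 : G)) =
        fderiv ℝ (mcChart d G) (lc d (1 : G)) w v - fderiv ℝ (mcChart d G) (lc d (1 : G)) v w from
    (DFunLike.congr_fun h2 _).trans hX
  rw [hset, lieBracketWithin_univ]
  have h3 : ∀ u v : E, fderiv ℝ (fun z => invField G z v) (lc d (1 : G)) u =
      -fderiv ℝ (mcChart d G) (lc d (1 : G)) u v := by
    intro u v
    have h4 := ((contDiffOn_invField (G := G)).contDiffAt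
      (isOpen_lcTarget.mem_nhds ho)).differentiableAt (by simp)
    rw [← fderiv_invField_one, (h4.hasFDerivAt.clm_apply (hasFDerivAt_const v _)).fderiv]
    simp
  have h6 : invField G (lc d (1 : G)) = ContinuousLinearMap.id ℝ E := by
    have := mcChart_comp_invField ho
    rwa [mcChart_one, ContinuousLinearMap.id_comp] at this
  change fderiv ℝ (fun z => invField G z w) (lc d (1 : G)) (invField G (lc d (1 : G)) v) -
    fderiv ℝ (fun z => invField G z v) (lc d (1 : G)) (invField G (lc d (1 : G)) w) = _
  rw [h3, h3, h6]
  simp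
  abel

/-- The Maurer-Cartan equation. -/
theorem mc_equation {s : Set F} {h : F → G} {x : F} (hh : ContMDiffOn 𝓘(ℝ, F) (𝓡 d) ∞ h s)
    (hs : UniqueDiffOn ℝ s) (hx : x ∈ s) (hxi : x ∈ closure (interior s)) (a b : F) :
    fderivWithin ℝ (MC d s h) s x a b - fderivWithin ℝ (MC d s h) s x b a =
      -lieBr G (MC d s h x a) (MC d s h x b) := by
  -- Translation by `(h x)⁻¹` moves the base point to the unit, where `mcChart` is the identity.
  -- Near `x` the form is `mcChart (y z) ∘ dy`. Its derivative is a sum of the second derivative of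
  -- `y`, which is symmetric (at boundary points thanks to `hxi`), and of the derivative of
  -- `mcChart`, whose antisymmetrization is the bracket.
  set y : F → E := fun z => lc d ((h x)⁻¹ * h z) with hy
  have hx1 : (h x)⁻¹ * h x ∈ lcSource d G := by rw [inv_mul_cancel]; exact one_mem_lcSource
  have hyx : y x = lc d (1 : G) := by simp [hy]
  have hc : ∀ᶠ z in 𝓝[s] x, (h x)⁻¹ * h z ∈ lcSource d G :=
    (contMDiffWithinAt_mul_left (h x)⁻¹ (hh x hx)).continuousWithinAt
      (isOpen_lcSource.mem_nhds hx1)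
  have h1 : MC d s h =ᶠ[𝓝[s] x] fun z => (mcChart d G (y z)).comp (fderivWithin ℝ y s z) := by
    filter_upwards [hc, self_mem_nhdsWithin] with z hz hzs
    exact MC_eq_mcChart _ (hh z hzs) hz (hs z hzs)
  have h2 : ContDiffWithinAt ℝ ∞ y s x := contDiffWithinAt_lc_inv_mul (hh x hx)
  have h3 : DifferentiableWithinAt ℝ (fderivWithin ℝ y s) s x :=
    (h2.fderivWithin_right (m := ∞) hs (by simp) hx).differentiableWithinAt (by simp)
  have ho := lc_mem (one_mem_lcSource (d := d) (G := G))
  have h4 : HasFDerivAt (mcChart d G) (fderiv ℝ (mcChart d G) (lc d (1 : G))) (y x) := by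
    rw [hyx]
    exact (((contDiffOn_mcChart (G := G)).contDiffAt
      (isOpen_lcTarget.mem_nhds ho)).differentiableAt (by simp)).hasFDerivAt
  have h5 := (h2.differentiableWithinAt (by simp)).hasFDerivWithinAt
  have h6 := ((h4.comp_hasFDerivWithinAt x h5).clm_comp h3.hasFDerivWithinAt).congr_of_eventuallyEq
    h1 (h1.self_of_nhdsWithin hx)
  have hM : MC d s h x = fderivWithin ℝ y s x := rfl
  have hsym : IsSymmSndFDerivWithinAt ℝ y s x :=
    ContDiffWithinAt.isSymmSndFDerivWithinAt (n := ∞) h2 (by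
      rw [minSmoothness_of_isRCLikeNormedField]; exact WithTop.coe_le_coe.2 (le_top : (2 : ℕ∞) ≤ ⊤)) hs hxi hx
  rw [h6.fderivWithin (hs x hx), lieBr_eq, hM]
  have := hsym a b
  simp [hyx, mcChart_one, this]

end Bracket

end LieInt

namespace LieInt

/-! ### Flatness of Lie algebra valued forms and the Chevalley-Eilenberg differential -/

section PullForm

variable {U : CartSp} {k : ℕ} {𝔤 : Type} [LieRing 𝔤] [LieAlgebra ℝ 𝔤] [FiniteDimensional ℝ 𝔤]

/-- The forms obtained from multilinear forms on `𝔤` by means of a `𝔤`-valued `1`-form. -/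
def pullForm (η : U.Pt → Simp k → V k →ₗ[ℝ] 𝔤) :
    ExteriorAlgebra ℝ (Dual ℝ 𝔤) →ₐ[ℝ] Form U k where
  toFun a := fun u x => ExteriorAlgebra.map (η u x).dualMap a
  map_one' := by funext u x; simp
  map_mul' a b := by funext u x; simp
  map_zero' := by funext u x; simp
  map_add' a b := by funext u x; simp
  commutes' r := by
    funext u x
    exact AlgHom.commutes _ r

theorem pullForm_apply (η : U.Pt → Simp k → V k →ₗ[ℝ] 𝔤) (a : ExteriorAlgebra ℝ (Dual ℝ 𝔤))
    (u : U.Pt) (x : Simp k) : pullForm η a u x = ExteriorAlgebra.map (η u x).dualMap a := rfl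

theorem ι_eq_sum_dx (α : Dual ℝ (V k)) :
    ExteriorAlgebra.ι ℝ α = ∑ l, α (frame k l) • dx l := by
  have : α = ∑ l, α (frame k l) • (LinearMap.proj l : Dual ℝ (V k)) := by
    refine (Pi.basisFun ℝ (Fin k)).ext fun i => ?_
    simp [Pi.single_apply]
  conv_lhs => rw [this]
  simp [dx]

/-- The sum of `B l m dx_l ∧ dx_m`. -/
def quadForm (B : Fin k → Fin k → ℝ) : Alt k := ∑ l, ∑ m, B l m • (dx l * dx m)

/-- The products `dx l * dx m` are antisymmetric, so the symmetric part of `B` does not contribute.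
-/
theorem quadForm_eq_half (B : Fin k → Fin k → ℝ) :
    quadForm B = (1 / 2 : ℝ) • quadForm fun l m => B l m - B m l := by
  have h : quadForm (fun l m => B m l) = -quadForm B := by
    rw [quadForm, quadForm, Finset.sum_comm, ← Finset.sum_neg_distrib]
    refine Finset.sum_congr rfl fun m _ => ?_
    rw [← Finset.sum_neg_distrib]
    refine Finset.sum_congr rfl fun l _ => ?_
    rw [← smul_neg]
    congr 1
    exact eq_neg_of_add_eq_zero_left (ExteriorAlgebra.ι_add_mul_swap _ _)
  have h2 : (quadForm fun l m => B l m - B m l) = quadForm B - quadForm fun l m => B m l := by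
    simp [quadForm, sub_smul]
  rw [h2, h, sub_neg_eq_add, ← two_smul ℝ, smul_smul]
  norm_num

theorem evalAlt_one (v : V k) (α : Dual ℝ (V k)) :
    evalAlt ![v] (ExteriorAlgebra.ι ℝ α) = α v := by
  have h := evalAlt_ιMulti (n := 1) ![v] ![α]
  simpa [ExteriorAlgebra.ιMulti_apply] using h

theorem evalAlt_two (v w : V k) (α β : Dual ℝ (V k)) :
    evalAlt ![v, w] (ExteriorAlgebra.ι ℝ α * ExteriorAlgebra.ι ℝ β) = α v * β w - α w * β v := by
  have h := evalAlt_ιMulti (n := 2) ![v, w] ![α, β]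
  rw [Matrix.det_fin_two] at h
  simpa [ExteriorAlgebra.ιMulti_apply] using h

theorem evalAlt_quadForm (B : Fin k → Fin k → ℝ) (p q : Fin k) :
    evalAlt ![frame k p, frame k q] (quadForm B) = B p q - B q p := by
  simp only [quadForm, map_sum, map_smul, dx, evalAlt_two, smul_eq_mul]
  simp [mul_sub, Finset.sum_sub_distrib, Pi.single_apply]

theorem ceD_ι (φ : Dual ℝ 𝔤) : ceD 𝔤 (ExteriorAlgebra.ι ℝ φ) =
    (-(1 / 2) : ℝ) • ∑ i, ∑ j, φ ⁅finBasis ℝ 𝔤 i, finBasis ℝ 𝔤 j⁆ •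
      (ExteriorAlgebra.ι ℝ ((finBasis ℝ 𝔤).coord i) *
        ExteriorAlgebra.ι ℝ ((finBasis ℝ 𝔤).coord j)) := by
  have h : ∀ x : 𝔤, CliffordAlgebra.contractLeft (Q := (0 : QuadraticForm ℝ (Dual ℝ 𝔤)))
      (Dual.eval ℝ 𝔤 x) (ExteriorAlgebra.ι ℝ φ) = algebraMap ℝ _ (φ x) := fun x =>
    CliffordAlgebra.contractLeft_ι _ _ _
  simp only [ceD, LinearMap.smul_apply, LinearMap.sum_apply, LinearMap.comp_apply,
    LinearMap.mulLeft_apply]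
  congr 1
  refine Finset.sum_congr rfl fun i _ => Finset.sum_congr rfl fun j _ => ?_
  refine (congrArg _ (h _)).trans ?_
  rw [← Algebra.commutes, ← Algebra.smul_def]

theorem ceD_algebraMap (r : ℝ) : ceD 𝔤 (algebraMap ℝ _ r) = 0 := by
  have h : ∀ x : 𝔤, CliffordAlgebra.contractLeft (Q := (0 : QuadraticForm ℝ (Dual ℝ 𝔤)))
      (Dual.eval ℝ 𝔤 x) (algebraMap ℝ _ r) = 0 := fun x =>
    CliffordAlgebra.contractLeft_algebraMap _ _ _
  simp only [ceD, LinearMap.smul_apply, LinearMap.sum_apply, LinearMap.comp_apply,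
    LinearMap.mulLeft_apply]
  refine (congrArg _ (Finset.sum_eq_zero fun i _ => Finset.sum_eq_zero fun j _ => ?_)).trans
    (smul_zero _)
  exact (congrArg _ (h _)).trans (mul_zero _)

/-- Contraction is an antiderivation, and `ι φ` passes the two covectors of `ceD` without a sign. -/
theorem ceD_ι_mul (φ : Dual ℝ 𝔤) (a : ExteriorAlgebra ℝ (Dual ℝ 𝔤)) :
    ceD 𝔤 (ExteriorAlgebra.ι ℝ φ * a) =
      ceD 𝔤 (ExteriorAlgebra.ι ℝ φ) * a - ExteriorAlgebra.ι ℝ φ * ceD 𝔤 a := by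
  have h : ∀ x : 𝔤, CliffordAlgebra.contractLeft (Q := (0 : QuadraticForm ℝ (Dual ℝ 𝔤)))
      (Dual.eval ℝ 𝔤 x) (ExteriorAlgebra.ι ℝ φ * a) = φ x • a - ExteriorAlgebra.ι ℝ φ *
        CliffordAlgebra.contractLeft (Q := (0 : QuadraticForm ℝ (Dual ℝ 𝔤)))
          (Dual.eval ℝ 𝔤 x) a := fun x => CliffordAlgebra.contractLeft_ι_mul _ _ _
  have hswap : ∀ α β : Dual ℝ 𝔤, ExteriorAlgebra.ι ℝ α * ExteriorAlgebra.ι ℝ β =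
      -(ExteriorAlgebra.ι ℝ β * ExteriorAlgebra.ι ℝ α) := fun α β =>
    eq_neg_of_add_eq_zero_left (ExteriorAlgebra.ι_add_mul_swap _ _)
  rw [ceD_ι]
  simp only [ceD, LinearMap.smul_apply, LinearMap.sum_apply, LinearMap.comp_apply,
    LinearMap.mulLeft_apply]
  rw [smul_mul_assoc, mul_smul_comm, ← smul_sub, Finset.sum_mul, Finset.mul_sum,
    ← Finset.sum_sub_distrib]
  congr 1
  refine Finset.sum_congr rfl fun i _ => ?_
  rw [Finset.sum_mul, Finset.mul_sum, ← Finset.sum_sub_distrib]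
  refine Finset.sum_congr rfl fun j _ => ?_
  refine (congrArg _ (h _)).trans ?_
  rw [mul_sub, mul_smul_comm, smul_mul_assoc]
  congr 1
  simp only [← mul_assoc]
  congr 1
  rw [mul_assoc, hswap _ φ, mul_neg, ← mul_assoc, hswap _ φ, neg_mul, neg_neg]

theorem d_eq_quadForm {η : U.Pt → Simp k → V k →ₗ[ℝ] 𝔤} {u : U.Pt} {x : Simp k} {φ : Dual ℝ 𝔤}
    {W : V k →ₗ[ℝ] Dual ℝ (V k)}
    (h : Form.HasD (pullForm η (ExteriorAlgebra.ι ℝ φ)) u x (ExteriorAlgebra.ι ℝ ∘ₗ W)) :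
    Form.d (pullForm η (ExteriorAlgebra.ι ℝ φ)) u x =
      quadForm fun l m => W (frame k l) (frame k m) := by
  rw [Form.d, h.eq, quadForm]
  refine Finset.sum_congr rfl fun l _ => ?_
  rw [LinearMap.comp_apply, ι_eq_sum_dx, Finset.mul_sum]
  exact Finset.sum_congr rfl fun m _ => mul_smul_comm _ _ _

theorem pullForm_ceD_ι (η : U.Pt → Simp k → V k →ₗ[ℝ] 𝔤) (u : U.Pt) (x : Simp k) (φ : Dual ℝ 𝔤) :
    pullForm η (ceD 𝔤 (ExteriorAlgebra.ι ℝ φ)) u x =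
      (-(1 / 2) : ℝ) • quadForm fun l m => φ ⁅η u x (frame k l), η u x (frame k m)⁆ := by
  rw [pullForm_apply, ceD_ι, map_smul, quadForm]
  congr 1
  have hb : ∀ l, η u x (frame k l) = ∑ i, (finBasis ℝ 𝔤).coord i (η u x (frame k l)) •
      finBasis ℝ 𝔤 i := fun l => ((finBasis ℝ 𝔤).sum_repr _).symm
  have h1 : ∀ l m, φ ⁅η u x (frame k l), η u x (frame k m)⁆ =
      ∑ i, ∑ j, (finBasis ℝ 𝔤).coord i (η u x (frame k l)) *
        (finBasis ℝ 𝔤).coord j (η u x (frame k m)) *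
        φ ⁅finBasis ℝ 𝔤 i, finBasis ℝ 𝔤 j⁆ := by
    intro l m
    conv_lhs => rw [hb l, hb m]
    rw [sum_lie]
    simp only [lie_sum, smul_lie, lie_smul, map_sum, map_smul, smul_eq_mul]
    refine Finset.sum_congr rfl fun i _ => ?_
    refine Finset.sum_congr rfl fun j _ => by ring
  simp only [h1, Finset.sum_smul, map_sum, map_smul, map_mul, ExteriorAlgebra.map_apply_ι,
    ι_eq_sum_dx, Finset.sum_mul, Finset.mul_sum, Finset.smul_sum, smul_mul_smul_comm, smul_smul]
  conv_rhs => rw [Finset.sum_comm]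
  rw [Finset.sum_congr rfl fun i _ => Finset.sum_comm, Finset.sum_comm]
  refine Finset.sum_congr rfl fun l _ => ?_
  rw [Finset.sum_congr rfl fun i _ => Finset.sum_comm, Finset.sum_comm]
  refine Finset.sum_congr rfl fun m _ => ?_
  refine Finset.sum_congr rfl fun i _ => Finset.sum_congr rfl fun j _ => ?_
  congr 1
  simp only [LinearMap.dualMap_apply]
  ring

theorem pullForm_smooth {η : U.Pt → Simp k → V k →ₗ[ℝ] 𝔤}
    (hs : ∀ φ, Form.Smooth (pullForm η (ExteriorAlgebra.ι ℝ φ)))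
    (a : ExteriorAlgebra ℝ (Dual ℝ 𝔤)) : Form.Smooth (pullForm η a) := by
  induction a using ExteriorAlgebra.induction with
  | algebraMap r => rw [AlgHom.commutes]; exact Form.Smooth.const r
  | ι φ => exact hs φ
  | mul a b ha hb => rw [map_mul]; exact ha.mul hb
  | add a b ha hb => rw [map_add]; exact ha.add hb

/-- The derivative of a `𝔤`-valued form along the simplex is `W`. -/
def HasFormDeriv (η : U.Pt → Simp k → V k →ₗ[ℝ] 𝔤)
    (W : U.Pt → Simp k → V k →ₗ[ℝ] V k →ₗ[ℝ] 𝔤) : Prop :=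
  ∀ u x φ, Form.HasD (pullForm η (ExteriorAlgebra.ι ℝ φ)) u x
    (ExteriorAlgebra.ι ℝ ∘ₗ (W u x).compr₂ φ)

/-- Both differentials are antiderivations, so it suffices to compare them on covectors. There `d`
is the antisymmetrized derivative of `η`, and flatness identifies it with minus the bracket, as in
`ceD`. -/
theorem d_pullForm {η : U.Pt → Simp k → V k →ₗ[ℝ] 𝔤}
    {W : U.Pt → Simp k → V k →ₗ[ℝ] V k →ₗ[ℝ] 𝔤}
    (hs : ∀ φ, Form.Smooth (pullForm η (ExteriorAlgebra.ι ℝ φ)))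
    (hW : HasFormDeriv η W) (hflat : ∀ u x a b, W u x a b - W u x b a = -⁅η u x a, η u x b⁆)
    (a : ExteriorAlgebra ℝ (Dual ℝ 𝔤)) :
    Form.d (pullForm η a) = pullForm η (ceD 𝔤 a) := by
  have hι : ∀ φ, Form.d (pullForm η (ExteriorAlgebra.ι ℝ φ)) =
      pullForm η (ceD 𝔤 (ExteriorAlgebra.ι ℝ φ)) := by
    intro φ
    funext u x
    rw [d_eq_quadForm (hW u x φ), pullForm_ceD_ι, quadForm_eq_half]
    simp only [LinearMap.compr₂_apply, ← map_sub, hflat, map_neg]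
    simp [quadForm]
  induction a using CliffordAlgebra.left_induction with
  | algebraMap r =>
    have h1 : pullForm η (algebraMap ℝ (ExteriorAlgebra ℝ (Dual ℝ 𝔤)) r) = algebraMap ℝ _ r :=
      AlgHom.commutes _ r
    have h2 : pullForm η (ceD 𝔤 (algebraMap ℝ (ExteriorAlgebra ℝ (Dual ℝ 𝔤)) r)) = 0 := by
      rw [ceD_algebraMap, map_zero]
    exact (congrArg Form.d h1).trans ((Form.d_const r).trans h2.symm)
  | add a b ha hb =>
    rw [map_add, Form.d_add (pullForm_smooth hs a) (pullForm_smooth hs b), ha, hb, map_add,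
      map_add]
  | ι_mul a φ ha =>
    change Form.d (pullForm η (ExteriorAlgebra.ι ℝ φ * a)) =
      pullForm η (ceD 𝔤 (ExteriorAlgebra.ι ℝ φ * a))
    have hinv : Form.inv (pullForm η (ExteriorAlgebra.ι ℝ φ)) =
        -pullForm η (ExteriorAlgebra.ι ℝ φ) := by
      funext u x
      change CliffordAlgebra.involute (ExteriorAlgebra.map (η u x).dualMap (ExteriorAlgebra.ι ℝ φ)) =
        -ExteriorAlgebra.map (η u x).dualMap (ExteriorAlgebra.ι ℝ φ)
      rw [ExteriorAlgebra.map_apply_ι]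
      exact CliffordAlgebra.involute_ι _
    rw [map_mul, Form.d_mul (hs φ) (pullForm_smooth hs a), hι, ha, hinv, ceD_ι_mul, map_sub,
      map_mul, map_mul, neg_mul, sub_eq_add_neg]

/-- The converse of `d_pullForm`: the coordinate covectors, evaluated on pairs of frame vectors,
recover flatness, and bilinearity extends it to all vectors. -/
theorem flat_of_d_pullForm {η : U.Pt → Simp k → V k →ₗ[ℝ] 𝔤}
    {W : U.Pt → Simp k → V k →ₗ[ℝ] V k →ₗ[ℝ] 𝔤} (hW : HasFormDeriv η W)
    (hd : ∀ φ, Form.d (pullForm η (ExteriorAlgebra.ι ℝ φ)) =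
      pullForm η (ceD 𝔤 (ExteriorAlgebra.ι ℝ φ))) (u : U.Pt) (x : Simp k) (a b : V k) :
    W u x a b - W u x b a = -⁅η u x a, η u x b⁆ := by
  have h : ∀ p q, W u x (frame k p) (frame k q) - W u x (frame k q) (frame k p) =
      -⁅η u x (frame k p), η u x (frame k q)⁆ := by
    intro p q
    refine (finBasis ℝ 𝔤).ext_elem fun i => ?_
    have h1 := congrFun (congrFun (hd ((finBasis ℝ 𝔤).coord i)) u) x
    rw [d_eq_quadForm (hW u x _), pullForm_ceD_ι] at h1
    have h2 := congrArg (evalAlt ![frame k p, frame k q]) h1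
    rw [map_smul, evalAlt_quadForm, evalAlt_quadForm, ← lie_skew (η u x (frame k q))] at h2
    simp only [LinearMap.compr₂_apply, map_neg, smul_eq_mul, Basis.coord_apply] at h2
    simp only [map_sub, map_neg, Finsupp.sub_apply, Finsupp.neg_apply]
    rw [h2]
    ring
  let B : V k →ₗ[ℝ] V k →ₗ[ℝ] 𝔤 := LinearMap.mk₂ ℝ
    (fun a b => W u x a b - W u x b a + ⁅η u x a, η u x b⁆)
    (fun a a' b => by simp only [map_add, LinearMap.add_apply, add_lie]; abel)
    (fun c a b => by simp only [map_smul, LinearMap.smul_apply, smul_lie, smul_add, smul_sub])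
    (fun a b b' => by simp only [map_add, LinearMap.add_apply, lie_add]; abel)
    (fun c a b => by simp only [map_smul, LinearMap.smul_apply, lie_smul, smul_add, smul_sub])
  have h2 : B = 0 := by
    refine LinearMap.pi_ext' fun p => LinearMap.ext_ring (LinearMap.pi_ext' fun q =>
      LinearMap.ext_ring ?_)
    exact add_eq_zero_iff_eq_neg.2 (h p q)
  exact add_eq_zero_iff_eq_neg.1 (LinearMap.congr_fun (LinearMap.congr_fun h2 a) b)

end PullForm

end LieInt

namespace LieInt

/-! ### Forms on the simplex from smooth maps to the group -/

section GroupForms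

variable {U : CartSp} {k : ℕ} {d : ℕ} {G : Type*}
  [TopologicalSpace G] [ChartedSpace (EuclideanSpace ℝ (Fin d)) G] [Group G]

local notation "E" => EuclideanSpace ℝ (Fin d)
local notation "LG" => GroupLieAlgebra (𝓡 d) G

variable (G) in
/-- A linear map to the model space, as a map to the Lie algebra. -/
def toLie {F : Type} [AddCommGroup F] [Module ℝ F] (f : F →ₗ[ℝ] E) : F →ₗ[ℝ] LG where
  toFun v := f v
  map_add' v w := map_add f v w
  map_smul' c v := map_smul f c v

variable (G) in
/-- A covector on the Lie algebra, as a covector on the model space. -/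
def ofLie (φ : Dual ℝ LG) : E →L[ℝ] ℝ := LinearMap.toContinuousLinearMap
  { toFun := fun v => φ v
    map_add' := fun v w => φ.map_add v w
    map_smul' := fun c v => φ.map_smul c v }

theorem convex_interior_Simp (x : V k) (hx : x ∈ Simp k) : x ∈ closure (interior (Simp k)) := by
  have hne : (interior (Simp k)).Nonempty := by
    refine ⟨fun _ => 1 / (k + 2 : ℝ), ?_⟩
    rw [mem_interior]
    refine ⟨{x | (∀ i, 0 < x i) ∧ ∑ i, x i < 1}, fun x hx => ⟨fun i => (hx.1 i).le, hx.2.le⟩, ?_, ?_⟩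
    · have h1 : IsOpen {x : V k | ∀ i, 0 < x i} := by
        have : {x : V k | ∀ i, 0 < x i} = ⋂ i, {x : V k | 0 < x i} := by ext; simp
        rw [this]
        exact isOpen_iInter_of_finite fun i => isOpen_lt continuous_const (continuous_apply i)
      have h2 : IsOpen {x : V k | ∑ i, x i < 1} :=
        isOpen_lt (continuous_finsetSum _ fun i _ => continuous_apply i) continuous_const
      exact h1.inter h2
    · refine ⟨fun i => by positivity, ?_⟩
      simp
      rw [← div_eq_mul_inv, div_lt_one (by positivity)]
      linarith
  rw [(convex_Simp k).closure_interior_eq_closure_of_nonempty_interior hne]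
  exact subset_closure hx

/-- The constant family of forms given by a form on the simplex. -/
def constForm (U : CartSp) (G : Type*) [TopologicalSpace G] [ChartedSpace E G] [Group G]
    (w : V k → V k →L[ℝ] E) : U.Pt → Simp k → V k →ₗ[ℝ] LG :=
  fun _ x => toLie G (w x.1 : V k →ₗ[ℝ] E)

variable [LieGroup (𝓡 d) ∞ G]

theorem coef_constForm (w : V k → V k →L[ℝ] E) (φ : Dual ℝ LG) (ψ : Alt k →ₗ[ℝ] ℝ) (u : U.Pt)
    {x : V k} (hx : x ∈ Simp k) :
    Form.coef ψ (pullForm (constForm U G w) (ExteriorAlgebra.ι ℝ φ)) u x =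
      ∑ m, ofLie G φ (w x (frame k m)) * ψ (dx m) := by
  rw [Form.coef_of_mem _ _ _ hx, pullForm_apply, ExteriorAlgebra.map_apply_ι, ι_eq_sum_dx, map_sum]
  exact Finset.sum_congr rfl fun m _ => by rw [map_smul, smul_eq_mul]; rfl

theorem smooth_constForm {w : V k → V k →L[ℝ] E} (hw : ContDiffOn ℝ ∞ w (Simp k)) (φ : Dual ℝ LG) :
    Form.Smooth (pullForm (constForm U G w) (ExteriorAlgebra.ι ℝ φ)) := by
  intro S
  have h1 : ContDiffOn ℝ ∞ (fun p : U.Pt × V k => w p.2) (univ ×ˢ Simp k) :=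
    hw.comp contDiff_snd.contDiffOn fun p hp => hp.2
  refine (ContDiffOn.sum (s := Finset.univ) fun m _ => ContDiffOn.mul
    ((ofLie G φ).contDiff.comp_contDiffOn (h1.clm_apply contDiffOn_const)) contDiffOn_const).congr
    fun p hp => coef_constForm w φ _ p.1 hp.2

/-- The derivative of a one-form. -/
def formDeriv (G : Type*) [TopologicalSpace G] [ChartedSpace E G] [Group G]
    (w : V k → V k →L[ℝ] E) (x : V k) : V k →ₗ[ℝ] V k →ₗ[ℝ] LG where
  toFun a := toLie G (fderivWithin ℝ w (Simp k) x a : V k →ₗ[ℝ] E)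
  map_add' a b := by ext v : 1; simp [toLie]; rfl
  map_smul' c a := by ext v : 1; simp [toLie]; rfl

theorem hasFormDeriv_constForm {w : V k → V k →L[ℝ] E} (hw : ContDiffOn ℝ ∞ w (Simp k)) :
    HasFormDeriv (𝔤 := LG) (constForm U G w) (fun _ x => formDeriv G w x) := by
  intro u x φ ψ
  have h1 := (hw.differentiableOn (by simp) x.1 x.2).hasFDerivWithinAt
  have h2 : HasFDerivWithinAt (fun y => ∑ m, ofLie G φ (w y (frame k m)) * ψ (dx m)) _
      (Simp k) x.1 := HasFDerivWithinAt.fun_sum (u := Finset.univ) fun m _ =>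
    ((ofLie G φ).hasFDerivAt.comp_hasFDerivWithinAt x.1
      (h1.clm_apply (hasFDerivWithinAt_const (frame k m) x.1 (Simp k)))).mul_const (ψ (dx m))
  refine (h2.congr (fun y hy => coef_constForm w φ ψ u hy)
    (coef_constForm w φ ψ u x.2)).congr_fderiv ?_
  ext v
  simp only [LinearMap.coe_toContinuousLinearMap', LinearMap.comp_apply, ι_eq_sum_dx]
  simp
  exact Finset.sum_congr rfl fun m _ => mul_comm _ _

variable (U) in
/-- The form given by the pullback of the left-invariant form `a` along `h`. -/
def mcForm (h : V k → G) (a : ExteriorAlgebra ℝ (Dual ℝ LG)) : Form U k :=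
  pullForm (constForm U G (MC d (Simp k) h)) a

variable {h : V k → G} (hh : ContMDiffOn 𝓘(ℝ, V k) (𝓡 d) ∞ h (Simp k))
include hh

theorem smooth_mcForm (a : ExteriorAlgebra ℝ (Dual ℝ LG)) : Form.Smooth (mcForm U h a) :=
  pullForm_smooth (smooth_constForm (contDiffOn_MC hh (Simp_uniqueDiffOn k))) a

/-- The Maurer-Cartan equation is the flatness required by `d_pullForm`. It also holds on the
boundary, as each point of the simplex is a limit of interior points. -/
theorem d_mcForm (a : ExteriorAlgebra ℝ (Dual ℝ LG)) :
    Form.d (mcForm U h a) = mcForm U h (ceD LG a) :=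
  d_pullForm (smooth_constForm (contDiffOn_MC hh (Simp_uniqueDiffOn k)))
    (hasFormDeriv_constForm (contDiffOn_MC hh (Simp_uniqueDiffOn k)))
    (fun _ x a b => mc_equation hh (Simp_uniqueDiffOn k) x.2 (convex_interior_Simp x.1 x.2) a b) a

end GroupForms

/-! ### Cells of `exp_Δ(𝔤)` as flat forms -/

section FormsOfHom

variable {U : CartSp} {k : ℕ} {d : ℕ} {G : Type*}
  [TopologicalSpace G] [ChartedSpace (EuclideanSpace ℝ (Fin d)) G] [Group G]
  [LieGroup (𝓡 d) ∞ G]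

local notation "E" => EuclideanSpace ℝ (Fin d)
local notation "LG" => GroupLieAlgebra (𝓡 d) G

/-- A morphism of dg-algebras on `Λ 𝔤*` is determined by the images of covectors. For degree reasons
these are one-forms, which assemble to a `𝔤`-valued form, and compatibility with the differentials
is flatness. -/
theorem exists_flat_form (Φ : DGAlg.Hom (CE LG) (Omega U k)) (u : U.Pt) :
    ∃ w : V k → V k →L[ℝ] E, ContDiffOn ℝ ∞ w (Simp k) ∧
      (∀ x ∈ Simp k, ∀ a b, fderivWithin ℝ w (Simp k) x a b - fderivWithin ℝ w (Simp k) x b a =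
        -lieBr G (w x a) (w x b)) ∧
      ∀ (a : ExteriorAlgebra ℝ (Dual ℝ LG)) (x : Simp k),
        (Φ.toAlgHom a).1 u x = ExteriorAlgebra.map (toLie G (w x.1 : V k →ₗ[ℝ] E)).dualMap a := by
  let b := finBasis ℝ LG
  let b' : Fin (finrank ℝ LG) → E := fun i => b i
  let α : Fin (finrank ℝ LG) → Form U k := fun i =>
    (Φ.toAlgHom (ExteriorAlgebra.ι ℝ (b.coord i) : ExteriorAlgebra ℝ (Dual ℝ LG))).1
  have hα : ∀ i, Form.Smooth (α i) := fun i => Form.siForms_le _ _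
    (Φ.toAlgHom (ExteriorAlgebra.ι ℝ (b.coord i) : ExteriorAlgebra ℝ (Dual ℝ LG))).2
  let w : V k → V k →L[ℝ] E := fun x => ∑ i, ∑ m, Form.coef (evalAlt ![frame k m]) (α i) u x •
    (ContinuousLinearMap.proj m : V k →L[ℝ] ℝ).smulRight (b' i)
  have hw : ContDiffOn ℝ ∞ w (Simp k) := ContDiffOn.sum fun i _ => ContDiffOn.sum fun m _ =>
    ((hα i).coef_right _ u).smul contDiffOn_const
  -- Pullback along the constant map with value `u` freezes the parameter, so the result is a
  -- constant family of forms.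
  let Φ' : DGAlg.Hom (CE LG) (Omega U k) := Φ.comp (Omega.pull (U := U) (W := U)
    ⟨fun _ => u, contDiff_const⟩ (𝟙 _))
  have hΦ' : ∀ (a : ExteriorAlgebra ℝ (Dual ℝ LG)) u' x, (Φ'.toAlgHom a).1 u' x =
      (Φ.toAlgHom a).1 u x := fun a u' x => pull_param_apply (fun _ => u) _ u' x
  have hval : ∀ a : ExteriorAlgebra ℝ (Dual ℝ LG),
      (Φ'.toAlgHom a).1 = pullForm (constForm U G w) a := by
    intro a
    let f : ExteriorAlgebra ℝ (Dual ℝ LG) →ₐ[ℝ] Form U k := (Form.siForms U k).val.comp Φ'.toAlgHom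
    suffices f = pullForm (constForm U G w) from AlgHom.congr_fun this a
    refine ExteriorAlgebra.hom_ext (LinearMap.ext fun φ => ?_)
    funext u' x
    -- Degree preservation turns a covector of `𝔤` into a covector `β φ` at each point.
    have hdeg : ∀ φ : Dual ℝ LG, ∃ β, (Φ.toAlgHom
        (ExteriorAlgebra.ι ℝ φ : ExteriorAlgebra ℝ (Dual ℝ LG))).1 u x = ExteriorAlgebra.ι ℝ β := by
      intro φ
      have e1 : ⋀[ℝ]^1 (Dual ℝ LG) = LinearMap.range (ExteriorAlgebra.ι ℝ) := pow_one _
      have e2 : ⋀[ℝ]^1 (Dual ℝ (V k)) = LinearMap.range (ExteriorAlgebra.ι ℝ) := pow_one _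
      have h0 : ExteriorAlgebra.ι ℝ φ ∈ ⋀[ℝ]^1 (Dual ℝ LG) := by rw [e1]; exact ⟨φ, rfl⟩
      have h1 : (Φ.toAlgHom (ExteriorAlgebra.ι ℝ φ : ExteriorAlgebra ℝ (Dual ℝ LG))).1 u x ∈
        ⋀[ℝ]^1 (Dual ℝ (V k)) := Φ.map_deg 1 _ h0 u x
      rw [e2] at h1
      obtain ⟨β, hβ⟩ := h1
      exact ⟨β, hβ.symm⟩
    choose β hβ using hdeg
    have hlin : ∀ φ, β φ = ∑ i, φ (b i) • β (b.coord i) := by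
      intro φ
      have h1 : φ = ∑ i, φ (b i) • b.coord i := by
        refine b.ext fun j => ?_
        simp
      have h2 : ExteriorAlgebra.ι ℝ (β φ) = ExteriorAlgebra.ι ℝ (∑ i, φ (b i) • β (b.coord i)) := by
        let T : Dual ℝ LG →ₗ[ℝ] Alt k :=
          { toFun := fun φ => (Φ.toAlgHom
              (ExteriorAlgebra.ι ℝ φ : ExteriorAlgebra ℝ (Dual ℝ LG))).1 u x
            map_add' := fun φ φ' => by rw [map_add]; exact congrFun (congrFun (congrArg
              Subtype.val (map_add Φ.toAlgHom (ExteriorAlgebra.ι ℝ φ) (ExteriorAlgebra.ι ℝ φ'))) u) x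
            map_smul' := fun c φ => by rw [map_smul]; exact congrFun (congrFun (congrArg
              Subtype.val (map_smul Φ.toAlgHom c (ExteriorAlgebra.ι ℝ φ))) u) x }
        have hT : ∀ φ, T φ = ExteriorAlgebra.ι ℝ (β φ) := hβ
        rw [← hT]
        refine (congrArg T h1).trans ?_
        rw [map_sum, map_sum]
        exact Finset.sum_congr rfl fun i _ => by rw [map_smul, map_smul, hT]
      exact ExteriorAlgebra.ι_leftInverse.injective h2
    change (Φ'.toAlgHom (ExteriorAlgebra.ι ℝ φ : ExteriorAlgebra ℝ (Dual ℝ LG))).1 u' x =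
      ExteriorAlgebra.map _ (ExteriorAlgebra.ι ℝ φ)
    rw [hΦ', hβ, ExteriorAlgebra.map_apply_ι, hlin]
    congr 1
    refine LinearMap.ext fun v => ?_
    have h3 : w x.1 v = ∑ i, β (b.coord i) v • b' i := by
      simp only [w, Form.coef_of_mem _ _ _ x.2, sum_apply,
        smul_apply, ContinuousLinearMap.smulRight_apply, ContinuousLinearMap.proj_apply, smul_smul,
        ← Finset.sum_smul]
      refine Finset.sum_congr rfl fun i _ => ?_
      congr 1
      conv_rhs => rw [← LinearMap.sum_single_apply (fun _ : Fin k => ℝ) v, map_sum]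
      refine Finset.sum_congr rfl fun m _ => ?_
      rw [show α i u x = ExteriorAlgebra.ι ℝ (β (b.coord i)) from hβ _, evalAlt_one]
      rw [show (Pi.single m (v m) : V k) = v m • frame k m by ext j; simp [Pi.single_apply], map_smul]
      exact mul_comm _ _
    have h4 : toLie G (w x.1 : V k →ₗ[ℝ] E) v = ∑ i, β (b.coord i) v • b i := h3
    refine Eq.trans ?_ (congrArg φ h4).symm
    rw [map_sum, LinearMap.sum_apply]
    refine Finset.sum_congr rfl fun i _ => ?_
    rw [map_smul, LinearMap.smul_apply]
    exact mul_comm _ _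
  refine ⟨w, hw, fun x hx a c => ?_, fun a x => ?_⟩
  · refine flat_of_d_pullForm (hasFormDeriv_constForm (U := U) (G := G) hw) (fun φ => ?_) u ⟨x, hx⟩ a c
    rw [← hval, ← hval]
    exact (congrArg Subtype.val (Φ'.map_d (ExteriorAlgebra.ι ℝ φ : ExteriorAlgebra ℝ (Dual ℝ LG)))).symm
  · rw [← hΦ' a u, hval]
    rfl

end FormsOfHom

end LieInt

namespace LieInt

open MeasureTheory

theorem map_dualMap_comp {W W' W'' : Type} [AddCommGroup W] [Module ℝ W] [AddCommGroup W']
    [Module ℝ W'] [AddCommGroup W''] [Module ℝ W''] (f : W →ₗ[ℝ] W') (g : W' →ₗ[ℝ] W'')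
    (a : ExteriorAlgebra ℝ (Dual ℝ W'')) : ExteriorAlgebra.map (g ∘ₗ f).dualMap a =
      ExteriorAlgebra.map f.dualMap (ExteriorAlgebra.map g.dualMap a) := by
  rw [← AlgHom.comp_apply, ExteriorAlgebra.map_comp_map, LinearMap.dualMap_comp_dualMap]

/-! ### Integrals of left-invariant forms over smooth simplices -/

section SimplexIntegrals

variable {k j n : ℕ} {d : ℕ} {G : Type*}
  [TopologicalSpace G] [ChartedSpace (EuclideanSpace ℝ (Fin d)) G] [Group G]

local notation "E" => EuclideanSpace ℝ (Fin d)
local notation "LG" => GroupLieAlgebra (𝓡 d) G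

/-- The integral over the simplex of the pullback along `h` of a left-invariant form. -/
def sInt (m : ExteriorAlgebra ℝ (Dual ℝ LG)) (h : V n → G) : ℝ :=
  ∫ x in Simp n, evalAlt (fun i => toLie G (MC d (Simp n) h x : V n →ₗ[ℝ] E) (frame n i)) m

/-- The smooth simplices of `G`. -/
def SSimp (d : ℕ) {G : Type*} [TopologicalSpace G] [ChartedSpace (EuclideanSpace ℝ (Fin d)) G]
    (h : V k → G) : Prop := ContMDiffOn 𝓘(ℝ, V k) (𝓡 d) ∞ h (Simp k)

theorem sInt_congr {m : ExteriorAlgebra ℝ (Dual ℝ LG)} {h h' : V n → G}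
    (hh : EqOn h h' (Simp n)) : sInt m h = sInt m h' := by
  refine setIntegral_congr_fun (measurableSet_Simp _) fun x hx => ?_
  have : MC d (Simp n) h x = MC d (Simp n) h' x :=
    MC_congr (Filter.eventuallyEq_of_mem self_mem_nhdsWithin hh) (hh hx)
  simp only [this]

theorem sInt_mul_left {m : ExteriorAlgebra ℝ (Dual ℝ LG)} (g : G) (h : V n → G) :
    sInt m (fun x => g * h x) = sInt m h := by
  simp only [sInt, MC_mul_left]

theorem SSimp.comp_affMap {h : V j → G} (hh : SSimp d h) (P : AffMap k j) :
    SSimp d fun x => h (P.fn x) :=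
  ContMDiffOn.comp (g := h) hh P.contDiff_fn.contMDiff.contMDiffOn fun _ hx => P.fn_mem hx

variable [LieGroup (𝓡 d) ∞ G]

theorem SSimp.mul {h h' : V k → G} (hh : SSimp d h) (hh' : SSimp d h') :
    SSimp d fun x => h x * h' x := ContMDiffOn.mul hh hh'

theorem SSimp.inv {h : V k → G} (hh : SSimp d h) : SSimp d fun x => (h x)⁻¹ := ContMDiffOn.inv hh

theorem MC_comp_affMap {h : V j → G} (hh : SSimp d h) (P : AffMap k j) {x : V k}
    (hx : x ∈ Simp k) : MC d (Simp k) (fun x => h (P.fn x)) x =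
      (MC d (Simp j) h (P.fn x)).comp (LinearMap.toContinuousLinearMap P.lin) := by
  rw [MC_comp_smooth (t := Simp j) (h := h) (f := P.fn)
    (P.hasFDerivAt_fn x).differentiableAt.differentiableWithinAt
    (fun _ hx => P.fn_mem hx) (hh _ (P.fn_mem hx)) (Simp_uniqueDiffOn k x hx),
    (P.hasFDerivAt_fn x).hasFDerivWithinAt.fderivWithin (Simp_uniqueDiffOn k x hx)]

theorem mcForm_comp_affMap {U : CartSp} {h : V j → G} (hh : SSimp d h) (P : AffMap k j)
    (m : ExteriorAlgebra ℝ (Dual ℝ LG)) :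
    mcForm U (fun x => h (P.fn x)) m = Form.pull id P (mcForm U h m) := by
  funext u x
  have : toLie G (MC d (Simp k) (fun x => h (P.fn x)) x.1 : V k →ₗ[ℝ] E) =
      LinearMap.comp (toLie G (MC d (Simp j) h (P.fn x.1) : V j →ₗ[ℝ] E)) P.lin :=
    LinearMap.ext fun v => DFunLike.congr_fun (MC_comp_affMap hh P x.2) v
  change ExteriorAlgebra.map
      (toLie G (MC d (Simp k) (fun x => h (P.fn x)) x.1 : V k →ₗ[ℝ] E)).dualMap m =
    ExteriorAlgebra.map P.lin.dualMap (ExteriorAlgebra.map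
      (toLie G (MC d (Simp j) h (P.fn x.1) : V j →ₗ[ℝ] E)).dualMap m)
  rw [this]
  exact map_dualMap_comp _ _ m

theorem coef_mcForm {U : CartSp} (h : V n → G) (m : ExteriorAlgebra ℝ (Dual ℝ LG)) (u : U.Pt)
    {x : V n} (hx : x ∈ Simp n) : Form.coef (evalAlt (frame n)) (mcForm U h m) u x =
      evalAlt (fun i => toLie G (MC d (Simp n) h x : V n →ₗ[ℝ] E) (frame n i)) m := by
  rw [Form.coef_of_mem _ _ _ hx]
  exact evalAlt_map _ _ _

theorem sInt_eq {U : CartSp} (h : V n → G) (m : ExteriorAlgebra ℝ (Dual ℝ LG)) (u : U.Pt) :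
    sInt m h = ∫ x in Simp n, Form.coef (evalAlt (frame n)) (mcForm U h m) u x :=
  setIntegral_congr_fun (measurableSet_Simp _) fun _ hx => (coef_mcForm h m u hx).symm

/-- The integrals of a closed left-invariant form over the boundary of a simplex add up to zero. -/
theorem sum_sInt_faces {m : ExteriorAlgebra ℝ (Dual ℝ LG)} (hm : ceD LG m = 0) {h : V (n + 1) → G}
    (hh : SSimp d h) : ∑ i : Fin (n + 2), (-1 : ℝ) ^ (i : ℕ) *
      sInt m (fun x => h ((AffMap.ofVertices i.succAbove).fn x)) = 0 := by
  let U : CartSp := ⟨0⟩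
  have h1 := stokes_Simp (smooth_mcForm (U := U) hh m) (0 : U.Pt)
  rw [d_mcForm hh, hm] at h1
  have h2 : ∀ i : Fin (n + 2), sInt m (fun x => h ((AffMap.ofVertices i.succAbove).fn x)) =
      ∫ x in Simp n, Form.coef (evalAlt (frame n))
        (Form.pull id (AffMap.ofVertices i.succAbove) (mcForm U h m)) 0 x := by
    intro i
    rw [sInt_eq _ m (0 : U.Pt), mcForm_comp_affMap hh]
  simp only [h2]
  rw [← h1]
  refine setIntegral_eq_zero_of_forall_eq_zero fun x hx => ?_
  rw [coef_mcForm _ _ _ hx, map_zero]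

/-- The form factors through the linear part of a vertex map that is not injective, so it is
evaluated on linearly dependent vectors. -/
theorem sInt_degenerate {m : ExteriorAlgebra ℝ (Dual ℝ LG)} {h : V j → G} (hh : SSimp d h)
    {θ : Fin (n + 1) → Fin (j + 1)} (hθ : ¬ Function.Injective θ) :
    sInt m (fun x => h ((AffMap.ofVertices (j := j) θ).fn x)) = 0 := by
  refine setIntegral_eq_zero_of_forall_eq_zero fun x hx => evalAlt_eq_zero ?_ _
  rw [MC_comp_affMap hh _ hx]
  intro hli
  refine not_injective_frame (j := j) hθ (LinearIndependent.of_comp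
    (toLie G (MC d (Simp j) h ((AffMap.ofVertices θ).fn x) : V j →ₗ[ℝ] E)) hli)

end SimplexIntegrals

/-! ### Uniqueness of maps with a given Maurer-Cartan form -/

section Uniqueness

variable {F : Type} [NormedAddCommGroup F] [NormedSpace ℝ F] {d : ℕ} {G : Type*}
  [TopologicalSpace G] [ChartedSpace (EuclideanSpace ℝ (Fin d)) G] [Group G] [LieGroup (𝓡 d) ∞ G]
  {s : Set F} {h h' : F → G}

local notation "E" => EuclideanSpace ℝ (Fin d)

/-- In the chart the translated quotient is `Q` applied to the two translated maps. `Q` is constant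
on the diagonal, so its derivative annihilates the pair of equal derivatives of the two maps. -/
theorem MC_div_eq_zero {x : F} (hh : ContMDiffWithinAt 𝓘(ℝ, F) (𝓡 d) ∞ h s x)
    (hh' : ContMDiffWithinAt 𝓘(ℝ, F) (𝓡 d) ∞ h' s x) (hs : UniqueDiffWithinAt ℝ s x)
    (hxs : x ∈ s) (he : MC d s h x = MC d s h' x) : MC d s (fun z => h z * (h' z)⁻¹) x = 0 := by
  have hy := (contDiffWithinAt_lc_inv_mul hh).differentiableWithinAt (by simp)
  have hy' := (contDiffWithinAt_lc_inv_mul hh').differentiableWithinAt (by simp)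
  have ho := lc_mem (one_mem_lcSource (d := d) (G := G))
  let c := h' x
  let Q : E × E → E := fun p => lc d (c * (ec p.1 * (ec p.2)⁻¹) * c⁻¹ : G)
  let o : E := lc d (1 : G)
  have hec : ∀ f : E × E → E, ContDiff ℝ ∞ f → f (o, o) = o →
      ContMDiffAt 𝓘(ℝ, E × E) (𝓡 d) ∞ (fun p => (ec (f p) : G)) (o, o) := fun f hf hfo =>
    ContMDiffAt.comp (f := f) (o, o) (hfo.symm ▸ contMDiffAt_ec ho) hf.contMDiff.contMDiffAt
  have hQ : DifferentiableAt ℝ Q (o, o) := by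
    have h1 : ContMDiffAt 𝓘(ℝ, E × E) (𝓡 d) ∞
        (fun p : E × E => (c * (ec p.1 * (ec p.2)⁻¹) * c⁻¹ : G)) (o, o) :=
      (contMDiffAt_const.mul ((hec _ contDiff_fst rfl).mul (hec _ contDiff_snd rfl).inv)).mul
        contMDiffAt_const
    have h2 := contDiffWithinAt_lc_comp (s := univ) h1.contMDiffWithinAt
      (by simp [o, ec_lc_one, one_mem_lcSource])
    exact h2.contDiffAt Filter.univ_mem |>.differentiableAt (by simp)
  have hQ0 : ∀ v : E, fderiv ℝ Q (o, o) (v, v) = 0 := by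
    intro v
    have h1 : HasFDerivAt (fun z : E => Q (z, z)) _ o :=
      HasFDerivAt.comp (g := Q) (f := fun z : E => (z, z)) o hQ.hasFDerivAt
        ((hasFDerivAt_id o).prodMk (hasFDerivAt_id o))
    have h2 : (fun z : E => Q (z, z)) = fun _ => o := by
      funext z
      simp [Q, o]
    rw [h2] at h1
    have := DFunLike.congr_fun (h1.unique (hasFDerivAt_const o o)) v
    simpa using this
  have heq : (fun z => lc d ((h x * (h' x)⁻¹)⁻¹ * (h z * (h' z)⁻¹))) =ᶠ[𝓝[s] x]
      fun z => Q (lc d ((h x)⁻¹ * h z), lc d ((h' x)⁻¹ * h' z)) := by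
    have hev : ∀ f : F → G, ContMDiffWithinAt 𝓘(ℝ, F) (𝓡 d) ∞ f s x →
        ∀ᶠ z in 𝓝[s] x, (f x)⁻¹ * f z ∈ lcSource d G := fun f hf =>
      (contMDiffWithinAt_mul_left (f x)⁻¹ hf).continuousWithinAt
        (isOpen_lcSource.mem_nhds (by rw [inv_mul_cancel]; exact one_mem_lcSource))
    filter_upwards [hev h hh, hev h' hh'] with z hz hz'
    simp only [Q, ec_lc hz, ec_lc hz', c]
    congr 1
    group
  have hx1 : ∀ f : F → G, lc d ((f x)⁻¹ * f x) = o := fun f => by simp [o]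
  rw [MC, heq.fderivWithin_eq_of_mem hxs]
  have hQ' : HasFDerivAt Q (fderiv ℝ Q (o, o)) (lc d ((h x)⁻¹ * h x), lc d ((h' x)⁻¹ * h' x)) := by
    rw [hx1, hx1]
    exact hQ.hasFDerivAt
  have h3 := HasFDerivAt.comp_hasFDerivWithinAt x hQ'
    (hy.hasFDerivWithinAt.prodMk hy'.hasFDerivWithinAt)
  refine (h3.fderivWithin hs).trans ?_
  ext1 v
  have he' : fderivWithin ℝ (fun z => lc d ((h x)⁻¹ * h z)) s x =
    fderivWithin ℝ (fun z => lc d ((h' x)⁻¹ * h' z)) s x := he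
  rw [he']
  exact hQ0 _

/-- `mcChart` is invertible, so the derivative of the map in the chart vanishes, and the map is
constant on a convex neighbourhood. -/
theorem eventually_eq_of_MC_eq_zero (hs : UniqueDiffOn ℝ s) (hc : Convex ℝ s)
    (hh : ContMDiffOn 𝓘(ℝ, F) (𝓡 d) ∞ h s) (h0 : ∀ x ∈ s, MC d s h x = 0) {x : F} (hx : x ∈ s) :
    ∀ᶠ z in 𝓝[s] x, h z = h x := by
  have hx1 : (h x)⁻¹ * h x ∈ lcSource d G := by rw [inv_mul_cancel]; exact one_mem_lcSource
  have hev : ∀ᶠ z in 𝓝[s] x, (h x)⁻¹ * h z ∈ lcSource d G :=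
    (contMDiffWithinAt_mul_left (h x)⁻¹ (hh x hx)).continuousWithinAt
      (isOpen_lcSource.mem_nhds hx1)
  obtain ⟨ε, hε, hball⟩ := Metric.mem_nhdsWithin_iff.1 hev
  have hsub : s ∩ Metric.ball x ε ⊆ s := inter_subset_left
  have hud : UniqueDiffOn ℝ (s ∩ Metric.ball x ε) := hs.inter Metric.isOpen_ball
  have hS : ∀ z ∈ s ∩ Metric.ball x ε, (h x)⁻¹ * h z ∈ lcSource d G := fun z hz =>
    hball ⟨hz.2, hz.1⟩
  have hd0 : ∀ z ∈ s ∩ Metric.ball x ε,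
      HasFDerivWithinAt (fun z => lc d ((h x)⁻¹ * h z)) (0 : F →L[ℝ] E)
        (s ∩ Metric.ball x ε) z := by
    intro z hz
    have h1 := MC_eq_mcChart (h x)⁻¹ (hh z hz.1) (hS z hz) (hs z hz.1)
    rw [h0 z hz.1] at h1
    have h2 := ((contDiffWithinAt_lc_mul (h x)⁻¹ (hh z hz.1) (hS z hz)).differentiableWithinAt
      (by simp)).hasFDerivWithinAt
    have h3 : fderivWithin ℝ (fun z => lc d ((h x)⁻¹ * h z)) s z = 0 := by
      have := congrArg ((invField G (lc d ((h x)⁻¹ * h z))).comp) h1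
      rw [← ContinuousLinearMap.comp_assoc, invField_comp_mcChart (lc_mem (hS z hz))] at this
      simpa using this.symm
    rw [h3] at h2
    exact h2.mono hsub
  have hcb : Convex ℝ (s ∩ Metric.ball x ε) := hc.inter (convex_ball x ε)
  filter_upwards [hev, self_mem_nhdsWithin, mem_nhdsWithin_of_mem_nhds (Metric.ball_mem_nhds x hε)]
    with z hz hzs hzb
  have h4 := hcb.is_const_of_fderivWithin_eq_zero (𝕜 := ℝ)
    (f := fun z => lc d ((h x)⁻¹ * h z)) (fun z hz => (hd0 z hz).differentiableWithinAt)
    (fun z hz => (hd0 z hz).fderivWithin (hud z hz)) ⟨hzs, hzb⟩ ⟨hx, Metric.mem_ball_self hε⟩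
  have h5 := congrArg (ec : E → G) h4
  rw [ec_lc hz, ec_lc hx1] at h5
  exact mul_left_cancel h5

theorem exists_eq_mul_of_MC_eq (hs : UniqueDiffOn ℝ s) (hc : Convex ℝ s)
    (hh : ContMDiffOn 𝓘(ℝ, F) (𝓡 d) ∞ h s) (hh' : ContMDiffOn 𝓘(ℝ, F) (𝓡 d) ∞ h' s)
    (he : ∀ x ∈ s, MC d s h x = MC d s h' x) {x z : F} (hx : x ∈ s) (hz : z ∈ s) :
    (h x)⁻¹ * h z = (h' x)⁻¹ * h' z := by
  have h1 : ∀ x ∈ s, ∀ᶠ z in 𝓝[s] x, h z * (h' z)⁻¹ = h x * (h' x)⁻¹ := fun x hx =>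
    eventually_eq_of_MC_eq_zero hs hc (hh.mul hh'.inv)
      (fun x hx => MC_div_eq_zero (hh x hx) (hh' x hx) (hs x hx) hx (he x hx)) hx
  have h2 : h z * (h' z)⁻¹ = h x * (h' x)⁻¹ := by
    -- A locally constant map is continuous for the discrete topology on the target, hence constant
    -- on a preconnected set.
    let _ : TopologicalSpace G := ⊥
    have : DiscreteTopology G := ⟨rfl⟩
    refine hc.isPreconnected.constant (f := fun z => h z * (h' z)⁻¹) (fun y hy => ?_) hz hx
    rw [ContinuousWithinAt, nhds_discrete, Filter.tendsto_pure]
    exact h1 y hy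
  rw [mul_inv_eq_iff_eq_mul] at h2
  rw [h2]
  group

end Uniqueness

end LieInt

namespace LieInt

/-! ### The Frobenius theorem on compact convex sets -/

section Frobenius

open Metric NNReal

variable {X Y : Type*} [NormedAddCommGroup X] [NormedSpace ℝ X] [NormedAddCommGroup Y]
  [NormedSpace ℝ Y]

theorem exists_bound_of_contDiffOn {C : Set X} (hc : IsCompact C) (hC : Convex ℝ C)
    (hu : UniqueDiffOn ℝ C) {f : X → Y} (hf : ContDiffOn ℝ ∞ f C) :
    ∃ K : ℝ≥0, (∀ p ∈ C, ‖f p‖ ≤ K) ∧ (∀ p ∈ C, ‖fderivWithin ℝ f C p‖ ≤ K) ∧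
      LipschitzOnWith K f C := by
  obtain ⟨K, hK⟩ := hc.exists_bound_of_continuousOn
    (f := fderivWithin ℝ f C) (hf.continuousOn_fderivWithin hu (by simp))
  obtain ⟨K', hK'⟩ := hc.exists_bound_of_continuousOn hf.continuousOn
  refine ⟨(max K K').toNNReal, fun p hp => ?_, fun p hp => ?_, ?_⟩
  · exact (hK' p hp).trans ((le_max_right _ _).trans (Real.le_coe_toNNReal _))
  · exact (hK p hp).trans ((le_max_left _ _).trans (Real.le_coe_toNNReal _))
  · refine hC.lipschitzOnWith_of_nnnorm_fderivWithin_le (𝕜 := ℝ)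
      (hf.differentiableOn (by simp)) fun p hp => ?_
    rw [← NNReal.coe_le_coe, coe_nnnorm]
    exact (hK p hp).trans ((le_max_left _ _).trans (Real.le_coe_toNNReal _))

theorem exists_taylor_bound {C : Set X} (hc : IsCompact C) (hC : Convex ℝ C)
    (hu : UniqueDiffOn ℝ C) {f : X → Y} (hf : ContDiffOn ℝ ∞ f C) :
    ∃ K : ℝ≥0, ∀ p ∈ C, ∀ q ∈ C, ‖f q - f p - fderivWithin ℝ f C p (q - p)‖ ≤ K * ‖q - p‖ ^ 2 := by
  obtain ⟨K, -, -, hK⟩ := exists_bound_of_contDiffOn hc hC hu (hf.fderivWithin hu (m := ∞) (by simp))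
  refine ⟨K, fun p hp q hq => ?_⟩
  have hsub : segment ℝ p q ⊆ C := hC.segment_subset hp hq
  have := (convex_segment p q).norm_image_sub_le_of_norm_hasFDerivWithin_le' (𝕜 := ℝ)
    (f := f) (f' := fderivWithin ℝ f C) (φ := fderivWithin ℝ f C p) (C := K * ‖q - p‖)
    (x := p) (y := q)
    (fun z hz => (((hf.differentiableOn (by simp)) z (hsub hz)).hasFDerivWithinAt).mono hsub)
    (fun z hz => by
      have h1 := hK.dist_le_mul z (hsub hz) p hp
      rw [dist_eq_norm] at h1
      refine h1.trans ?_
      gcongr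
      rw [dist_eq_norm]
      exact norm_sub_le_of_mem_segment hz)
    (left_mem_segment _ _ _) (right_mem_segment _ _ _)
  rw [pow_two, ← mul_assoc]
  exact this

/-- The ordinary differential equation along rays. -/
theorem exists_ray_solution [CompleteSpace Y] {S : Set X} (hS : Convex ℝ S) {y₀ : Y} {r : ℝ}
    {F : X × Y → X →L[ℝ] Y} {K : ℝ≥0} (hM : ∀ p ∈ S ×ˢ closedBall y₀ r, ‖F p‖ ≤ K)
    (hL : LipschitzOnWith K F (S ×ˢ closedBall y₀ r)) {x₀ x : X} (hx₀ : x₀ ∈ S) (hx : x ∈ S)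
    (hr : K * ‖x - x₀‖ ≤ r) :
    ∃ γ : ℝ → Y, γ 0 = y₀ ∧ ∀ t ∈ Icc (0 : ℝ) 1,
      HasDerivWithinAt γ (F (x₀ + t • (x - x₀), γ t) (x - x₀)) (Icc 0 1) t ∧
        ‖γ t - y₀‖ ≤ K * ‖x - x₀‖ := by
  have hr0 : 0 ≤ r := le_trans (by positivity) hr
  let a : ℝ≥0 := ⟨r, hr0⟩
  let t₀ : Icc (0 : ℝ) 1 := ⟨0, by simp⟩
  have hmem : ∀ t ∈ Icc (0 : ℝ) 1, x₀ + t • (x - x₀) ∈ S := fun t ht =>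
    hS.add_smul_sub_mem hx₀ hx ht
  let f : ℝ → Y → Y := fun t y => F (x₀ + t • (x - x₀), y) (x - x₀)
  have hf : IsPicardLindelof f t₀ y₀ a 0 (K * ‖x - x₀‖₊) (‖x - x₀‖₊ * K) := by
    refine ⟨fun t ht => ?_, fun y hy => ?_, fun t ht y hy => ?_, ?_⟩
    · refine LipschitzOnWith.of_dist_le_mul fun y hy y' hy' => ?_
      have h1 := hL.dist_le_mul (x₀ + t • (x - x₀), y) ⟨hmem t ht, hy⟩
        (x₀ + t • (x - x₀), y') ⟨hmem t ht, hy'⟩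
      rw [dist_prod_same_left] at h1
      rw [dist_eq_norm] at h1 ⊢
      change ‖(F _) _ - (F _) _‖ ≤ _
      rw [← sub_apply]
      refine (ContinuousLinearMap.le_opNorm _ _).trans ?_
      rw [mul_comm]
      push_cast
      rw [mul_assoc]
      gcongr
    · have h1 : ContinuousOn (fun t : ℝ => F (x₀ + t • (x - x₀), y)) (Icc 0 1) :=
        hL.continuousOn.comp (by fun_prop) fun t ht => ⟨hmem t ht, hy⟩
      exact h1.clm_apply continuousOn_const
    · push_cast
      refine (ContinuousLinearMap.le_opNorm _ _).trans ?_
      gcongr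
      exact hM _ ⟨hmem t ht, hy⟩
    · simp only [t₀, a]
      push_cast
      simp only [sub_zero, max_eq_left zero_le_one, mul_one]
      exact hr
  -- The fixed point of the Picard iteration lies in a space of curves that stay in the ball, which
  -- keeps the solution in the domain of the estimates.
  obtain ⟨α, hα⟩ := ODE.FunSpace.exists_isFixedPt_next hf
    (mem_closedBall_self (x := y₀) (ε := ((0 : ℝ≥0) : ℝ)) le_rfl)
  have hstay : ∀ t, α.compProj t ∈ closedBall y₀ a := fun t => α.compProj_mem_closedBall hf.mul_max_le
  have h0 : α.compProj 0 = y₀ := by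
    have : α.compProj t₀ = y₀ := by
      rw [ODE.FunSpace.compProj_val, ← hα, ODE.FunSpace.next_apply₀]
    exact this
  have hder : ∀ t ∈ Icc (0 : ℝ) 1, HasDerivWithinAt α.compProj (f t (α.compProj t)) (Icc 0 1) t := by
    intro t ht
    apply ODE.hasDerivWithinAt_picard_Icc t₀.2 hf.continuousOn_uncurry
      α.continuous_compProj.continuousOn (fun _ ht' ↦ α.compProj_mem_closedBall hf.mul_max_le)
      y₀ ht |>.congr_of_mem _ ht
    intro t' ht'
    nth_rw 1 [← hα]
    rw [ODE.FunSpace.compProj_of_mem ht', ODE.FunSpace.next_apply]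
  refine ⟨α.compProj, h0, fun t ht => ⟨hder t ht, ?_⟩⟩
  have h2 := norm_image_sub_le_of_norm_deriv_le_segment' (C := K * ‖x - x₀‖) hder
    (fun s hs => (ContinuousLinearMap.le_opNorm _ _).trans (mul_le_mul_of_nonneg_right
      (hM _ ⟨hmem s (Ico_subset_Icc_self hs), hstay s⟩) (norm_nonneg _))) t ht
  rw [h0, sub_zero] at h2
  exact h2.trans (mul_le_of_le_one_right (by positivity) ht.2)

/-- The Frobenius theorem: local solutions of an integrable total differential equation, with a
uniform size. -/
theorem exists_local_solution [CompleteSpace Y] [ProperSpace Y] {S : Set X} (hS : Convex ℝ S)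
    (hSc : IsCompact S) (hSu : UniqueDiffOn ℝ S) {y₀ : Y} {r : ℝ} (hr : 0 < r)
    {F : X × Y → X →L[ℝ] Y} (hF : ContDiffOn ℝ ∞ F (S ×ˢ closedBall y₀ r))
    (hI : ∀ p ∈ S ×ˢ closedBall y₀ r, ∀ a b : X,
      fderivWithin ℝ F (S ×ˢ closedBall y₀ r) p (a, F p a) b =
        fderivWithin ℝ F (S ×ˢ closedBall y₀ r) p (b, F p b) a) :
    ∃ ε > 0, ∀ x₀ ∈ S, ∃ y : X → Y, y x₀ = y₀ ∧ ∀ x ∈ S ∩ closedBall x₀ ε,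
      y x ∈ closedBall y₀ r ∧ HasFDerivWithinAt y (F (x, y x)) (S ∩ closedBall x₀ ε) x := by
  set C := S ×ˢ closedBall y₀ r with hCdef
  have hCc : IsCompact C := hSc.prod (isCompact_closedBall y₀ r)
  have hCv : Convex ℝ C := hS.prod (convex_closedBall y₀ r)
  have hCu : UniqueDiffOn ℝ C := hSu.prod
    (uniqueDiffOn_convex (convex_closedBall y₀ r) (by
      rw [interior_closedBall _ hr.ne']; exact ⟨y₀, mem_ball_self hr⟩))
  obtain ⟨K, hK1, hK2, hK3⟩ := exists_bound_of_contDiffOn hCc hCv hCu hF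
  obtain ⟨B, hB⟩ := exists_taylor_bound hCc hCv hCu hF
  -- With this `ε` the solution along each ray moves by at most `r / 4`. This leaves room for the
  -- comparison curve `δ` below, which deviates by at most another `r / 2`.
  let ε : ℝ := r / (4 * (K + 1))
  have hε : 0 < ε := by positivity
  have hKε : K * ε ≤ r / 4 := by
    have : (K + 1) * ε = r / 4 := by simp only [ε]; field_simp
    nlinarith
  refine ⟨ε, hε, fun x₀ hx₀ => ?_⟩
  have hnorm : ∀ x ∈ S ∩ closedBall x₀ ε, K * ‖x - x₀‖ ≤ r / 4 := fun x hx => by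
    refine le_trans ?_ hKε
    gcongr
    exact mem_closedBall_iff_norm.1 hx.2
  choose! γ hγ0 hγ using fun x (hx : x ∈ S ∩ closedBall x₀ ε) =>
    exists_ray_solution hS hK1 hK3 hx₀ hx.1 ((hnorm x hx).trans (by linarith))
  have h01 : (1 : ℝ) ∈ Icc (0 : ℝ) 1 := by simp
  have hγm : ∀ x ∈ S ∩ closedBall x₀ ε, ∀ t ∈ Icc (0 : ℝ) 1, γ x t ∈ closedBall y₀ (r / 4) :=
    fun x hx t ht => mem_closedBall_iff_norm.2 (((hγ x hx t ht).2).trans (hnorm x hx))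
  have hmem : ∀ x ∈ S, ∀ t ∈ Icc (0 : ℝ) 1, x₀ + t • (x - x₀) ∈ S := fun x hx t ht =>
    hS.add_smul_sub_mem hx₀ hx ht
  let c : ℝ := B * (1 + K) ^ 2 * ε + K * (1 + K)
  let c' : ℝ := c / (K * ε + 1) * (Real.exp (K * ε + 1) - 1)
  -- The solution is `y x = γ x 1`. This quadratic estimate gives its differentiability with the
  -- required derivative, without the smooth dependence of solutions on parameters.
  have key : ∀ x ∈ S ∩ closedBall x₀ ε, ∀ x' ∈ S ∩ closedBall x₀ ε,
      ‖γ x' 1 - γ x 1 - F (x, γ x 1) (x' - x)‖ ≤ c' * ‖x' - x‖ ^ 2 := by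
    intro x hx x' hx'
    set v := x' - x with hv
    let z : ℝ → X × Y := fun t => (x₀ + t • (x - x₀), γ x t)
    have hz : ∀ t ∈ Icc (0 : ℝ) 1, z t ∈ C := fun t ht =>
      ⟨hmem x hx.1 t ht, closedBall_subset_closedBall (by linarith) (hγm x hx t ht)⟩
    let w : ℝ → X × Y := fun t => t • (v, F (z t) v)
    -- The first-order guess for the solution along the ray to `x'`, starting from the one along the
    -- ray to `x`. It solves the equation for `x'` up to an error quadratic in `v`.
    let δ : ℝ → Y := fun t => γ x t + t • F (z t) v
    have hFv : ∀ t ∈ Icc (0 : ℝ) 1, ‖F (z t) v‖ ≤ K * ‖v‖ := fun t ht =>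
      (ContinuousLinearMap.le_opNorm _ _).trans
        (mul_le_mul_of_nonneg_right (hK1 _ (hz t ht)) (norm_nonneg _))
    have hw : ∀ t ∈ Icc (0 : ℝ) 1, ‖w t‖ ≤ (1 + K) * ‖v‖ := by
      intro t ht
      rw [norm_smul, Real.norm_of_nonneg ht.1]
      refine (mul_le_of_le_one_left (norm_nonneg _) ht.2).trans ?_
      rw [Prod.norm_def]
      refine max_le ?_ ?_
      · nlinarith [norm_nonneg v, K.2]
      · nlinarith [norm_nonneg v, K.2, hFv t ht]
    have hzw : ∀ t, z t + w t = (x₀ + t • (x' - x₀), δ t) := fun t => by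
      simp only [z, w, δ, hv, Prod.smul_mk, Prod.mk_add_mk]
      congr 1
      module
    have hv2 : K * ‖v‖ ≤ r / 2 := by
      have h1 : ‖v‖ ≤ ‖x' - x₀‖ + ‖x - x₀‖ := by
        rw [hv, ← sub_sub_sub_cancel_right x' x x₀]
        exact norm_sub_le _ _
      have h2 := hnorm x hx
      have h3 := hnorm x' hx'
      nlinarith [K.2]
    have hδ : ∀ t ∈ Icc (0 : ℝ) 1, δ t ∈ closedBall y₀ r := by
      intro t ht
      rw [mem_closedBall_iff_norm]
      have h1 := mem_closedBall_iff_norm.1 (hγm x hx t ht)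
      have h2 : ‖t • F (z t) v‖ ≤ K * ‖v‖ := by
        rw [norm_smul, Real.norm_of_nonneg ht.1]
        exact (mul_le_of_le_one_left (norm_nonneg _) ht.2).trans (hFv t ht)
      calc ‖δ t - y₀‖ = ‖(γ x t - y₀) + t • F (z t) v‖ := by simp only [δ]; congr 1; abel
        _ ≤ r := (norm_add_le _ _).trans (by linarith)
    have hz' : ∀ t ∈ Icc (0 : ℝ) 1, HasDerivWithinAt z (x - x₀, F (z t) (x - x₀)) (Icc 0 1) t := by
      intro t ht
      refine HasDerivWithinAt.prodMk ?_ (hγ x hx t ht).1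
      have := ((hasDerivAt_id t).smul_const (x - x₀)).const_add x₀
      simpa using this.hasDerivWithinAt
    let D := fderivWithin ℝ F C
    have hFz : ∀ t ∈ Icc (0 : ℝ) 1, HasDerivWithinAt (fun t => F (z t))
        (D (z t) (x - x₀, F (z t) (x - x₀))) (Icc 0 1) t := fun t ht =>
      HasFDerivWithinAt.comp_hasDerivWithinAt (t := C) t
        ((hF.differentiableOn (by simp) _ (hz t ht)).hasFDerivWithinAt) (hz' t ht) hz
    let δ' : ℝ → Y := fun t => F (z t) (x' - x₀) + D (z t) (w t) (x - x₀)
    have hδ' : ∀ t ∈ Icc (0 : ℝ) 1, HasDerivWithinAt δ (δ' t) (Icc 0 1) t := by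
      intro t ht
      have h1 := (hγ x hx t ht).1.add ((hasDerivAt_id t).hasDerivWithinAt.smul
        ((hFz t ht).clm_apply (hasDerivWithinAt_const t _ v)))
      refine h1.congr_deriv ?_
      -- Integrability exchanges the directions `v` and `x - x₀`, so the derivative of `δ` becomes a
      -- first-order Taylor term of `F` in the direction `w t`.
      have h2 := hI (z t) (hz t ht) v (x - x₀)
      have h3 : x' - x₀ = (x - x₀) + v := by rw [hv]; abel
      simp only [δ', w, h3, map_add, map_smul, smul_apply, id_eq, D, h2, z,
        map_zero, add_zero, one_smul]
      abel
    have herr : ∀ t ∈ Ico (0 : ℝ) 1, dist (δ' t) (F (x₀ + t • (x' - x₀), δ t) (x' - x₀)) ≤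
        c * ‖v‖ ^ 2 := by
      intro t ht
      have ht' := Ico_subset_Icc_self ht
      have hzC : z t + w t ∈ C := by
        rw [hzw]
        exact ⟨hmem x' hx'.1 t ht', hδ t ht'⟩
      have h1 := hB (z t) (hz t ht') _ hzC
      rw [add_sub_cancel_left] at h1
      have h3 : x' - x₀ = (x - x₀) + v := by rw [hv]; abel
      have h4 : δ' t - F (z t + w t) (x' - x₀) =
          -((F (z t + w t) - F (z t) - D (z t) (w t)) (x' - x₀)) - D (z t) (w t) v := by
        simp only [δ', sub_apply, h3, map_add]
        abel
      rw [← hzw, dist_eq_norm, h4]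
      refine (norm_sub_le _ _).trans ?_
      rw [norm_neg]
      have h5 : ‖(F (z t + w t) - F (z t) - D (z t) (w t)) (x' - x₀)‖ ≤
          (B * ((1 + K) * ‖v‖) ^ 2) * ε := by
        refine (ContinuousLinearMap.le_opNorm _ _).trans ?_
        refine mul_le_mul (h1.trans ?_) (mem_closedBall_iff_norm.1 hx'.2) (norm_nonneg _)
          (by positivity)
        gcongr
        exact hw t ht'
      have h6 : ‖D (z t) (w t) v‖ ≤ K * ((1 + K) * ‖v‖) * ‖v‖ := by
        refine (ContinuousLinearMap.le_opNorm _ _).trans ?_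
        gcongr
        refine (ContinuousLinearMap.le_opNorm _ _).trans ?_
        gcongr
        · exact hK2 _ (hz t ht')
        · exact hw t ht'
      refine (add_le_add h5 h6).trans (le_of_eq ?_)
      simp only [c]
      ring
    have hIci : ∀ {g : ℝ → Y} {g' : Y} {t : ℝ}, t ∈ Ico (0 : ℝ) 1 →
        HasDerivWithinAt g g' (Icc 0 1) t → HasDerivWithinAt g g' (Ici t) t := fun ht hg =>
      hg.mono_of_mem_nhdsWithin (Icc_mem_nhdsGE_of_mem ht)
    -- Grönwall's inequality compares `γ x'` with the approximate solution `δ`. Adding `1` to the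
    -- Lipschitz constant makes it nonzero, so that a single formula for the bound applies.
    have hgr := dist_le_of_approx_trajectories_ODE_of_mem (K := K * ⟨ε, hε.le⟩ + 1)
      (v := fun t y => F (x₀ + t • (x' - x₀), y) (x' - x₀)) (s := fun _ => closedBall y₀ r)
      (f := γ x') (g := δ) (a := 0) (b := 1) (εf := 0) (εg := c * ‖v‖ ^ 2) (δ := 0)
      (f' := fun t => F (x₀ + t • (x' - x₀), γ x' t) (x' - x₀)) (g' := δ')
      (fun t ht => by
        refine LipschitzOnWith.of_dist_le_mul fun y hy y' hy' => ?_
        have hm := hmem x' hx'.1 t (Ico_subset_Icc_self ht)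
        have h1 := hK3.dist_le_mul (x₀ + t • (x' - x₀), y) ⟨hm, hy⟩ (x₀ + t • (x' - x₀), y') ⟨hm, hy'⟩
        rw [dist_prod_same_left] at h1
        rw [dist_eq_norm] at h1 ⊢
        rw [← sub_apply]
        refine (ContinuousLinearMap.le_opNorm _ _).trans ?_
        refine (mul_le_mul h1 (mem_closedBall_iff_norm.1 hx'.2) (norm_nonneg _)
          (by positivity)).trans ?_
        push_cast
        change _ ≤ (K * ε + 1) * dist y y'
        nlinarith [dist_nonneg (x := y) (y := y')])
      (fun t ht => (hγ x' hx' t ht).1.continuousWithinAt)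
      (fun t ht => hIci ht (hγ x' hx' t (Ico_subset_Icc_self ht)).1)
      (fun t ht => by rw [dist_self])
      (fun t ht => closedBall_subset_closedBall (by linarith)
        (hγm x' hx' t (Ico_subset_Icc_self ht)))
      (fun t ht => (hδ' t ht).continuousWithinAt)
      (fun t ht => hIci ht (hδ' t (Ico_subset_Icc_self ht)))
      herr (fun t ht => hδ t (Ico_subset_Icc_self ht))
      (by simp [δ, hγ0 x hx, hγ0 x' hx']) 1 h01
    have hKne : ((K * ⟨ε, hε.le⟩ + 1 : ℝ≥0) : ℝ) = K * ε + 1 := by push_cast; rfl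
    rw [gronwallBound_of_K_ne_0 (by rw [hKne]; positivity), hKne, dist_eq_norm] at hgr
    have h7 : γ x' 1 - δ 1 = γ x' 1 - γ x 1 - F (x, γ x 1) v := by
      simp only [δ, z, one_smul, add_sub_cancel]
      abel
    rw [← h7]
    refine hgr.trans (le_of_eq ?_)
    simp only [c', sub_zero, mul_one, zero_mul, zero_add]
    ring
  refine ⟨fun x => γ x 1, ?_, fun x hx => ⟨closedBall_subset_closedBall (by linarith)
    (hγm x hx 1 h01), ?_⟩⟩
  · have h1 : x₀ ∈ S ∩ closedBall x₀ ε := ⟨hx₀, mem_closedBall_self hε.le⟩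
    have := (hγ x₀ h1 1 h01).2
    rw [sub_self, norm_zero, mul_zero] at this
    exact sub_eq_zero.1 (norm_le_zero_iff.1 this)
  · refine HasFDerivWithinAt.of_isLittleO ?_
    refine Asymptotics.IsBigO.trans_isLittleO (g := fun x' => ‖x' - x‖ ^ 2) ?_
      ((Asymptotics.isLittleO_pow_sub_sub x one_lt_two).mono nhdsWithin_le_nhds)
    refine Asymptotics.IsBigO.of_bound c' ?_
    filter_upwards [self_mem_nhdsWithin] with x' hx'
    rw [Real.norm_of_nonneg (by positivity)]
    exact key x hx x' hx'

end Frobenius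

end LieInt

namespace LieInt

/-! ### Flat forms as Maurer-Cartan forms of smooth maps -/

section Developing

open Metric

variable {X : Type} [NormedAddCommGroup X] [NormedSpace ℝ X]

/-- Bootstrapping: if `y` is of class `Cⁿ`, so is its derivative `F (x, y x)`. -/
theorem contDiffOn_of_hasFDerivWithinAt_comp {Y : Type*} [NormedAddCommGroup Y] [NormedSpace ℝ Y]
    {T : Set X} {C : Set (X × Y)} {F : X × Y → X →L[ℝ] Y} (hF : ContDiffOn ℝ ∞ F C) {y : X → Y}
    (hC : ∀ x ∈ T, (x, y x) ∈ C) (hu : UniqueDiffOn ℝ T)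
    (hy : ∀ x ∈ T, HasFDerivWithinAt y (F (x, y x)) T x) : ContDiffOn ℝ ∞ y T := by
  rw [contDiffOn_infty]
  intro n
  induction n with
  | zero => exact contDiffOn_zero.2 fun x hx => (hy x hx).continuousWithinAt
  | succ n ih =>
    have : ((n + 1 : ℕ) : WithTop ℕ∞) = (n : WithTop ℕ∞) + 1 := by norm_cast
    rw [this, contDiffOn_succ_iff_fderivWithin hu]
    refine ⟨fun x hx => (hy x hx).differentiableWithinAt, by simp, ?_⟩
    have h1 : ContDiffOn ℝ n (fun x => F (x, y x)) T :=
      ContDiffOn.comp (g := F) (hF.of_le (by exact_mod_cast le_top)) (contDiffOn_id.prodMk ih) hC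
    exact h1.congr fun x hx => (hy x hx).fderivWithin (hu x hx)

variable {d : ℕ} {G : Type*} [TopologicalSpace G] [ChartedSpace (EuclideanSpace ℝ (Fin d)) G]
  [Group G]

local notation "E" => EuclideanSpace ℝ (Fin d)

theorem MC_inter {s t : Set X} {h : X → G} {x : X} (ht : t ∈ 𝓝 x) :
    MC d (s ∩ t) h x = MC d s h x := fderivWithin_inter ht

variable [LieGroup (𝓡 d) ∞ G]

theorem fderiv_mcChart_sub {z : E} (hz : z ∈ lcTarget d G) (a b : E) :
    fderiv ℝ (mcChart d G) z a b - fderiv ℝ (mcChart d G) z b a =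
      -lieBr G (mcChart d G z a) (mcChart d G z b) := by
  have h1 := mc_equation (h := (ec : E → G)) (s := lcTarget d G)
    (fun z hz => (contMDiffAt_ec hz).contMDiffWithinAt) isOpen_lcTarget.uniqueDiffOn hz
    (by rw [isOpen_lcTarget.interior_eq]; exact subset_closure hz) a b
  have h2 : EqOn (MC d (lcTarget d G) (ec : E → G)) (mcChart d G) (lcTarget d G) := fun z hz => by
    rw [mcChart, ← MC_inter (s := univ) (isOpen_lcTarget.mem_nhds hz), univ_inter]
  rwa [fderivWithin_congr h2 (h2 hz), h2 hz, fderivWithin_of_isOpen isOpen_lcTarget hz] at h1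

/-- Derivative of the identity `invField G z (mcChart d G z a) = a` in `z`. -/
theorem fderiv_invField {z : E} (hz : z ∈ lcTarget d G) (η a : E) :
    fderiv ℝ (invField G) z η (mcChart d G z a) =
      -invField G z (fderiv ℝ (mcChart d G) z η a) := by
  have h1 := (((contDiffOn_mcChart (G := G)).contDiffAt
    (isOpen_lcTarget.mem_nhds hz)).differentiableAt (by simp)).hasFDerivAt
  have h2 := (((contDiffOn_invField (G := G)).contDiffAt
    (isOpen_lcTarget.mem_nhds hz)).differentiableAt (by simp)).hasFDerivAt
  have h3 := h2.clm_apply (h1.clm_apply (hasFDerivAt_const a z))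
  have h4 : (fun z : E => invField G z (mcChart d G z a)) =ᶠ[𝓝 z] fun _ => a := by
    filter_upwards [isOpen_lcTarget.mem_nhds hz] with z hz
    exact DFunLike.congr_fun (invField_comp_mcChart hz) a
  have h5 := DFunLike.congr_fun ((h3.congr_of_eventuallyEq h4.symm).unique (hasFDerivAt_const a z)) η
  simp only [ContinuousLinearMap.comp_zero, zero_add, add_apply,
    ContinuousLinearMap.coe_comp, Function.comp_apply, ContinuousLinearMap.flip_apply,
    zero_apply] at h5
  rw [eq_neg_iff_add_eq_zero, add_comm]
  exact h5

/-- Flat forms with values in the Lie algebra: the Maurer-Cartan equation. -/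
def FlatOn (G : Type*) [TopologicalSpace G] [ChartedSpace E G] [Group G] [LieGroup (𝓡 d) ∞ G]
    (w : X → X →L[ℝ] E) (S : Set X) : Prop :=
  ∀ x ∈ S, ∀ a b, fderivWithin ℝ w S x a b - fderivWithin ℝ w S x b a = -lieBr G (w x a) (w x b)

variable {S : Set X} {w : X → X →L[ℝ] EuclideanSpace ℝ (Fin d)}

/-- The equation `dy = invField(y) ∘ w` says that `ec ∘ y` has Maurer-Cartan form `w`. Its
integrability is the difference between the flatness of `w` and the Maurer-Cartan equation for
`mcChart`. -/
theorem integrable_invField (hu : UniqueDiffOn ℝ S) (hw : ContDiffOn ℝ ∞ w S) (hf : FlatOn G w S)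
    {B : Set E} (hB : B ⊆ lcTarget d G) (hBu : UniqueDiffOn ℝ B) {p : X × E} (hp : p ∈ S ×ˢ B)
    (a b : X) :
    fderivWithin ℝ (fun p : X × E => (invField G p.2).comp (w p.1)) (S ×ˢ B) p
        (a, (invField G p.2).comp (w p.1) a) b =
      fderivWithin ℝ (fun p : X × E => (invField G p.2).comp (w p.1)) (S ×ˢ B) p
        (b, (invField G p.2).comp (w p.1) b) a := by
  have hz := hB hp.2
  have h1 : HasFDerivWithinAt (fun p : X × E => w p.1)
      ((fderivWithin ℝ w S p.1).comp (ContinuousLinearMap.fst ℝ X E)) (S ×ˢ B) p :=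
    HasFDerivWithinAt.comp (g := w) (t := S) p
      ((hw.differentiableOn (by simp)) _ hp.1).hasFDerivWithinAt
      hasFDerivWithinAt_fst fun q hq => hq.1
  have h2 : HasFDerivWithinAt (fun p : X × E => invField G p.2)
      ((fderiv ℝ (invField G) p.2).comp (ContinuousLinearMap.snd ℝ X E)) (S ×ˢ B) p :=
    HasFDerivAt.comp_hasFDerivWithinAt (g := invField G) p
      (((contDiffOn_invField (G := G)).contDiffAt
        (isOpen_lcTarget.mem_nhds hz)).differentiableAt (by simp)).hasFDerivAt
      hasFDerivWithinAt_snd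
  rw [(h2.clm_comp h1).fderivWithin (hu.prod hBu p hp)]
  have hinv : ∀ v : E, mcChart d G p.2 (invField G p.2 v) = v := fun v =>
    DFunLike.congr_fun (mcChart_comp_invField hz) v
  have h3 : ∀ a b : X, fderiv ℝ (invField G) p.2 (invField G p.2 (w p.1 a)) (w p.1 b) =
      -invField G p.2 (fderiv ℝ (mcChart d G) p.2 (invField G p.2 (w p.1 a))
        (invField G p.2 (w p.1 b))) := fun a b => by
    rw [← fderiv_invField hz, hinv]
  have h4 := fderiv_mcChart_sub hz (invField G p.2 (w p.1 a)) (invField G p.2 (w p.1 b))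
  rw [hinv, hinv, ← hf p.1 hp.1 a b] at h4
  have h5 := congrArg (invField G p.2) h4
  rw [map_sub, map_sub] at h5
  simp only [add_apply, ContinuousLinearMap.coe_comp, Function.comp_apply,
    ContinuousLinearMap.compL_apply, ContinuousLinearMap.flip_apply, ContinuousLinearMap.coe_fst',
    ContinuousLinearMap.coe_snd', h3]
  rw [← sub_eq_zero] at h5 ⊢
  rw [← neg_eq_zero, ← h5]
  abel

/-- The Frobenius theorem solves `dy = invField(y) ∘ w` in the chart. Every local solution starts at
the unit, so one ball in the chart serves all base points and `ε` is uniform. -/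
theorem exists_local_development (hS : Convex ℝ S) (hSc : IsCompact S) (hu : UniqueDiffOn ℝ S)
    (hw : ContDiffOn ℝ ∞ w S) (hf : FlatOn G w S) :
    ∃ ε > 0, ∀ x₀ ∈ S, ∃ h : X → G, ContMDiffOn 𝓘(ℝ, X) (𝓡 d) ∞ h (S ∩ ball x₀ ε) ∧
      ∀ x ∈ S ∩ ball x₀ ε, MC d S h x = w x := by
  have ho := lc_mem (one_mem_lcSource (d := d) (G := G))
  obtain ⟨r, hr, hB⟩ := nhds_basis_closedBall.mem_iff.1 (isOpen_lcTarget.mem_nhds ho)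
  have hBu : UniqueDiffOn ℝ (closedBall (lc d (1 : G)) r) :=
    uniqueDiffOn_convex (convex_closedBall _ r) (by
      rw [interior_closedBall _ hr.ne']; exact ⟨_, mem_ball_self hr⟩)
  have hF : ContDiffOn ℝ ∞ (fun p : X × E => (invField G p.2).comp (w p.1))
      (S ×ˢ closedBall (lc d (1 : G)) r) :=
    ContDiffOn.clm_comp (ContDiffOn.comp (g := invField G) contDiffOn_invField contDiffOn_snd
      (fun p (hp : p ∈ S ×ˢ _) => hB hp.2))
      (ContDiffOn.comp (g := w) hw contDiffOn_fst fun p (hp : p ∈ S ×ˢ _) => hp.1)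
  obtain ⟨ε, hε, H⟩ := exists_local_solution hS hSc hu hr hF
    (fun p hp a b => integrable_invField hu hw hf hB hBu hp a b)
  refine ⟨ε, hε, fun x₀ hx₀ => ?_⟩
  obtain ⟨y, -, hy⟩ := H x₀ hx₀
  have hsub : S ∩ ball x₀ ε ⊆ S ∩ closedBall x₀ ε := inter_subset_inter_right _ ball_subset_closedBall
  have hud : UniqueDiffOn ℝ (S ∩ ball x₀ ε) := hu.inter isOpen_ball
  have hder : ∀ x ∈ S ∩ ball x₀ ε, HasFDerivWithinAt y ((invField G (y x)).comp (w x))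
      (S ∩ ball x₀ ε) x := fun x hx => (hy x (hsub hx)).2.mono hsub
  have hys := contDiffOn_of_hasFDerivWithinAt_comp hF (y := y) (T := S ∩ ball x₀ ε)
    (fun x hx => ⟨hx.1, (hy x (hsub hx)).1⟩) hud hder
  have hyT : ∀ x ∈ S ∩ ball x₀ ε, y x ∈ lcTarget d G := fun x hx => hB (hy x (hsub hx)).1
  refine ⟨fun x => ec (y x), fun x hx => ?_, fun x hx => ?_⟩
  · exact (contMDiffAt_ec (hyT x hx)).comp_contMDiffWithinAt (f := y) x (hys x hx).contMDiffWithinAt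
  · rw [← MC_inter (isOpen_ball.mem_nhds hx.2), MC_ec_comp (hder x hx).differentiableWithinAt
      (hyT x hx) (hud x hx), (hder x hx).fderivWithin (hud x hx), ← ContinuousLinearMap.comp_assoc,
      mcChart_comp_invField (hyT x hx), ContinuousLinearMap.id_comp]

theorem MC_scale {T : Set X} {u : X → G} {t : ℝ} {x : X} (hT : T ∈ 𝓝 (t • x))
    (hst : MapsTo (fun z => t • z) S S)
    (hh : ContMDiffWithinAt 𝓘(ℝ, X) (𝓡 d) ∞ u (S ∩ T) (t • x)) (hu : UniqueDiffWithinAt ℝ S x) :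
    MC d S (fun z => u (t • z)) x = t • MC d S u (t • x) := by
  have hc : (fun z : X => t • z) ⁻¹' T ∈ 𝓝 x := (by fun_prop : ContinuousAt (fun z : X => t • z) x) hT
  have h1 : HasFDerivAt (fun z : X => t • z) (t • ContinuousLinearMap.id ℝ X) x :=
    (hasFDerivAt_id x).const_smul t
  rw [← MC_inter hc, MC_comp_smooth (t := S ∩ T) (h := u) h1.differentiableAt.differentiableWithinAt
    (fun z hz => ⟨hst hz.1, hz.2⟩) hh (hu.inter hc),
    h1.hasFDerivWithinAt.fderivWithin (hu.inter hc), MC_inter hT]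
  ext v
  simp

/-- Every flat form on a compact convex set is the Maurer-Cartan form of a map to the group. -/
theorem exists_development (hS : Convex ℝ S) (hSc : IsCompact S) (hu : UniqueDiffOn ℝ S)
    (h0 : (0 : X) ∈ S) (hw : ContDiffOn ℝ ∞ w S) (hf : FlatOn G w S) :
    ∃ h : X → G, ContMDiffOn 𝓘(ℝ, X) (𝓡 d) ∞ h S ∧ ∀ x ∈ S, MC d S h x = w x := by
  obtain ⟨ε, hε, H⟩ := exists_local_development (d := d) (G := G) hS hSc hu hw hf
  choose! u hus huw using H
  obtain ⟨R, hR⟩ := hSc.isBounded.subset_closedBall 0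
  have hscale : ∀ t ∈ Icc (0 : ℝ) 1, MapsTo (fun z : X => t • z) S S := fun t ht z hz =>
    hS.smul_mem_of_zero_mem h0 hz ht
  -- The form `t • w (t • x)` is the pullback of `w` under the dilation by `t`. It is trivial for `t
  -- = 0` and equals `w` for `t = 1`; a map for the parameter `t` is continued to nearby `t'`.
  have step : ∀ t ∈ Icc (0 : ℝ) 1, ∀ t' ∈ Icc (0 : ℝ) 1, |t' - t| * R < ε / 2 → ∀ h : X → G,
      ContMDiffOn 𝓘(ℝ, X) (𝓡 d) ∞ h S → (∀ x ∈ S, MC d S h x = t • w (t • x)) →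
      ∃ h' : X → G, ContMDiffOn 𝓘(ℝ, X) (𝓡 d) ∞ h' S ∧ ∀ x ∈ S, MC d S h' x = t' • w (t' • x) := by
    intro t ht t' ht' htt h hh hhw
    -- The local development around `t • x` transports the value from `t • x` to `t' • x`.
    let h' : X → G := fun x => h x * ((u (t • x) (t • x))⁻¹ * u (t • x) (t' • x))
    have hdist : ∀ x ∈ S, dist (t' • x) (t • x) < ε / 2 := fun x hx => by
      rw [dist_eq_norm, ← sub_smul, norm_smul, Real.norm_eq_abs]
      refine lt_of_le_of_lt ?_ htt
      gcongr
      exact mem_closedBall_zero_iff.1 (hR hx)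
    -- Near `x`, one local development suffices: by uniqueness the developments around `t • z` and
    -- `t • x` differ by a translation, and so do `h` and the development composed with the
    -- dilation.
    have hloc : ∀ x ∈ S, ∃ g : G, ∀ z ∈ S ∩ ball x (ε / 2), h' z = g * u (t • x) (t' • z) := by
      intro x hx
      have hq := hscale t ht hx
      have hball : ∀ z ∈ ball x (ε / 2), dist (t • z) (t • x) < ε / 2 := fun z hz => by
        rw [dist_smul₀, Real.norm_of_nonneg ht.1]
        exact lt_of_le_of_lt (mul_le_of_le_one_left dist_nonneg ht.2) hz
      refine ⟨h x * (u (t • x) (t • x))⁻¹, fun z hz => ?_⟩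
      have hz1 := hscale t ht hz.1
      have hz2 := hscale t' ht' hz.1
      have e1 : (u (t • z) (t • z))⁻¹ * u (t • z) (t' • z) =
          (u (t • x) (t • z))⁻¹ * u (t • x) (t' • z) := by
        have hm1 : S ∩ (ball (t • z) ε ∩ ball (t • x) ε) ⊆ S ∩ ball (t • z) ε :=
          inter_subset_inter_right _ inter_subset_left
        have hm2 : S ∩ (ball (t • z) ε ∩ ball (t • x) ε) ⊆ S ∩ ball (t • x) ε :=
          inter_subset_inter_right _ inter_subset_right
        have ho : IsOpen (ball (t • z) ε ∩ ball (t • x) ε) := isOpen_ball.inter isOpen_ball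
        refine exists_eq_mul_of_MC_eq (d := d) (s := S ∩ (ball (t • z) ε ∩ ball (t • x) ε))
          (hu.inter ho) (hS.inter ((convex_ball _ _).inter (convex_ball _ _)))
          ((hus _ hz1).mono hm1) ((hus _ hq).mono hm2) (fun y hy => ?_)
          ⟨hz1, mem_ball_self hε, (hball z hz.2).trans (by linarith)⟩
          ⟨hz2, (hdist z hz.1).trans (by linarith), ?_⟩
        · rw [MC_inter (ho.mem_nhds hy.2), MC_inter (ho.mem_nhds hy.2), huw _ hz1 _ (hm1 hy),
            huw _ hq _ (hm2 hy)]
        · exact (dist_triangle _ _ _).trans_lt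
            (by linarith [hdist z hz.1, hball z hz.2])
      have e2 : (h x)⁻¹ * h z = (u (t • x) (t • x))⁻¹ * u (t • x) (t • z) := by
        have hm : MapsTo (fun z => t • z) (S ∩ ball x (ε / 2)) (S ∩ ball (t • x) ε) := fun y hy =>
          ⟨hscale t ht hy.1, (hball y hy.2).trans (by linarith)⟩
        refine exists_eq_mul_of_MC_eq (d := d) (s := S ∩ ball x (ε / 2))
          (h' := fun z => u (t • x) (t • z))
          (hu.inter isOpen_ball) (hS.inter (convex_ball _ _)) (hh.mono inter_subset_left)
          (ContMDiffOn.comp (g := u (t • x)) (hus _ hq)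
            ((contDiff_const_smul t).contMDiff.contMDiffOn) hm)
          (fun y hy => ?_) ⟨hx, mem_ball_self (by positivity)⟩ hz
        rw [MC_inter (isOpen_ball.mem_nhds hy.2), MC_inter (isOpen_ball.mem_nhds hy.2),
          hhw y hy.1, MC_scale (T := ball (t • x) ε) (isOpen_ball.mem_nhds (hm hy).2) (hscale t ht)
          (hus _ hq _ (hm hy)) (hu y hy.1), huw _ hq _ (hm hy)]
      rw [inv_mul_eq_iff_eq_mul] at e2
      simp only [h', e1, e2]
      group
    have hmem : ∀ x ∈ S, t' • x ∈ S ∩ ball (t • x) ε := fun x hx =>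
      ⟨hscale t' ht' hx, (hdist x hx).trans (by linarith)⟩
    have hbn : ∀ x : X, ball x (ε / 2) ∈ 𝓝 x := fun x => ball_mem_nhds x (by positivity)
    have hev : ∀ x ∈ S, ∀ g : G, (∀ z ∈ S ∩ ball x (ε / 2), h' z = g * u (t • x) (t' • z)) →
        h' =ᶠ[𝓝[S] x] fun z => g * u (t • x) (t' • z) := fun x hx g hg =>
      Filter.eventuallyEq_of_mem (inter_mem_nhdsWithin S (hbn x)) hg
    refine ⟨h', fun x hx => ?_, fun x hx => ?_⟩
    · obtain ⟨g, hg⟩ := hloc x hx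
      refine ContMDiffWithinAt.congr_of_eventuallyEq (contMDiffWithinAt_mul_left g ?_) (hev x hx g hg)
        (hg x ⟨hx, mem_of_mem_nhds (hbn x)⟩)
      have hc : (fun z : X => t' • z) ⁻¹' ball (t • x) ε ∈ 𝓝 x :=
        (by fun_prop : ContinuousAt (fun z : X => t' • z) x) (isOpen_ball.mem_nhds (hmem x hx).2)
      rw [← contMDiffWithinAt_inter hc]
      exact ContMDiffWithinAt.comp (g := u (t • x)) x (hus _ (hscale t ht hx) _ (hmem x hx))
        ((contDiff_const_smul t').contMDiff.contMDiffAt.contMDiffWithinAt)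
        fun z hz => ⟨hscale t' ht' hz.1, hz.2⟩
    · obtain ⟨g, hg⟩ := hloc x hx
      rw [MC_congr (d := d) (hev x hx g hg) (hg x ⟨hx, mem_of_mem_nhds (hbn x)⟩), MC_mul_left,
        MC_scale (T := ball (t • x) ε) (isOpen_ball.mem_nhds (hmem x hx).2) (hscale t' ht')
        (hus _ (hscale t ht hx) _ (hmem x hx)) (hu x hx), huw _ (hscale t ht hx) _ (hmem x hx)]
  -- The interval from `0` to `1` is divided into `N + 1` steps, each moving the points of `S`, of
  -- norm at most `R`, by less than `ε / 2`.
  obtain ⟨N, hN⟩ := exists_nat_gt (R / (ε / 2))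
  have hN' : R < (N + 1 : ℝ) * (ε / 2) := by
    rw [div_lt_iff₀ (by positivity)] at hN
    nlinarith
  have all : ∀ i : ℕ, i ≤ N + 1 → ∃ h : X → G, ContMDiffOn 𝓘(ℝ, X) (𝓡 d) ∞ h S ∧
      ∀ x ∈ S, MC d S h x = ((i : ℝ) / (N + 1)) • w (((i : ℝ) / (N + 1)) • x) := by
    intro i
    induction i with
    | zero =>
      refine fun _ => ⟨fun _ => 1, contMDiffOn_const, fun x hx => ?_⟩
      have h1 : MC d S (fun _ => (1 : G)) x = 0 := by
        rw [MC, fderivWithin_fun_const]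
        rfl
      rw [h1, Nat.cast_zero, zero_div, zero_smul ℝ (w _)]
    | succ i ih =>
      intro hi
      obtain ⟨h, hh, hhw⟩ := ih (by omega)
      have hi' : (i : ℝ) + 1 ≤ N + 1 := by exact_mod_cast hi
      refine step _ ⟨by positivity, ?_⟩ _ ⟨by positivity, ?_⟩ ?_ h hh hhw
      · rw [div_le_one (by positivity)]; linarith
      · rw [div_le_one (by positivity)]; push_cast; linarith
      · rw [← sub_div]
        push_cast
        rw [add_sub_cancel_left, abs_of_pos (by positivity), one_div, inv_mul_lt_iff₀ (by positivity)]
        exact hN'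
  obtain ⟨h, hh, hhw⟩ := all (N + 1) le_rfl
  refine ⟨h, hh, fun x hx => ?_⟩
  have h1 : (((N + 1 : ℕ) : ℝ) / (N + 1)) = 1 := by
    push_cast
    exact div_self (by positivity)
  rw [hhw x hx, h1, one_smul, one_smul]

end Developing

/-! ### Cells of `exp_Δ(𝔤)` as smooth simplices of the group -/

section Cells

variable {k n d : ℕ} {G : Type*} [TopologicalSpace G] [ChartedSpace (EuclideanSpace ℝ (Fin d)) G]
  [Group G] [LieGroup (𝓡 d) ∞ G] {U : CartSp}

local notation "LG" => GroupLieAlgebra (𝓡 d) G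

/-- The cells of `exp_Δ(𝔤)` come from smooth simplices of the group. -/
theorem exists_mcForm_eq (Φ : DGAlg.Hom (CE LG) (Omega U k)) (u : U.Pt) :
    ∃ h : V k → G, SSimp d h ∧ ∀ (a : ExteriorAlgebra ℝ (Dual ℝ LG)),
      (Φ.toAlgHom a).1 u = mcForm U h a u := by
  obtain ⟨w, hw, hf, hΦ⟩ := exists_flat_form Φ u
  obtain ⟨h, hh, hhw⟩ := exists_development (d := d) (G := G) (convex_Simp k) (isCompact_Simp k)
    (Simp_uniqueDiffOn k) (zero_mem_Simp k) hw hf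
  refine ⟨h, hh, fun a => funext fun x => ?_⟩
  rw [hΦ, ← hhw x x.2]
  rfl

theorem simplexIntegral_eq_sInt {Φ : DGAlg.Hom (CE LG) (Omega U n)} {u : U.Pt} {h : V n → G}
    {m : ExteriorAlgebra ℝ (Dual ℝ LG)} (hΦ : (Φ.toAlgHom m).1 u = mcForm U h m u) :
    simplexIntegral (Φ.toAlgHom m) u = sInt m h := by
  rw [sInt_eq h m u, simplexIntegral]
  refine MeasureTheory.setIntegral_congr_fun (measurableSet_Simp _) fun x hx => ?_
  simp only [Form.coef_of_mem _ _ _ hx, hΦ]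

end Cells

end LieInt

namespace LieInt

/-! ### Affine maps given by maps of vertices -/

section VertexMaps

variable {k j l : ℕ}

theorem bary_ofVertices (θ : Fin (k + 1) → Fin (j + 1)) (x : V k) (b : Fin (j + 1)) :
    bary ((AffMap.ofVertices θ).fn x) b = ∑ a, if θ a = b then bary x a else 0 := by
  rw [AffMap.bary_fn]
  simp [AffMap.ofVertices]

theorem bary_ofVertices_eq_zero {θ : Fin (k + 1) → Fin (j + 1)} {b : Fin (j + 1)}
    (h : ∀ a, θ a ≠ b) (x : V k) : bary ((AffMap.ofVertices θ).fn x) b = 0 := by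
  rw [bary_ofVertices]
  exact Finset.sum_eq_zero fun a _ => if_neg (h a)

theorem bary_ofVertices_of_unique {θ : Fin (k + 1) → Fin (j + 1)} {b : Fin (j + 1)}
    {a : Fin (k + 1)} (h : ∀ a', θ a' = b ↔ a' = a) (x : V k) :
    bary ((AffMap.ofVertices θ).fn x) b = bary x a := by
  rw [bary_ofVertices]
  simp [h]

theorem fn_ofVertices_comp (θ : Fin (k + 1) → Fin (j + 1)) (η : Fin (j + 1) → Fin (l + 1)) (x : V k) :
    (AffMap.ofVertices η).fn ((AffMap.ofVertices θ).fn x) = (AffMap.ofVertices (η ∘ θ)).fn x := by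
  rw [AffMap.ofVertices_comp, AffMap.fn_comp]

end VertexMaps

/-! ### Horn fillers in the simplicial group of smooth simplices -/

section Horns

variable {k d : ℕ} {G : Type*} [TopologicalSpace G] [ChartedSpace (EuclideanSpace ℝ (Fin d)) G]
  [Group G] [LieGroup (𝓡 d) ∞ G]

/-- The affine retraction of the simplex to the face opposite to `a` that moves the vertex `a` to
the vertex `0`. -/
abbrev collapse (a : Fin (k + 1)) : AffMap k k :=
  AffMap.ofVertices fun b => if b = a then 0 else b

theorem bary_collapse_self {a : Fin (k + 1)} (ha : a ≠ 0) (x : V k) :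
    bary ((collapse a).fn x) a = 0 :=
  bary_ofVertices_eq_zero (fun b => by split_ifs with h; exacts [ha.symm, h]) x

theorem bary_collapse {a b : Fin (k + 1)} (hb : b ≠ 0) (hba : b ≠ a) (x : V k) :
    bary ((collapse a).fn x) b = bary x b :=
  bary_ofVertices_of_unique (fun c => by
    by_cases h : c = a
    · simp only [h, if_true]
      exact ⟨fun h' => absurd h'.symm hb, fun h' => absurd h'.symm hba⟩
    · simp [h]) x

theorem collapse_eq_self {a : Fin (k + 1)} {x : V k} (hx : bary x a = 0) : (collapse a).fn x = x := by
  refine bary_injective (funext fun b => ?_)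
  rw [bary_ofVertices, ← Finset.sum_subset (Finset.subset_univ {a}ᶜ)]
  · rw [Finset.sum_congr rfl (g := fun c => if c = b then bary x c else 0)]
    · rw [Finset.sum_subset (Finset.subset_univ {a}ᶜ)]
      · simp
      · intro c _ hc
        simp at hc
        simp [hc, hx]
    · intro c hc
      simp at hc
      simp [hc]
  · intro c _ hc
    simp at hc
    simp [hc, hx]

/-- Fillers of horns in the simplicial group of smooth simplices. -/
theorem exists_horn_filler (h : Fin (k + 1) → V k → G) (hh : ∀ a, SSimp d (h a))
    (hc : ∀ a b x, x ∈ Simp k → bary x a = 0 → bary x b = 0 → h a x = h b x)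
    (I : Finset (Fin (k + 1))) (hI : 0 ∉ I) :
    ∃ H : V k → G, SSimp d H ∧ ∀ a ∈ I, ∀ x ∈ Simp k, bary x a = 0 → H x = h a x := by
  induction I using Finset.induction_on with
  | empty => exact ⟨fun _ => 1, contMDiffOn_const, by simp⟩
  | insert a I ha ih =>
    rw [Finset.mem_insert, not_or] at hI
    obtain ⟨H, hH, hHI⟩ := ih hI.2
    -- Moore's correction term. On the face `a` the collapse is the identity, so the value becomes
    -- `h a`. On an earlier face `b` the collapsed point lies on both faces, where `H = h b = h a`,
    -- so the correction is trivial.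
    refine ⟨fun x => H x * ((H ((collapse a).fn x))⁻¹ * h a ((collapse a).fn x)),
      hH.mul ((hH.comp_affMap _).inv.mul ((hh a).comp_affMap _)), fun b hb x hx hxb => ?_⟩
    rcases Finset.mem_insert.1 hb with rfl | hb'
    · simp only [collapse_eq_self hxb, mul_inv_cancel_left]
    · have hb0 : b ≠ 0 := fun h => hI.2 (h ▸ hb')
      have hba : b ≠ a := fun h => ha (h ▸ hb')
      have h1 : bary ((collapse a).fn x) b = 0 := by rw [bary_collapse hb0 hba, hxb]
      have h2 := (collapse a).fn_mem hx
      simp only [hHI b hb' _ h2 h1, hHI b hb' x hx hxb,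
        hc b a _ h2 h1 (bary_collapse_self (Ne.symm hI.1) x), inv_mul_cancel, mul_one]

end Horns

/-! ### Additivity of integrals under pointwise products -/

section Products

variable {n d : ℕ} {G : Type*} [TopologicalSpace G] [ChartedSpace (EuclideanSpace ℝ (Fin d)) G]
  [Group G] [LieGroup (𝓡 d) ∞ G]

local notation "LG" => GroupLieAlgebra (𝓡 d) G

/-- Collapse of the initial vertices. -/
abbrev collapseUpTo (j : ℕ) : AffMap n n :=
  AffMap.ofVertices fun a => if (a : ℕ) ≤ j then 0 else a

theorem sInt_mul_step {m : ExteriorAlgebra ℝ (Dual ℝ LG)} (hm : ceD LG m = 0) {h g : V n → G}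
    (hh : SSimp d h) (hg : SSimp d g) (hg1 : ∀ x ∈ Simp n, (∃ a, bary x a = 0) → g x = 1)
    (j : Fin n) : sInt m (fun x => h x * g x) = sInt m h + sInt m (fun x =>
      h ((AffMap.ofVertices fun a : Fin (n + 1) =>
        if a = j.succ then j.castSucc else a).fn x) * g x) := by
  let A : Fin (n + 1 + 1) → Fin (n + 1) := Fin.predAbove j.castSucc
  let B : Fin (n + 1 + 1) → Fin (n + 1) := Fin.predAbove j.succ
  let W : V (n + 1) → G := fun x => h ((AffMap.ofVertices A).fn x) * g ((AffMap.ofVertices B).fn x)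
  have hW : SSimp d W := (hh.comp_affMap _).mul (hg.comp_affMap _)
  have h1 := sum_sInt_faces hm hW
  have hA : ∀ a, ((A a : Fin (n + 1)) : ℕ) = if (a : ℕ) ≤ j then (a : ℕ) else a - 1 := fun a => by
    simp only [A, Fin.predAbove, Fin.lt_def, Fin.val_castSucc]
    split_ifs <;> simp_all <;> omega
  have hB : ∀ a, ((B a : Fin (n + 1)) : ℕ) = if (a : ℕ) ≤ j + 1 then (a : ℕ) else a - 1 := fun a => by
    simp only [B, Fin.predAbove, Fin.lt_def, Fin.val_castSucc, Fin.val_succ]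
    split_ifs <;> simp_all <;> omega
  have hδ : ∀ (i : Fin (n + 2)) (a : Fin (n + 1)), ((i.succAbove a : Fin (n + 2)) : ℕ) =
      if (a : ℕ) < i then (a : ℕ) else a + 1 := fun i a => by
    simp only [Fin.succAbove, Fin.lt_def]
    split_ifs <;> simp_all
  have hj := j.2
  have face : ∀ i : Fin (n + 2), (fun x => W ((AffMap.ofVertices i.succAbove).fn x)) = fun x =>
      h ((AffMap.ofVertices (A ∘ i.succAbove)).fn x) *
        g ((AffMap.ofVertices (B ∘ i.succAbove)).fn x) := fun i => by
    funext x
    simp only [W, fn_ofVertices_comp]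
  have hgB : ∀ i : Fin (n + 2), (i : ℕ) ≠ j + 1 → (i : ℕ) ≠ j + 2 → ∀ x ∈ Simp n,
      g ((AffMap.ofVertices (B ∘ i.succAbove)).fn x) = 1 := by
    intro i hi1 hi2 x hx
    refine hg1 _ ((AffMap.ofVertices (B ∘ i.succAbove)).fn_mem hx) ⟨B i, ?_⟩
    refine bary_ofVertices_eq_zero (fun a => ?_) x
    rw [Function.comp_apply, Ne, Fin.ext_iff, hB, hB, hδ]
    split_ifs <;> omega
  -- On these faces the factor `g` is evaluated on the boundary and disappears. The factor `h`
  -- remains, undegenerated only on the face `j`.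
  have hone : ∀ i : Fin (n + 2), (i : ℕ) ≠ j + 1 → (i : ℕ) ≠ j + 2 →
      sInt m (fun x => W ((AffMap.ofVertices i.succAbove).fn x)) =
      if (i : ℕ) = j then sInt m h else 0 := by
    intro i hi1 hi2
    rw [face, sInt_congr (h' := fun x => h ((AffMap.ofVertices (A ∘ i.succAbove)).fn x))
      fun x hx => by simp only [hgB i hi1 hi2 x hx, mul_one]]
    split_ifs with hij
    · have : A ∘ i.succAbove = id := funext fun a => Fin.ext (by
        rw [Function.comp_apply, hA, hδ, id]; split_ifs <;> omega)
      simp only [this, AffMap.fn_id]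
    · refine sInt_degenerate hh fun hinj => ?_
      rcases lt_or_ge (i : ℕ) j with hlt | hge
      · have := @hinj ⟨j - 1, by omega⟩ ⟨j, by omega⟩ (Fin.ext (by
          rw [Function.comp_apply, Function.comp_apply, hA, hA, hδ, hδ]
          simp only
          split_ifs <;> omega))
        simp only [Fin.mk.injEq] at this
        omega
      · have := @hinj ⟨j, by omega⟩ ⟨j + 1, by omega⟩ (Fin.ext (by
          rw [Function.comp_apply, Function.comp_apply, hA, hA, hδ, hδ]
          simp only
          split_ifs <;> omega))
        simp only [Fin.mk.injEq] at this
        omega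
  let i1 : Fin (n + 2) := ⟨j + 1, by omega⟩
  let i2 : Fin (n + 2) := ⟨j + 2, by omega⟩
  let i0 : Fin (n + 2) := ⟨j, by omega⟩
  have hi1 : sInt m (fun x => W ((AffMap.ofVertices i1.succAbove).fn x)) =
      sInt m fun x => h x * g x := by
    have e1 : A ∘ i1.succAbove = id := funext fun a => Fin.ext (by
      rw [Function.comp_apply, hA, hδ, id]; simp only [i1]; split_ifs <;> omega)
    have e2 : B ∘ i1.succAbove = id := funext fun a => Fin.ext (by
      rw [Function.comp_apply, hB, hδ, id]; simp only [i1]; split_ifs <;> omega)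
    simp only [face, e1, e2, AffMap.fn_id]
  have hi2 : sInt m (fun x => W ((AffMap.ofVertices i2.succAbove).fn x)) = sInt m (fun x =>
      h ((AffMap.ofVertices fun a : Fin (n + 1) =>
        if a = j.succ then j.castSucc else a).fn x) * g x) := by
    have e1 : A ∘ i2.succAbove = fun a => if a = j.succ then j.castSucc else a :=
      funext fun a => by
        rw [Fin.ext_iff, Function.comp_apply, hA, hδ, apply_ite Fin.val]
        simp only [i2, Fin.ext_iff, Fin.val_succ, Fin.val_castSucc]
        split_ifs <;> omega
    have e2 : B ∘ i2.succAbove = id := funext fun a => Fin.ext (by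
      rw [Function.comp_apply, hB, hδ, id]; simp only [i2]; split_ifs <;> omega)
    simp only [face, e1, e2, AffMap.fn_id]
  have hi0 : sInt m (fun x => W ((AffMap.ofVertices i0.succAbove).fn x)) = sInt m h := by
    rw [hone i0 (by simp [i0]) (by simp [i0]), if_pos rfl]
  have n01 : i0 ≠ i1 := by simp [i0, i1]
  have n02 : i0 ≠ i2 := by simp [i0, i2]
  have n12 : i1 ≠ i2 := by simp [i1, i2]
  rw [← Finset.sum_subset (Finset.subset_univ ({i0, i1, i2} : Finset (Fin (n + 2)))),
    Finset.sum_insert (by simp [n01, n02]), Finset.sum_insert (by simp [n12]),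
    Finset.sum_singleton, hi0, hi1, hi2] at h1
  · simp only [i0, i1, i2, pow_succ] at h1
    have h2 : ((-1 : ℝ) ^ (j : ℕ)) * (sInt m h - sInt m (fun x => h x * g x) + sInt m (fun x =>
      h ((AffMap.ofVertices fun a : Fin (n + 1) =>
        if a = j.succ then j.castSucc else a).fn x) * g x)) = 0 := by
      rw [← h1]; ring
    have h3 := (mul_eq_zero.1 h2).resolve_left (pow_ne_zero _ (by norm_num))
    linarith
  · intro i _ hi
    simp only [Finset.mem_insert, Finset.mem_singleton, not_or, Fin.ext_iff, i0, i1, i2] at hi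
    rw [hone i hi.2.1 hi.2.2, if_neg hi.1, mul_zero]

/-- The integral of a closed left-invariant form is additive for products with a simplex that is
trivial on the boundary. -/
theorem sInt_mul (hn : 0 < n) {m : ExteriorAlgebra ℝ (Dual ℝ LG)} (hm : ceD LG m = 0)
    {h g : V n → G} (hh : SSimp d h) (hg : SSimp d g)
    (hg1 : ∀ x ∈ Simp n, (∃ a, bary x a = 0) → g x = 1) :
    sInt m (fun x => h x * g x) = sInt m h + sInt m g := by
  have hdeg : ∀ j, 0 < j → sInt m (fun x => h ((collapseUpTo j).fn x)) = 0 := by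
    intro j hj
    refine sInt_degenerate hh fun hinj => ?_
    have := @hinj ⟨0, by omega⟩ ⟨1, by omega⟩ (by simp; intro h; omega)
    simp at this
  -- By repeated use of `sInt_mul_step`, `h` is collapsed vertex by vertex until it is constant;
  -- then left invariance removes it. The integrals of the collapsed simplices vanish.
  have key : ∀ j ≤ n, sInt m (fun x => h x * g x) =
      sInt m h + (sInt m (fun x => h ((collapseUpTo j).fn x) * g x) -
        sInt m (fun x => h ((collapseUpTo j).fn x))) := by
    intro j
    induction j with
    | zero =>
      intro _
      have : (fun a : Fin (n + 1) => if (a : ℕ) ≤ 0 then 0 else a) = id := funext fun a => by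
        split_ifs with h
        · exact Fin.ext (by simp; omega)
        · rfl
      simp only [collapseUpTo, this, AffMap.fn_id]
      ring
    | succ j ih =>
      intro hj
      rw [ih (by omega), sInt_mul_step hm (hh.comp_affMap (collapseUpTo j)) hg hg1 ⟨j, by omega⟩,
        hdeg (j + 1) (by omega)]
      have e : (fun a : Fin (n + 1) => if (a : ℕ) ≤ j then 0 else a) ∘ (fun a : Fin (n + 1) =>
          if a = (⟨j, by omega⟩ : Fin n).succ then (⟨j, by omega⟩ : Fin n).castSucc else a) =
          fun a : Fin (n + 1) => if (a : ℕ) ≤ j + 1 then 0 else a := by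
        funext a
        simp only [Function.comp_apply, Fin.ext_iff, Fin.val_succ]
        split_ifs <;> simp_all <;> omega
      simp only [collapseUpTo, fn_ofVertices_comp, e]
      ring
  rw [key n le_rfl, hdeg n hn, sub_zero]
  congr 1
  have : (fun a : Fin (n + 1) => if (a : ℕ) ≤ n then 0 else a) = fun _ => 0 := funext fun a =>
    if_pos (by omega)
  have h2 : ∀ x, h ((AffMap.ofVertices fun _ : Fin (n + 1) => (0 : Fin (n + 1))).fn x) = h 0 := by
    intro x
    congr 1
    ext b
    simp [AffMap.fn, AffMap.ofVertices, (Fin.succ_ne_zero b).symm]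
  simp only [collapseUpTo, this, h2]
  exact sInt_mul_left _ _

end Products

end LieInt

namespace LieInt

/-! ### Gluing maps on the faces of a simplex -/

section Faces

variable {n k j d : ℕ} {G : Type*} [TopologicalSpace G] [ChartedSpace (EuclideanSpace ℝ (Fin d)) G]
  [Group G] [LieGroup (𝓡 d) ∞ G]

local notation "LG" => GroupLieAlgebra (𝓡 d) G

theorem fn_ofVertices_eq_self {θ : Fin (k + 1) → Fin (k + 1)} {x : V k}
    (h : ∀ a, bary x a ≠ 0 → θ a = a) : (AffMap.ofVertices θ).fn x = x := by
  refine bary_injective (funext fun b => ?_)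
  rw [bary_ofVertices]
  have : ∀ a, (if θ a = b then bary x a else 0) = if a = b then bary x a else 0 := fun a => by
    by_cases ha : bary x a = 0
    · simp [ha]
    · rw [h a ha]
  simp [this]

/-- The vertices of the simplex. -/
def vtx (a : Fin (k + 1)) : V k := (AffMap.ofVertices (k := 0) fun _ => a).fn 0

theorem vtx_mem (a : Fin (k + 1)) : vtx a ∈ Simp k := AffMap.fn_mem _ (zero_mem_Simp 0)

theorem bary_vtx {a b : Fin (k + 1)} (h : a ≠ b) : bary (vtx a) b = 0 :=
  bary_ofVertices_eq_zero (fun _ => h) _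

/-- Maps on the faces of the simplex that agree, up to translation, on the intersections of the
faces. -/
def Coherent (h : Fin (k + 1) → V k → G) : Prop :=
  ∀ a b, ∀ z ∈ Simp k, bary z a = 0 → bary z b = 0 → ∀ z' ∈ Simp k, bary z' a = 0 →
    bary z' b = 0 → (h a z)⁻¹ * h a z' = (h b z)⁻¹ * h b z'

omit [LieGroup (𝓡 d) ∞ G] [ChartedSpace (EuclideanSpace ℝ (Fin d)) G] [TopologicalSpace G] in
-- The translations are normalized at the vertex `0` on the faces that contain it, and the remaining
-- face is attached along one of its edges or higher faces. Consistency needs a vertex outside three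
-- given ones, hence `3 ≤ k`; on the boundary of a triangle the holonomy may be nontrivial.
theorem Coherent.exists_translates (hk : 3 ≤ k) {h : Fin (k + 1) → V k → G} (hc : Coherent h) :
    ∃ c : Fin (k + 1) → G, ∀ a b x, x ∈ Simp k → bary x a = 0 → bary x b = 0 →
      c a * h a x = c b * h b x := by
  obtain ⟨k, rfl⟩ : ∃ l, k = l + 3 := ⟨k - 3, by omega⟩
  -- Coherence propagates agreement at one common vertex to the whole intersection of two faces.
  have spread : ∀ (c : Fin (k + 3 + 1) → G) a b v, v ≠ a → v ≠ b →
      c a * h a (vtx v) = c b * h b (vtx v) → ∀ x ∈ Simp (k + 3), bary x a = 0 → bary x b = 0 →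
      c a * h a x = c b * h b x := by
    intro c a b v hva hvb hv x hx hxa hxb
    have h1 := hc a b (vtx v) (vtx_mem v) (bary_vtx hva) (bary_vtx hvb) x hx hxa hxb
    rw [inv_mul_eq_iff_eq_mul] at h1
    rw [h1, ← mul_assoc, hv]
    group
  let t₁ : Fin (k + 3 + 1) := ⟨1, by omega⟩
  let t₂ : Fin (k + 3 + 1) := ⟨2, by omega⟩
  let t₃ : Fin (k + 3 + 1) := ⟨3, by omega⟩
  -- For `a ≠ 0` the translated map is `1` at the vertex `0`. The face opposite to `0` does not
  -- contain that vertex; it is matched with the face opposite to `1` at the vertex `2`.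
  let c : Fin (k + 3 + 1) → G := fun a => if a = 0 then
    (h t₁ (vtx 0))⁻¹ * h t₁ (vtx t₂) * (h 0 (vtx t₂))⁻¹ else (h a (vtx 0))⁻¹
  have h10 : t₁ ≠ 0 := by simp [Fin.ext_iff, t₁]
  have h20 : t₂ ≠ 0 := by simp [Fin.ext_iff, t₂]
  have h21 : t₂ ≠ t₁ := by simp [Fin.ext_iff, t₂, t₁]
  have pos : ∀ a b, a ≠ 0 → b ≠ 0 → ∀ x ∈ Simp (k + 3), bary x a = 0 → bary x b = 0 →
      c a * h a x = c b * h b x := fun a b ha hb =>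
    spread c a b 0 ha.symm hb.symm (by simp [c, ha, hb])
  have zero_one : ∀ x ∈ Simp (k + 3), bary x 0 = 0 → bary x t₁ = 0 → c 0 * h 0 x = c t₁ * h t₁ x :=
    spread c 0 t₁ t₂ h20 h21 (by simp [c, h10])
  have zero : ∀ b, b ≠ 0 → ∀ x ∈ Simp (k + 3), bary x 0 = 0 → bary x b = 0 →
      c 0 * h 0 x = c b * h b x := by
    intro b hb
    -- At such a vertex the face `0` agrees with the face `1`, which agrees with the face `b`.
    obtain ⟨v, hv0, hv1, hvb⟩ : ∃ v : Fin (k + 3 + 1), v ≠ 0 ∧ v ≠ t₁ ∧ v ≠ b := by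
      by_cases h2 : b = t₂
      · refine ⟨t₃, ?_, ?_, ?_⟩ <;> simp [Fin.ext_iff, h2, t₁, t₂, t₃]
      · exact ⟨t₂, h20, h21, Ne.symm h2⟩
    exact spread c 0 b v hv0 hvb
      ((zero_one _ (vtx_mem v) (bary_vtx hv0) (bary_vtx hv1)).trans
        (pos t₁ b h10 hb _ (vtx_mem v) (bary_vtx hv1) (bary_vtx hvb)))
  refine ⟨c, fun a b x hx hxa hxb => ?_⟩
  by_cases ha : a = 0
  · subst ha
    by_cases hb : b = 0
    · rw [hb]
    · exact zero b hb x hx hxa hxb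
  · by_cases hb : b = 0
    · subst hb
      exact (zero a ha x hx hxb hxa).symm
    · exact pos a b ha hb x hx hxa hxb

/-- The alternating sum of the integrals over coherent faces is the integral over a simplex that is
trivial on the boundary. -/
theorem Coherent.exists_sum_eq (hn : 2 ≤ n) {m : ExteriorAlgebra ℝ (Dual ℝ LG)} (hm : ceD LG m = 0)
    {h : Fin (n + 2) → V (n + 1) → G} (hh : ∀ a, SSimp d (h a)) (hc : Coherent h) :
    ∃ g : V n → G, SSimp d g ∧ (∀ x ∈ Simp n, (∃ a, bary x a = 0) → g x = 1) ∧
      ∑ i : Fin (n + 2), (-1 : ℝ) ^ (i : ℕ) *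
        sInt m (fun x => h i ((AffMap.ofVertices i.succAbove).fn x)) = sInt m g := by
  obtain ⟨c, hc⟩ := hc.exists_translates (by omega)
  let h' : Fin (n + 2) → V (n + 1) → G := fun a x => c a * h a x
  have hh' : ∀ a, SSimp d (h' a) := fun a => ContMDiffOn.mul contMDiffOn_const (hh a)
  -- `H` fills all faces except the face `0`. There, `H` and the given map agree on the boundary, so
  -- their quotient is trivial on the boundary and accounts for the failure of Stokes' theorem.
  obtain ⟨H, hH, hHI⟩ := exists_horn_filler h' hh' hc (Finset.univ.erase 0) (by simp)
  have hmem : ∀ (i : Fin (n + 2)), ∀ x ∈ Simp n, (AffMap.ofVertices i.succAbove).fn x ∈ Simp (n + 1) :=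
    fun i x hx => AffMap.fn_mem _ hx
  have hzero : ∀ (i : Fin (n + 2)) (x : V n), bary ((AffMap.ofVertices i.succAbove).fn x) i = 0 :=
    fun i x => bary_ofVertices_eq_zero (fun a => Fin.succAbove_ne i a) x
  have hface : ∀ i : Fin (n + 2), sInt m (fun x => h i ((AffMap.ofVertices i.succAbove).fn x)) =
      sInt m (fun x => h' i ((AffMap.ofVertices i.succAbove).fn x)) := fun i =>
    (sInt_mul_left (c i) _).symm
  let H₀ : V n → G := fun x => H ((AffMap.ofVertices (Fin.succAbove 0)).fn x)
  let h₀ : V n → G := fun x => h' 0 ((AffMap.ofVertices (Fin.succAbove 0)).fn x)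
  have hH₀ : SSimp d H₀ := hH.comp_affMap _
  have hh₀ : SSimp d h₀ := (hh' 0).comp_affMap _
  have hg : SSimp d fun x => (H₀ x)⁻¹ * h₀ x := hH₀.inv.mul hh₀
  have hg1 : ∀ x ∈ Simp n, (∃ a, bary x a = 0) → (H₀ x)⁻¹ * h₀ x = 1 := by
    rintro x hx ⟨a, ha⟩
    have h1 : bary ((AffMap.ofVertices (Fin.succAbove (0 : Fin (n + 2)))).fn x) a.succ = 0 := by
      rw [bary_ofVertices_of_unique (a := a) (fun a' => by simp), ha]
    rw [inv_mul_eq_one]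
    exact (hHI a.succ (by simp) _ (hmem 0 x hx) h1).trans
      (hc _ _ _ (hmem 0 x hx) h1 (hzero 0 x))
  refine ⟨fun x => (H₀ x)⁻¹ * h₀ x, hg, hg1, ?_⟩
  have h2 := sInt_mul (by omega) hm hH₀ hg hg1
  simp only [mul_inv_cancel_left] at h2
  have h3 := sum_sInt_faces hm hH
  rw [Fin.sum_univ_succ] at h3 ⊢
  have h4 : ∀ i : Fin (n + 1),
      sInt m (fun x => H ((AffMap.ofVertices i.succ.succAbove).fn x)) =
      sInt m (fun x => h i.succ ((AffMap.ofVertices i.succ.succAbove).fn x)) := fun i => by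
    rw [hface]
    exact sInt_congr fun x hx => hHI _ (by simp) _ (hmem _ x hx) (hzero _ x)
  simp only [h4] at h3
  rw [hface 0]
  change _ * sInt m h₀ + _ = _
  change _ * sInt m H₀ + _ = _ at h3
  simp only [Fin.val_zero, pow_zero, one_mul] at h3 ⊢
  linarith

end Faces

/-! ### Coboundaries on the coskeleton as integrals over spheres -/

section CoskCells

open Simplicial

variable {n d : ℕ} {G : Type*} [TopologicalSpace G] [ChartedSpace (EuclideanSpace ℝ (Fin d)) G]
  [Group G] [LieGroup (𝓡 d) ∞ G]

local notation "LG" => GroupLieAlgebra (𝓡 d) G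

/-- The covectors of `𝔤` separate vectors, so the forms of degree one determine the Maurer-Cartan
form. -/
theorem MC_eq_of_mcForm_eq {U : CartSp} {k : ℕ} {h h' : V k → G} {u : U.Pt}
    (heq : ∀ a : ExteriorAlgebra ℝ (Dual ℝ LG), mcForm U h a u = mcForm U h' a u) {x : V k}
    (hx : x ∈ Simp k) : MC d (Simp k) h x = MC d (Simp k) h' x := by
  ext1 v
  have h1 : ∀ φ : Dual ℝ LG, φ (MC d (Simp k) h x v : EuclideanSpace ℝ (Fin d)) =
      φ (MC d (Simp k) h' x v : EuclideanSpace ℝ (Fin d)) := by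
    intro φ
    have h2 := congrFun (heq (ExteriorAlgebra.ι ℝ φ)) ⟨x, hx⟩
    have h3 : ∀ h : V k → G, mcForm U h (ExteriorAlgebra.ι ℝ φ) u ⟨x, hx⟩ =
        ExteriorAlgebra.ι ℝ ((toLie G (MC d (Simp k) h x : V k →ₗ[ℝ] _)).dualMap φ) := fun h =>
      ExteriorAlgebra.map_apply_ι _ _
    rw [h3, h3] at h2
    exact LinearMap.congr_fun (ExteriorAlgebra.ι_leftInverse.injective h2) v
  rw [← sub_eq_zero]
  refine (Module.forall_dual_apply_eq_zero_iff ℝ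
    (V := LG) (MC d (Simp k) h x v - MC d (Simp k) h' x v : EuclideanSpace ℝ (Fin d))).1 fun φ => ?_
  exact (map_sub φ _ _).trans (sub_eq_zero.2 (h1 φ))

set_option maxHeartbeats 800000 in
/-- The coboundaries on the coskeleton are integrals over simplices that are trivial on the
boundary. -/
theorem exists_delta_cosk_eq (hn : 2 ≤ n) (μ : DGAlg.Hom (CELine n) (CE LG)) (U : CartSpᵒᵖ)
    (y : ((coskP n (expD (CE LG))).obj U).obj (op ⦋n + 1⦌)) (u : U.unop.Pt) :
    ∃ g : V n → G, SSimp d g ∧ (∀ x ∈ Simp n, (∃ a, bary x a = 0) → g x = 1) ∧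
      (((cocycleCochain μ).cosk).delta U y).1 u = sInt (μ.toAlgHom (lineGen n)) g := by
  obtain ⟨p, rfl⟩ : ∃ p, n = p + 1 := ⟨n - 1, by omega⟩
  let X := expD (CE LG)
  let e := coskEquiv (p + 1) X U
  let Φ : Fin (p + 3) → (X.obj U).obj (op ⦋p + 1⦌) := fun i =>
    e.symm (((coskP (p + 1) X).obj U).map (SimplexCategory.δ i).op y)
  have hΦ : ∀ i, ((toCosk (p + 1) X).app U).app _ (Φ i) =
      ((coskP (p + 1) X).obj U).map (SimplexCategory.δ i).op y := fun i => e.apply_symm_apply _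
  let Ψ : Fin (p + 3) → DGAlg.Hom (CE LG) (Omega U.unop (p + 1)) := Φ
  choose h hh hΦh using fun i => exists_mcForm_eq (Ψ i) u
  -- In dimension `p < n` the cells of the coskeleton are those of `exp_Δ(𝔤)`, so the faces of the
  -- cell have common faces there.
  have hcompat : ∀ (i j : Fin (p + 3)) (ρ ρ' : ⦋p⦌ ⟶ ⦋p + 1⦌),
      ρ ≫ SimplexCategory.δ i = ρ' ≫ SimplexCategory.δ j →
      (X.obj U).map ρ.op (Φ i) = (X.obj U).map ρ'.op (Φ j) := by
    intro i j ρ ρ' hρ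
    apply (cosk_unit_bijective (Nat.le_succ p) (X.obj U)).1
    have h1 : ∀ (i : Fin (p + 3)) (ρ : ⦋p⦌ ⟶ ⦋p + 1⦌),
        ((SSet.coskAdj (p + 1)).unit.app (X.obj U)).app (op ⦋p⦌) ((X.obj U).map ρ.op (Φ i)) =
        ((coskP (p + 1) X).obj U).map (ρ ≫ SimplexCategory.δ i).op y := by
      intro i ρ
      refine (ConcreteCategory.congr_hom (((toCosk (p + 1) X).app U).naturality ρ.op) (Φ i)).trans ?_
      refine (congrArg (((coskP (p + 1) X).obj U).map ρ.op) (hΦ i)).trans ?_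
      rw [op_comp, Functor.map_comp]
      rfl
    exact (h1 i ρ).trans ((congrArg (fun q : ⦋p⦌ ⟶ ⦋p + 2⦌ =>
      ((coskP (p + 1) X).obj U).map q.op y) hρ).trans (h1 j ρ').symm)
  -- On a common face both maps have the same Maurer-Cartan form, hence differ by a left
  -- translation.
  have hMC : ∀ (i j : Fin (p + 3)) (ρ ρ' : ⦋p⦌ ⟶ ⦋p + 1⦌),
      ρ ≫ SimplexCategory.δ i = ρ' ≫ SimplexCategory.δ j → ∀ x ∈ Simp p, ∀ x' ∈ Simp p,
      (h i ((AffMap.ofVertices ρ.toOrderHom).fn x))⁻¹ * h i ((AffMap.ofVertices ρ.toOrderHom).fn x') =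
      (h j ((AffMap.ofVertices ρ'.toOrderHom).fn x))⁻¹ *
        h j ((AffMap.ofVertices ρ'.toOrderHom).fn x') := by
    intro i j ρ ρ' hρ x hx x' hx'
    refine exists_eq_mul_of_MC_eq (d := d)
      (h := fun x => h i ((AffMap.ofVertices ρ.toOrderHom).fn x))
      (h' := fun x => h j ((AffMap.ofVertices ρ'.toOrderHom).fn x)) (Simp_uniqueDiffOn p)
      (convex_Simp p) ((hh i).comp_affMap _) ((hh j).comp_affMap _) (fun z hz => ?_) hx hx'
    refine MC_eq_of_mcForm_eq (U := U.unop) (u := u) (fun a => ?_) hz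
    have h2 : ∀ (i : Fin (p + 3)) (ρ : ⦋p⦌ ⟶ ⦋p + 1⦌),
        mcForm U.unop (fun x => h i ((AffMap.ofVertices ρ.toOrderHom).fn x)) a u =
        (((Ψ i).comp (Omega.pull (𝟙 U.unop) ρ)).toAlgHom a).1 u := by
      intro i ρ
      rw [mcForm_comp_affMap (hh i)]
      funext x
      change ExteriorAlgebra.map _ (mcForm U.unop (h i) a u _) =
        ExteriorAlgebra.map _ (((Ψ i).toAlgHom a).1 u _)
      rw [hΦh i a]
    rw [h2, h2]
    have h3 : (Ψ i).comp (Omega.pull (𝟙 U.unop) ρ) = (Ψ j).comp (Omega.pull (𝟙 U.unop) ρ') :=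
      hcompat i j ρ ρ' hρ
    rw [h3]
  -- A left inverse of the inclusion of the face `i` on vertices, used to extend the map on that
  -- face to the whole simplex.
  let l : Fin (p + 3) → Fin (p + 3) → Fin (p + 2) := fun i => Function.invFun i.succAbove
  have hl : ∀ i, l i ∘ i.succAbove = id := fun i =>
    Function.invFun_comp Fin.succAbove_right_injective
  have hco : Coherent fun i (z : V (p + 2)) => h i ((AffMap.ofVertices (l i)).fn z) := by
    have hlt : ∀ i j : Fin (p + 3), i < j → ∀ z ∈ Simp (p + 2), bary z i = 0 → bary z j = 0 →
        ∀ z' ∈ Simp (p + 2), bary z' i = 0 → bary z' j = 0 →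
        (h i ((AffMap.ofVertices (l i)).fn z))⁻¹ * h i ((AffMap.ofVertices (l i)).fn z') =
        (h j ((AffMap.ofVertices (l j)).fn z))⁻¹ * h j ((AffMap.ofVertices (l j)).fn z') := by
      intro i j hij z hz hzi hzj z' hz' hzi' hzj'
      obtain ⟨i₀, rfl⟩ : ∃ i₀ : Fin (p + 2), i = i₀.castSucc :=
        ⟨i.castPred (Fin.ne_last_of_lt hij), (Fin.castSucc_castPred _ _).symm⟩
      obtain ⟨j₀, rfl⟩ : ∃ j₀ : Fin (p + 2), j = j₀.succ :=
        ⟨j.pred (Fin.ne_zero_of_lt hij), (Fin.succ_pred _ _).symm⟩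
      have hle : i₀ ≤ j₀ := by
        simp only [Fin.lt_def, Fin.val_castSucc, Fin.val_succ, Fin.le_def] at hij ⊢
        omega
      have hδ := SimplexCategory.δ_comp_δ hle
      have hfun : ∀ a, j₀.succ.succAbove (i₀.succAbove a) = i₀.castSucc.succAbove (j₀.succAbove a) :=
        fun a => DFunLike.congr_fun (congrArg SimplexCategory.Hom.toOrderHom hδ) a
      let τ : Fin (p + 1) → Fin (p + 3) := fun a => j₀.succ.succAbove (i₀.succAbove a)
      -- `τ` includes the common face of the faces `i` and `j`, and `κ` is a left inverse on
      -- vertices. Points of the intersection are thus images under `τ`, and both maps are compared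
      -- on its source.
      let κ := Function.invFun τ
      have hκ : ∀ a, a ≠ i₀.castSucc → a ≠ j₀.succ → τ (κ a) = a := by
        intro a hai haj
        apply Function.invFun_eq
        obtain ⟨b, rfl⟩ := Fin.exists_succAbove_eq haj
        have hb : b ≠ i₀ := by
          rintro rfl
          exact hai (Fin.succAbove_of_castSucc_lt _ _ hij)
        obtain ⟨c, rfl⟩ := Fin.exists_succAbove_eq hb
        exact ⟨c, rfl⟩
      have hz1 : ∀ z : V (p + 2), bary z i₀.castSucc = 0 → bary z j₀.succ = 0 →
          (AffMap.ofVertices τ).fn ((AffMap.ofVertices κ).fn z) = z := by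
        intro z h1 h2
        rw [fn_ofVertices_comp]
        refine fn_ofVertices_eq_self fun a ha => hκ a ?_ ?_
        · rintro rfl; exact ha h1
        · rintro rfl; exact ha h2
      have hi : ∀ z : V (p + 2), bary z i₀.castSucc = 0 → bary z j₀.succ = 0 →
          (AffMap.ofVertices (l i₀.castSucc)).fn z = (AffMap.ofVertices
            (SimplexCategory.δ j₀).toOrderHom).fn ((AffMap.ofVertices κ).fn z) := by
        intro z h1 h2
        conv_lhs => rw [← hz1 z h1 h2]
        rw [fn_ofVertices_comp]
        congr 2
        funext a
        exact (congrArg (l i₀.castSucc) (hfun a)).trans (congrFun (hl i₀.castSucc) _)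
      have hj : ∀ z : V (p + 2), bary z i₀.castSucc = 0 → bary z j₀.succ = 0 →
          (AffMap.ofVertices (l j₀.succ)).fn z = (AffMap.ofVertices
            (SimplexCategory.δ i₀).toOrderHom).fn ((AffMap.ofVertices κ).fn z) := by
        intro z h1 h2
        conv_lhs => rw [← hz1 z h1 h2]
        rw [fn_ofVertices_comp]
        congr 2
        funext a
        exact congrFun (hl j₀.succ) _
      rw [hi z hzi hzj, hi z' hzi' hzj', hj z hzi hzj, hj z' hzi' hzj']
      exact hMC _ _ _ _ hδ.symm _ (AffMap.fn_mem _ hz) _ (AffMap.fn_mem _ hz')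
    intro i j z hz hzi hzj z' hz' hzi' hzj'
    rcases lt_trichotomy i j with hij | rfl | hij
    · exact hlt i j hij z hz hzi hzj z' hz' hzi' hzj'
    · rfl
    · exact (hlt j i hij z hz hzj hzi z' hz' hzj' hzi').symm
  obtain ⟨g, hg, hg1, hsum⟩ := hco.exists_sum_eq hn (cocycle_d μ) (d := d)
    fun i => (hh i).comp_affMap _
  refine ⟨g, hg, hg1, ?_⟩
  rw [← hsum, delta_apply]
  refine Finset.sum_congr rfl fun i _ => ?_
  congr 1
  refine (simplexIntegral_eq_sInt (hΦh i _)).trans ?_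
  simp only [fn_ofVertices_comp, hl, AffMap.fn_id]

end CoskCells

end LieInt

namespace LieInt

open MeasureTheory

/-! ### Change of variables for integrals of left-invariant forms -/

section ChangeOfVariables

variable {n d : ℕ} {G : Type*} [TopologicalSpace G] [ChartedSpace (EuclideanSpace ℝ (Fin d)) G]
  [Group G]

local notation "E" => EuclideanSpace ℝ (Fin d)
local notation "LG" => GroupLieAlgebra (𝓡 d) G

/-- On a space of dimension `n`, an alternating `n`-form is a multiple of the determinant in the
standard basis. -/
theorem evalAlt_comp_det {W : Type} [AddCommGroup W] [Module ℝ W] (f : V n →ₗ[ℝ] W)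
    (L : V n →ₗ[ℝ] V n) (m : ExteriorAlgebra ℝ (Dual ℝ W)) :
    evalAlt (fun i => f (L (frame n i))) m =
      LinearMap.det L * evalAlt (fun i => f (frame n i)) m := by
  let e := Pi.basisFun ℝ (Fin n)
  have he : ∀ i, frame n i = e i := fun i => by simp [e]
  rw [← evalAlt_map, ← evalAlt_map f, ← altOf_apply, ← altOf_apply]
  rw [AlternatingMap.eq_smul_basis_det e (altOf (ExteriorAlgebra.map f.dualMap m))]
  have h1 : (fun i => L (frame n i)) = L ∘ e := funext fun i => congrArg L (he i)
  have h2 : frame n = e := funext he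
  rw [h1, h2, AlternatingMap.smul_apply, AlternatingMap.smul_apply, Basis.det_comp, e.det_self]
  simp only [smul_eq_mul]
  ring

/-- The integral over a set of the pullback of a left-invariant form. -/
def mcInt (m : ExteriorAlgebra ℝ (Dual ℝ LG)) (S : Set (V n)) (h : V n → G) : ℝ :=
  ∫ x in S, evalAlt (fun i => toLie G (MC d univ h x : V n →ₗ[ℝ] E) (frame n i)) m

theorem MC_of_mem_nhds {S : Set (V n)} {h : V n → G} {x : V n} (hx : S ∈ 𝓝 x) :
    MC d S h x = MC d univ h x := by
  rw [← MC_inter (s := univ) hx, univ_inter]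

/-- The boundary of a convex set is a null set, and in the interior derivatives within the simplex
are full derivatives. -/
theorem sInt_eq_mcInt (m : ExteriorAlgebra ℝ (Dual ℝ LG)) (h : V n → G) :
    sInt m h = mcInt m (interior (Simp n)) h := by
  have h1 := interior_ae_eq_of_null_frontier (μ := volume) ((convex_Simp n).addHaar_frontier volume)
  rw [sInt, ← setIntegral_congr_set h1, mcInt]
  refine setIntegral_congr_fun isOpen_interior.measurableSet fun x hx => ?_
  simp only [MC_of_mem_nhds (mem_interior_iff_mem_nhds.1 hx)]

variable [LieGroup (𝓡 d) ∞ G]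

/-- `mcPull` is a derivative on the manifold, `MC` one in the chart at `1`; the chart has the
identity as its derivative at `1`. -/
theorem mcPull_eq {F : V n → G} {y : V n} (hF : ContMDiffAt 𝓘(ℝ, V n) (𝓡 d) ∞ F y) (v : V n) :
    mcPull (d := d) F y v = toLie G (MC d univ F y : V n →ₗ[ℝ] E) v := by
  have hg : MDifferentiableAt 𝓘(ℝ, V n) (𝓡 d) (fun z => (F y)⁻¹ * F z) y :=
    (contMDiffWithinAt_mul_left (s := univ) (F y)⁻¹ hF.contMDiffWithinAt).contMDiffAt
      Filter.univ_mem |>.mdifferentiableAt (by simp)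
  have hgy : (F y)⁻¹ * F y = 1 := inv_mul_cancel _
  have hlc : ∀ p : G, p = 1 → MDifferentiableAt (𝓡 d) 𝓘(ℝ, E) (lc d : G → E) p ∧
      (mfderiv (𝓡 d) 𝓘(ℝ, E) (lc d : G → E) p : E →L[ℝ] E) = ContinuousLinearMap.id ℝ E := by
    rintro _ rfl
    exact ⟨(contMDiffAt_lc one_mem_lcSource).mdifferentiableAt (by simp), mfderiv_lc_one⟩
  have h1 := mfderiv_comp (g := (lc d : G → E)) (I'' := 𝓘(ℝ, E)) y (hlc _ hgy).1 hg
  have h2 : (MC d univ F y : V n →L[ℝ] E) = mfderiv 𝓘(ℝ, V n) 𝓘(ℝ, E)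
      ((lc d : G → E) ∘ fun z => (F y)⁻¹ * F z) y := by
    rw [mfderiv_eq_fderiv, MC, fderivWithin_univ]
    rfl
  have h3 : (mfderiv 𝓘(ℝ, V n) (𝓡 d) (fun z => (F y)⁻¹ * F z) y : V n →L[ℝ] E) =
      MC d univ F y := by
    rw [h2, h1]
    have h4 := (hlc _ hgy).2
    ext1 w
    exact (DFunLike.congr_fun h4 _).symm
  exact DFunLike.congr_fun h3 v

/-- The open unit cube. -/
def openCube (n : ℕ) : Set (V n) := pi univ fun _ => Ioo 0 1

theorem isOpen_openCube (n : ℕ) : IsOpen (openCube n) := isOpen_set_pi finite_univ fun _ _ => isOpen_Ioo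

theorem cubeIntegral_eq_mcInt {F : V n → G} (hF : ContMDiff 𝓘(ℝ, V n) (𝓡 d) ∞ F)
    (m : ExteriorAlgebra ℝ (Dual ℝ LG)) : cubeIntegral m F = mcInt m (openCube n) F := by
  have h1 : openCube n =ᵐ[volume] Icc (0 : V n) 1 := Measure.univ_pi_Ioo_ae_eq_Icc
  rw [cubeIntegral, ← setIntegral_congr_set h1, mcInt]
  simp only [mcPull_eq (hF _)]

theorem mcInt_comp {Q O : Set (V n)} (hQ : IsOpen Q) (hO : IsOpen O) {f : V n → V n}
    (hf : DifferentiableOn ℝ f Q) (hfi : InjOn f Q) (hfO : f '' Q = O)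
    (hdet : ∀ y ∈ Q, 0 ≤ (fderiv ℝ f y).det) {h : V n → G}
    (hh : ContMDiffOn 𝓘(ℝ, V n) (𝓡 d) ∞ h O) (m : ExteriorAlgebra ℝ (Dual ℝ LG)) :
    mcInt m Q (fun y => h (f y)) = mcInt m O h := by
  have hfd : ∀ y ∈ Q, HasFDerivAt f (fderiv ℝ f y) y := fun y hy =>
    (hf.differentiableAt (hQ.mem_nhds hy)).hasFDerivAt
  rw [mcInt, mcInt, ← hfO, integral_image_eq_integral_abs_det_fderiv_smul volume hQ.measurableSet
    (fun y hy => (hfd y hy).hasFDerivWithinAt) hfi]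
  refine setIntegral_congr_fun hQ.measurableSet fun y hy => ?_
  have hfy : f y ∈ O := hfO ▸ mem_image_of_mem f hy
  have h1 : MC d univ (fun y => h (f y)) y = (MC d univ h (f y)).comp (fderiv ℝ f y) := by
    rw [← MC_of_mem_nhds (hQ.mem_nhds hy), MC_comp_smooth (t := O) (h := h)
      (hfd y hy).differentiableAt.differentiableWithinAt
      (fun z hz => hfO ▸ mem_image_of_mem f hz) (hh _ hfy) (hQ.uniqueDiffWithinAt hy),
      MC_of_mem_nhds (hO.mem_nhds hfy), (hfd y hy).hasFDerivWithinAt.fderivWithin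
        (hQ.uniqueDiffWithinAt hy)]
  simp only [h1, abs_of_nonneg (hdet y hy), smul_eq_mul]
  exact evalAlt_comp_det (toLie G (MC d univ h (f y) : V n →ₗ[ℝ] E)) (fderiv ℝ f y : V n →ₗ[ℝ] V n) m

end ChangeOfVariables

/-! ### Triangular parametrizations of the cube and the simplex -/

section Triangular

open Real

variable {n : ℕ}

theorem smoothTransition_strictMonoOn : StrictMonoOn smoothTransition (Ioo 0 1) := by
  intro x hx y hy hxy
  have hexp : ∀ {x y : ℝ}, 0 < x → x < y → expNegInvGlue x < expNegInvGlue y := by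
    intro x y hx hxy
    have hy := hx.trans hxy
    simp only [expNegInvGlue, not_le.2 hx, not_le.2 hy, if_false]
    exact Real.exp_lt_exp.2 (neg_lt_neg (inv_strictAnti₀ hx hxy))
  have h1 := hexp hx.1 hxy
  have h2 : expNegInvGlue (1 - y) < expNegInvGlue (1 - x) :=
    hexp (by linarith [hy.2]) (by linarith)
  have p1 := expNegInvGlue.pos_of_pos hx.1
  have p2 : 0 < expNegInvGlue (1 - y) := expNegInvGlue.pos_of_pos (by linarith [hy.2])
  rw [smoothTransition, smoothTransition, div_lt_div_iff₀ (smoothTransition.pos_denom x)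
    (smoothTransition.pos_denom y)]
  nlinarith

theorem exists_smoothTransition_eq {t : ℝ} (ht : t ∈ Ioo (0 : ℝ) 1) :
    ∃ y ∈ Ioo (0 : ℝ) 1, smoothTransition y = t := by
  have h := intermediate_value_Ioo (zero_le_one (α := ℝ)) smoothTransition.continuous.continuousOn
  rw [smoothTransition.zero, smoothTransition.one] at h
  exact h ht

/-- A triangular map. -/
def triMap (c : Fin n → V n → ℝ) (y : V n) : V n := fun i => smoothTransition (y i) * c i y

variable {c : Fin n → V n → ℝ}

theorem contDiff_triMap (hc : ∀ i, ContDiff ℝ ∞ (c i)) : ContDiff ℝ ∞ (triMap c) :=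
  contDiff_pi.2 fun i => (smoothTransition.contDiff.comp (contDiff_apply ℝ ℝ i)).mul (hc i)

/-- The coordinates are recovered one after the other, since `c i` depends only on the earlier ones.
-/
theorem triMap_injOn (hdep : ∀ i y y', (∀ j < i, y j = y' j) → c i y = c i y')
    (hpos : ∀ i, ∀ y ∈ openCube n, 0 < c i y) : InjOn (triMap c) (openCube n) := by
  intro y hy y' hy' h
  have key : ∀ i, y i = y' i := by
    intro i
    induction i using WellFoundedLT.induction with
    | ind i ih =>
      have h1 := congrFun h i
      simp only [triMap] at h1
      rw [hdep i y y' ih] at h1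
      exact smoothTransition_strictMonoOn.injOn (hy i trivial) (hy' i trivial)
        (mul_right_cancel₀ (hpos i y' hy').ne' h1)
  exact funext key

/-- The Jacobian is lower triangular, with the nonnegative diagonal entries `c i y` times the
derivative of `smoothTransition`. -/
theorem det_triMap_nonneg (hc : ∀ i, ContDiff ℝ ∞ (c i))
    (hdep : ∀ i y y', (∀ j < i, y j = y' j) → c i y = c i y')
    {y : V n} (hpos : ∀ i, 0 ≤ c i y) : 0 ≤ (fderiv ℝ (triMap c) y).det := by
  have hT : ∀ t, HasDerivAt smoothTransition (deriv smoothTransition t) t := fun t =>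
    ((smoothTransition.contDiff (n := ⊤)).differentiable (by simp) t).hasDerivAt
  have hcd : ∀ i, HasFDerivAt (c i) (fderiv ℝ (c i) y) y := fun i =>
    ((hc i).differentiable (by simp) y).hasFDerivAt
  have h1 : HasFDerivAt (triMap c) (ContinuousLinearMap.pi fun i =>
      smoothTransition (y i) • fderiv ℝ (c i) y +
        c i y • (deriv smoothTransition (y i) • (ContinuousLinearMap.proj i : V n →L[ℝ] ℝ))) y :=
    hasFDerivAt_pi.2 fun i =>
      ((hT (y i)).comp_hasFDerivAt (f := fun y : V n => y i) y (hasFDerivAt_apply i y)).mul (hcd i)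
  have h2 : ∀ i j, i ≤ j → fderiv ℝ (c i) y (Pi.single j 1) = 0 := by
    intro i j hij
    have h3 := (hcd i).hasLineDerivAt (Pi.single j 1)
    have h4 : (fun t : ℝ => c i (y + t • Pi.single j 1)) = fun _ => c i y := by
      funext t
      refine hdep i _ _ fun l hl => ?_
      simp [(hl.trans_le hij).ne]
    rw [HasLineDerivAt, h4] at h3
    exact h3.unique (hasDerivAt_const _ _)
  rw [h1.fderiv, ContinuousLinearMap.det, ← LinearMap.det_toMatrix', Matrix.det_of_isLowerTriangular]
  · refine Finset.prod_nonneg fun i _ => ?_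
    rw [LinearMap.toMatrix'_apply]
    change 0 ≤ smoothTransition (y i) • fderiv ℝ (c i) y (Pi.single i 1) +
      c i y • (deriv smoothTransition (y i) • (Pi.single i 1 : V n) i)
    rw [h2 i i le_rfl]
    simpa using mul_nonneg (hpos i) smoothTransition.monotone.deriv_nonneg
  · intro i j hij
    rw [LinearMap.toMatrix'_apply]
    change smoothTransition (y i) • fderiv ℝ (c i) y (Pi.single j 1) +
      c i y • (deriv smoothTransition (y i) • (Pi.single j 1 : V n) i) = 0
    have hij' : i < j := hij
    rw [h2 i j hij'.le]
    simp [hij'.ne]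

/-- The smooth parametrization of the simplex by the cube. -/
def simpParam (n : ℕ) : V n → V n := triMap fun i y => ∏ j with j < i, (1 - smoothTransition (y j))

/-- The smooth reparametrization of the cube. -/
def cubeParam (n : ℕ) : V n → V n := triMap fun _ _ => 1

theorem cubeParam_apply (y : V n) (i : Fin n) : cubeParam n y i = smoothTransition (y i) :=
  mul_one _

theorem contDiff_cubeParam : ContDiff ℝ ∞ (cubeParam n) := contDiff_triMap fun _ => contDiff_const

theorem contDiff_simpCoef (i : Fin n) :
    ContDiff ℝ ∞ fun y : V n => ∏ j with j < i, (1 - smoothTransition (y j)) :=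
  contDiff_prod fun j _ => contDiff_const.sub (smoothTransition.contDiff.comp (contDiff_apply ℝ ℝ j))

theorem contDiff_simpParam : ContDiff ℝ ∞ (simpParam n) := contDiff_triMap contDiff_simpCoef

theorem sum_simpParam (y : V n) : 1 - ∑ i, simpParam n y i = ∏ i, (1 - smoothTransition (y i)) :=
  (Finset.prod_one_sub_ordered Finset.univ fun i => smoothTransition (y i)).symm

theorem simpParam_mem (y : V n) : simpParam n y ∈ Simp n := by
  have h0 : ∀ i, 0 ≤ 1 - smoothTransition (y i) := fun i => sub_nonneg.2 (smoothTransition.le_one _)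
  refine ⟨fun i => mul_nonneg (smoothTransition.nonneg _) (Finset.prod_nonneg fun j _ => h0 j), ?_⟩
  have h1 := sum_simpParam y
  have h2 : 0 ≤ ∏ i, (1 - smoothTransition (y i)) := Finset.prod_nonneg fun i _ => h0 i
  linarith

theorem cubeParam_image : cubeParam n '' openCube n = openCube n := by
  refine Subset.antisymm ?_ fun x hx => ?_
  · rintro _ ⟨y, hy, rfl⟩ i -
    rw [cubeParam_apply]
    exact ⟨smoothTransition.pos_of_pos (hy i trivial).1,
      smoothTransition.lt_one_of_lt_one (hy i trivial).2⟩
  · choose y hy hyx using fun i => exists_smoothTransition_eq (hx i trivial)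
    exact ⟨y, fun i _ => hy i, funext fun i => (cubeParam_apply y i).trans (hyx i)⟩

/-- An interior point can be moved by a small amount in both directions of each coordinate, which
excludes equality in the defining inequalities. -/
theorem interior_Simp : interior (Simp n) = {x | (∀ i, 0 < x i) ∧ ∑ i, x i < 1} := by
  have ho : IsOpen {x : V n | (∀ i, 0 < x i) ∧ ∑ i, x i < 1} := by
    have h1 : IsOpen {x : V n | ∀ i, 0 < x i} := by
      simp only [setOf_forall]
      exact isOpen_iInter_of_finite fun i => isOpen_lt continuous_const (continuous_apply i)
    exact h1.inter (isOpen_lt (continuous_finsetSum _ fun i _ => continuous_apply i)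
      continuous_const)
  refine Subset.antisymm (fun x hx => ?_)
    (interior_maximal (fun x hx => ⟨fun i => (hx.1 i).le, hx.2.le⟩) ho)
  have key : ∀ a : ℝ, ∀ᶠ t in 𝓝 (0 : ℝ), ∀ i, (x + (t * a) • (Pi.single i 1 : V n)) ∈ Simp n := by
    intro a
    rw [Filter.eventually_all]
    intro i
    have hc : ContinuousAt (fun t : ℝ => x + (t * a) • (Pi.single i 1 : V n)) 0 := by fun_prop
    exact hc (by simpa using mem_interior_iff_mem_nhds.1 hx)
  have h1 : ∀ a : ℝ, ∃ t : ℝ, 0 < t ∧ ∀ i, (x + (t * a) • (Pi.single i 1 : V n)) ∈ Simp n :=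
    fun a => by
      have h0 : ∀ᶠ t in 𝓝[>] (0 : ℝ), 0 < t := eventually_mem_nhdsWithin
      exact (h0.and ((key a).filter_mono nhdsWithin_le_nhds)).exists
  obtain ⟨t, ht, hm⟩ := h1 (-1)
  obtain ⟨t', ht', hp⟩ := h1 1
  constructor
  · intro i
    have := (hm i).1 i
    simp at this
    linarith
  · rcases Nat.eq_zero_or_pos n with rfl | hn
    · simp
    · have := (hp ⟨0, hn⟩).2
      simp only [mul_one, Pi.add_apply, Pi.smul_apply, smul_eq_mul, Finset.sum_add_distrib,
        ← Finset.mul_sum, Finset.sum_pi_single', Finset.mem_univ, if_true, Pi.single_apply,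
        Finset.sum_ite_eq'] at this
      linarith

theorem simpParam_image : simpParam n '' openCube n = interior (Simp n) := by
  rw [interior_Simp]
  refine Subset.antisymm ?_ fun x hx => ?_
  · rintro _ ⟨y, hy, rfl⟩
    have h0 : ∀ i, 0 < 1 - smoothTransition (y i) := fun i =>
      sub_pos.2 (smoothTransition.lt_one_of_lt_one (hy i trivial).2)
    refine ⟨fun i => mul_pos (smoothTransition.pos_of_pos (hy i trivial).1)
      (Finset.prod_pos fun j _ => h0 j), ?_⟩
    have h1 := sum_simpParam y
    have h2 : 0 < ∏ i, (1 - smoothTransition (y i)) := Finset.prod_pos fun i _ => h0 i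
    linarith
  · let R : Fin n → ℝ := fun i => 1 - ∑ j with j < i, x j
    have hle : ∀ i, ∑ j with j < i, x j + x i ≤ ∑ j, x j := by
      intro i
      have h1 : i ∉ Finset.univ.filter fun j => j < i := by simp
      rw [add_comm, ← Finset.sum_insert h1]
      exact Finset.sum_le_sum_of_subset_of_nonneg (Finset.subset_univ _) fun j _ _ => (hx.1 j).le
    have hR : ∀ i, x i < R i := fun i => by
      have := hle i
      have := hx.2
      simp only [R]
      linarith
    have hR0 : ∀ i, 0 < R i := fun i => (hx.1 i).trans (hR i)
    choose y hy hyx using fun i => exists_smoothTransition_eq (t := x i / R i)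
      ⟨div_pos (hx.1 i) (hR0 i), (div_lt_one (hR0 i)).2 (hR i)⟩
    have key : ∀ i, ∏ j with j < i, (1 - smoothTransition (y j)) = R i := by
      intro i
      induction i using WellFoundedLT.induction with
      | ind i ih =>
        rw [Finset.prod_one_sub_ordered]
        simp only [R]
        congr 1
        refine Finset.sum_congr rfl fun j hj => ?_
        have hji : j < i := (Finset.mem_filter.1 hj).2
        have h2 : (Finset.univ.filter fun l => l < i).filter (fun l => l < j) =
            Finset.univ.filter fun l => l < j := by
          ext l
          simp only [Finset.mem_filter, Finset.mem_univ, true_and, and_iff_right_iff_imp]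
          exact fun hl => hl.trans hji
        rw [h2, ih j hji, hyx, div_mul_cancel₀ _ (hR0 j).ne']
    refine ⟨y, fun i _ => hy i, funext fun i => ?_⟩
    change smoothTransition (y i) * (∏ j with j < i, (1 - smoothTransition (y j))) = x i
    rw [key, hyx, div_mul_cancel₀ _ (hR0 i).ne']

end Triangular

/-! ### Simplices that are trivial on the boundary as cubes -/

section Cubes

variable {n d : ℕ} {G : Type*} [TopologicalSpace G] [ChartedSpace (EuclideanSpace ℝ (Fin d)) G]
  [Group G] [LieGroup (𝓡 d) ∞ G]

local notation "LG" => GroupLieAlgebra (𝓡 d) G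

theorem cubeIntegral_comp_cubeParam {F : V n → G} (hF : ContMDiff 𝓘(ℝ, V n) (𝓡 d) ∞ F)
    (m : ExteriorAlgebra ℝ (Dual ℝ LG)) :
    cubeIntegral m (fun y => F (cubeParam n y)) = cubeIntegral m F := by
  rw [cubeIntegral_eq_mcInt hF, 
    cubeIntegral_eq_mcInt (F := fun y => F (cubeParam n y))
      (hF.comp contDiff_cubeParam.contMDiff)]
  exact mcInt_comp (isOpen_openCube n) (isOpen_openCube n)
    (contDiff_cubeParam.differentiable (by simp)).differentiableOn
    (triMap_injOn (fun _ _ _ _ => rfl) fun _ _ _ => one_pos) cubeParam_image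
    (fun y _ => det_triMap_nonneg (fun _ => contDiff_const) (fun _ _ _ _ => rfl)
      fun _ => zero_le_one) hF.contMDiffOn m

/-- A smooth simplex that is trivial on the boundary, as a smooth map on the cube. -/
theorem exists_cube_of_simplex {g : V n → G} (hg : SSimp d g)
    (hg1 : ∀ x ∈ Simp n, (∃ a, bary x a = 0) → g x = 1) :
    ∃ F : V n → G, ContMDiff 𝓘(ℝ, V n) (𝓡 d) ∞ F ∧ (∀ y, (∃ i, y i ≤ 0 ∨ 1 ≤ y i) → F y = 1) ∧
      ∀ m : ExteriorAlgebra ℝ (Dual ℝ LG), sInt m g = cubeIntegral m F := by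
  have hF : ContMDiff 𝓘(ℝ, V n) (𝓡 d) ∞ fun y => g (simpParam n y) :=
    contMDiffOn_univ.1 (ContMDiffOn.comp (g := g) hg contDiff_simpParam.contMDiff.contMDiffOn
      fun y _ => simpParam_mem y)
  refine ⟨fun y => g (simpParam n y), hF, ?_, fun m => ?_⟩
  · rintro y ⟨i, hi⟩
    refine hg1 _ (simpParam_mem y) ?_
    rcases hi with hi | hi
    · refine ⟨i.succ, ?_⟩
      change simpParam n y i = 0
      rw [simpParam, triMap, Real.smoothTransition.zero_of_nonpos hi, zero_mul]
    · refine ⟨0, ?_⟩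
      change 1 - ∑ i, simpParam n y i = 0
      rw [sum_simpParam]
      exact Finset.prod_eq_zero (Finset.mem_univ i) (by
        rw [Real.smoothTransition.one_of_one_le hi, sub_self])
  · rw [cubeIntegral_eq_mcInt hF, sInt_eq_mcInt]
    refine (mcInt_comp (isOpen_openCube n) isOpen_interior
      (contDiff_simpParam.differentiable (by simp)).differentiableOn
      (triMap_injOn ?_ fun i y hy => ?_) simpParam_image
      (fun y hy => det_triMap_nonneg contDiff_simpCoef ?_ fun i => ?_)
      (ContMDiffOn.mono hg interior_subset) m).symm
    · intro i y y' h
      exact Finset.prod_congr rfl fun j hj => by rw [h j (Finset.mem_filter.1 hj).2]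
    · exact Finset.prod_pos fun j _ =>
        sub_pos.2 (Real.smoothTransition.lt_one_of_lt_one (hy j trivial).2)
    · intro i y y' h
      exact Finset.prod_congr rfl fun j hj => by rw [h j (Finset.mem_filter.1 hj).2]
    · exact Finset.prod_nonneg fun j _ => sub_nonneg.2 (Real.smoothTransition.le_one _)

end Cubes

end LieInt

namespace LieInt

/-! ### Smooth approximation of maps to a Lie group -/

section Approximation

variable {m d : ℕ} {G : Type*} [TopologicalSpace G] [ChartedSpace (EuclideanSpace ℝ (Fin d)) G]
  [Group G]

local notation "E" => EuclideanSpace ℝ (Fin d)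

variable (d G) in
theorem exists_ball_subset_lcTarget : ∃ r > 0, Metric.ball (lc d (1 : G)) r ⊆ lcTarget d G :=
  Metric.isOpen_iff.1 isOpen_lcTarget _ (lc_mem one_mem_lcSource)

variable (d G) in
/-- The preimage of a ball under the chart at `1`. -/
def lcBall (r : ℝ) : Set G := {g | g ∈ lcSource d G ∧ lc d g ∈ Metric.ball (lc d (1 : G)) r}

/-- A map is approximable on `K` if smooth maps come arbitrarily close to it on `K`. -/
def SmoothApproxOn (d : ℕ) {G : Type*} [TopologicalSpace G]
    [ChartedSpace (EuclideanSpace ℝ (Fin d)) G] [Group G] (K : Set (V m)) (F : V m → G) : Prop :=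
  ∀ W ∈ 𝓝 (1 : G), ∃ Q : V m → G, ContMDiff 𝓘(ℝ, V m) (𝓡 d) ∞ Q ∧ ∀ y ∈ K, (F y)⁻¹ * Q y ∈ W

variable [LieGroup (𝓡 d) ∞ G]

theorem continuousOn_lc : ContinuousOn (lc d : G → _) (lcSource d G) := fun _ hg =>
  (contMDiffAt_lc hg).continuousAt.continuousWithinAt

theorem continuousOn_ec : ContinuousOn (ec : _ → G) (lcTarget d G) := fun _ hz =>
  (continuousAt_ec hz).continuousWithinAt

theorem isOpen_lcBall (r : ℝ) : IsOpen (lcBall d G r) :=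
  continuousOn_lc.isOpen_inter_preimage isOpen_lcSource Metric.isOpen_ball

theorem one_mem_lcBall {r : ℝ} (hr : 0 < r) : (1 : G) ∈ lcBall d G r :=
  ⟨one_mem_lcSource, Metric.mem_ball_self hr⟩

/-- The error of the product is `(F')⁻¹ * (F⁻¹ * Q) * F' * ((F')⁻¹ * Q')`. It is near `1` uniformly
over the compact set of values of `F'`, by the tube lemma. -/
theorem SmoothApproxOn.mul {K : Set (V m)} (hK : IsCompact K) {F F' : V m → G}
    (hF' : Continuous F') (h : SmoothApproxOn d K F) (h' : SmoothApproxOn d K F') :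
    SmoothApproxOn d K fun y => F y * F' y := by
  have : IsTopologicalGroup G := topologicalGroup_of_lieGroup (𝓡 d) ∞
  intro W hW
  obtain ⟨W', hW', hWo, h1⟩ := mem_nhds_iff.1 hW
  have hc : Continuous fun p : G × G × G => p.1⁻¹ * p.2.1 * p.1 * p.2.2 := by fun_prop
  obtain ⟨A, B, -, hB, hA1, hB1, hAB⟩ := generalized_tube_lemma (hK.image hF')
    (isCompact_singleton (x := ((1, 1) : G × G))) (hWo.preimage hc) (by
      rintro ⟨g, a, b⟩ ⟨-, hab⟩
      obtain ⟨rfl, rfl⟩ := Prod.ext_iff.1 hab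
      simpa using h1)
  obtain ⟨B1, B2, hB1o, hB2o, h11, h12, hB12⟩ := isOpen_prod_iff.1 hB 1 1 (hB1 rfl)
  obtain ⟨Q, hQ, hQK⟩ := h B1 (hB1o.mem_nhds h11)
  obtain ⟨Q', hQ', hQK'⟩ := h' B2 (hB2o.mem_nhds h12)
  refine ⟨fun y => Q y * Q' y, hQ.mul hQ', fun y hy => hW' ?_⟩
  have := hAB (mk_mem_prod (hA1 (mem_image_of_mem F' hy))
    (hB12 (mk_mem_prod (hQK y hy) (hQK' y hy))))
  simpa [mul_assoc] using this

/-- A map with values in a chart ball is a vector-valued function, which has smooth approximations.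
A minimum of two tolerances keeps them in the ball. -/
theorem smoothApproxOn_of_small {r : ℝ} (hr : Metric.ball (lc d (1 : G)) r ⊆ lcTarget d G)
    {K : Set (V m)} (hK : IsCompact K) {F : V m → G} (hF : Continuous F)
    (hFr : ∀ y, F y ∈ lcBall d G r) : SmoothApproxOn d K F := by
  have : IsTopologicalGroup G := topologicalGroup_of_lieGroup (𝓡 d) ∞
  intro W hW
  obtain ⟨W', hW', hWo, hW1⟩ := mem_nhds_iff.1 hW
  have hv : Continuous fun y => lc d (F y) :=
    continuousOn_lc.comp_continuous hF fun y => (hFr y).1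
  let S : Set (V m × E) := {p | p.2 ∈ Metric.ball (lc d (1 : G)) r ∧ (F p.1)⁻¹ * ec p.2 ∈ W'}
  have hS : IsOpen S := by
    have h1 : ContinuousOn (fun p : V m × E => (F p.1)⁻¹ * ec p.2)
        (Prod.snd ⁻¹' Metric.ball (lc d (1 : G)) r) :=
      ContinuousOn.mul (by fun_prop) (continuousOn_ec.comp continuousOn_snd fun p hp => hr hp)
    exact h1.isOpen_inter_preimage (Metric.isOpen_ball.preimage continuous_snd) hWo
  obtain ⟨δ, hδ, hδS⟩ := (hK.image (f := fun y => (y, lc d (F y)))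
    (by fun_prop)).exists_thickening_subset_open hS (by
      rintro _ ⟨y, -, rfl⟩
      refine ⟨(hFr y).2, ?_⟩
      simpa [ec_lc (hFr y).1] using hW1)
  obtain ⟨w, hw, hwd, -⟩ := hv.exists_contDiff_approx (n := ⊤)
    (ε := fun y => min δ (r - dist (lc d (F y)) (lc d (1 : G)))) (by fun_prop)
    fun y => lt_min hδ (sub_pos.2 (hFr y).2)
  have hwb : ∀ y, w y ∈ Metric.ball (lc d (1 : G)) r := fun y => by
    have h1 := (hwd y).trans_le (min_le_right _ _)
    have h2 := dist_triangle (w y) (lc d (F y)) (lc d (1 : G))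
    rw [Metric.mem_ball]
    linarith
  refine ⟨fun y => ec (w y), fun y => (contMDiffAt_ec (hr (hwb y))).comp y hw.contMDiff.contMDiffAt,
    fun y hy => hW' ?_⟩
  have h3 : (y, w y) ∈ S := hδS (Metric.mem_thickening_iff.2
    ⟨_, mem_image_of_mem _ hy, by
      rw [Prod.dist_eq, dist_self]
      exact max_lt hδ ((hwd y).trans_le (min_le_left _ _))⟩)
  exact h3.2

/-- The map is a product of the constant `f 0` and of many quotients of values at neighbouring
points of a ray. By uniform continuity, each quotient has values in a small ball around `1`, where
`smoothApproxOn_of_small` applies. -/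
theorem smoothApproxOn_comp_bounded {T : V m → V m} {f : V m → G} (hf : Continuous f)
    {R : ℝ} (hT : Continuous T) (hTR : ∀ y, T y ∈ Metric.closedBall 0 R)
    {K : Set (V m)} (hK : IsCompact K) : SmoothApproxOn d K fun y => f (T y) := by
  have : IsTopologicalGroup G := topologicalGroup_of_lieGroup (𝓡 d) ∞
  obtain ⟨r, hr0, hr⟩ := exists_ball_subset_lcTarget d G
  have hc : Continuous fun p : ℝ × ℝ × V m => (f (p.1 • p.2.2))⁻¹ * f (p.2.1 • p.2.2) := by fun_prop
  obtain ⟨δ, hδ, hδS⟩ := ((isCompact_Icc (a := (0 : ℝ)) (b := 1)).prod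
    (isCompact_closedBall (0 : V m) R)).image (f := fun p : ℝ × V m => (p.1, p.1, p.2))
    (by fun_prop) |>.exists_thickening_subset_open ((isOpen_lcBall r).preimage hc) (by
      rintro _ ⟨⟨s, y⟩, -, rfl⟩
      simpa using one_mem_lcBall (d := d) (G := G) hr0)
  obtain ⟨N, hN⟩ := exists_nat_gt δ⁻¹
  have hN0 : (0 : ℝ) < N := (inv_pos.2 hδ).trans hN
  have hstep : ∀ k : ℕ, k ≤ N → SmoothApproxOn d K fun y => f (((k : ℝ) / N) • T y) := by
    intro k
    induction k with
    | zero =>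
      intro _ W hW
      refine ⟨fun _ => f 0, contMDiff_const, fun y _ => ?_⟩
      simpa using mem_of_mem_nhds hW
    | succ k ih =>
      intro hk
      have h1 := (ih (by omega)).mul hK
        (F' := fun y => (f (((k : ℝ) / N) • T y))⁻¹ * f ((((k + 1 : ℕ) : ℝ) / N) • T y))
        (by fun_prop) (smoothApproxOn_of_small hr hK (by fun_prop) fun y => ?_)
      · simpa using h1
      · refine hδS (a := (_, _, T y)) (Metric.mem_thickening_iff.2
          ⟨_, mem_image_of_mem _ (mk_mem_prod (a := ((k : ℝ) / N)) (b := T y) ⟨by positivity, ?_⟩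
            (hTR y)), ?_⟩)
        · rw [div_le_one hN0]
          exact_mod_cast Nat.le_of_succ_le hk
        · simp only [Prod.dist_eq, dist_self]
          refine max_lt hδ (max_lt ?_ hδ)
          rw [Real.dist_eq, ← sub_div]
          push_cast
          rw [add_sub_cancel_left, abs_of_pos (by positivity), div_lt_iff₀ hN0]
          rw [inv_lt_iff_one_lt_mul₀ hδ] at hN
          linarith
  have := hstep N le_rfl
  simpa [div_self hN0.ne'] using this

/-- Truncation of the coordinates at `R` reduces to bounded arguments without changing the map on
`K`. -/
theorem smoothApproxOn_of_continuous {F : V m → G} (hF : Continuous F) {K : Set (V m)}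
    (hK : IsCompact K) : SmoothApproxOn d K F := by
  obtain ⟨R, hR⟩ := hK.isBounded.subset_closedBall 0
  rcases lt_or_ge R 0 with h | h0
  · intro W _
    refine ⟨fun _ => 1, contMDiff_const, fun y hy => ?_⟩
    simpa [Metric.closedBall_eq_empty.2 h] using hR hy
  let T : V m → V m := fun y i => max (-R) (min R (y i))
  have hTR : ∀ y, T y ∈ Metric.closedBall 0 R := fun y => by
    rw [mem_closedBall_zero_iff, pi_norm_le_iff_of_nonneg h0]
    intro i
    rw [Real.norm_eq_abs, abs_le]
    exact ⟨le_max_left _ _, max_le (by linarith) (min_le_left _ _)⟩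
  have hT : Continuous T := by fun_prop
  have hTK : ∀ y ∈ K, T y = y := fun y hy => funext fun i => by
    have h1 := (pi_norm_le_iff_of_nonneg h0).1 (mem_closedBall_zero_iff.1 (hR hy)) i
    rw [Real.norm_eq_abs, abs_le] at h1
    simp only [T]
    rw [min_eq_right h1.2, max_eq_right h1.1]
  intro W hW
  obtain ⟨Q, hQ, h1⟩ := smoothApproxOn_comp_bounded (d := d) hF hT hTR hK W hW
  exact ⟨Q, hQ, fun y hy => by simpa [hTK y hy] using h1 y hy⟩

/-- A continuous map that is smooth off the closed set `C` can be made smooth by a homotopy that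
is supported in a bounded open neighbourhood of `C`. -/
theorem exists_smooth_homotopic {F : V m → G} (hF : Continuous F) {C O : Set (V m)}
    (hC : IsClosed C) (hO : IsOpen O) (hCO : C ⊆ O) (hOb : Bornology.IsBounded O)
    (hFC : ∀ y ∉ C, ContMDiffAt 𝓘(ℝ, V m) (𝓡 d) ∞ F y) :
    ∃ H : ℝ × V m → G, Continuous H ∧ (∀ y, H (0, y) = F y) ∧
      ContMDiff 𝓘(ℝ, V m) (𝓡 d) ∞ (fun y => H (1, y)) ∧ ∀ t, ∀ y ∉ O, H (t, y) = F y := by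
  have : IsTopologicalGroup G := topologicalGroup_of_lieGroup (𝓡 d) ∞
  obtain ⟨r, hr0, hr⟩ := exists_ball_subset_lcTarget d G
  obtain ⟨Q, hQ, hQK⟩ := smoothApproxOn_of_continuous (d := d) hF hOb.isCompact_closure
    (lcBall d G r) ((isOpen_lcBall r).mem_nhds (one_mem_lcBall hr0))
  obtain ⟨χ, h0, h1, hχ⟩ := exists_contMDiffMap_zero_one_nhds_of_isClosed (n := ⊤) 𝓘(ℝ, V m)
    hO.isClosed_compl hC (disjoint_compl_left_iff_subset.2 hCO)
  have hχs : ContDiff ℝ ∞ χ := χ.contMDiff.contDiff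
  have hχc : Continuous χ := hχs.continuous
  have hD : ∀ y ∈ O, (F y)⁻¹ * Q y ∈ lcBall d G r := fun y hy => hQK y (subset_closure hy)
  let τ : ℝ → ℝ := fun t => max 0 (min 1 t)
  -- In the chart, the homotopy follows the segment from `1` to the error `F⁻¹ * Q`, damped by the
  -- cutoff `χ`. At time `1` the result is `Q` near `C`, is `F` off `O`, and elsewhere is smooth
  -- because `F` is smooth off `C`. The clamped time `τ` keeps the segment in the ball for all real
  -- times.
  let z : ℝ × V m → E := fun p =>
    lc d (1 : G) + (τ p.1 * χ p.2) • (lc d ((F p.2)⁻¹ * Q p.2) - lc d (1 : G))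
  have hz1 : ∀ p : ℝ × V m, p.2 ∈ O → z p ∈ Metric.ball (lc d (1 : G)) r := fun p hp =>
    (convex_ball _ _).add_smul_sub_mem (Metric.mem_ball_self hr0) (hD _ hp).2
      ⟨mul_nonneg (le_max_left _ _) (hχ _).1,
        mul_le_one₀ (max_le zero_le_one (min_le_left _ _)) (hχ _).1 (hχ _).2⟩
  have hzF : ∀ p : ℝ × V m, χ p.2 = 0 → F p.2 * ec (z p) = F p.2 := fun p hp => by
    simp only [z, hp, mul_zero, zero_smul, add_zero, ec_lc_one, mul_one]
  have h0' : ∀ y ∉ O, ∀ᶠ q in 𝓝 y, χ q = 0 := mem_nhdsSet_iff_forall.1 h0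
  refine ⟨fun p => F p.2 * ec (z p), continuous_iff_continuousAt.2 fun p => ?_, fun y => ?_,
    fun y => ?_, fun t y hy => hzF (t, y) (h0' y hy).self_of_nhds⟩
  · by_cases hp : p.2 ∈ O
    · have h2 : ContinuousAt (fun p : ℝ × V m => lc d ((F p.2)⁻¹ * Q p.2)) p :=
        (contMDiffAt_lc (hD _ hp).1).continuousAt.comp (f := fun p : ℝ × V m => (F p.2)⁻¹ * Q p.2)
          ((hF.comp continuous_snd).inv.mul (hQ.continuous.comp continuous_snd)).continuousAt
      have hz : ContinuousAt z p := by fun_prop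
      exact (hF.comp continuous_snd).continuousAt.mul
        ((continuousAt_ec (hr (hz1 p hp))).comp hz)
    · refine (hF.comp continuous_snd).continuousAt.congr ?_
      filter_upwards [continuous_snd.continuousAt.eventually (h0' _ hp)] with q hq
      exact (hzF q hq).symm
  · simp [z, τ, ec_lc_one]
  · by_cases hyC : y ∈ C
    · refine (hQ y).congr_of_eventuallyEq ?_
      filter_upwards [mem_nhdsSet_iff_forall.1 h1 y hyC, hO.mem_nhds (hCO hyC)] with q hq hqO
      simp [z, τ, hq, ec_lc (hD q hqO).1]
    by_cases hy : y ∈ O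
    · have h2 : ContDiffAt ℝ ∞ (fun q => lc d ((F q)⁻¹ * Q q)) y :=
        contDiffWithinAt_univ.1 (contDiffWithinAt_lc_comp
          (((hFC y hyC).inv.mul (hQ y)).contMDiffWithinAt) (hD y hy).1)
      have hz : ContDiffAt ℝ ∞ (fun q => z (1, q)) y :=
        contDiffAt_const.add (ContDiffAt.fun_smul (f := fun q => τ 1 * χ q)
          (contDiffAt_const.mul hχs.contDiffAt) (h2.sub contDiffAt_const))
      exact (hFC y hyC).mul
        (ContMDiffAt.comp y (contMDiffAt_ec (hr (hz1 (1, y) hy))) hz.contMDiffAt)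
    · refine (hFC y hyC).congr_of_eventuallyEq ?_
      filter_upwards [h0' y hy] with q hq
      exact hzF (1, q) hq

end Approximation

end LieInt

namespace LieInt

/-! ### Integrals over smooth cubes -/

section SmoothCubes

open MeasureTheory

variable {n d : ℕ} {G : Type*} [TopologicalSpace G] [ChartedSpace (EuclideanSpace ℝ (Fin d)) G]
  [Group G]

local notation "E" => EuclideanSpace ℝ (Fin d)
local notation "LG" => GroupLieAlgebra (𝓡 d) G

/-- The smooth maps that are trivial outside of the open unit cube. -/
structure SmoothCube (d : ℕ) {G : Type*} [TopologicalSpace G]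
    [ChartedSpace (EuclideanSpace ℝ (Fin d)) G] [Group G] (F : V n → G) : Prop where
  smooth : ContMDiff 𝓘(ℝ, V n) (𝓡 d) ∞ F
  trivial : ∀ y ∉ openCube n, F y = 1

/-- Off the closure of `S` the map is locally constant, so the integrand vanishes there (in positive
degree), and the frontier of a convex set is a null set. -/
theorem mcInt_eq_of_trivial (hn : 0 < n) {S S' : Set (V n)} (hS : Convex ℝ S)
    (hS' : MeasurableSet S') (hSS' : S ⊆ S') {F : V n → G} (hF : ∀ y ∉ S, F y = 1)
    (m : ExteriorAlgebra ℝ (Dual ℝ LG)) : mcInt m S' F = mcInt m S F := by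
  have h1 : ∀ᵐ y, y ∉ frontier S := measure_eq_zero_iff_ae_notMem.1 (hS.addHaar_frontier volume)
  refine setIntegral_eq_of_subset_of_ae_sdiff_eq_zero hS'.nullMeasurableSet hSS' ?_
  filter_upwards [h1] with y hy hyS
  have hyc : y ∉ closure S := fun hyc => hy ⟨hyc, fun hi => hyS.2 (interior_subset hi)⟩
  have h2 : F =ᶠ[𝓝 y] fun _ => 1 := by
    filter_upwards [isClosed_closure.isOpen_compl.mem_nhds hyc] with z hz
    exact hF z fun h => hz (subset_closure h)
  have h3 : MC d univ F y = 0 := by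
    rw [MC_congr (nhdsWithin_univ y ▸ h2) h2.self_of_nhds]
    simp [MC]
  refine evalAlt_eq_zero (fun hli => hli.ne_zero ⟨0, hn⟩ ?_) _
  rw [h3]
  rfl

variable [LieGroup (𝓡 d) ∞ G]

/-- A dilation of the coordinates, followed by a translation. -/
def diagMap (a b : V n) (y : V n) : V n := fun i => a i * y i + b i

theorem contDiff_diagMap (a b : V n) : ContDiff ℝ ∞ (diagMap a b) := by
  unfold diagMap
  fun_prop

theorem mcInt_comp_diagMap {a : V n} (b : V n) (ha : ∀ i, 0 < a i) {O : Set (V n)} (hO : IsOpen O)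
    {h : V n → G} (hh : ContMDiffOn 𝓘(ℝ, V n) (𝓡 d) ∞ h O) (m : ExteriorAlgebra ℝ (Dual ℝ LG)) :
    mcInt m (diagMap a b ⁻¹' O) (fun y => h (diagMap a b y)) = mcInt m O h := by
  have hd := (contDiff_diagMap a b).differentiable (by simp)
  have hs : Function.Surjective (diagMap a b) := fun x =>
    ⟨fun i => (x i - b i) / a i, funext fun i => by
      simp only [diagMap]
      rw [mul_div_cancel₀ _ (ha i).ne']
      ring⟩
  refine mcInt_comp (hO.preimage hd.continuous) hO hd.differentiableOn (fun x _ y _ hxy => ?_)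
    (image_preimage_eq _ hs) (fun y _ => ?_) hh m
  · funext i
    have := congrFun hxy i
    simp only [diagMap, add_left_inj] at this
    exact mul_left_cancel₀ (ha i).ne' this
  · have h1 : HasFDerivAt (diagMap a b)
        (ContinuousLinearMap.pi fun i => a i • ContinuousLinearMap.proj (R := ℝ) i) y :=
      hasFDerivAt_pi.2 fun i => (((ContinuousLinearMap.proj (R := ℝ) (φ := fun _ : Fin n => ℝ)
        i).hasFDerivAt (x := y)).const_mul (a i)).add_const (b i)
    rw [h1.fderiv, ContinuousLinearMap.det]
    have h2 : ((ContinuousLinearMap.pi fun i => a i • ContinuousLinearMap.proj (R := ℝ) i :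
        V n →L[ℝ] V n) : V n →ₗ[ℝ] V n) =
        LinearMap.pi fun i => (a i • LinearMap.id : ℝ →ₗ[ℝ] ℝ) ∘ₗ LinearMap.proj i := by
      ext; simp
    rw [h2, LinearMap.det_pi]
    refine Finset.prod_nonneg fun i _ => ?_
    simp [(ha i).le]

theorem convex_openCube : Convex ℝ (openCube n) := convex_pi fun _ _ => convex_Ioo _ _

theorem convex_diagMap_preimage (a b : V n) {S : Set (V n)} (hS : Convex ℝ S) :
    Convex ℝ (diagMap a b ⁻¹' S) := by
  intro x hx y hy s t hs ht hst
  have h1 : diagMap a b (s • x + t • y) = s • diagMap a b x + t • diagMap a b y := by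
    funext i
    simp only [diagMap, Pi.add_apply, Pi.smul_apply, smul_eq_mul]
    linear_combination (- b i) * hst
  rw [mem_preimage, h1]
  exact hS hx hy hs ht hst

theorem SmoothCube.mcInt_diagMap (hn : 0 < n) {F : V n → G} (hF : SmoothCube d F) {a : V n}
    (b : V n) (ha : ∀ i, 0 < a i) {S : Set (V n)} (hS : MeasurableSet S)
    (hab : diagMap a b ⁻¹' openCube n ⊆ S) (m : ExteriorAlgebra ℝ (Dual ℝ LG)) :
    mcInt m S (fun y => F (diagMap a b y)) = cubeIntegral m F := by
  rw [cubeIntegral_eq_mcInt hF.smooth, ← mcInt_comp_diagMap b ha (isOpen_openCube n)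
    hF.smooth.contMDiffOn]
  exact mcInt_eq_of_trivial hn (convex_diagMap_preimage a b convex_openCube) hS hab
    (fun y hy => hF.trivial _ hy) m

theorem SmoothCube.comp_diagMap {F : V n → G} (hF : SmoothCube d F) {a b : V n}
    (hab : diagMap a b ⁻¹' openCube n ⊆ openCube n) : SmoothCube d fun y => F (diagMap a b y) :=
  ⟨hF.smooth.comp (contDiff_diagMap a b).contMDiff, fun y hy => hF.trivial _ fun h => hy (hab h)⟩

theorem SmoothCube.cubeIntegral_comp_diagMap (hn : 0 < n) {F : V n → G} (hF : SmoothCube d F)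
    {a b : V n} (ha : ∀ i, 0 < a i) (hab : diagMap a b ⁻¹' openCube n ⊆ openCube n)
    (m : ExteriorAlgebra ℝ (Dual ℝ LG)) :
    cubeIntegral m (fun y => F (diagMap a b y)) = cubeIntegral m F := by
  rw [cubeIntegral_eq_mcInt (hF.comp_diagMap hab).smooth]
  exact hF.mcInt_diagMap hn b ha (isOpen_openCube n).measurableSet hab m

theorem SmoothCube.mul {F F' : V n → G} (hF : SmoothCube d F) (hF' : SmoothCube d F') :
    SmoothCube d fun y => F y * F' y :=
  ⟨hF.smooth.mul hF'.smooth, fun y hy => by rw [hF.trivial y hy, hF'.trivial y hy, one_mul]⟩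

/-- An affine map that maps the interior of the simplex over the cube `[-1, 2]ⁿ`. -/
def stretch (n : ℕ) : V n → V n := diagMap (fun _ => 8 * n) fun _ => -2

theorem stretch_apply (x : V n) (i : Fin n) : stretch n x i = 8 * n * x i - 2 := rfl

/-- The preimage of the cube `(-1, 2)ⁿ` consists of points with coordinates between `1 / (8n)` and
`1 / (2n)`. Their sum is at most `1 / 2`, which leaves the margin needed in the proof of homotopy
invariance. -/
theorem lt_of_stretch {x : V n} (hx : ∀ i, -1 < stretch n x i ∧ stretch n x i < 2) :
    (∀ i, 1 < 8 * n * x i) ∧ 2 * ∑ i, x i ≤ 1 := by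
  simp only [stretch_apply] at hx
  refine ⟨fun i => by linarith [(hx i).1], ?_⟩
  rcases Nat.eq_zero_or_pos n with rfl | hn
  · simp
  have hn' : (0 : ℝ) < n := by exact_mod_cast hn
  have h1 : ∑ i, x i ≤ ∑ _i : Fin n, 1 / (2 * n : ℝ) := Finset.sum_le_sum fun i _ => by
    rw [le_div_iff₀ (by positivity)]
    linarith [(hx i).2]
  simp only [Finset.sum_const, Finset.card_univ, Fintype.card_fin, nsmul_eq_mul] at h1
  have h2 : (n : ℝ) * (1 / (2 * n)) = 1 / 2 := by field_simp
  linarith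

theorem stretch_preimage_subset (hn : 0 < n) : stretch n ⁻¹' openCube n ⊆ interior (Simp n) := by
  intro x hx
  have h := lt_of_stretch (x := x) fun i =>
    ⟨by linarith [(hx i trivial).1], by linarith [(hx i trivial).2]⟩
  rw [interior_Simp]
  have hn' : (0 : ℝ) < n := by exact_mod_cast hn
  exact ⟨fun i => pos_of_mul_pos_right (one_pos.trans (h.1 i)) (by positivity), by linarith [h.2]⟩

theorem SmoothCube.sInt_stretch (hn : 0 < n) {F : V n → G} (hF : SmoothCube d F)
    (m : ExteriorAlgebra ℝ (Dual ℝ LG)) : sInt m (fun x => F (stretch n x)) = cubeIntegral m F := by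
  rw [sInt_eq_mcInt]
  exact hF.mcInt_diagMap hn _ (fun _ => by have : (0 : ℝ) < n := by exact_mod_cast hn
                                           positivity) isOpen_interior.measurableSet
    (stretch_preimage_subset hn) m

theorem SmoothCube.sSimp_stretch {F : V n → G} (hF : SmoothCube d F) :
    SSimp d fun x => F (stretch n x) :=
  (hF.smooth.comp (contDiff_diagMap _ _).contMDiff).contMDiffOn

theorem SmoothCube.stretch_eq_one (hn : 0 < n) {F : V n → G} (hF : SmoothCube d F) {x : V n}
    (hx : x ∉ interior (Simp n)) : F (stretch n x) = 1 :=
  hF.trivial _ fun h => hx (stretch_preimage_subset hn h)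

theorem notMem_interior_Simp {x : V n} (hx : ∃ a, bary x a = 0) : x ∉ interior (Simp n) := by
  rw [interior_Simp]
  rintro ⟨h1, h2⟩
  obtain ⟨a, ha⟩ := hx
  refine Fin.cases (fun h => ?_) (fun i h => (h1 i).ne' h) a ha
  simp only [bary, Fin.cons_zero] at h
  linarith

/-- Stretched, both cubes become simplices that are trivial on the boundary, to which `sInt_mul`
applies. -/
theorem SmoothCube.cubeIntegral_mul (hn : 0 < n) {m : ExteriorAlgebra ℝ (Dual ℝ LG)}
    (hm : ceD LG m = 0) {F F' : V n → G} (hF : SmoothCube d F) (hF' : SmoothCube d F') :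
    cubeIntegral m (fun y => F y * F' y) = cubeIntegral m F + cubeIntegral m F' := by
  rw [← (hF.mul hF').sInt_stretch hn, ← hF.sInt_stretch hn, ← hF'.sInt_stretch hn]
  exact sInt_mul hn hm hF.sSimp_stretch hF'.sSimp_stretch fun x _ hx =>
    hF'.stretch_eq_one hn (notMem_interior_Simp hx)

end SmoothCubes

end LieInt

namespace LieInt

/-! ### Smooth representatives of homotopy classes -/

section Loops

open scoped unitInterval

variable {n d : ℕ} {G : Type*} [TopologicalSpace G] [ChartedSpace (EuclideanSpace ℝ (Fin d)) G]
  [Group G]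

local notation "E" => EuclideanSpace ℝ (Fin d)
local notation "LG" => GroupLieAlgebra (𝓡 d) G

/-- A point of the cube as a point of the coordinate space. -/
def cubeVal (y : Fin n → I) : V n := fun i => y i

/-- The retraction of the coordinate space onto the cube. -/
def clamp (y : V n) : Fin n → I := fun i => projIcc 0 1 zero_le_one (y i)

theorem continuous_cubeVal : Continuous (cubeVal (n := n)) := by
  unfold cubeVal
  fun_prop

theorem continuous_clamp : Continuous (clamp (n := n)) :=
  continuous_pi fun i => continuous_projIcc.comp (continuous_apply i)

theorem clamp_cubeVal (y : Fin n → I) : clamp (cubeVal y) = y :=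
  funext fun i => projIcc_val zero_le_one (y i)

theorem notMem_openCube {y : V n} : y ∉ openCube n ↔ ∃ i, y i ≤ 0 ∨ 1 ≤ y i := by
  simp only [openCube, mem_univ_pi, mem_Ioo, not_forall, not_and_or, not_lt]

theorem clamp_mem_boundary {y : V n} (hy : y ∉ openCube n) : clamp y ∈ Cube.boundary (Fin n) := by
  obtain ⟨i, h | h⟩ := notMem_openCube.1 hy
  · exact ⟨i, Or.inl (projIcc_of_le_left _ h)⟩
  · exact ⟨i, Or.inr (projIcc_of_right_le _ h)⟩

theorem cubeVal_notMem {y : Fin n → I} (hy : y ∈ Cube.boundary (Fin n)) :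
    cubeVal y ∉ openCube n := by
  obtain ⟨i, h | h⟩ := hy
  · exact notMem_openCube.2 ⟨i, Or.inl (by simp [cubeVal, h])⟩
  · exact notMem_openCube.2 ⟨i, Or.inr (by simp [cubeVal, h])⟩

theorem eq_cubeVal_clamp {y : V n} (hy : y ∈ openCube n) : cubeVal (clamp y) = y :=
  funext fun i => by
    simp only [cubeVal, clamp]
    rw [projIcc_of_mem zero_le_one ⟨(hy i trivial).1.le, (hy i trivial).2.le⟩]

theorem homotopic_of_extension {f g : GenLoop (Fin n) G 1} (K : ℝ × V n → G) (hK : Continuous K)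
    (h0 : ∀ y, K (0, cubeVal y) = f y) (h1 : ∀ y, K (1, cubeVal y) = g y)
    (hb : ∀ t ∈ Icc (0 : ℝ) 1, ∀ y ∈ Cube.boundary (Fin n), K (t, cubeVal y) = 1) :
    GenLoop.Homotopic f g :=
  ⟨{ toFun := fun p => K (p.1, cubeVal p.2)
     continuous_toFun := by
      have := continuous_cubeVal (n := n)
      fun_prop
     map_zero_left := h0
     map_one_left := h1
     prop' := fun t y hy => (hb t t.2 y hy).trans (f.2 y hy).symm }⟩

/-- The based map of the cube given by a smooth cube. -/
def SmoothCube.toGenLoop {F : V n → G} (hF : SmoothCube d F) : GenLoop (Fin n) G 1 :=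
  ⟨⟨fun y => F (cubeVal y), hF.smooth.continuous.comp continuous_cubeVal⟩,
    fun _ hy => hF.trivial _ (cubeVal_notMem hy)⟩

theorem SmoothCube.toGenLoop_apply {F : V n → G} (hF : SmoothCube d F) (y : Fin n → I) :
    hF.toGenLoop y = F (cubeVal y) := rfl

/-- Smoothing the parametrization of a smooth based map of the cube. -/
theorem exists_smoothCube_of_smooth {F : V n → G} (hF : ContMDiff 𝓘(ℝ, V n) (𝓡 d) ∞ F)
    {f : GenLoop (Fin n) G 1} (hf : ∀ y, f y = F (cubeVal y)) :
    ∃ h : SmoothCube d fun y => F (cubeParam n y), GenLoop.Homotopic f h.toGenLoop := by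
  have h1 : ∀ y ∈ Cube.boundary (Fin n), F (cubeVal y) = 1 := fun y hy =>
    (hf y).symm.trans (f.2 y hy)
  -- `cubeParam` takes values in the closed unit cube and sends the complement of the open cube to
  -- its boundary. Hence `F ∘ cubeParam` is trivial there, though `F` itself may be arbitrary
  -- outside of the cube.
  have h2 : ∀ y, cubeVal (clamp (cubeParam n y)) = cubeParam n y := fun y => funext fun i => by
    simp only [cubeVal, clamp]
    rw [projIcc_of_mem zero_le_one]
    rw [cubeParam_apply]
    exact ⟨Real.smoothTransition.nonneg _, Real.smoothTransition.le_one _⟩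
  have h3 : ∀ {y : V n} {i}, y i ≤ 0 → cubeParam n y i = 0 := fun h => by
    rw [cubeParam_apply, Real.smoothTransition.zero_of_nonpos h]
  have h4 : ∀ {y : V n} {i}, 1 ≤ y i → cubeParam n y i = 1 := fun h => by
    rw [cubeParam_apply, Real.smoothTransition.one_of_one_le h]
  have h : SmoothCube d fun y => F (cubeParam n y) := by
    refine ⟨hF.comp contDiff_cubeParam.contMDiff, fun y hy => ?_⟩
    rw [← h2, h1 _ (clamp_mem_boundary _)]
    obtain ⟨i, hi | hi⟩ := notMem_openCube.1 hy
    · exact notMem_openCube.2 ⟨i, Or.inl (h3 hi).le⟩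
    · exact notMem_openCube.2 ⟨i, Or.inr (h4 hi).ge⟩
  have hc : Continuous (cubeParam n) := contDiff_cubeParam.continuous
  have hFc : Continuous F := hF.continuous
  -- The homotopy is the linear one between the identity and the reparametrization; it preserves
  -- every facet of the cube.
  refine ⟨h, homotopic_of_extension (fun p => F ((1 - p.1) • p.2 + p.1 • cubeParam n p.2))
    (by fun_prop) (fun y => by simp [hf]) (fun y => by simp [h.toGenLoop_apply]) ?_⟩
  rintro t ht y ⟨i, hi⟩
  have h5 : ∀ i, ((1 - t) • cubeVal y + t • cubeParam n (cubeVal y)) i ∈ Icc (0 : ℝ) 1 := fun i =>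
    (convex_Icc (0 : ℝ) 1) (y i).2 (by
      rw [cubeParam_apply]
      exact ⟨Real.smoothTransition.nonneg _, Real.smoothTransition.le_one _⟩)
      (sub_nonneg.2 ht.2) ht.1 (by ring)
  have h6 := h1 (fun i => ⟨_, h5 i⟩) ⟨i, by
    rcases hi with hi | hi
    · left
      have : cubeVal y i = 0 := by simp [cubeVal, hi]
      ext
      simp [h3 this.le, this]
    · right
      have : cubeVal y i = 1 := by simp [cubeVal, hi]
      ext
      simp [h4 this.ge, this]⟩
  exact h6

/-- Every class in the homotopy group contains a smooth cube. -/
theorem exists_smoothCube (d : ℕ) {G : Type*} [TopologicalSpace G]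
    [ChartedSpace (EuclideanSpace ℝ (Fin d)) G] [Group G] [LieGroup (𝓡 d) ∞ G]
    (f : GenLoop (Fin n) G 1) :
    ∃ F : V n → G, ∃ h : SmoothCube d F, GenLoop.Homotopic f h.toGenLoop := by
  let O : Set (V n) := pi univ fun _ => Ioo (-1) 2
  have hfT : Continuous fun y => f (clamp y) := f.1.continuous.comp continuous_clamp
  have hf1 : ∀ y ∉ openCube n, f (clamp y) = 1 := fun y hy => f.2 _ (clamp_mem_boundary hy)
  obtain ⟨H, hH, hH0, hHs, hHO⟩ := exists_smooth_homotopic (d := d) hfT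
    (C := Icc 0 1) (O := O) isClosed_Icc (isOpen_set_pi finite_univ fun _ _ => isOpen_Ioo)
    (fun y hy i _ => by
      have h1 : 0 ≤ y i := hy.1 i
      have h2 : y i ≤ 1 := hy.2 i
      exact ⟨by linarith, by linarith⟩)
    (Bornology.IsBounded.pi fun _ => Metric.isBounded_Ioo _ _) (fun y hy => by
      refine (contMDiffAt_const (c := (1 : G))).congr_of_eventuallyEq ?_
      filter_upwards [isClosed_Icc.isOpen_compl.mem_nhds hy] with z hz
      refine hf1 z fun h => hz ⟨fun i => (h i trivial).1.le, fun i => (h i trivial).2.le⟩)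
  -- The smoothing takes place in `(-1, 2)ⁿ`, which exceeds the unit cube. `A` maps the unit cube
  -- onto `[-1, 2]ⁿ`, so precomposition with it gives a map that is trivial outside of the open unit
  -- cube.
  let A : V n → V n := diagMap (fun _ => 3) fun _ => -1
  have hA : ContDiff ℝ ∞ A := contDiff_diagMap _ _
  have hAO : ∀ y ∉ openCube n, A y ∉ O := fun y hy h => hy fun i _ => by
    have := h i trivial
    simp only [A, diagMap, mem_Ioo] at this
    exact ⟨by linarith [this.1], by linarith [this.2]⟩
  have hA1 : ∀ y ∉ openCube n, f (clamp (A y)) = 1 := fun y hy => hf1 _ fun h =>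
    hAO y hy fun i _ => ⟨by linarith [(h i trivial).1], by linarith [(h i trivial).2]⟩
  have hF : SmoothCube d fun y => H (1, A y) :=
    ⟨hHs.comp hA.contMDiff, fun y hy => by rw [hHO _ _ (hAO y hy), hA1 y hy]⟩
  have hAc : Continuous A := hA.continuous
  -- The intermediate map `g` separates the rescaling by `A` from the smoothing homotopy.
  let g : GenLoop (Fin n) G 1 := ⟨⟨fun y => f (clamp (A (cubeVal y))),
    hfT.comp (hAc.comp continuous_cubeVal)⟩, fun y hy => hA1 _ (cubeVal_notMem hy)⟩
  refine ⟨_, hF, GenLoop.Homotopic.trans (g := g) ?_ ?_⟩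
  · refine homotopic_of_extension (fun p => f (clamp ((1 - p.1) • p.2 + p.1 • A p.2)))
      (hfT.comp (by fun_prop)) (fun y => by simp [clamp_cubeVal])
      (fun y => by simp; rfl) ?_
    rintro t ht y hy
    refine hf1 _ ?_
    obtain ⟨i, hi⟩ := hy
    rw [notMem_openCube]
    refine ⟨i, hi.imp (fun hi => ?_) fun hi => ?_⟩ <;>
    · simp [A, diagMap, cubeVal, hi]
      linarith [ht.1, ht.2]
  · exact homotopic_of_extension (fun p => H (p.1, A p.2)) (by fun_prop) (fun y => hH0 _)
      (fun y => rfl) fun t _ y hy => (hHO _ _ (hAO _ (cubeVal_notMem hy))).trans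
        (hA1 _ (cubeVal_notMem hy))

end Loops

end LieInt

namespace LieInt

/-! ### Homotopy invariance of the integrals -/

section HomotopyInvariance

open scoped unitInterval

variable {n d : ℕ} {G : Type*} [TopologicalSpace G] [ChartedSpace (EuclideanSpace ℝ (Fin d)) G]
  [Group G]

local notation "E" => EuclideanSpace ℝ (Fin d)
local notation "LG" => GroupLieAlgebra (𝓡 d) G

theorem sInt_const (hn : 0 < n) (m : ExteriorAlgebra ℝ (Dual ℝ LG)) (g : G) :
    sInt m (fun _ : V n => g) = 0 := by
  refine MeasureTheory.setIntegral_eq_zero_of_forall_eq_zero fun x _ => evalAlt_eq_zero ?_ _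
  refine fun hli => hli.ne_zero ⟨0, hn⟩ ?_
  rw [show MC d (Simp n) (fun _ => g) x = 0 by simp [MC]]
  rfl

/-- A simplex of dimension `n + 1` all of whose faces but the first two are trivial has equal
integrals over the first two. -/
theorem sInt_face_eq [LieGroup (𝓡 d) ∞ G] (hn : 0 < n) {m : ExteriorAlgebra ℝ (Dual ℝ LG)}
    (hm : ceD LG m = 0) {W : V (n + 1) → G} (hW : SSimp d W)
    (h1 : ∀ x ∈ Simp (n + 1), ∀ j : Fin n, x j.succ = 0 → W x = 1) :
    sInt m (fun x => W (bary x)) = sInt m (fun x => W (Fin.cons 0 x)) := by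
  have h := sum_sInt_faces hm hW
  rw [Fin.sum_univ_succ, Fin.sum_univ_succ] at h
  have hrest : ∀ j : Fin n, sInt m (fun x => W ((AffMap.ofVertices
      (j.succ.succ : Fin (n + 2)).succAbove).fn x)) = 0 := fun j => by
    rw [← sInt_const hn m 1]
    refine sInt_congr fun x hx => h1 _ (AffMap.fn_mem _ hx) j ?_
    exact bary_ofVertices_eq_zero (b := j.succ.succ) (fun a => Fin.succAbove_ne _ a) x
  have h0 : ∀ x : V n, (AffMap.ofVertices (0 : Fin (n + 2)).succAbove).fn x = bary x := fun x =>
    funext fun b => bary_ofVertices_of_unique (b := b.succ) (a := b)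
      (fun a => by simp [Fin.succAbove_zero]) x
  have h2 : ∀ x : V n, (AffMap.ofVertices (Fin.succ 0 : Fin (n + 2)).succAbove).fn x =
      Fin.cons 0 x := fun x => funext fun b => by
    refine Fin.cases ?_ (fun b => ?_) b
    · exact bary_ofVertices_eq_zero (b := (0 : Fin (n + 1)).succ) (fun a => Fin.succAbove_ne _ a) x
    · refine bary_ofVertices_of_unique (b := b.succ.succ) (a := b.succ) (fun a => ?_) x
      rw [← Fin.succAbove_of_lt_succ (Fin.succ 0) b.succ (by simp [Fin.lt_def])]
      exact Fin.succAbove_right_injective.eq_iff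
  simp only [hrest, h0, h2, mul_zero, Finset.sum_const_zero] at h
  simp at h
  linarith

variable [LieGroup (𝓡 d) ∞ G]

/-- A homotopy of smooth cubes can be made smooth. -/
theorem exists_smooth_homotopy {F F' : V n → G} (hF : SmoothCube d F) (hF' : SmoothCube d F')
    (h : GenLoop.Homotopic hF.toGenLoop hF'.toGenLoop) :
    ∃ H : V (n + 1) → G, ContMDiff 𝓘(ℝ, V (n + 1)) (𝓡 d) ∞ H ∧
      (∀ t ≤ -1, ∀ y, H (Fin.cons t y) = F y) ∧ (∀ t ≥ 2, ∀ y, H (Fin.cons t y) = F' y) ∧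
      ∀ t y, (∃ i, y i ≤ -1 ∨ 2 ≤ y i) → H (Fin.cons t y) = 1 := by
  obtain ⟨K⟩ := h
  -- The homotopy is extended to all of the coordinate space, constantly in time before `0` and
  -- after `1`. It is then smooth off the closed unit cube: there it is locally `F`, `F'` or
  -- trivial.
  let H₀ : V (n + 1) → G := fun z =>
    K (projIcc 0 1 zero_le_one (z 0), clamp fun i => z i.succ)
  have hH₀ : Continuous H₀ := by
    have := continuous_clamp (n := n)
    have h2 : Continuous (projIcc (0 : ℝ) 1 zero_le_one) := continuous_projIcc
    have h3 : Continuous K := K.continuous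
    fun_prop
  have h1 : ∀ z : V (n + 1), (fun i => z i.succ) ∉ openCube n → H₀ z = 1 := fun z hz =>
    (K.eq_fst _ (clamp_mem_boundary hz)).trans (hF.toGenLoop.2 _ (clamp_mem_boundary hz))
  have hF0 : ∀ z : V (n + 1), z 0 ≤ 0 → H₀ z = F fun i => z i.succ := fun z hz => by
    by_cases hzc : (fun i => z i.succ) ∈ openCube n
    · simp only [H₀, projIcc_of_le_left _ hz]
      exact (K.apply_zero _).trans (congrArg F (eq_cubeVal_clamp hzc))
    · rw [h1 z hzc, hF.trivial _ hzc]
  have hF1 : ∀ z : V (n + 1), 1 ≤ z 0 → H₀ z = F' fun i => z i.succ := fun z hz => by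
    by_cases hzc : (fun i => z i.succ) ∈ openCube n
    · simp only [H₀, projIcc_of_right_le _ hz]
      exact (K.apply_one _).trans (congrArg F' (eq_cubeVal_clamp hzc))
    · rw [h1 z hzc, hF'.trivial _ hzc]
  have hsucc : ContDiff ℝ ∞ fun z : V (n + 1) => (fun i => z i.succ : V n) := by fun_prop
  let O : Set (V (n + 1)) := pi univ fun _ => Ioo (-1) 2
  obtain ⟨H, hH, hH0, hHs, hHO⟩ := exists_smooth_homotopic (d := d) hH₀
    (C := Icc 0 1) (O := O) isClosed_Icc (isOpen_set_pi finite_univ fun _ _ => isOpen_Ioo)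
    (fun y hy i _ => by
      have h1 : 0 ≤ y i := hy.1 i
      have h2 : y i ≤ 1 := hy.2 i
      exact ⟨by linarith, by linarith⟩)
    (Bornology.IsBounded.pi fun _ => Metric.isBounded_Ioo _ _) (fun z hz => by
      rcases lt_or_ge (z 0) 0 with h0 | h0
      · refine (hF.smooth.comp hsucc.contMDiff z).congr_of_eventuallyEq ?_
        filter_upwards [(isOpen_lt (continuous_apply 0) continuous_const).mem_nhds h0] with w hw
        exact hF0 w (le_of_lt hw)
      rcases lt_or_ge 1 (z 0) with h0' | h0'
      · refine (hF'.smooth.comp hsucc.contMDiff z).congr_of_eventuallyEq ?_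
        filter_upwards [(isOpen_lt continuous_const (continuous_apply 0)).mem_nhds h0'] with w hw
        exact hF1 w (le_of_lt hw)
      refine (contMDiffAt_const (c := (1 : G))).congr_of_eventuallyEq ?_
      have hz' : z ∈ (fun z : V (n + 1) => (fun i => z i.succ : V n)) ⁻¹' (Icc 0 1)ᶜ := fun h =>
        hz ⟨fun i => Fin.cases h0 (fun i => h.1 i) i, fun i => Fin.cases h0' (fun i => h.2 i) i⟩
      filter_upwards [(isClosed_Icc.isOpen_compl.preimage hsucc.continuous).mem_nhds hz'] with w hw
      exact h1 w fun h => hw ⟨fun i => (h i trivial).1.le, fun i => (h i trivial).2.le⟩)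
  refine ⟨_, hHs, fun t ht y => ?_, fun t ht y => ?_, fun t y hy => ?_⟩
  · rw [hHO _ _ fun h => by have := (h 0 trivial).1; simp at this; linarith,
      hF0 _ (by simp; linarith)]
    simp
  · rw [hHO _ _ fun h => by have := (h 0 trivial).2; simp at this; linarith,
      hF1 _ (by simp; linarith)]
    simp
  · obtain ⟨i, hi⟩ := hy
    rw [hHO _ _ fun h => by
      have := h i.succ trivial
      simp at this
      rcases hi with hi | hi <;> linarith [this.1, this.2]]
    refine h1 _ (notMem_openCube.2 ⟨i, ?_⟩)
    simp only [Fin.cons_succ]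
    exact hi.imp (fun h => by linarith) fun h => by linarith

theorem SmoothCube.cubeIntegral_eq_of_homotopic (hn : 0 < n) {m : ExteriorAlgebra ℝ (Dual ℝ LG)}
    (hm : ceD LG m = 0) {F F' : V n → G} (hF : SmoothCube d F) (hF' : SmoothCube d F')
    (h : GenLoop.Homotopic hF.toGenLoop hF'.toGenLoop) : cubeIntegral m F = cubeIntegral m F' := by
  obtain ⟨H, hH, h0, h1, h2⟩ := exists_smooth_homotopy hF hF' h
  -- The coordinate `x 0` plays the role of time. At `x 0 = 0` the time is `-1` and `W` is `F`; on
  -- the slanted face, `x 0 ≥ 1/2` wherever the stretched point lies in `(-1, 2)ⁿ`, so the time is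
  -- at least `2` and `W` is `F'`.
  let W : V (n + 1) → G := fun x => H (Fin.cons (-1 + 6 * x 0) (stretch n fun i => x i.succ))
  have hW : ContMDiff 𝓘(ℝ, V (n + 1)) (𝓡 d) ∞ W := by
    refine hH.comp (ContDiff.contMDiff ?_)
    refine contDiff_pi.2 fun i => Fin.cases ?_ (fun i => ?_) i
    · simp only [Fin.cons_zero]
      fun_prop
    · simp only [Fin.cons_succ, stretch_apply]
      fun_prop
  have h3 := sInt_face_eq hn hm (W := W) hW.contMDiffOn fun x hx j hj =>
    h2 _ _ ⟨j, Or.inl (by rw [stretch_apply, hj]; norm_num)⟩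
  rw [← hF.sInt_stretch hn, ← hF'.sInt_stretch hn]
  convert h3.symm using 2
  · funext x
    simp only [W, Fin.cons_succ]
    exact (h0 _ (by simp) _).symm
  · funext x
    simp only [W, bary, Fin.cons_succ, Fin.cons_zero]
    by_cases hx : ∀ i, -1 < stretch n x i ∧ stretch n x i < 2
    · exact (h1 _ (by linarith [(lt_of_stretch hx).2]) _).symm
    · obtain ⟨i, hi⟩ := not_forall.1 hx
      have hi' : stretch n x i ≤ -1 ∨ 2 ≤ stretch n x i := by
        rwa [not_and_or, not_lt, not_lt] at hi
      rw [h2 _ _ ⟨i, hi'⟩, hF'.trivial _ (notMem_openCube.2 ⟨i, hi'.imp (fun h => by linarith)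
        fun h => by linarith⟩)]

end HomotopyInvariance

end LieInt

namespace LieInt

/-! ### The period homomorphism -/

section PeriodHom

open scoped unitInterval

variable {n d : ℕ} {G : Type*} [TopologicalSpace G] [ChartedSpace (EuclideanSpace ℝ (Fin d)) G]
  [Group G] [LieGroup (𝓡 d) ∞ G]

local notation "LG" => GroupLieAlgebra (𝓡 d) G

/-- The concatenation of two smooth cubes. -/
theorem SmoothCube.exists_transAt (hn : 0 < n) {m : ExteriorAlgebra ℝ (Dual ℝ LG)}
    (hm : ceD LG m = 0) {F F' : V n → G} (hF : SmoothCube d F) (hF' : SmoothCube d F') (i : Fin n) :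
    ∃ F'' : V n → G, ∃ h : SmoothCube d F'',
      h.toGenLoop = GenLoop.transAt i hF.toGenLoop hF'.toGenLoop ∧
      cubeIntegral m F'' = cubeIntegral m F + cubeIntegral m F' := by
  -- The two cubes are squeezed into the halves of the unit cube in direction `i`. At every point
  -- one of the factors is trivial, so the pointwise product is the concatenation.
  let a : V n := Function.update 1 i 2
  let b : V n := Function.update 0 i (-1)
  have ha : ∀ j, 0 < a j := fun j => by
    by_cases hj : j = i
    · subst hj; simp [a]
    · simp [a, hj]
  have hdi : ∀ (c : V n) (y : V n), diagMap a c y i = 2 * y i + c i := fun c y => by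
    simp [diagMap, a]
  have hdj : ∀ (c : V n) (y : V n) {j}, j ≠ i → diagMap a c y j = y j + c j := fun c y j hj => by
    simp [diagMap, a, hj]
  have h1 : diagMap a 0 ⁻¹' openCube n ⊆ openCube n := fun y hy j _ => by
    have := hy j (mem_univ j)
    by_cases hj : j = i
    · subst hj
      rw [hdi] at this
      simp at this
      exact ⟨by linarith [this.1], by linarith [this.2]⟩
    · rw [hdj _ _ hj] at this
      simpa using this
  have hbi : b i = -1 := by simp [b]
  have h2 : diagMap a b ⁻¹' openCube n ⊆ openCube n := fun y hy j _ => by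
    have := hy j (mem_univ j)
    by_cases hj : j = i
    · subst hj
      rw [hdi, hbi] at this
      exact ⟨by linarith [this.1], by linarith [this.2]⟩
    · rw [hdj _ _ hj] at this
      simpa [b, hj] using this
  have hG := (hF.comp_diagMap h1).mul (hF'.comp_diagMap h2)
  refine ⟨_, hG, ?_, ?_⟩
  · ext y
    change F (diagMap a 0 (cubeVal y)) * F' (diagMap a b (cubeVal y)) = if (y i : ℝ) ≤ 1 / 2
      then F (cubeVal (Function.update y i (projIcc 0 1 zero_le_one (2 * y i))))
      else F' (cubeVal (Function.update y i (projIcc 0 1 zero_le_one (2 * y i - 1))))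
    split_ifs with hy
    · rw [hF'.trivial (diagMap a b (cubeVal y)), mul_one]
      · congr 1
        funext j
        by_cases hj : j = i
        · subst hj
          rw [hdi]
          simp only [cubeVal, Function.update_self, Pi.zero_apply, add_zero]
          rw [projIcc_of_mem zero_le_one ⟨by linarith [(y j).2.1], by linarith⟩]
        · rw [hdj _ _ hj]
          simp [cubeVal, hj]
      · refine notMem_openCube.2 ⟨i, Or.inl ?_⟩
        rw [hdi, hbi]
        simp only [cubeVal]
        linarith
    · rw [hF.trivial (diagMap a 0 (cubeVal y)), one_mul]
      · congr 1
        funext j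
        by_cases hj : j = i
        · subst hj
          rw [hdi, hbi]
          simp only [cubeVal, Function.update_self]
          rw [projIcc_of_mem zero_le_one ⟨by linarith, by linarith [(y j).2.2]⟩]
          rfl
        · rw [hdj _ _ hj]
          simp [cubeVal, hj, b]
      · refine notMem_openCube.2 ⟨i, Or.inr ?_⟩
        rw [hdi]
        simp only [cubeVal, Pi.zero_apply]
        linarith
  · rw [SmoothCube.cubeIntegral_mul hn hm (hF.comp_diagMap h1) (hF'.comp_diagMap h2),
      hF.cubeIntegral_comp_diagMap hn ha h1, hF'.cubeIntegral_comp_diagMap hn ha h2]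

/-- The integral of a closed form over a smooth cube in the class of a based map. -/
def periodFun (hn : 0 < n) {m : ExteriorAlgebra ℝ (Dual ℝ LG)} (hm : ceD LG m = 0) :
    HomotopyGroup.Pi n G (1 : G) → ℝ :=
  Quotient.lift (fun f => cubeIntegral m (exists_smoothCube d f).choose) fun f f' h =>
    let h1 := (exists_smoothCube d f).choose_spec
    let h2 := (exists_smoothCube d f').choose_spec
    h1.choose.cubeIntegral_eq_of_homotopic hn hm h2.choose
      ((h1.choose_spec.symm.trans h).trans h2.choose_spec)

theorem periodFun_mk (hn : 0 < n) {m : ExteriorAlgebra ℝ (Dual ℝ LG)} (hm : ceD LG m = 0)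
    {f : GenLoop (Fin n) G 1} {F : V n → G} (hF : SmoothCube d F)
    (h : GenLoop.Homotopic f hF.toGenLoop) : periodFun hn hm ⟦f⟧ = cubeIntegral m F :=
  let h1 := (exists_smoothCube d f).choose_spec
  h1.choose.cubeIntegral_eq_of_homotopic hn hm hF (h1.choose_spec.symm.trans h)

theorem periodFun_mul [NeZero n] (hn : 0 < n) {m : ExteriorAlgebra ℝ (Dual ℝ LG)}
    (hm : ceD LG m = 0) (p q : HomotopyGroup.Pi n G (1 : G)) :
    periodFun hn hm (p * q) = periodFun hn hm p + periodFun hn hm q := by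
  induction p using Quotient.inductionOn with | _ f
  induction q using Quotient.inductionOn with | _ f'
  obtain ⟨F, hF, hf⟩ := exists_smoothCube d f
  obtain ⟨F', hF', hf'⟩ := exists_smoothCube d f'
  -- The product of homotopy classes concatenates its factors in the opposite order.
  obtain ⟨F'', hF'', h1, h2⟩ := hF'.exists_transAt hn hm hF 0
  let mk : GenLoop (Fin n) G 1 → HomotopyGroup.Pi n G (1 : G) := fun f => ⟦f⟧
  have h3 : mk f * mk f' = mk hF''.toGenLoop := by
    rw [show mk f = mk hF.toGenLoop from Quotient.sound hf,
      show mk f' = mk hF'.toGenLoop from Quotient.sound hf', h1]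
    exact HomotopyGroup.mul_spec (i := (0 : Fin n))
  change periodFun hn hm (mk f * mk f') = periodFun hn hm (mk f) + periodFun hn hm (mk f')
  rw [h3, periodFun_mk hn hm hF'' (GenLoop.Homotopic.refl _), periodFun_mk hn hm hF hf,
    periodFun_mk hn hm hF' hf', h2, add_comm]

/-- The period homomorphism of a closed form. -/
def periodHom [NeZero n] {m : ExteriorAlgebra ℝ (Dual ℝ LG)} (hm : ceD LG m = 0) :
    Additive (HomotopyGroup.Pi n G (1 : G)) →+ ℝ :=
  AddMonoidHom.mk' (fun p => periodFun (NeZero.pos n) hm p.toMul) fun p q =>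
    periodFun_mul (NeZero.pos n) hm p.toMul q.toMul

theorem periodHom_mk [NeZero n] {m : ExteriorAlgebra ℝ (Dual ℝ LG)} (hm : ceD LG m = 0)
    {f : GenLoop (Fin n) G 1} {F : V n → G} (hF : ContMDiff 𝓘(ℝ, V n) (𝓡 d) ∞ F)
    (hf : ∀ y, f y = F (cubeVal y)) :
    periodHom hm (Additive.ofMul ⟦f⟧) = cubeIntegral m F := by
  obtain ⟨h, h1⟩ := exists_smoothCube_of_smooth hF hf
  exact (periodFun_mk (NeZero.pos n) hm h h1).trans (cubeIntegral_comp_cubeParam hF m)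

/-- Every class contains a smooth cube, and every smooth cube defines a class. -/
theorem mem_range_periodHom [NeZero n] {m : ExteriorAlgebra ℝ (Dual ℝ LG)} (hm : ceD LG m = 0)
    {r : ℝ} : r ∈ range (periodHom (n := n) (d := d) (G := G) hm) ↔ ∃ F : V n → G, SmoothCube d F ∧
      cubeIntegral m F = r := by
  constructor
  · rintro ⟨p, rfl⟩
    obtain ⟨f, hf⟩ := Quotient.exists_rep p.toMul
    obtain ⟨F, hF, h⟩ := exists_smoothCube d f
    refine ⟨F, hF, ?_⟩
    rw [← periodFun_mk (NeZero.pos n) hm hF h, hf]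
    rfl
  · rintro ⟨F, hF, rfl⟩
    exact ⟨Additive.ofMul ⟦hF.toGenLoop⟧, periodHom_mk hm hF.smooth fun _ => rfl⟩

theorem isPeriodHom_periodHom [NeZero n] (μ : DGAlg.Hom (CELine n) (CE LG)) :
    IsPeriodHom μ (periodHom (m := μ.toAlgHom (lineGen n)) (cocycle_d μ)) :=
  fun _ _ hF hf => periodHom_mk _ hF hf

/-- Each coboundary is the integral over a simplex that is trivial on the boundary, hence over a
smooth cube. -/
theorem cosubgroup_le_closure_range_periodHom [NeZero n] (hn : 2 ≤ n)
    (μ : DGAlg.Hom (CELine n) (CE LG)) : cosubgroup μ ≤ AddSubgroup.closure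
      (range (periodHom (n := n) (d := d) (G := G) (m := μ.toAlgHom (lineGen n)) (cocycle_d μ))) := by
  refine (AddSubgroup.closure_le _).2 ?_
  rintro _ ⟨U, y, u, rfl⟩
  obtain ⟨g, hg, hg1, h⟩ := exists_delta_cosk_eq hn μ U y u
  obtain ⟨F, hF, hF1, hgF⟩ := exists_cube_of_simplex hg hg1
  rw [h.trans (hgF _)]
  exact AddSubgroup.subset_closure ((mem_range_periodHom _).2
    ⟨F, ⟨hF, fun y hy => hF1 y (notMem_openCube.1 hy)⟩, rfl⟩)

end PeriodHom

end LieInt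

namespace LieInt

/-! ### Cells of the coskeleton from smooth spheres -/

section SphereCells

open Simplicial

variable {n k j d : ℕ} {G : Type*} [TopologicalSpace G] [ChartedSpace (EuclideanSpace ℝ (Fin d)) G]
  [Group G] [LieGroup (𝓡 d) ∞ G]

local notation "E" => EuclideanSpace ℝ (Fin d)
local notation "LG" => GroupLieAlgebra (𝓡 d) G

theorem mcForm_congr {U : CartSp} {h h' : V k → G} (hh : EqOn h h' (Simp k))
    (a : ExteriorAlgebra ℝ (Dual ℝ LG)) : mcForm U h a = mcForm U h' a := by
  funext u x
  have : MC d (Simp k) h x = MC d (Simp k) h' x :=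
    MC_congr (Filter.eventuallyEq_of_mem self_mem_nhdsWithin hh) (hh x.2)
  simp only [mcForm, pullForm_apply, constForm, this]

theorem mcForm_ι_eq_zero {U : CartSp} {h : V k → G} {x : Simp k} (hx : MC d (Simp k) h x = 0)
    (φ : Dual ℝ LG) (u : U.Pt) : mcForm U h (ExteriorAlgebra.ι ℝ φ) u x = 0 := by
  rw [mcForm, pullForm_apply, constForm, hx, ExteriorAlgebra.map_apply_ι]
  have : (toLie G ((0 : V k →L[ℝ] E) : V k →ₗ[ℝ] E)).dualMap φ = 0 :=
    LinearMap.ext fun v => map_zero φ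
  rw [this, map_zero]

theorem faceProj_univ {S : Finset (Fin (k + 1))} (hS : S.Nonempty) (h : S = Finset.univ) :
    AffMap.faceProj S hS = AffMap.ofVertices id := by
  subst h
  ext a b
  simp [AffMap.faceProj, AffMap.ofVertices]

theorem faceProj_supp (p : V k) : (AffMap.faceProj (supp p) (supp_nonempty p)).fn p = p := by
  refine funext fun b => ?_
  have h1 : ∀ a, bary p a * (AffMap.faceProj (supp p) (supp_nonempty p)).mat a b.succ =
      if a = b.succ then bary p a else 0 := fun a => by
    by_cases ha : a ∈ supp p
    · simp [AffMap.faceProj, ha]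
    · have : bary p a = 0 := by simpa [supp] using ha
      simp [this]
  rw [AffMap.fn, Finset.sum_congr rfl fun a _ => h1 a]
  simp [bary]

/-- A smooth map that is trivial near the boundary of the simplex induces forms with sitting
instants. -/
theorem sittingInstants_mcForm {U : CartSp} {h : V k → G}
    (hb : ∀ p ∈ Simp k, (∃ a, bary p a = 0) → ∀ᶠ x in 𝓝 p, MC d (Simp k) h x = 0) (φ : Dual ℝ LG) :
    Form.SittingInstants (mcForm U h (ExteriorAlgebra.ι ℝ φ)) := by
  intro u p
  -- Near a boundary point the form vanishes, and so does its pullback along the face projection,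
  -- which is continuous and fixes the point. At an interior point the smallest face is the whole
  -- simplex and the projection is the identity.
  by_cases hp : ∃ a, bary p.1 a = 0
  · let P := AffMap.faceProj (supp p.1) (supp_nonempty p.1)
    have h1 := hb p.1 p.2 hp
    have h2 : ContinuousAt (fun x : Simp k => P.fn x.1) p :=
      (P.contDiff_fn.continuous.comp continuous_subtype_val).continuousAt
    have h3 : ∀ᶠ x in 𝓝 (P.fn p.1), MC d (Simp k) h x = 0 := by rwa [faceProj_supp]
    filter_upwards [h2.eventually h3, continuous_subtype_val.continuousAt.eventually h1] with x hx hx'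
    rw [mcForm_ι_eq_zero hx']
    change _ = ExteriorAlgebra.map _ (mcForm U h (ExteriorAlgebra.ι ℝ φ) u (P.onSimp x))
    rw [mcForm_ι_eq_zero (x := P.onSimp x) hx, map_zero]
  · have h1 : supp p.1 = Finset.univ := by
      ext a
      simpa [supp] using fun h => hp ⟨a, h⟩
    refine Filter.Eventually.of_forall fun x => ?_
    rw [faceProj_univ _ h1, pull_param_apply]
    rfl

theorem map_mem_exteriorPower {M N : Type*} [AddCommGroup M] [Module ℝ M] [AddCommGroup N]
    [Module ℝ N] (f : M →ₗ[ℝ] N) {p : ℕ} {a : ExteriorAlgebra ℝ M} (ha : a ∈ ⋀[ℝ]^p M) :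
    ExteriorAlgebra.map f a ∈ ⋀[ℝ]^p N := by
  rw [← ExteriorAlgebra.ιMulti_span_fixedDegree] at ha
  induction ha using Submodule.span_induction with
  | mem a ha =>
    obtain ⟨v, rfl⟩ := ha
    rw [ExteriorAlgebra.map_apply_ιMulti]
    exact ExteriorAlgebra.ιMulti_range ℝ p ⟨_, rfl⟩
  | zero => simp
  | add a b _ _ ha hb => rw [map_add]; exact Submodule.add_mem _ ha hb
  | smul c a _ ha => rw [map_smul]; exact Submodule.smul_mem _ c ha

/-- The forms obtained from a smooth map to `G`, as an algebra morphism. -/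
def mcAlgHom (U : CartSp) (h : V k → G)
    (hs : ∀ a : ExteriorAlgebra ℝ (Dual ℝ LG), mcForm U h a ∈ Form.siForms U k) :
    ExteriorAlgebra ℝ (Dual ℝ LG) →ₐ[ℝ] Form.siForms U k :=
  AlgHom.codRestrict (pullForm (𝔤 := LG) (constForm U G (MC d (Simp k) h))) (Form.siForms U k)
    fun a => by
      have := hs a
      rwa [mcForm] at this

/-- The cell given by a smooth map to `G` whose forms have sitting instants. -/
def mcHom (U : CartSp) {h : V k → G} (hh : SSimp d h)
    (hs : ∀ a : ExteriorAlgebra ℝ (Dual ℝ LG), mcForm U h a ∈ Form.siForms U k) :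
    DGAlg.Hom (CE LG) (Omega U k) where
  toAlgHom := mcAlgHom U h hs
  map_deg p a ha u x := map_mem_exteriorPower _ ha
  map_d a := Subtype.ext (d_mcForm hh a).symm

/-- The images of covectors have sitting instants and generate all other forms of this kind by sums
and products. -/
theorem mcForm_mem_siForms {U : CartSp} {h : V k → G} (hh : SSimp d h)
    (hb : ∀ p ∈ Simp k, (∃ a, bary p a = 0) → ∀ᶠ x in 𝓝 p, MC d (Simp k) h x = 0)
    (a : ExteriorAlgebra ℝ (Dual ℝ LG)) : mcForm U h a ∈ Form.siForms U k := by
  change pullForm _ a ∈ _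
  induction a using ExteriorAlgebra.induction with
  | algebraMap r => rw [AlgHom.commutes]; exact Subalgebra.algebraMap_mem _ r
  | ι φ =>
    refine Algebra.subset_adjoin ⟨k, 𝟙 _, mcForm U h (ExteriorAlgebra.ι ℝ φ), smooth_mcForm hh _,
      sittingInstants_mcForm hb φ, ?_⟩
    funext u x
    exact (pull_param_apply id _ u x).symm
  | mul a b ha hb => rw [map_mul]; exact Subalgebra.mul_mem _ ha hb
  | add a b ha hb => rw [map_add]; exact Subalgebra.add_mem _ ha hb

theorem MC_const (s : Set (V k)) (g : G) (x : V k) : MC d s (fun _ => g) x = 0 := by simp [MC]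

variable (d G k) in
/-- The constant cell. -/
def trivialCell (U : CartSp) : DGAlg.Hom (CE LG) (Omega U k) :=
  mcHom U (h := fun _ => (1 : G)) contMDiffOn_const (mcForm_mem_siForms contMDiffOn_const
    fun _ _ _ => Filter.Eventually.of_forall fun x => MC_const _ _ x)

theorem mcHom_pull_eq_trivialCell {U : CartSp} {h : V n → G} (hh : SSimp d h)
    (hs : ∀ a : ExteriorAlgebra ℝ (Dual ℝ LG), mcForm U h a ∈ Form.siForms U n)
    (θ : SimplexCategory.mk k ⟶ SimplexCategory.mk n)
    (hθ : ∀ x ∈ Simp k, h ((AffMap.ofVertices θ.toOrderHom).fn x) = 1) :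
    (mcHom U hh hs).comp (Omega.pull (𝟙 U) θ) = trivialCell k d G U := by
  refine DGAlg.Hom.ext (AlgHom.ext fun a => Subtype.ext ?_)
  change Form.pull id (AffMap.ofVertices θ.toOrderHom) (mcForm U h a) = mcForm U _ a
  exact (mcForm_comp_affMap hh _ _).symm.trans (mcForm_congr hθ a)

/-- A smooth map to `G` that is trivial near the boundary of the simplex gives a cell of the
coskeleton whose other faces are trivial. -/
theorem exists_cosk_cell (hn : 0 < n) (μ : DGAlg.Hom (CELine n) (CE LG)) {h : V n → G}
    (hh : SSimp d h) (h1 : ∀ x ∈ Simp n, (∃ a, bary x a = 0) → h x = 1)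
    (hb : ∀ p ∈ Simp n, (∃ a, bary p a = 0) → ∀ᶠ x in 𝓝 p, MC d (Simp n) h x = 0) (U : CartSp)
    (u : U.Pt) : ∃ y, (((cocycleCochain μ).cosk).delta (op U) y).1 u =
      sInt (μ.toAlgHom (lineGen n)) h := by
  let X := expD (CE LG)
  let c : DGAlg.Hom (CE LG) (Omega U n) := mcHom U hh (mcForm_mem_siForms hh hb)
  have hc : ∀ {j : ℕ} (η : ⦋j⦌ ⟶ ⦋n⦌), ¬ Function.Surjective η.toOrderHom →
      c.comp (Omega.pull (𝟙 U) η) = trivialCell j d G U := by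
    intro j η hη
    obtain ⟨b, hb⟩ := not_forall.1 hη
    exact mcHom_pull_eq_trivialCell hh _ η fun x hx => h1 _ (AffMap.fn_mem _ hx)
      ⟨b, bary_ofVertices_eq_zero (fun a ha => hb ⟨a, ha⟩) x⟩
  have ht : ∀ {k j : ℕ} (ρ : ⦋j⦌ ⟶ ⦋k⦌),
      (trivialCell k d G U).comp (Omega.pull (𝟙 U) ρ) = trivialCell j d G U := fun ρ =>
    mcHom_pull_eq_trivialCell _ _ ρ fun _ _ => rfl
  open Classical in
  -- The face opposite to the vertex `0` carries `c`, all faces through that vertex carry the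
  -- constant cell. On the former, `σ 0` inverts the face inclusion.
  let y : ∀ k, (⦋k⦌ ⟶ ⦋n + 1⦌) → DGAlg.Hom (CE LG) (Omega U k) := fun k θ =>
    if 0 ∈ range θ.toOrderHom then trivialCell k d G U
      else c.comp (Omega.pull (𝟙 U) (θ ≫ SimplexCategory.σ 0))
  have hy : ∀ {k} {θ : ⦋k⦌ ⟶ ⦋n + 1⦌}, 0 ∈ range θ.toOrderHom → y k θ = trivialCell k d G U :=
    fun h => if_pos h
  have hy' : ∀ {k} {θ : ⦋k⦌ ⟶ ⦋n + 1⦌}, 0 ∉ range θ.toOrderHom →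
      y k θ = c.comp (Omega.pull (𝟙 U) (θ ≫ SimplexCategory.σ 0)) := fun h => if_neg h
  obtain ⟨z, hz⟩ : ∃ z : ((coskP n X).obj (op U)).obj (op ⦋n + 1⦌), ∀ k (_ : k ≤ n)
      (θ : ⦋k⦌ ⟶ ⦋n + 1⦌), ((coskP n X).obj (op U)).map θ.op z =
        ((toCosk n X).app (op U)).app (op ⦋k⦌) (y k θ) := cosk_cell_exists (X.obj (op U)) (fun k _ => y k) (by
    intro k hk j hj ρ θ
    change (y k θ).comp (Omega.pull (𝟙 U) ρ) = y j (ρ ≫ θ)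
    by_cases h0 : 0 ∈ range θ.toOrderHom
    · rw [hy h0, ht ρ]
      by_cases h0' : 0 ∈ range (ρ ≫ θ).toOrderHom
      · rw [hy h0']
      rw [hy' h0']
      -- If `ρ ≫ θ ≫ σ 0` were surjective, then `θ` would be surjective onto the `n + 2` vertices,
      -- which is impossible for `k ≤ n`. So a proper face of `c` is meant, which is constant.
      refine (hc _ fun hs => ?_).symm
      have h3 : Function.Surjective θ.toOrderHom := by
        intro b
        refine Fin.cases h0 (fun b => ?_) b
        obtain ⟨a, ha⟩ := hs b
        refine ⟨ρ.toOrderHom a, ?_⟩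
        have h4 : θ.toOrderHom (ρ.toOrderHom a) ≠ 0 := fun h => h0' ⟨a, h⟩
        have h5 : Fin.predAbove 0 (θ.toOrderHom (ρ.toOrderHom a)) = b := ha
        rw [Fin.predAbove_zero_of_ne_zero h4] at h5
        rw [← h5, Fin.succ_pred]
      have := Fintype.card_le_of_surjective _ h3
      simp at this
      omega
    · have h0' : 0 ∉ range (ρ ≫ θ).toOrderHom := fun ⟨a, ha⟩ => h0 ⟨ρ.toOrderHom a, ha⟩
      rw [hy' h0, hy' h0']
      refine DGAlg.Hom.ext (AlgHom.ext fun a => ?_)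
      exact (Omega.pull_comp (𝟙 U) (𝟙 U) ρ (θ ≫ SimplexCategory.σ 0) (c.toAlgHom a)).symm)
  refine ⟨z, ?_⟩
  have hval : ∀ i : Fin (n + 2), ((cocycleCochain μ).cosk.val (op U)
      (((coskP n X).obj (op U)).map (SimplexCategory.δ i).op z)) =
      (cocycleCochain μ).val (op U) (y n (SimplexCategory.δ i)) := by
    intro i
    change (cocycleCochain μ).val (op U) ((coskEquiv n X (op U)).symm _) = _
    congr 1
    exact (Equiv.symm_apply_eq (coskEquiv n X (op U))).2 (hz n le_rfl (SimplexCategory.δ i))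
  rw [delta_apply, Fin.sum_univ_succ]
  have hrest : ∀ i : Fin (n + 1), ((cocycleCochain μ).cosk.val (op U)
      (((coskP n X).obj (op U)).map (SimplexCategory.δ i.succ).op z)).1 u = 0 := by
    intro i
    rw [hval, show y n (SimplexCategory.δ i.succ) = trivialCell n d G U from
      if_pos ⟨0, Fin.succAbove_ne_zero_zero (Fin.succ_ne_zero i)⟩]
    exact (simplexIntegral_eq_sInt (h := fun _ => (1 : G)) rfl).trans (sInt_const hn _ _)
  have hfirst : ((cocycleCochain μ).cosk.val (op U)
      (((coskP n X).obj (op U)).map (SimplexCategory.δ 0).op z)).1 u =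
      sInt (μ.toAlgHom (lineGen n)) h := by
    rw [hval, show y n (SimplexCategory.δ 0) = c.comp (Omega.pull (𝟙 U)
      (SimplexCategory.δ 0 ≫ SimplexCategory.σ 0)) from
      if_neg fun ⟨a, ha⟩ => Fin.succ_ne_zero a ha]
    have h3 : c.comp (Omega.pull (𝟙 U) (SimplexCategory.δ 0 ≫ SimplexCategory.σ 0)) = c := by
      rw [SimplexCategory.δ_comp_σ_self' (by simp)]
      exact DGAlg.Hom.ext (AlgHom.ext fun a => Omega.pull_id _ _ _)
    rw [h3]
    exact simplexIntegral_eq_sInt rfl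
  rw [hfirst, Finset.sum_eq_zero fun i _ => by rw [hrest i, mul_zero]]
  simp

/-- A smooth cube, stretched into the interior of the simplex, is trivial near the boundary, so
`exists_cosk_cell` realizes its period as a coboundary. Here `n = 1` is allowed. -/
theorem closure_range_periodHom_le_cosubgroup [NeZero n] (μ : DGAlg.Hom (CELine n) (CE LG)) :
    AddSubgroup.closure (range (periodHom (n := n) (d := d) (G := G)
      (m := μ.toAlgHom (lineGen n)) (cocycle_d μ))) ≤ cosubgroup μ := by
  have hn := NeZero.pos n
  refine (AddSubgroup.closure_le _).2 fun r hr => ?_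
  obtain ⟨F, hF, rfl⟩ := (mem_range_periodHom _).1 hr
  -- Sitting instants need triviality on a neighbourhood of the boundary. The preimage of the closed
  -- unit cube is contained in the interior of the simplex, and its complement is open.
  have hb : ∀ p : V n, p ∉ interior (Simp n) → ∀ᶠ x in 𝓝 p, F (stretch n x) = 1 := by
    intro p hp
    have h1 : stretch n p ∉ Icc (0 : V n) 1 := fun h => hp <| by
      have h2 := lt_of_stretch (x := p) fun i =>
        ⟨lt_of_lt_of_le (by norm_num) (h.1 i), lt_of_le_of_lt (h.2 i) (by norm_num)⟩
      rw [interior_Simp]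
      exact ⟨fun i => pos_of_mul_pos_right (one_pos.trans (h2.1 i)) (by positivity),
        by linarith [h2.2]⟩
    have h3 : Continuous (stretch n) := (contDiff_diagMap _ _).continuous
    filter_upwards [(isClosed_Icc.isOpen_compl.preimage h3).mem_nhds h1] with x hx
    exact hF.trivial _ fun h => hx ⟨fun i => (h i trivial).1.le, fun i => (h i trivial).2.le⟩
  obtain ⟨y, hy⟩ := exists_cosk_cell hn μ hF.sSimp_stretch
    (fun x _ hx => hF.stretch_eq_one hn (notMem_interior_Simp hx)) (fun p _ hp => by
      filter_upwards [(hb p (notMem_interior_Simp hp)).eventually_nhds] with x hx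
      rw [MC_congr (h' := fun _ => (1 : G)) (Filter.Eventually.filter_mono nhdsWithin_le_nhds hx)
        hx.self_of_nhds, MC_const]) ⟨0⟩ 0
  exact AddSubgroup.subset_closure ⟨_, y, 0, hy.trans (hF.sInt_stretch hn _)⟩

end SphereCells

end LieInt

end

/-! ### The main theorem -/

theorem mainTheorem2 {d : ℕ} {G : Type*} [TopologicalSpace G]
    [ChartedSpace (EuclideanSpace ℝ (Fin d)) G] [Group G] [LieGroup (𝓡 d) ∞ G]
    (n : ℕ) [NeZero n]
    (μ : LieInt.DGAlg.Hom (LieInt.CELine n) (LieInt.CE (GroupLieAlgebra (𝓡 d) G))) :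
    ∃ I : LieInt.expD (LieInt.CELine n) ⟶ LieInt.BR n, LieInt.IsFiberIntegration I ∧
      ∃ Λμ : AddSubgroup ℝ,
        IsLeast {Λ : AddSubgroup ℝ |
          ∃ φ : LieInt.coskP n (LieInt.expD (LieInt.CE (GroupLieAlgebra (𝓡 d) G))) ⟶
              LieInt.BQuot n Λ,
            LieInt.toCosk n _ ≫ φ = LieInt.expMap μ ≫ I ≫ LieInt.toBQuot n Λ} Λμ ∧
        ∃ per : Additive (HomotopyGroup.Pi n G (1 : G)) →+ ℝ,
          LieInt.IsPeriodHom μ per ∧ (2 ≤ n → Λμ = AddSubgroup.closure (Set.range per)) := by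
  obtain ⟨I, hI, hI'⟩ := LieInt.exists_fiberIntegration n
  exact ⟨I, hI, LieInt.cosubgroup μ, LieInt.isLeast_cosubgroup μ hI', _,
    LieInt.isPeriodHom_periodHom μ, fun hn =>
      le_antisymm (LieInt.cosubgroup_le_closure_range_periodHom hn μ)
        (LieInt.closure_range_periodHom_le_cosubgroup μ)⟩
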